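/- Setting. Let $(W,\preceq)$ be a totally ordered set of weights and let $w$ be an aggregate ranking function, i.e. a map assigning a weight $w(X)\in W$ to every finite multiset $X$ of elements of $W$. Assume that $w$ is *strong subset-monotone*: for all multisets $X_1,X_2,Y_1,Y_2$ with $w(X_1)\preceq w(X_2)$, $w(X_1\uplus Y_1)\preceq w(X_1\uplus Y_2)$ implies $w(X_2\uplus Y_1)\preceq w(X_2\uplus Y_2)$. Assume also that $w(\emptyset)\preceq w(X)$ for all $X$, or, instead of this, that $w$ is *subset-monotone*: $w(Y_1)\preceq w(Y_2)$ implies $w(X\uplus Y_1)\preceq w(X\uplus Y_2)$ (this covers, for instance, sums of real weights of arbitrary sign). Assume that $w$ is *decomposable*: $w(X\uplus Y)$ is obtained from $w(X)$ and $w(Y)$ by a binary operation on $W$, which, like $x\mapsto w(\{x\})$, the constant $w(\emptyset)$, copying a weight and comparing two weights, takes one step. Let $G=(V,E)$ be a directed acyclic graph (without parallel edges) with $N$ nodes and size $|G|=|V|+|E|$, with weights in $W$ on its edges, given by the list of its edges in arbitrary order, and let $s,t\in V$. The weight of a path is the value of $w$ on the multiset of the weights of its edges, and the length of a path is its number of edges;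 let $\ell$ be the maximum length of an $s$–$t$ path ($\ell=0$ if there is none). The machine model is the random access machine with uniform cost, where every operation and every memory access takes one step. Theorem. There are a single program and a single constant $C$, independent of $(W,\preceq)$, $w$, $G$, $s$, $t$ and $k$, such that on each such input the program outputs all $s$–$t$ paths, one at a time, without repetition, in ascending order of weight, each explicitly as the list of its edges, and then halts. For every $k\ge 1$ not larger than the number of $s$–$t$ paths, the $k$-th path is output after at most $$\mathrm{TT}(k)\le C\,\bigl(|G|+k(\log N+\ell)\bigr)$$ steps, and up to then the program uses space at most $$\mathrm{MEM}(k)\le C\,\bigl(|G|+k\ell\bigr),$$ in the sense that this number bounds every address and every integer that occurs in the computation. If $K\ge 0$ is the number of $s$–$t$ paths, then the same bounds with $k=K$ hold for the time and the space until the program halts. Moreover, the time bound improves on the bound $O(|G|+k(\log k+\ell))$ of Eppstein's algorithm for explicit enumeration: there is a constant $D$ with $|G|+k(\log N+\ell)\le D\,\bigl(|G|+k(\log k+\ell)\bigr)$ for all such $G$, $k$, $\ell$ (with the convention $\log 0 = 0$); and for every constant $D$ there are a directed acyclic graph $G$ with nodes $s,t$ and a $k\ge 1$ not larger than the number of its $s$–$t$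 paths such that $D\,\bigl(|G|+k(\log N+\ell)\bigr)<|G|+k(\log k+\ell)$. Here $\log$ is the logarithm to base $2$, rounded down. -/

import Mathlib

universe u

namespace AnyK

/-! ### Ranking functions

`W` is a totally ordered domain of weights and an aggregate ranking function is a map
`w : Multiset W → W` (so that the order of aggregation is irrelevant). -/

/-- `w(Y₁) ≼ w(Y₂)` implies `w(X ⊎ Y₁) ≼ w(X ⊎ Y₂)`. -/
def SubsetMonotone {W : Type u} [LinearOrder W] (w : Multiset W → W) : Prop :=
  ∀ X Y₁ Y₂ : Multiset W, w Y₁ ≤ w Y₂ → w (X + Y₁) ≤ w (X + Y₂)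

/-- `w(X₁ ⊎ Y₁) ≼ w(X₁ ⊎ Y₂)` implies `w(X₂ ⊎ Y₁) ≼ w(X₂ ⊎ Y₂)` whenever `w(X₁) ≼ w(X₂)`. -/
def StrongSubsetMonotone {W : Type u} [LinearOrder W] (w : Multiset W → W) : Prop :=
  ∀ X₁ X₂ Y₁ Y₂ : Multiset W, w X₁ ≤ w X₂ →
    w (X₁ + Y₁) ≤ w (X₁ + Y₂) → w (X₂ + Y₁) ≤ w (X₂ + Y₂)

/-- The operations on weights that a machine may use as single steps: the weight of the empty
multiset, the aggregate weight of one input weight, and the combination of two partial weights. -/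
structure WeightOps (W : Type u) where
  empty : W
  single : W → W
  combine : W → W → W

/-- Decomposability: the operations compute `w(∅)`, `w({x})`, and `w(X ⊎ Y)` out of `w(X)` and
`w(Y)`. -/
structure WeightOps.Computes {W : Type u} (ops : WeightOps W) (w : Multiset W → W) : Prop where
  empty_eq : ops.empty = w 0
  single_eq : ∀ x : W, ops.single x = w {x}
  combine_eq : ∀ X Y : Multiset W, ops.combine (w X) (w Y) = w (X + Y)

/-! ### Directed acyclic graphs and their paths -/

/-- `p`, a list of edges out of `E`, is a path from `u` to `v`. The empty list is the path of
length `0` from `u` to `u`; the length of a path is its number of edges. -/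
def IsPathIn {N : ℕ} (E : List (Fin N × Fin N)) : Fin N → Fin N → List (Fin N × Fin N) → Prop
  | u, v, [] => u = v
  | u, v, e :: p => e ∈ E ∧ e.1 = u ∧ IsPathIn E e.2 v p

/-- A directed acyclic graph with nodes `0, …, N - 1`, given by its edges, each listed once, in an
arbitrary order. -/
structure DAG (N : ℕ) where
  edges : List (Fin N × Fin N)
  nodup : edges.Nodup
  acyclic : ∀ (u : Fin N) (p : List (Fin N × Fin N)), IsPathIn edges u u p → p = []

namespace DAG

variable {N : ℕ}

/-- `|G| = |V| + |E|`. -/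
def size (G : DAG N) : ℕ := N + G.edges.length

/-- `p` is a path of `G` from `u` to `v`. -/
def IsPath (G : DAG N) (u v : Fin N) (p : List (Fin N × Fin N)) : Prop := IsPathIn G.edges u v p

/-- `ℓ` is the maximum length of a path from `s` to `t` (with `ℓ = 0` if there is no path). -/
def IsMaxPathLength (G : DAG N) (s t : Fin N) (ℓ : ℕ) : Prop :=
  IsLUB {n : ℕ | ∃ p, G.IsPath s t p ∧ p.length = n} ℓ

end DAG

/-- The weight of a path: the aggregate of the multiset of the weights of its edges. -/
def pathWeight {W : Type u} {N : ℕ} (w : Multiset W → W) (wt : Fin N × Fin N → W)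
    (p : List (Fin N × Fin N)) : W :=
  w (Multiset.map wt (p : Multiset (Fin N × Fin N)))

/-- `ps` lists all paths from `s` to `t`, without repetition, in ascending order of weight. -/
structure IsRankedEnumeration {W : Type u} [LinearOrder W] {N : ℕ} (w : Multiset W → W)
    (G : DAG N) (wt : Fin N × Fin N → W) (s t : Fin N) (ps : List (List (Fin N × Fin N))) :
    Prop where
  complete : ∀ p, p ∈ ps ↔ G.IsPath s t p
  nodup : ps.Nodup
  sorted : ps.Pairwise fun p q => pathWeight w wt p ≤ pathWeight w wt q

/-- The explicit form of a path: the list of its edges, each as its source followed by its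
target. -/
def encodePath {N : ℕ} (p : List (Fin N × Fin N)) : List ℕ :=
  p.flatMap fun e => [e.1.val, e.2.val]

/-! ### Random access machines

A program works on registers that hold natural numbers, on arrays of natural numbers and on arrays
of weights. Registers and arrays are named by numerals that are fixed in the text of the program,
so that a program uses finitely many of them; cells of arrays are addressed by computed indices.
Every operation and every memory access takes one step. Weights can only be copied, compared and
combined through `WeightOps`. -/

/-- An answer that has been delivered, with the number of steps and the space used until then. -/
structure Answer where
  word : List ℕ
  time : ℕ
  space : ℕ

/-- The state of a machine. `clock` counts the steps made so far, and `peak` is the largest natural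
number that has been computed, read, written or used as an address so far. Thus every cell that has
been accessed has an address `≤ peak` in one of the arrays, and holds a weight or a number
`≤ peak`. The output is write-only: `out` is the part of the current answer that has been written,
and `answers` are the answers delivered so far. -/
structure State (W : Type u) where
  reg : ℕ → ℕ
  mem : ℕ → ℕ → ℕ
  wmem : ℕ → ℕ → W
  clock : ℕ
  peak : ℕ
  out : List ℕ
  answers : List Answer

/-- Let `c` steps pass in which `p` is the largest number that occurs. -/
def State.tick {W : Type u} (σ : State W) (c p : ℕ) : State W :=
  { σ with clock := σ.clock + c, peak := max σ.peak p }

/-- Expressions for natural numbers: literals, registers, array cells, addition, truncated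
subtraction and halving. -/
inductive Exp : Type
  | lit (n : ℕ)
  | reg (x : ℕ)
  | cell (a : ℕ) (i : Exp)
  | add (e f : Exp)
  | sub (e f : Exp)
  | half (e : Exp)

namespace Exp

/-- The value of an expression. -/
def eval {W : Type u} (σ : State W) : Exp → ℕ
  | lit n => n
  | reg x => σ.reg x
  | cell a i => σ.mem a (i.eval σ)
  | add e f => e.eval σ + f.eval σ
  | sub e f => e.eval σ - f.eval σ
  | half e => e.eval σ / 2

/-- The number of steps of an evaluation. -/
def cost : Exp → ℕ
  | lit _ => 1
  | reg _ => 1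
  | cell _ i => i.cost + 1
  | add e f => e.cost + f.cost + 1
  | sub e f => e.cost + f.cost + 1
  | half e => e.cost + 1

/-- The largest number that occurs in an evaluation (addresses of cells included). -/
def peak {W : Type u} (σ : State W) : Exp → ℕ
  | lit n => n
  | reg x => σ.reg x
  | cell a i => max (i.peak σ) (σ.mem a (i.eval σ))
  | add e f => max (max (e.peak σ) (f.peak σ)) (e.eval σ + f.eval σ)
  | sub e f => max (e.peak σ) (f.peak σ)
  | half e => e.peak σ

end Exp

/-- Expressions for weights. -/
inductive WExp : Type
  | cell (a : ℕ) (i : Exp)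
  | empty
  | single (e : WExp)
  | combine (e f : WExp)

namespace WExp

/-- The value of an expression. -/
def eval {W : Type u} (ops : WeightOps W) (σ : State W) : WExp → W
  | cell a i => σ.wmem a (i.eval σ)
  | empty => ops.empty
  | single e => ops.single (e.eval ops σ)
  | combine e f => ops.combine (e.eval ops σ) (f.eval ops σ)

/-- The number of steps of an evaluation. -/
def cost : WExp → ℕ
  | cell _ i => i.cost + 1
  | empty => 1
  | single e => e.cost + 1
  | combine e f => e.cost + f.cost + 1

/-- The largest number that occurs in an evaluation. -/
def peak {W : Type u} (σ : State W) : WExp → ℕ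
  | cell _ i => i.peak σ
  | empty => 0
  | single e => e.peak σ
  | combine e f => max (e.peak σ) (f.peak σ)

end WExp

/-- Tests: comparisons of numbers, comparisons of weights, and Boolean combinations. -/
inductive Test : Type
  | lt (e f : Exp)
  | eq (e f : Exp)
  | wle (e f : WExp)
  | neg (b : Test)
  | conj (b c : Test)

namespace Test

/-- The truth value of a test. -/
def Holds {W : Type u} [LinearOrder W] (ops : WeightOps W) (σ : State W) : Test → Prop
  | lt e f => e.eval σ < f.eval σ
  | eq e f => e.eval σ = f.eval σ
  | wle e f => e.eval ops σ ≤ f.eval ops σ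
  | neg b => ¬ b.Holds ops σ
  | conj b c => b.Holds ops σ ∧ c.Holds ops σ

/-- The number of steps of a test. -/
def cost : Test → ℕ
  | lt e f => e.cost + f.cost + 1
  | eq e f => e.cost + f.cost + 1
  | wle e f => e.cost + f.cost + 1
  | neg b => b.cost + 1
  | conj b c => b.cost + c.cost + 1

/-- The largest number that occurs in a test. -/
def peak {W : Type u} (σ : State W) : Test → ℕ
  | lt e f => max (e.peak σ) (f.peak σ)
  | eq e f => max (e.peak σ) (f.peak σ)
  | wle e f => max (e.peak σ) (f.peak σ)
  | neg b => b.peak σ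
  | conj b c => max (b.peak σ) (c.peak σ)

end Test

/-- Programs. -/
inductive Program : Type
  | skip
  | assign (x : ℕ) (e : Exp)
  | store (a : ℕ) (i e : Exp)
  | wstore (a : ℕ) (i : Exp) (e : WExp)
  | emit (e : Exp)
  | deliver
  | seq (c d : Program)
  | branch (b : Test) (c d : Program)
  | loop (b : Test) (c : Program)

/-- `Run ops c σ τ`: the program `c`, started in the state `σ`, halts in the state `τ`. -/
inductive Run {W : Type u} [LinearOrder W] (ops : WeightOps W) :
    Program → State W → State W → Prop
  | skip (σ : State W) : Run ops .skip σ (σ.tick 1 0)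
  | assign (x : ℕ) (e : Exp) (σ : State W) :
      Run ops (.assign x e) σ
        ({ σ with reg := Function.update σ.reg x (e.eval σ) }.tick (e.cost + 1) (e.peak σ))
  | store (a : ℕ) (i e : Exp) (σ : State W) :
      Run ops (.store a i e) σ
        ({ σ with
            mem := Function.update σ.mem a
              (Function.update (σ.mem a) (i.eval σ) (e.eval σ)) }.tick
          (i.cost + e.cost + 1) (max (i.peak σ) (e.peak σ)))
  | wstore (a : ℕ) (i : Exp) (e : WExp) (σ : State W) :
      Run ops (.wstore a i e) σ
        ({ σ with
            wmem := Function.update σ.wmem a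
              (Function.update (σ.wmem a) (i.eval σ) (e.eval ops σ)) }.tick
          (i.cost + e.cost + 1) (max (i.peak σ) (e.peak σ)))
  | emit (e : Exp) (σ : State W) :
      Run ops (.emit e) σ
        ({ σ with out := σ.out ++ [e.eval σ] }.tick (e.cost + 1) (e.peak σ))
  | deliver (σ : State W) :
      Run ops .deliver σ
        ({ σ with
            out := []
            answers := σ.answers ++ [Answer.mk σ.out (σ.clock + 1) σ.peak] }.tick 1 0)
  | seq {c d : Program} {σ τ υ : State W} :
      Run ops c σ τ → Run ops d τ υ → Run ops (.seq c d) σ υ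
  | branch_true {b : Test} {c d : Program} {σ τ : State W} : b.Holds ops σ →
      Run ops c (σ.tick (b.cost + 1) (b.peak σ)) τ → Run ops (.branch b c d) σ τ
  | branch_false {b : Test} {c d : Program} {σ τ : State W} : ¬ b.Holds ops σ →
      Run ops d (σ.tick (b.cost + 1) (b.peak σ)) τ → Run ops (.branch b c d) σ τ
  | loop_true {b : Test} {c : Program} {σ τ υ : State W} : b.Holds ops σ →
      Run ops c (σ.tick (b.cost + 1) (b.peak σ)) τ → Run ops (.loop b c) τ υ →
      Run ops (.loop b c) σ υ
  | loop_false {b : Test} {c : Program} {σ : State W} : ¬ b.Holds ops σ →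
      Run ops (.loop b c) σ (σ.tick (b.cost + 1) (b.peak σ))

/-- The initial state for a weighted graph with source `s` and target `t`: registers `0` to `3`
hold the number of nodes, the number of edges, `s` and `t`; the number arrays `0` and `1` hold the
sources and the targets of the edges, and the weight array `0` holds the weights of the edges.
All other registers and cells are blank. -/
def initialState {W : Type u} {N : ℕ} (ops : WeightOps W) (G : DAG N) (wt : Fin N × Fin N → W)
    (s t : Fin N) : State W where
  reg := fun x =>
    if x = 0 then N
    else if x = 1 then G.edges.length
    else if x = 2 then s.val
    else if x = 3 then t.val
    else 0
  mem := fun a i =>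
    if h : i < G.edges.length then
      if a = 0 then (G.edges[i]).1.val
      else if a = 1 then (G.edges[i]).2.val
      else 0
    else 0
  wmem := fun a i =>
    if h : i < G.edges.length then
      if a = 0 then wt G.edges[i] else ops.empty
    else ops.empty
  clock := 0
  peak := 0
  out := []
  answers := []

end AnyK

/-! The paths from each node `v` to `t` are ranked lazily and recursively. A node keeps the list of
the paths found so far; each is stored in constant space, as a first edge and an entry in the list
of the head of that edge. A tournament tree has one leaf for every edge out of `v` whose head
reaches `t`; the candidate of a leaf is its edge followed by one entry of the head, its current
entry. By subset-monotonicity, a path that is not yet listed weighs at least as much as some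
candidate, so the best candidate is the next path of `v` (`Core.exists_leaf`, `Core.create`). To get
the next path, the leaf that gave the last one moves to the next entry of its head; if that entry
does not exist yet, the list of the head is extended first. Hence one answer descends along at most
`ℓ` edges (`downLoop_spec`) and advances at most one leaf per level on the way back (`upLoop_spec`).

With balanced trees an answer would cost `ℓ log N`. Instead, the trees adapt to their use: above the
leaf that has advanced, `fixup` rotates in the manner of splaying. For any weights at least `1` on
the leaves, let the potential be the sum of the logarithms of the masses of the inner nodes. Then an
advance of leaf `f` in a tree of mass `M` makes at most `2 (log M - log (w f))` rotations, amortized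
(`fixup_spec`, `TreeOk.amort`). The weights occur in the analysis only, so they may be chosen after
the run: `w f = 1 + A * q f`, where `A` is the number of advances at the node and `q f` is the share
of the leaf. By `two_mul_add_sum_le`, the rotations at a node are then bounded by a multiple of its
degree and of `A`, plus the entropy term `2 ∑ pos f * log (1 / q f)`.

The point is that these entropies do not add up to `ℓ log N` per answer. The list of a node `u ≠ s`
grows only because some leaf at its end asks for more, so all advances at `u` are matched by those
of a single leaf that leads to `u` (`Ghost.Led`). Taking such a leaf as the heavy arc into `u` gives
a forest. Let `S v` be the number of nodes below `v` in it. A heavy arc gets the share `S (head) / S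
(own)`, any other arc `1 / N`. The logarithms of the heavy shares telescope along the flow of
advances, and the other arcs carry in total no more than the flow out of `s`, which is at most `k`.
So the total entropy is at most `3 k log N` (`exists_shares`), and the rotations for `k` answers
number `O(|E| + k (log N + ℓ))` (`Inv.sum_rot_le`).

The preprocessing visits the nodes from the sinks upwards and gives each a balanced tree and its
best path, in linear time (`visitLoop_spec`); balanced trees have a potential that is linear in
leaves and mass for all weights (`BT.Balanced.pot_le`). For the space, every straight piece of code
raises the largest number by at most a constant, and rotations do not raise it at all. The
comparison with `k log k` is elementary: `k log N` is large compared with `k log k` only if `k` is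
so small that `N` dominates it (`mul_log_le`), while layered graphs have exponentially many paths
(`exists_bound_lt`). -/

namespace AnyK

/-! ### Static bounds on programs -/

/-- By how much a number in the evaluation can exceed all numbers in the state. The clause for sums
is meaningful only under `Exp.linear`, where the second summand is a literal. -/
def Exp.growth : Exp → ℕ
  | .lit n => n
  | .reg _ => 0
  | .cell _ i => i.growth
  | .add e f => e.growth + f.growth
  | .sub e f => max e.growth f.growth
  | .half e => e.growth

def Exp.isLit : Exp → Bool
  | .lit _ => true
  | _ => false

/-- Sums have a literal as their second summand. -/
def Exp.linear : Exp → Bool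
  | .lit _ => true
  | .reg _ => true
  | .cell _ i => i.linear
  | .add e f => e.linear && f.isLit
  | .sub e f => e.linear && f.linear
  | .half e => e.linear

def WExp.growth : WExp → ℕ
  | .cell _ i => i.growth
  | .empty => 0
  | .single e => e.growth
  | .combine e f => max e.growth f.growth

def WExp.linear : WExp → Bool
  | .cell _ i => i.linear
  | .empty => true
  | .single e => e.linear
  | .combine e f => e.linear && f.linear

def Test.growth : Test → ℕ
  | .lt e f => max e.growth f.growth
  | .eq e f => max e.growth f.growth
  | .wle e f => max e.growth f.growth
  | .neg b => b.growth
  | .conj b c => max b.growth c.growth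

def Test.linear : Test → Bool
  | .lt e f => e.linear && f.linear
  | .eq e f => e.linear && f.linear
  | .wle e f => e.linear && f.linear
  | .neg b => b.linear
  | .conj b c => b.linear && c.linear

namespace Program

/-- Programs without loops and deliveries, whose sums are increments. -/
def straight : Program → Bool
  | .skip => true
  | .assign _ e => e.linear
  | .store _ i e => i.linear && e.linear
  | .wstore _ i e => i.linear && e.linear
  | .emit e => e.linear
  | .deliver => false
  | .seq c d => c.straight && d.straight
  | .branch b c d => b.linear && c.straight && d.straight
  | .loop _ _ => false

/-- The worst case over branches. The value at loops is a dummy, since only `straight` programs are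
measured in this way. -/
def time : Program → ℕ
  | .skip => 1
  | .assign _ e => e.cost + 1
  | .store _ i e => i.cost + e.cost + 1
  | .wstore _ i e => i.cost + e.cost + 1
  | .emit e => e.cost + 1
  | .deliver => 1
  | .seq c d => c.time + d.time
  | .branch b c d => b.cost + 1 + max c.time d.time
  | .loop _ _ => 0

/-- A bound on the increase of the largest number in a run without loops. -/
def growth : Program → ℕ
  | .skip => 0
  | .assign _ e => e.growth
  | .store _ i e => max i.growth e.growth
  | .wstore _ i e => max i.growth e.growth
  | .emit e => e.growth
  | .deliver => 0
  | .seq c d => c.growth + d.growth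
  | .branch b c d => b.growth + max c.growth d.growth
  | .loop _ _ => 0

/-- The registers that a program assigns. -/
def regs : Program → List ℕ
  | .assign x _ => [x]
  | .seq c d => c.regs ++ d.regs
  | .branch _ c d => c.regs ++ d.regs
  | .loop _ c => c.regs
  | _ => []

/-- The number arrays that a program writes. -/
def arrays : Program → List ℕ
  | .store a _ _ => [a]
  | .seq c d => c.arrays ++ d.arrays
  | .branch _ c d => c.arrays ++ d.arrays
  | .loop _ c => c.arrays
  | _ => []

/-- The weight arrays that a program writes. -/
def warrays : Program → List ℕ
  | .wstore a _ _ => [a]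
  | .seq c d => c.warrays ++ d.warrays
  | .branch _ c d => c.warrays ++ d.warrays
  | .loop _ c => c.warrays
  | _ => []

/-- Programs that produce no output. -/
def quiet : Program → Bool
  | .emit _ => false
  | .deliver => false
  | .seq c d => c.quiet && d.quiet
  | .branch _ c d => c.quiet && d.quiet
  | .loop _ c => c.quiet
  | _ => true

open Classical in
/-- The effect of a program without loops and deliveries on registers, memory and output. -/
noncomputable def exec {W : Type u} [LinearOrder W] (ops : WeightOps W) :
    Program → State W → State W
  | .skip, σ => σ
  | .assign x e, σ => { σ with reg := Function.update σ.reg x (e.eval σ) }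
  | .store a i e, σ =>
      { σ with
        mem := Function.update σ.mem a
          (Function.update (σ.mem a) (i.eval σ) (e.eval σ)) }
  | .wstore a i e, σ =>
      { σ with
        wmem := Function.update σ.wmem a
          (Function.update (σ.wmem a) (i.eval σ) (e.eval ops σ)) }
  | .emit e, σ => { σ with out := σ.out ++ [e.eval σ] }
  | .deliver, σ => σ
  | .seq c d, σ => d.exec ops (c.exec ops σ)
  | .branch b c d, σ => if b.Holds ops σ then c.exec ops σ else d.exec ops σ
  | .loop _ _, σ => σ

end Program

/-! ### Runs up to clock and peak -/

/-- Two states agree in registers, memory and current answer. -/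
structure State.Sim {W : Type u} (σ τ : State W) : Prop where
  reg : σ.reg = τ.reg
  mem : σ.mem = τ.mem
  wmem : σ.wmem = τ.wmem
  out : σ.out = τ.out

/-- All numbers in the registers and in the memory, and all that occurred before, are `≤ B`. -/
structure State.Bounded {W : Type u} (B : ℕ) (σ : State W) : Prop where
  peak : σ.peak ≤ B
  reg : ∀ x, σ.reg x ≤ B
  mem : ∀ a i, σ.mem a i ≤ B

section
variable {W : Type u} {σ τ υ : State W}

theorem State.Sim.refl (σ : State W) : σ.Sim σ := ⟨rfl, rfl, rfl, rfl⟩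

theorem State.Sim.trans (h : σ.Sim τ) (h' : τ.Sim υ) : σ.Sim υ :=
  ⟨h.1.trans h'.1, h.2.trans h'.2, h.3.trans h'.3, h.4.trans h'.4⟩

theorem State.tick_sim (σ : State W) (c p : ℕ) : (σ.tick c p).Sim σ := ⟨rfl, rfl, rfl, rfl⟩

theorem State.Bounded.mono {B C : ℕ} (h : σ.Bounded B) (hB : B ≤ C) : σ.Bounded C :=
  ⟨h.1.trans hB, fun x => (h.2 x).trans hB, fun a i => (h.3 a i).trans hB⟩

theorem State.Bounded.tick {B c p : ℕ} (h : σ.Bounded B) (hp : p ≤ B) : (σ.tick c p).Bounded B :=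
  ⟨max_le h.1 hp, h.2, h.3⟩

theorem State.Sim.exp_eval (h : σ.Sim τ) (e : Exp) : e.eval σ = e.eval τ := by
  induction e <;> simp_all [Exp.eval, h.reg, h.mem]

theorem State.Sim.wexp_eval (h : σ.Sim τ) (ops : WeightOps W) (e : WExp) :
    e.eval ops σ = e.eval ops τ := by
  induction e <;> simp_all [WExp.eval, h.wmem, h.exp_eval]

theorem State.Sim.holds [LinearOrder W] (h : σ.Sim τ) (ops : WeightOps W) (b : Test) :
    b.Holds ops σ ↔ b.Holds ops τ := by
  induction b <;> simp_all [Test.Holds, h.exp_eval, h.wexp_eval]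

/-- Adding two registers could double the largest number; adding a literal raises it by a constant.
This is why space can be bounded by counting straight pieces of code. -/
theorem Exp.eval_le {B : ℕ} (h : σ.Bounded B) (e : Exp) (he : e.linear) :
    e.eval σ ≤ B + e.growth := by
  induction e with
  | lit n => simp [Exp.eval, Exp.growth]
  | reg x => simpa [Exp.eval, Exp.growth] using h.reg x
  | cell a i => exact (h.mem _ _).trans (Nat.le_add_right _ _)
  | add e f ihe ihf =>
    simp only [Exp.linear, Bool.and_eq_true] at he
    have := ihe he.1
    cases f <;> simp_all [Exp.isLit, Exp.eval, Exp.growth]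
    omega
  | sub e f ihe ihf =>
    simp only [Exp.linear, Bool.and_eq_true] at he
    have := ihe he.1
    simp only [Exp.eval, Exp.growth]
    omega
  | half e ih =>
    have := ih he
    simp only [Exp.eval, Exp.growth]
    omega

theorem Exp.peak_le {B : ℕ} (h : σ.Bounded B) (e : Exp) (he : e.linear) :
    e.peak σ ≤ B + e.growth := by
  induction e with
  | lit n => simp [Exp.peak, Exp.growth]
  | reg x => simpa [Exp.peak, Exp.growth] using h.reg x
  | cell a i ih => exact max_le (ih he) ((h.mem _ _).trans (Nat.le_add_right _ _))
  | add e f ihe ihf =>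
    have h3 := Exp.eval_le h _ he
    simp only [Exp.linear, Bool.and_eq_true] at he
    have h1 := ihe he.1
    simp only [Exp.peak, Exp.growth, Exp.eval] at h3 ⊢
    have h2 : f.peak σ ≤ f.growth := by
      cases f <;> simp_all [Exp.isLit, Exp.peak, Exp.growth]
    omega
  | sub e f ihe ihf =>
    simp only [Exp.linear, Bool.and_eq_true] at he
    have := ihe he.1
    have := ihf he.2
    simp only [Exp.peak, Exp.growth]
    omega
  | half e ih => exact ih he

theorem WExp.peak_le {B : ℕ} (h : σ.Bounded B) (e : WExp) (he : e.linear) :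
    e.peak σ ≤ B + e.growth := by
  induction e with
  | cell a i => exact Exp.peak_le h i he
  | empty => simp [WExp.peak]
  | single e ih => exact ih he
  | combine e f ihe ihf =>
    simp only [WExp.linear, Bool.and_eq_true] at he
    have := ihe he.1
    have := ihf he.2
    simp only [WExp.peak, WExp.growth]
    omega

theorem Test.peak_le {B : ℕ} (h : σ.Bounded B) (b : Test) (hb : b.linear) :
    b.peak σ ≤ B + b.growth := by
  induction b with
  | lt e f =>
    simp only [Test.linear, Bool.and_eq_true] at hb
    have := Exp.peak_le h e hb.1
    have := Exp.peak_le h f hb.2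
    simp only [Test.peak, Test.growth]
    omega
  | eq e f =>
    simp only [Test.linear, Bool.and_eq_true] at hb
    have := Exp.peak_le h e hb.1
    have := Exp.peak_le h f hb.2
    simp only [Test.peak, Test.growth]
    omega
  | wle e f =>
    simp only [Test.linear, Bool.and_eq_true] at hb
    have := WExp.peak_le h e hb.1
    have := WExp.peak_le h f hb.2
    simp only [Test.peak, Test.growth]
    omega
  | neg b ih => exact ih hb
  | conj b c ihb ihc =>
    simp only [Test.linear, Bool.and_eq_true] at hb
    have := ihb hb.1
    have := ihc hb.2
    simp only [Test.peak, Test.growth]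
    omega

theorem State.Bounded.tick_test {σ : State W} {B c : ℕ} {b : Test} (h : σ.Bounded B)
    (hb : b.linear) : (σ.tick c (b.peak σ)).Bounded (B + b.growth) :=
  (h.mono (Nat.le_add_right _ _)).tick (Test.peak_le h b hb)

end

/-! ### Rules for composing runs, with their time and space -/

section
variable {W : Type u} [LinearOrder W] {ops : WeightOps W}

/-- Up to clock, peak and answers, `c` leads from `σ` to `τ`; it takes at most `T` steps, increases
the largest number by at most `g`, and delivers no answers. -/
def Leads (ops : WeightOps W) (c : Program) (σ τ : State W) (T g : ℕ) : Prop :=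
  ∀ σ' : State W, σ'.Sim σ → ∃ τ' : State W, Run ops c σ' τ' ∧ τ'.Sim τ ∧
    τ'.answers = σ'.answers ∧ τ'.clock ≤ σ'.clock + T ∧ ∀ B, σ'.Bounded B → τ'.Bounded (B + g)

theorem Leads.mono {c : Program} {σ τ : State W} {T T' g g' : ℕ} (h : Leads ops c σ τ T g)
    (hT : T ≤ T') (hg : g ≤ g') : Leads ops c σ τ T' g' := by
  intro σ' hσ
  obtain ⟨τ', h1, h2, h3, h4, h5⟩ := h σ' hσ
  exact ⟨τ', h1, h2, h3, by omega, fun B hB => (h5 B hB).mono (by omega)⟩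

theorem Leads.seq {c d : Program} {σ τ υ : State W} {T T' g g' : ℕ} (h : Leads ops c σ τ T g)
    (h' : Leads ops d τ υ T' g') : Leads ops (.seq c d) σ υ (T + T') (g + g') := by
  intro σ' hσ
  obtain ⟨τ', h1, h2, h3, h4, h5⟩ := h σ' hσ
  obtain ⟨υ', k1, k2, k3, k4, k5⟩ := h' τ' h2
  exact ⟨υ', .seq h1 k1, k2, k3.trans h3, by omega,
    fun B hB => (k5 _ (h5 B hB)).mono (by omega)⟩

theorem Leads.branch_true {b : Test} {c d : Program} {σ τ : State W} {T g : ℕ}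
    (hb : b.Holds ops σ) (hl : b.linear) (h : Leads ops c σ τ T g) :
    Leads ops (.branch b c d) σ τ (T + (b.cost + 1)) (g + b.growth) := by
  intro σ' hσ
  obtain ⟨τ', h1, h2, h3, h4, h5⟩ := h (σ'.tick (b.cost + 1) (b.peak σ'))
    ((State.tick_sim _ _ _).trans hσ)
  refine ⟨τ', .branch_true ((hσ.holds _ _).2 hb) h1, h2, h3, ?_, fun B hB =>
    (h5 _ (hB.tick_test hl)).mono (by omega)⟩
  simp only [State.tick] at h4
  omega

theorem Leads.branch_false {b : Test} {c d : Program} {σ τ : State W} {T g : ℕ}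
    (hb : ¬ b.Holds ops σ) (hl : b.linear) (h : Leads ops d σ τ T g) :
    Leads ops (.branch b c d) σ τ (T + (b.cost + 1)) (g + b.growth) := by
  intro σ' hσ
  obtain ⟨τ', h1, h2, h3, h4, h5⟩ := h (σ'.tick (b.cost + 1) (b.peak σ'))
    ((State.tick_sim _ _ _).trans hσ)
  refine ⟨τ', .branch_false (fun k => hb ((hσ.holds _ _).1 k)) h1, h2, h3, ?_, fun B hB =>
    (h5 _ (hB.tick_test hl)).mono (by omega)⟩
  simp only [State.tick] at h4
  omega

theorem Leads.loop_false {b : Test} {c : Program} {σ : State W}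
    (hb : ¬ b.Holds ops σ) (hl : b.linear) :
    Leads ops (.loop b c) σ σ (b.cost + 1) b.growth := by
  intro σ' hσ
  exact ⟨_, .loop_false (fun k => hb ((hσ.holds _ _).1 k)), (State.tick_sim _ _ _).trans hσ, rfl,
    le_rfl, fun B hB => hB.tick_test hl⟩

theorem Leads.loop_true {b : Test} {c : Program} {σ τ υ : State W} {T T' g g' : ℕ}
    (hb : b.Holds ops σ) (hl : b.linear) (h : Leads ops c σ τ T g)
    (h' : Leads ops (.loop b c) τ υ T' g') :
    Leads ops (.loop b c) σ υ (T + (b.cost + 1) + T') (g + b.growth + g') := by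
  intro σ' hσ
  obtain ⟨τ', h1, h2, h3, h4, h5⟩ := h (σ'.tick (b.cost + 1) (b.peak σ'))
    ((State.tick_sim _ _ _).trans hσ)
  obtain ⟨υ', k1, k2, k3, k4, k5⟩ := h' τ' h2
  refine ⟨υ', .loop_true ((hσ.holds _ _).2 hb) h1 k1, k2, k3.trans h3, ?_,
    fun B hB => (k5 _ (h5 _ (hB.tick_test hl))).mono (by omega)⟩
  simp only [State.tick] at h4
  omega

/-- Reduces straight code to computation: its effect is found by simplifying `exec`, and its time
and growth are numerals that `decide` evaluates. -/
theorem Leads.exec (c : Program) (hc : c.straight) (σ : State W) :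
    Leads ops c σ (c.exec ops σ) c.time c.growth := by
  induction c generalizing σ with
  | skip =>
    exact fun σ' hσ => ⟨_, .skip σ', (State.tick_sim _ _ _).trans hσ, rfl, le_rfl,
      fun B hB => hB.tick (Nat.zero_le _)⟩
  | assign x e =>
    refine fun σ' hσ => ⟨_, .assign x e σ', ?_, rfl, le_rfl, fun B hB => ?_⟩
    · exact ⟨by simp [State.tick, Program.exec, hσ.reg, hσ.exp_eval], hσ.mem, hσ.wmem, hσ.out⟩
    · refine ⟨max_le (hB.peak.trans (Nat.le_add_right _ _)) (Exp.peak_le hB e hc), fun y => ?_,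
        fun a i => (hB.mem a i).trans (Nat.le_add_right _ _)⟩
      simp only [State.tick, Function.update_apply]
      split
      · exact Exp.eval_le hB e hc
      · exact (hB.reg y).trans (Nat.le_add_right _ _)
  | store a i e =>
    simp only [Program.straight, Bool.and_eq_true] at hc
    refine fun σ' hσ => ⟨_, .store a i e σ', ?_, rfl, le_rfl, fun B hB => ?_⟩
    · exact ⟨hσ.reg, by simp [State.tick, Program.exec, hσ.mem, hσ.exp_eval], hσ.wmem, hσ.out⟩
    · have h1 := Exp.peak_le hB i hc.1
      have h2 := Exp.peak_le hB e hc.2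
      have h3 := Exp.eval_le hB e hc.2
      have h4 := hB.peak
      refine ⟨?_, fun y => (hB.reg y).trans (Nat.le_add_right _ _), fun a' j => ?_⟩
      · simp only [State.tick, Program.growth]
        omega
      · simp only [State.tick, Function.update_apply, Program.growth]
        have := hB.mem a' j
        have := hB.mem a j
        split
        · rw [Function.update_apply]
          split <;> omega
        · omega
  | wstore a i e =>
    simp only [Program.straight, Bool.and_eq_true] at hc
    refine fun σ' hσ => ⟨_, .wstore a i e σ', ?_, rfl, le_rfl, fun B hB => ?_⟩
    · exact ⟨hσ.reg, hσ.mem,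
        by simp [State.tick, Program.exec, hσ.wmem, hσ.exp_eval, hσ.wexp_eval], hσ.out⟩
    · have h1 := Exp.peak_le hB i hc.1
      have h2 := WExp.peak_le hB e hc.2
      have h4 := hB.peak
      refine ⟨?_, fun y => (hB.reg y).trans (Nat.le_add_right _ _),
        fun a i => (hB.mem a i).trans (Nat.le_add_right _ _)⟩
      simp only [State.tick, Program.growth]
      omega
  | emit e =>
    refine fun σ' hσ => ⟨_, .emit e σ', ?_, rfl, le_rfl, fun B hB => ?_⟩
    · exact ⟨hσ.reg, hσ.mem, hσ.wmem,
        by simp [State.tick, Program.exec, hσ.out, hσ.exp_eval]⟩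
    · exact ⟨max_le (hB.peak.trans (Nat.le_add_right _ _)) (Exp.peak_le hB e hc),
        fun y => (hB.reg y).trans (Nat.le_add_right _ _),
        fun a i => (hB.mem a i).trans (Nat.le_add_right _ _)⟩
  | deliver => simp [Program.straight] at hc
  | seq c d ihc ihd =>
    simp only [Program.straight, Bool.and_eq_true] at hc
    exact (ihc hc.1 σ).seq (ihd hc.2 _)
  | branch b c d ihc ihd =>
    simp only [Program.straight, Bool.and_eq_true] at hc
    simp only [Program.exec]
    split
    next hb =>
      exact (Leads.branch_true hb hc.1.1 (ihc hc.1.2 σ)).mono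
        (by simp only [Program.time]; omega) (by simp only [Program.growth]; omega)
    next hb =>
      exact (Leads.branch_false hb hc.1.1 (ihd hc.2 σ)).mono
        (by simp only [Program.time]; omega) (by simp only [Program.growth]; omega)
  | loop b c => simp [Program.straight] at hc

/-! ### Frame rules: what a program does not mention stays as it is -/

theorem Run.frame_reg {c : Program} {σ τ : State W} (h : Run ops c σ τ) {x : ℕ}
    (hx : x ∉ c.regs) : τ.reg x = σ.reg x := by
  induction h with
  | assign y e σ =>
    simp only [Program.regs, List.mem_singleton] at hx
    simp [State.tick, Function.update_of_ne hx]
  | seq _ _ ih1 ih2 =>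
    simp only [Program.regs, List.mem_append, not_or] at hx
    rw [ih2 hx.2, ih1 hx.1]
  | branch_true _ _ ih =>
    simp only [Program.regs, List.mem_append, not_or] at hx
    exact ih hx.1
  | branch_false _ _ ih =>
    simp only [Program.regs, List.mem_append, not_or] at hx
    exact ih hx.2
  | loop_true _ _ _ ih1 ih2 => exact (ih2 hx).trans (ih1 hx)
  | _ => rfl

theorem Run.frame_mem {c : Program} {σ τ : State W} (h : Run ops c σ τ) {a : ℕ}
    (ha : a ∉ c.arrays) : τ.mem a = σ.mem a := by
  induction h with
  | store b i e σ =>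
    simp only [Program.arrays, List.mem_singleton] at ha
    simp [State.tick, Function.update_of_ne ha]
  | seq _ _ ih1 ih2 =>
    simp only [Program.arrays, List.mem_append, not_or] at ha
    rw [ih2 ha.2, ih1 ha.1]
  | branch_true _ _ ih =>
    simp only [Program.arrays, List.mem_append, not_or] at ha
    exact ih ha.1
  | branch_false _ _ ih =>
    simp only [Program.arrays, List.mem_append, not_or] at ha
    exact ih ha.2
  | loop_true _ _ _ ih1 ih2 => exact (ih2 ha).trans (ih1 ha)
  | _ => rfl

theorem Run.frame_wmem {c : Program} {σ τ : State W} (h : Run ops c σ τ) {a : ℕ}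
    (ha : a ∉ c.warrays) : τ.wmem a = σ.wmem a := by
  induction h with
  | wstore b i e σ =>
    simp only [Program.warrays, List.mem_singleton] at ha
    simp [State.tick, Function.update_of_ne ha]
  | seq _ _ ih1 ih2 =>
    simp only [Program.warrays, List.mem_append, not_or] at ha
    rw [ih2 ha.2, ih1 ha.1]
  | branch_true _ _ ih =>
    simp only [Program.warrays, List.mem_append, not_or] at ha
    exact ih ha.1
  | branch_false _ _ ih =>
    simp only [Program.warrays, List.mem_append, not_or] at ha
    exact ih ha.2
  | loop_true _ _ _ ih1 ih2 => exact (ih2 ha).trans (ih1 ha)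
  | _ => rfl

theorem Run.frame_out {c : Program} {σ τ : State W} (h : Run ops c σ τ) (hc : c.quiet) :
    τ.out = σ.out := by
  induction h with
  | emit => simp [Program.quiet] at hc
  | deliver => simp [Program.quiet] at hc
  | seq _ _ ih1 ih2 =>
    simp only [Program.quiet, Bool.and_eq_true] at hc
    rw [ih2 hc.2, ih1 hc.1]
  | branch_true _ _ ih =>
    simp only [Program.quiet, Bool.and_eq_true] at hc
    exact ih hc.1
  | branch_false _ _ ih =>
    simp only [Program.quiet, Bool.and_eq_true] at hc
    exact ih hc.2
  | loop_true _ _ _ ih1 ih2 => exact (ih2 hc).trans (ih1 hc)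
  | _ => rfl

theorem Leads.frame_reg {c : Program} {σ τ : State W} {T g : ℕ} (h : Leads ops c σ τ T g) (x : ℕ)
    (hx : x ∉ c.regs) : τ.reg x = σ.reg x := by
  obtain ⟨τ', h1, h2, -⟩ := h σ (.refl _)
  rw [← h2.reg, h1.frame_reg hx]

theorem Leads.frame_mem {c : Program} {σ τ : State W} {T g : ℕ} (h : Leads ops c σ τ T g) (a : ℕ)
    (ha : a ∉ c.arrays) : τ.mem a = σ.mem a := by
  obtain ⟨τ', h1, h2, -⟩ := h σ (.refl _)
  rw [← h2.mem, h1.frame_mem ha]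

theorem Leads.frame_wmem {c : Program} {σ τ : State W} {T g : ℕ} (h : Leads ops c σ τ T g) (a : ℕ)
    (ha : a ∉ c.warrays) : τ.wmem a = σ.wmem a := by
  obtain ⟨τ', h1, h2, -⟩ := h σ (.refl _)
  rw [← h2.wmem, h1.frame_wmem ha]

theorem Leads.frame_out {c : Program} {σ τ : State W} {T g : ℕ} (h : Leads ops c σ τ T g)
    (hc : c.quiet) : τ.out = σ.out := by
  obtain ⟨τ', h1, h2, -⟩ := h σ (.refl _)
  rw [← h2.out, h1.frame_out hc]

end

/-! ### Tournament trees

Node `i` of a tree has its parent, its sibling, and the best leaf below it in the arrays `10`, `11`,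
`12`. A leaf has an edge in array `13` and, in array `14`, an entry of the list of its head. -/

inductive BT : Type
  | leaf (i : ℕ)
  | node (i : ℕ) (l r : BT)

namespace BT

def id : BT → ℕ
  | leaf i => i
  | node i _ _ => i

/-- The nodes below the root. -/
def inner : BT → List ℕ
  | leaf _ => []
  | node _ l r => (l.id :: l.inner) ++ (r.id :: r.inner)

def ids (T : BT) : List ℕ := T.id :: T.inner

def leaves : BT → List ℕ
  | leaf i => [i]
  | node _ l r => l.leaves ++ r.leaves

/-- The total weight of the leaves. -/
noncomputable def mass (w : ℕ → ℝ) (T : BT) : ℝ := (T.leaves.map w).sum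

/-- The potential: the sum of the logarithms of the masses of all inner nodes. -/
noncomputable def pot (w : ℕ → ℝ) : BT → ℝ
  | leaf _ => 0
  | node _ l r => Real.log (l.mass w + r.mass w) + l.pot w + r.pot w

theorem ids_leaf (i : ℕ) : (leaf i).ids = [i] := rfl

theorem ids_node (i : ℕ) (l r : BT) : (node i l r).ids = i :: (l.ids ++ r.ids) := rfl

theorem id_mem_ids (T : BT) : T.id ∈ T.ids := List.mem_cons_self

theorem leaves_sublist_ids (T : BT) : T.leaves.Sublist T.ids := by
  induction T with
  | leaf i => exact List.Sublist.refl _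
  | node i l r ihl ihr => exact List.Sublist.cons _ (ihl.append ihr)

theorem leaves_ne_nil (T : BT) : T.leaves ≠ [] := by
  induction T with
  | leaf i => simp [leaves]
  | node i l r ihl ihr => simp [leaves, ihl]

theorem mass_leaf (w : ℕ → ℝ) (i : ℕ) : (leaf i).mass w = w i := by simp [mass, leaves]

theorem mass_node (w : ℕ → ℝ) (i : ℕ) (l r : BT) :
    (node i l r).mass w = l.mass w + r.mass w := by simp [mass, leaves]

theorem one_le_mass {w : ℕ → ℝ} (hw : ∀ i, 1 ≤ w i) (T : BT) : 1 ≤ T.mass w := by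
  induction T with
  | leaf i => rw [mass_leaf]; exact hw i
  | node i l r ihl ihr => rw [mass_node]; linarith

/-- Weights are at least `1` so that no logarithm is negative; at the end of the amortization the
remaining potential is dropped. -/
theorem pot_nonneg {w : ℕ → ℝ} (hw : ∀ i, 1 ≤ w i) (T : BT) : 0 ≤ T.pot w := by
  induction T with
  | leaf i => exact le_rfl
  | node i l r ihl ihr =>
    have h1 := one_le_mass hw l
    have h2 := one_le_mass hw r
    have := Real.log_nonneg (show 1 ≤ l.mass w + r.mass w by linarith)
    simp only [pot]
    linarith

end BT

/-- `b` is a leaf in `A` of least value, or `0` if all leaves in `A` are exhausted. -/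
def WinOk {W : Type u} [LinearOrder W] (val : ℕ → WithTop W) (b : ℕ) (A : List ℕ) : Prop :=
  (b = 0 ∧ ∀ f ∈ A, val f = ⊤) ∨ (b ≠ 0 ∧ b ∈ A ∧ val b ≠ ⊤ ∧ ∀ f ∈ A, val b ≤ val f)

/-! ### Winners, represented trees, and contexts of subtrees -/

section
variable {W : Type u} [LinearOrder W] {par sib win par' sib' win' : ℕ → ℕ}
  {val val' : ℕ → WithTop W}

theorem WinOk.congr {b : ℕ} {A : List ℕ} (h : WinOk val b A) (hv : ∀ f ∈ A, val' f = val f) :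
    WinOk val' b A := by
  rcases h with ⟨h1, h2⟩ | ⟨h1, h2, h3, h4⟩
  · exact .inl ⟨h1, fun f hf => (hv f hf).trans (h2 f hf)⟩
  · exact .inr ⟨h1, h2, by rwa [hv b h2], fun f hf => by rw [hv b h2, hv f hf]; exact h4 f hf⟩

theorem WinOk.subset {b : ℕ} {A B : List ℕ} (h : WinOk val b A) (h1 : A ⊆ B) (h2 : B ⊆ A) :
    WinOk val b B := by
  rcases h with ⟨k1, k2⟩ | ⟨k1, k2, k3, k4⟩
  · exact .inl ⟨k1, fun f hf => k2 f (h2 hf)⟩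
  · exact .inr ⟨k1, h1 k2, k3, fun f hf => k4 f (h2 hf)⟩

theorem WinOk.append_zero {b : ℕ} {A B : List ℕ} (h : WinOk val b A) (h' : WinOk val 0 B) :
    WinOk val b (A ++ B) := by
  have hB : ∀ f ∈ B, val f = ⊤ := by
    rcases h' with h' | h'
    · exact h'.2
    · exact absurd rfl h'.1
  rcases h with ⟨k1, k2⟩ | ⟨k1, k2, k3, k4⟩
  · refine .inl ⟨k1, fun f hf => ?_⟩
    rcases List.mem_append.1 hf with hf | hf
    exacts [k2 f hf, hB f hf]
  · refine .inr ⟨k1, List.mem_append_left _ k2, k3, fun f hf => ?_⟩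
    rcases List.mem_append.1 hf with hf | hf
    · exact k4 f hf
    · rw [hB f hf]; exact le_top

theorem WinOk.append_comm {b : ℕ} {A B : List ℕ} (h : WinOk val b (A ++ B)) :
    WinOk val b (B ++ A) :=
  h.subset (by simp) (by simp)

theorem WinOk.append_le {b c : ℕ} {A B : List ℕ} (h : WinOk val b A) (h' : WinOk val c B)
    (hb : b ≠ 0) (hc : c ≠ 0) (hbc : val b ≤ val c) : WinOk val b (A ++ B) := by
  rcases h with ⟨k1, k2⟩ | ⟨k1, k2, k3, k4⟩
  · exact absurd k1 hb
  rcases h' with ⟨m1, m2⟩ | ⟨m1, m2, m3, m4⟩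
  · exact absurd m1 hc
  refine .inr ⟨k1, List.mem_append_left _ k2, k3, fun f hf => ?_⟩
  rcases List.mem_append.1 hf with hf | hf
  exacts [k4 f hf, hbc.trans (m4 f hf)]

/-- The arrays `par`, `sib`, `win` represent the tree. -/
def Rep (par sib win : ℕ → ℕ) (val : ℕ → WithTop W) : BT → Prop
  | .leaf i => WinOk val (win i) [i]
  | .node i l r => par l.id = i ∧ par r.id = i ∧ sib l.id = r.id ∧ sib r.id = l.id ∧
      WinOk val (win i) (l.leaves ++ r.leaves) ∧ Rep par sib win val l ∧ Rep par sib win val r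

theorem Rep.winOk {T : BT} (h : Rep par sib win val T) : WinOk val (win T.id) T.leaves := by
  cases T with
  | leaf i => exact h
  | node i l r => exact h.2.2.2.2.1

/-- The parent and the sibling of the root are not part of `Rep`, hence `T.inner` for `par` and
`sib` but `T.ids` for `win`: a subtree can be hung elsewhere unharmed. -/
theorem Rep.congr {T : BT} (h : Rep par sib win val T) (hp : ∀ i ∈ T.inner, par' i = par i)
    (hs : ∀ i ∈ T.inner, sib' i = sib i) (hw : ∀ i ∈ T.ids, win' i = win i)
    (hv : ∀ i ∈ T.leaves, val' i = val i) : Rep par' sib' win' val' T := by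
  induction T with
  | leaf i =>
    have : win' i = win i := hw i (BT.id_mem_ids _)
    simp only [Rep, this] at h ⊢
    exact h.congr hv
  | node i l r ihl ihr =>
    obtain ⟨h1, h2, h3, h4, h5, h6, h7⟩ := h
    have hl : l.id ∈ (BT.node i l r).inner := by simp [BT.inner]
    have hr : r.id ∈ (BT.node i l r).inner := by simp [BT.inner]
    refine ⟨by rw [hp _ hl, h1], by rw [hp _ hr, h2], by rw [hs _ hl, h3], by rw [hs _ hr, h4], ?_,
      ihl h6 ?_ ?_ ?_ ?_, ihr h7 ?_ ?_ ?_ ?_⟩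
    · rw [hw i (BT.id_mem_ids _)]
      exact h5.congr hv
    · exact fun j hj => hp j (by simp [BT.inner, hj])
    · exact fun j hj => hs j (by simp [BT.inner, hj])
    · exact fun j hj => hw j (by simp [BT.ids_node, hj])
    · exact fun j hj => hv j (by simp [BT.leaves, hj])
    · exact fun j hj => hp j (by simp [BT.inner, hj])
    · exact fun j hj => hs j (by simp [BT.inner, hj])
    · exact fun j hj => hw j (by simp [BT.ids_node, hj])
    · exact fun j hj => hv j (by simp [BT.leaves, hj])

/-- The context of a subtree: the ancestors of its root from bottom to top, each with its other
subtree. -/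
abbrev Ctx := List (ℕ × BT)

def Ctx.ids : Ctx → List ℕ
  | [] => []
  | (p, s) :: k => p :: (s.ids ++ Ctx.ids k)

def Ctx.leaves : Ctx → List ℕ
  | [] => []
  | (_, s) :: k => s.leaves ++ Ctx.leaves k

/-- The potential of the ancestors and of their other subtrees, for a subtree of mass `m`. -/
noncomputable def Ctx.pot (w : ℕ → ℝ) : ℝ → Ctx → ℝ
  | _, [] => 0
  | m, (_, s) :: k => Real.log (m + s.mass w) + s.pot w + Ctx.pot w (m + s.mass w) k

/-- The root of the tree that consists of a subtree with root `c` and of its context. -/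
def Ctx.root : ℕ → Ctx → ℕ
  | c, [] => c
  | _, (p, _) :: k => Ctx.root p k

/-- The winners at the ancestors themselves are unconstrained: these are the values that may be out
of date while `fixup` climbs. Parent `0` marks the root. -/
def RepCtx (par sib win : ℕ → ℕ) (val : ℕ → WithTop W) : ℕ → Ctx → Prop
  | c, [] => par c = 0
  | c, (p, s) :: k => par c = p ∧ par s.id = p ∧ sib c = s.id ∧ sib s.id = c ∧
      Rep par sib win val s ∧ RepCtx par sib win val p k

theorem RepCtx.congr {c : ℕ} {k : Ctx} (h : RepCtx par sib win val c k)
    (hp : ∀ i ∈ c :: k.ids, par' i = par i) (hs : ∀ i ∈ c :: k.ids, sib' i = sib i)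
    (hw : ∀ s ∈ k, ∀ i ∈ s.2.ids, win' i = win i)
    (hv : ∀ i ∈ k.leaves, val' i = val i) : RepCtx par' sib' win' val' c k := by
  induction k generalizing c with
  | nil => exact (hp c (by simp)).trans h
  | cons a k ih =>
    obtain ⟨p, s⟩ := a
    obtain ⟨h1, h2, h3, h4, h5, h6⟩ := h
    have hc : c ∈ c :: Ctx.ids ((p, s) :: k) := by simp
    have hsi : s.id ∈ c :: Ctx.ids ((p, s) :: k) := by simp [Ctx.ids, BT.ids]
    refine ⟨by rw [hp _ hc, h1], by rw [hp _ hsi, h2], by rw [hs _ hc, h3], by rw [hs _ hsi, h4],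
      h5.congr ?_ ?_ ?_ ?_, ih h6 ?_ ?_ ?_ ?_⟩
    · exact fun j hj => hp j (by simp [Ctx.ids, BT.ids, hj])
    · exact fun j hj => hs j (by simp [Ctx.ids, BT.ids, hj])
    · exact fun j hj => hw (p, s) (by simp) j hj
    · exact fun j hj => hv j (by simp [Ctx.leaves, hj])
    · intro j hj
      refine hp j ?_
      rcases List.mem_cons.1 hj with rfl | hj <;> simp [Ctx.ids, *]
    · intro j hj
      refine hs j ?_
      rcases List.mem_cons.1 hj with rfl | hj <;> simp [Ctx.ids, *]
    · exact fun a ha => hw a (by simp [ha])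
    · exact fun j hj => hv j (by simp [Ctx.leaves, hj])

/-- Every leaf of a tree has a context. -/
theorem exists_ctx {T : BT} (k : Ctx) (h : Rep par sib win val T)
    (hk : RepCtx par sib win val T.id k) {f : ℕ} (hf : f ∈ T.leaves) :
    ∃ k' : Ctx, RepCtx par sib win val f k' ∧ (f :: k'.ids).Perm (T.ids ++ k.ids) ∧
      (f :: k'.leaves).Perm (T.leaves ++ k.leaves) ∧
      Ctx.root f k' = Ctx.root T.id k ∧ WinOk val (win f) [f] ∧
      ∀ w : ℕ → ℝ, k'.pot w (w f) = T.pot w + k.pot w (T.mass w) := by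
  induction T generalizing k with
  | leaf i =>
    obtain rfl : f = i := by simpa [BT.leaves] using hf
    exact ⟨k, hk, by simp [BT.ids, BT.id, BT.inner], by simp [BT.leaves], rfl, h, fun w => by
      simp [BT.pot, BT.mass_leaf]⟩
  | node i l r ihl ihr =>
    obtain ⟨h1, h2, h3, h4, h5, h6, h7⟩ := h
    rcases List.mem_append.1 (show f ∈ l.leaves ++ r.leaves from hf) with hf | hf
    · obtain ⟨k', e1, e2, e3, e5, e6, e4⟩ := ihl ((i, r) :: k) h6 ⟨h1, h2, h3, h4, h7, hk⟩ hf
      refine ⟨k', e1, e2.trans ?_, e3.trans ?_, e5, e6, fun w => ?_⟩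
      · simp only [Ctx.ids, BT.ids_node, List.cons_append, List.append_assoc]
        exact List.perm_middle
      · simp [Ctx.leaves, BT.leaves]
      · rw [e4]
        simp only [Ctx.pot, BT.pot, BT.mass_node]
        ring
    · obtain ⟨k', e1, e2, e3, e5, e6, e4⟩ := ihr ((i, l) :: k) h7 ⟨h2, h1, h4, h3, h6, hk⟩ hf
      refine ⟨k', e1, e2.trans ?_, e3.trans ?_, e5, e6, fun w => ?_⟩
      · simp only [Ctx.ids, BT.ids_node, List.cons_append, List.append_assoc]
        refine List.perm_middle.trans (List.Perm.cons _ ?_)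
        rw [← List.append_assoc, ← List.append_assoc]
        exact List.perm_append_comm.append_right _
      · simp only [Ctx.leaves, BT.leaves]
        rw [← List.append_assoc]
        exact List.perm_append_comm.append_right _
      · rw [e4]
        simp only [Ctx.pot, BT.pot, BT.mass_node, add_comm (r.mass w)]
        ring

end

/-- The gain of potential in a rotation. -/
theorem log_rotation {a b c : ℝ} (ha : 0 < a) (hb : 0 < b) (hc : 0 < c) :
    1 + Real.log (b + c) + Real.log a ≤ 2 * Real.log (a + b + c) := by
  -- The inequality of the means for `b + c` and `a`. The factor `4` turns into `log 4 > 1`, the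
  -- unit that pays for the rotation.
  have h1 : (b + c) * a * 4 ≤ (a + b + c) ^ 2 := by nlinarith [sq_nonneg (b + c - a)]
  have h2 : Real.log ((b + c) * a * 4) ≤ Real.log ((a + b + c) ^ 2) :=
    Real.log_le_log (by positivity) h1
  rw [Real.log_mul (by positivity) (by norm_num), Real.log_mul (by positivity) (by positivity),
    Real.log_pow] at h2
  have h3 : Real.log 4 = 2 * Real.log 2 := by
    rw [show (4 : ℝ) = 2 ^ 2 by norm_num, Real.log_pow]; norm_num
  have := Real.log_two_gt_d9
  push_cast at h2
  linarith

/-! ### The program for tournament trees -/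

/-- The weight of the candidate at the leaf `f`. -/
def keyExp (f : Exp) : WExp :=
  .combine (.single (.cell 0 (.cell 13 f))) (.cell 1 (.cell 14 f))

/-- Let the best leaf at `n` be the better one of the best leaves at `a` and `b`. -/
def setWin (n a b : Exp) : Program :=
  .branch (.eq (.cell 12 a) (.lit 0)) (.store 12 n (.cell 12 b))
    (.branch (.eq (.cell 12 b) (.lit 0)) (.store 12 n (.cell 12 a))
      (.branch (.wle (keyExp (.cell 12 a)) (keyExp (.cell 12 b)))
        (.store 12 n (.cell 12 a)) (.store 12 n (.cell 12 b))))

/-- The value of a leaf. -/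
def State.val {W : Type u} (ops : WeightOps W) (σ : State W) (f : ℕ) : WithTop W :=
  if σ.mem 14 f = 0 then ⊤
  else ((ops.combine (ops.single (σ.wmem 0 (σ.mem 13 f))) (σ.wmem 1 (σ.mem 14 f)) : W) : WithTop W)

section
variable {W : Type u} [LinearOrder W] {ops : WeightOps W}

/-- A winner `0` stands for an exhausted subtree, where there is no candidate to compare; the two
outer branches keep such subtrees out of the comparison. -/
theorem exec_setWin (n a b : Exp) (σ : State W) {A B : List ℕ}
    (hA : WinOk (σ.val ops) (σ.mem 12 (a.eval σ)) A)
    (hB : WinOk (σ.val ops) (σ.mem 12 (b.eval σ)) B) :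
    ∃ m, (setWin n a b).exec ops σ =
        { σ with
          mem := Function.update σ.mem 12 (Function.update (σ.mem 12) (n.eval σ) m) } ∧
      WinOk (σ.val ops) m (A ++ B) := by
  by_cases h1 : σ.mem 12 (a.eval σ) = 0
  · refine ⟨σ.mem 12 (b.eval σ), by simp [setWin, Program.exec, Test.Holds, Exp.eval, h1], ?_⟩
    rw [h1] at hA
    exact (hB.append_zero hA).append_comm
  by_cases h2 : σ.mem 12 (b.eval σ) = 0
  · refine ⟨σ.mem 12 (a.eval σ), by simp [setWin, Program.exec, Test.Holds, Exp.eval, h1, h2], ?_⟩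
    rw [h2] at hB
    exact hA.append_zero hB
  have h3 : σ.mem 14 (σ.mem 12 (a.eval σ)) ≠ 0 := by
    rcases hA with hA | ⟨-, -, hA, -⟩
    · exact absurd hA.1 h1
    · intro h; simp [State.val, h] at hA
  have h4 : σ.mem 14 (σ.mem 12 (b.eval σ)) ≠ 0 := by
    rcases hB with hB | ⟨-, -, hB, -⟩
    · exact absurd hB.1 h2
    · intro h; simp [State.val, h] at hB
  by_cases h5 : σ.val ops (σ.mem 12 (a.eval σ)) ≤ σ.val ops (σ.mem 12 (b.eval σ))
  · refine ⟨σ.mem 12 (a.eval σ), ?_, hA.append_le hB h1 h2 h5⟩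
    simp only [State.val, h3, h4, if_false, WithTop.coe_le_coe] at h5
    simp [setWin, Program.exec, Test.Holds, Exp.eval, WExp.eval, keyExp, h1, h2, h5]
  · refine ⟨σ.mem 12 (b.eval σ), ?_, (hB.append_le hA h2 h1 (le_of_not_ge h5)).append_comm⟩
    simp only [State.val, h3, h4, if_false, WithTop.coe_le_coe] at h5
    simp [setWin, Program.exec, Test.Holds, Exp.eval, WExp.eval, keyExp, h1, h2, h5]

end

infixr:60 " ⟫ " => Program.seq

/-- Rotate at the parent `p` and the grandparent `g` of node `c`, such that `c` becomes a child of
`g` and its former sibling and the sibling of `p` become the children of `p`. -/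
def rotateStep : Program :=
  .assign 17 (.cell 10 (.reg 15)) ⟫ .assign 16 (.cell 11 (.reg 14)) ⟫
  .assign 18 (.cell 11 (.reg 15)) ⟫
  .store 11 (.reg 16) (.reg 18) ⟫ .store 11 (.reg 18) (.reg 16) ⟫ .store 10 (.reg 18) (.reg 15) ⟫
  .store 11 (.reg 14) (.reg 15) ⟫ .store 11 (.reg 15) (.reg 14) ⟫ .store 10 (.reg 14) (.reg 17) ⟫
  setWin (.reg 15) (.reg 16) (.reg 18) ⟫ setWin (.reg 17) (.reg 14) (.reg 15) ⟫
  .assign 14 (.reg 17)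

def fixStep : Program :=
  .assign 15 (.cell 10 (.reg 14)) ⟫
  .branch (.eq (.cell 10 (.reg 15)) (.lit 0))
    (setWin (.reg 15) (.reg 14) (.cell 11 (.reg 14)) ⟫ .assign 14 (.reg 15))
    rotateStep

def fixTest : Test := .neg (.eq (.cell 10 (.reg 14)) (.lit 0))

/-- Restore the tree above the node in register `14`, whose best leaf may have changed. -/
def fixup : Program := .loop fixTest fixStep

theorem BT.id_node (i : ℕ) (l r : BT) : (BT.node i l r).id = i := rfl

section
variable {W : Type u} {ops : WeightOps W}

theorem State.val_congr {σ τ : State W} (h13 : τ.mem 13 = σ.mem 13) (h14 : τ.mem 14 = σ.mem 14)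
    (hw : τ.wmem = σ.wmem) : τ.val ops = σ.val ops := by
  funext f
  simp [State.val, h13, h14, hw]

end

theorem Ctx.ids_of_mem {k : Ctx} {a : ℕ × BT} (ha : a ∈ k) {i : ℕ} (hi : i ∈ a.2.ids) :
    i ∈ k.ids := by
  induction k with
  | nil => simp at ha
  | cons b k ih =>
    obtain ⟨p, s⟩ := b
    rcases List.mem_cons.1 ha with rfl | ha
    · simp [Ctx.ids, hi]
    · simp [Ctx.ids, ih ha]

/-- The disjointness of everything that a rotation touches, in the form in which updates at
different addresses are told apart. -/
theorem Ctx.separate {T s r : BT} {p g : ℕ} {k : Ctx}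
    (h : (T.ids ++ Ctx.ids ((p, s) :: (g, r) :: k)).Nodup) :
    (∀ x ∈ T.ids, x ≠ p ∧ x ≠ g ∧ x ∉ s.ids ∧ x ∉ r.ids ∧ x ∉ k.ids) ∧
    (∀ x ∈ s.ids, x ≠ p ∧ x ≠ g ∧ x ∉ r.ids ∧ x ∉ k.ids) ∧
    (∀ x ∈ r.ids, x ≠ p ∧ x ≠ g ∧ x ∉ k.ids) ∧ p ≠ g ∧ p ∉ k.ids ∧ g ∉ k.ids := by
  simp only [Ctx.ids, List.nodup_append, List.nodup_cons, List.mem_append, List.mem_cons,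
    not_or] at h
  obtain ⟨-, ⟨⟨h1, h2, h3, h4⟩, -, ⟨⟨h5, h6⟩, -, -, h7⟩, h8⟩, h9⟩ := h
  refine ⟨fun x hx => ⟨h9 x hx p (.inl rfl), h9 x hx g (.inr (.inr (.inl rfl))),
      fun k => h9 x hx x (.inr (.inl k)) rfl,
      fun k => h9 x hx x (.inr (.inr (.inr (.inl k)))) rfl,
      fun k => h9 x hx x (.inr (.inr (.inr (.inr k)))) rfl⟩,
    fun x hx => ⟨fun e => h1 (e ▸ hx), h8 x hx g (.inl rfl),
      fun k => h8 x hx x (.inr (.inl k)) rfl, fun k => h8 x hx x (.inr (.inr k)) rfl⟩,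
    fun x hx => ⟨fun e => h3 (e ▸ hx), fun e => h5 (e ▸ hx), fun k => h7 x hx x k rfl⟩,
    h2, h4, h6⟩

section
variable {W : Type u} [LinearOrder W] {ops : WeightOps W}

/-- The parent is the root, so there is no grandparent to rotate at, and only its winner has to be
found again. -/
theorem exec_fixStep_last (σ : State W) {c p : ℕ} {s : BT} {A : List ℕ} (hc : σ.reg 14 = c)
    (hp : σ.mem 10 c = p) (hp0 : σ.mem 10 p = 0) (hs : σ.mem 11 c = s.id)
    (hA : WinOk (σ.val ops) (σ.mem 12 c) A)
    (hB : WinOk (σ.val ops) (σ.mem 12 s.id) s.leaves) :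
    ∃ m, (fixStep.exec ops σ).reg 14 = p ∧ (fixStep.exec ops σ).mem 10 = σ.mem 10 ∧
      (fixStep.exec ops σ).mem 11 = σ.mem 11 ∧
      (fixStep.exec ops σ).mem 12 = Function.update (σ.mem 12) p m ∧
      WinOk (σ.val ops) m (A ++ s.leaves) := by
  obtain ⟨m, h1, h2⟩ := exec_setWin (ops := ops) (.reg 15) (.reg 14) (.cell 11 (.reg 14))
    { σ with reg := Function.update σ.reg 15 p } (A := A) (B := s.leaves)
    (by simpa only [Exp.eval, Function.update_self, ne_eq, Nat.reduceEqDiff, not_false_eq_true,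
          Function.update_of_ne, hc] using! hA)
    (by simpa only [Exp.eval, Function.update_self, ne_eq, Nat.reduceEqDiff, not_false_eq_true,
          Function.update_of_ne, hc, hs] using! hB)
  refine ⟨m, ?_⟩
  simp [fixStep, Program.exec, Test.Holds, Exp.eval, hc, hp, hp0, h1]
  exact h2

theorem exec_rotate (σ : State W) {c p g : ℕ} {s r : BT} {A : List ℕ} (hc : σ.reg 14 = c)
    (hp : σ.mem 10 c = p) (hg : σ.mem 10 p = g) (hg0 : g ≠ 0) (hs : σ.mem 11 c = s.id)
    (hr : σ.mem 11 p = r.id) (hA : WinOk (σ.val ops) (σ.mem 12 c) A)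
    (hB : WinOk (σ.val ops) (σ.mem 12 s.id) s.leaves)
    (hC : WinOk (σ.val ops) (σ.mem 12 r.id) r.leaves) (hcp : c ≠ p) :
    ∃ m n, (fixStep.exec ops σ).reg 14 = g ∧
      (fixStep.exec ops σ).mem 10 =
        Function.update (Function.update (σ.mem 10) r.id p) c g ∧
      (fixStep.exec ops σ).mem 11 =
        Function.update (Function.update (Function.update (Function.update (σ.mem 11)
          s.id r.id) r.id s.id) c p) p c ∧
      (fixStep.exec ops σ).mem 12 = Function.update (Function.update (σ.mem 12) p m) g n ∧
      WinOk (σ.val ops) m (s.leaves ++ r.leaves) ∧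
      WinOk (σ.val ops) n (A ++ (s.leaves ++ r.leaves)) := by
  -- The pointers are moved first; the two recomputations of winners then start from a state that is
  -- known cell by cell. The order of the latter matters: `g` is computed from the new winner of
  -- `p`.
  obtain ⟨σ1, hσ1⟩ : ∃ σ1 : State W, σ1 = Program.exec ops
      (.assign 15 (.cell 10 (.reg 14)) ⟫ .assign 17 (.cell 10 (.reg 15)) ⟫
      .assign 16 (.cell 11 (.reg 14)) ⟫ .assign 18 (.cell 11 (.reg 15)) ⟫
      .store 11 (.reg 16) (.reg 18) ⟫ .store 11 (.reg 18) (.reg 16) ⟫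
      .store 10 (.reg 18) (.reg 15) ⟫ .store 11 (.reg 14) (.reg 15) ⟫
      .store 11 (.reg 15) (.reg 14) ⟫ .store 10 (.reg 14) (.reg 17)) σ := ⟨_, rfl⟩
  have e14 : σ1.reg 14 = c := by simp [hσ1, Program.exec, hc]
  have e15 : σ1.reg 15 = p := by simp [hσ1, Program.exec, Exp.eval, hc, hp]
  have e16 : σ1.reg 16 = s.id := by simp [hσ1, Program.exec, Exp.eval, hc, hs]
  have e17 : σ1.reg 17 = g := by simp [hσ1, Program.exec, Exp.eval, hc, hp, hg]
  have e18 : σ1.reg 18 = r.id := by simp [hσ1, Program.exec, Exp.eval, hc, hp, hr]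
  have m10 : σ1.mem 10 = Function.update (Function.update (σ.mem 10) r.id p) c g := by
    simp [hσ1, Program.exec, Exp.eval, hc, hp, hr, hg]
  have m11 : σ1.mem 11 = Function.update (Function.update (Function.update (Function.update
      (σ.mem 11) s.id r.id) r.id s.id) c p) p c := by
    simp [hσ1, Program.exec, Exp.eval, hc, hp, hr, hs]
  have m12 : σ1.mem 12 = σ.mem 12 := by simp [hσ1, Program.exec]
  have hv : σ1.val ops = σ.val ops := by
    funext f; simp [State.val, hσ1, Program.exec]
  obtain ⟨m, h1, h2⟩ := exec_setWin (ops := ops) (.reg 15) (.reg 16) (.reg 18) σ1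
    (A := s.leaves) (B := r.leaves) (by simpa [Exp.eval, e16, hv, m12] using hB)
    (by simpa [Exp.eval, e18, hv, m12] using hC)
  obtain ⟨σ2, hσ2⟩ : ∃ σ2 : State W, σ2 = { σ1 with
    mem := Function.update σ1.mem 12 (Function.update (σ1.mem 12) p m) } := ⟨_, rfl⟩
  have f12 : σ2.mem 12 = Function.update (σ.mem 12) p m := by simp [hσ2, m12]
  have fv : σ2.val ops = σ.val ops := by
    rw [← hv]; funext f; simp [State.val, hσ2]
  rw [hv] at h2
  obtain ⟨n, h3, h4⟩ := exec_setWin (ops := ops) (.reg 17) (.reg 14) (.reg 15) σ2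
    (A := A) (B := s.leaves ++ r.leaves)
    (by rw [fv]; simpa [Exp.eval, hσ2, e14, m12, hcp] using hA)
    (by rw [fv]; simpa [Exp.eval, hσ2, e15] using h2)
  rw [fv] at h4
  have key : fixStep.exec ops σ = { σ2 with
      reg := Function.update σ2.reg 14 g
      mem := Function.update σ2.mem 12 (Function.update (σ2.mem 12) g n) } := by
    have : fixStep.exec ops σ = Program.exec ops (setWin (.reg 15) (.reg 16) (.reg 18) ⟫
        setWin (.reg 17) (.reg 14) (.reg 15) ⟫ .assign 14 (.reg 17)) σ1 := by
      rw [hσ1]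
      simp [fixStep, rotateStep, Program.exec, Test.Holds, Exp.eval, hc, hp, hg, hg0]
    rw [this]
    simp only [Program.exec]
    rw [h1, show (Exp.reg 15).eval σ1 = p from e15, ← hσ2, h3]
    simp [Exp.eval, hσ2, e17]
  refine ⟨m, n, ?_⟩
  rw [key]
  refine ⟨by simp, by simp [hσ2, m10], by simp [hσ2, m11], by simp [f12], h2, h4⟩

theorem fixStep_straight : fixStep.straight = true := by decide

/-- Rotations only move numbers that are already there. Hence the space bound contains no term for
their number, and no `log N`. -/
theorem fixStep_growth : fixStep.growth = 0 := by decide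

/-- `fixup` turns a subtree in a context into a tree; in this, the number of its steps is paid for
by the potential. -/
theorem fixup_spec (k : Ctx) (T : BT) (σ : State W) (hc : σ.reg 14 = T.id)
    (hT : Rep (σ.mem 10) (σ.mem 11) (σ.mem 12) (σ.val ops) T)
    (hk : RepCtx (σ.mem 10) (σ.mem 11) (σ.mem 12) (σ.val ops) T.id k)
    (hn : (0 :: (T.ids ++ k.ids)).Nodup) :
    ∃ (τ : State W) (T' : BT) (n : ℕ), Leads ops fixup σ τ (220 * n + 220) 0 ∧
      τ.reg 14 = T'.id ∧ T'.id = Ctx.root T.id k ∧ Rep (τ.mem 10) (τ.mem 11) (τ.mem 12) (σ.val ops) T' ∧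
      τ.mem 10 T'.id = 0 ∧ T'.ids.Perm (T.ids ++ k.ids) ∧ T'.leaves.Perm (T.leaves ++ k.leaves) ∧
      (∀ i, i ∉ T.ids ++ k.ids → τ.mem 10 i = σ.mem 10 i ∧ τ.mem 11 i = σ.mem 11 i ∧
        τ.mem 12 i = σ.mem 12 i) ∧
      ∀ w : ℕ → ℝ, (∀ i, 1 ≤ w i) → n + T'.pot w ≤ T.pot w + k.pot w (T.mass w) +
        2 * (Real.log (T'.mass w) - Real.log (T.mass w)) := by
  have hlin : fixTest.linear = true := by decide
  have hcost : fixTest.cost = 5 := by decide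
  have hgrow : fixTest.growth = 0 := by decide
  have htime : fixStep.time ≤ 200 := by decide
  have hval : ∀ υ, Leads ops fixStep σ υ fixStep.time fixStep.growth → υ.val ops = σ.val ops :=
    fun υ h => State.val_congr (h.frame_mem 13 (by decide)) (h.frame_mem 14 (by decide))
      (by funext a; exact h.frame_wmem a (by simp [show fixStep.warrays = [] by decide]))
  -- A rotation consumes two ancestors. A single remaining ancestor is the root and is handled
  -- without rotation, so at most one step of the loop is not counted in `n`.
  match k with
  | [] =>
    refine ⟨σ, T, 0, (Leads.loop_false ?_ hlin).mono (by rw [hcost]; omega) (by rw [hgrow]), hc, rfl, hT,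
      hk, by simp [Ctx.ids], by simp [Ctx.leaves], fun i _ => ⟨rfl, rfl, rfl⟩, fun w hw => ?_⟩
    · have : σ.mem 10 T.id = 0 := hk
      simp [fixTest, Test.Holds, Exp.eval, hc, this]
    · simp [Ctx.pot]
  | [(p, s)] =>
    obtain ⟨h1, h2, h3, h4, h5, h6⟩ := hk
    simp only [Ctx.ids, List.append_nil, List.nodup_cons, List.mem_append, List.mem_cons,
      not_or, List.nodup_append, BT.ids] at hn
    have hp0 : σ.mem 10 p = 0 := h6
    obtain ⟨m, e1, e2, e3, e4, e5⟩ := exec_fixStep_last (ops := ops) σ hc h1 hp0 h3 hT.winOk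
      h5.winOk
    have hL := Leads.exec (ops := ops) fixStep fixStep_straight σ
    set υ := fixStep.exec ops σ with hυ
    have hne : p ∉ T.ids := by
      simp only [BT.ids, List.mem_cons, not_or]; grind
    have hne' : p ∉ s.ids := by
      simp only [BT.ids, List.mem_cons, not_or]; grind
    refine ⟨υ, .node p T s, 0, (Leads.loop_true ?_ hlin hL (Leads.loop_false ?_ hlin)).mono
      (by rw [hcost]; omega) (by rw [hgrow, fixStep_growth]), e1, rfl, ?_, ?_, ?_, ?_, ?_, ?_⟩
    · simp only [fixTest, Test.Holds, Exp.eval, hc, h1]; grind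
    · simp [fixTest, Test.Holds, Exp.eval, e1, e2, hp0]
    · rw [e2, e3, e4]
      refine ⟨h1, h2, h3, h4, by simpa using e5, hT.congr (fun _ _ => rfl) (fun _ _ => rfl) ?_
        (fun _ _ => rfl), h5.congr (fun _ _ => rfl) (fun _ _ => rfl) ?_ (fun _ _ => rfl)⟩
      · exact fun i hi => Function.update_of_ne (by rintro rfl; exact hne hi) _ _
      · exact fun i hi => Function.update_of_ne (by rintro rfl; exact hne' hi) _ _
    · rw [e2]; exact hp0
    · simp only [BT.ids_node, Ctx.ids, List.append_nil]
      exact List.perm_middle.symm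
    · simp [BT.leaves, Ctx.leaves]
    · intro i hi
      rw [e2, e3, e4]
      simp only [Ctx.ids, List.mem_append, List.mem_cons, not_or] at hi
      exact ⟨rfl, rfl, Function.update_of_ne hi.2.1 _ _⟩
    · intro w hw
      have h8 := BT.one_le_mass hw s
      have h9 := BT.one_le_mass hw T
      -- Here the tree keeps its shape and the potential its value; it remains that the logarithmic
      -- term is nonnegative.
      have := Real.log_le_log (by linarith) (show T.mass w ≤ T.mass w + s.mass w by linarith)
      simp only [BT.pot, Ctx.pot, BT.mass_node, Nat.cast_zero]
      linarith
  | (p, s) :: (g, r) :: k =>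
    obtain ⟨h1, h2, h3, h4, h5, h6, h7, h8, h9, h10, h11⟩ := hk
    have hn' := hn
    obtain ⟨a1, a2, a3, a4, a5, a6⟩ := Ctx.separate (List.nodup_cons.1 hn).2
    have hcp : T.id ≠ p := (a1 _ T.id_mem_ids).1
    have hg0 : g ≠ 0 := by
      rintro rfl
      exact (List.nodup_cons.1 hn).1 (by simp [Ctx.ids])
    obtain ⟨m, n, e1, e2, e3, e4, e5, e6⟩ := exec_rotate (ops := ops) σ hc h1 h6 hg0 h3 h8 hT.winOk
      h5.winOk h10.winOk hcp
    have hL := Leads.exec (ops := ops) fixStep fixStep_straight σ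
    have hv := hval _ hL
    set υ := fixStep.exec ops σ with hυ
    -- After the rotation `g` has the children `T` and `p`, and `p` has the children `s` and `r`.
    -- The tree is unordered, so all that counts is that the same nodes occur.
    have hperm : (BT.node g T (.node p s r)).ids.Perm (T.ids ++ p :: (s.ids ++ g :: r.ids)) := by
      simp only [BT.ids_node]
      refine List.Perm.trans ?_ (List.Perm.append_left _ (List.Perm.cons _ List.perm_middle.symm))
      refine List.Perm.trans ?_ (List.Perm.append_left _ (List.Perm.swap _ _ _))
      exact List.perm_middle.symm
    have hperm2 : ((BT.node g T (.node p s r)).ids ++ Ctx.ids k).Perm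
        (T.ids ++ Ctx.ids ((p, s) :: (g, r) :: k)) := by
      refine (hperm.append_right _).trans ?_
      simp [Ctx.ids]
    have hRT : Rep (υ.mem 10) (υ.mem 11) (υ.mem 12) (υ.val ops) (.node g T (.node p s r)) := by
      rw [hv, e2, e3, e4]
      have nT : ∀ x ∈ T.inner, x ∈ T.ids ∧ x ≠ T.id := by
        have := (List.nodup_append.1 (List.nodup_cons.1 hn).2).1
        exact fun x hx => ⟨List.mem_cons_of_mem _ hx, by
          rintro rfl; exact (List.nodup_cons.1 this).1 hx⟩
      have hn3 := (List.nodup_cons.1 (List.nodup_append.1 (List.nodup_cons.1 hn).2).2.1).2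
      have ns : ∀ x ∈ s.inner, x ∈ s.ids ∧ x ≠ s.id := by
        have := (List.nodup_append.1 hn3).1
        exact fun x hx => ⟨List.mem_cons_of_mem _ hx, by
          rintro rfl; exact (List.nodup_cons.1 this).1 hx⟩
      have nr : ∀ x ∈ r.inner, x ∈ r.ids ∧ x ≠ r.id := by
        have := (List.nodup_append.1 (List.nodup_cons.1 (List.nodup_append.1 hn3).2.1).2).1
        exact fun x hx => ⟨List.mem_cons_of_mem _ hx, by
          rintro rfl; exact (List.nodup_cons.1 this).1 hx⟩
      have iT := T.id_mem_ids
      have is := s.id_mem_ids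
      have ir := r.id_mem_ids
      have w1 : Rep (σ.mem 10) (σ.mem 11) (σ.mem 12) (σ.val ops) T := hT
      clear_value υ
      clear hL hv hυ hperm hperm2 hn hn3 e1 e2 e3 e4
      refine ⟨by simp, ?_, ?_, ?_, by simpa [BT.leaves] using e6,
        hT.congr ?_ ?_ ?_ (fun _ _ => rfl), ?_, ?_, ?_, ?_, ?_,
        h5.congr ?_ ?_ ?_ (fun _ _ => rfl), h10.congr ?_ ?_ ?_ (fun _ _ => rfl)⟩
      all_goals clear hT h5 h10 h11 w1
      all_goals simp only [BT.id_node, Function.update_apply]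
      all_goals clear hc
      all_goals grind
    have hRk : RepCtx (υ.mem 10) (υ.mem 11) (υ.mem 12) (υ.val ops) g k := by
      rw [hv, e2, e3, e4]
      have iT := T.id_mem_ids
      have is := s.id_mem_ids
      have ir := r.id_mem_ids
      refine h11.congr ?_ ?_ ?_ (fun _ _ => rfl)
      · intro i hi
        clear * - a1 a2 a3 a4 a5 a6 iT is ir hi
        simp only [Function.update_apply]; grind
      · intro i hi
        clear * - a1 a2 a3 a4 a5 a6 iT is ir hi
        simp only [Function.update_apply]; grind
      · intro a ha i hi
        have := Ctx.ids_of_mem ha hi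
        clear * - a1 a2 a3 a4 a5 a6 iT is ir hi this
        simp only [Function.update_apply]; grind
    -- Induction applies to the whole new tree below `g`, in the context that is two levels shorter.
    obtain ⟨τ, T', n', k1, k2, k9, k3, k4, k5, k6, k7, k8⟩ := fixup_spec k (.node g T (.node p s r)) υ e1
      hRT hRk ((List.Perm.cons _ hperm2).nodup_iff.2 hn')
    refine ⟨τ, T', n' + 1, (Leads.loop_true ?_ hlin hL k1).mono (by rw [hcost]; omega)
      (by rw [hgrow, fixStep_growth]), k2, k9, ?_, k4, k5.trans hperm2, k6.trans ?_, ?_, ?_⟩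
    · simp only [fixTest, Test.Holds, Exp.eval, hc, h1]
      rintro rfl
      exact (List.nodup_cons.1 hn').1 (by simp [Ctx.ids])
    · rwa [hv] at k3
    · simp [BT.leaves, Ctx.leaves]
    · intro i hi
      obtain ⟨q1, q2, q3⟩ := k7 i (fun h => hi (hperm2.subset h))
      rw [q1, q2, q3, e2, e3, e4]
      have iT := T.id_mem_ids
      have is := s.id_mem_ids
      have ir := r.id_mem_ids
      simp only [Ctx.ids, List.mem_append, List.mem_cons, not_or] at hi
      clear * - iT is ir hi
      simp only [Function.update_apply]
      grind
    · intro w hw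
      have b1 := BT.one_le_mass hw s
      have b2 := BT.one_le_mass hw T
      have b3 := BT.one_le_mass hw r
      have := k8 w hw
      -- At `p`, the potential `log (T + s)` is replaced by `log (s + r)`. With `log T ≤ log (T +
      -- s)`, the rotation and this change are paid by twice the increase from `log T` to the
      -- logarithm of the mass at `g`.
      have hrot := log_rotation (a := T.mass w) (b := s.mass w) (c := r.mass w) (by linarith)
        (by linarith) (by linarith)
      have hmono := Real.log_le_log (by linarith)
        (show T.mass w ≤ T.mass w + s.mass w by linarith)
      simp only [BT.pot, Ctx.pot, BT.mass_node, Nat.cast_add, Nat.cast_one, ← add_assoc] at this ⊢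
      linarith
termination_by k.length

end

/-! ### Enumeration state

Every node has a list of entries, each representing a path to `t`, in ascending order of weight, and
a tournament tree with a leaf for every useful edge out of the node. -/

/-- The abstract content of a state: the entries of each node, the paths that they represent, the
trees of the nodes, the edges of the leaves, the number of times that each leaf has advanced, and
the number of rotations in each tree. -/
structure Ghost (N : ℕ) where
  ent : Fin N → List ℕ
  path : ℕ → List (Fin N × Fin N)
  tree : Fin N → Option BT
  edge : ℕ → Fin N × Fin N
  pos : ℕ → ℕ
  rot : Fin N → ℕ

def Ghost.leaves {N : ℕ} (Γ : Ghost N) (v : Fin N) : List ℕ := (Γ.tree v).elim [] BT.leaves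

def Ghost.paths {N : ℕ} (Γ : Ghost N) (v : Fin N) : List (List (Fin N × Fin N)) :=
  (Γ.ent v).map Γ.path

/-- The head of the edge of a leaf. -/
def Ghost.head {N : ℕ} (Γ : Ghost N) (f : ℕ) : Fin N := (Γ.edge f).2

section
variable {N : ℕ} {G : DAG N} {s t u v : Fin N}

theorem DAG.isPath_nil : G.IsPath u v [] ↔ u = v := Iff.rfl

theorem DAG.IsPath.eq_nil {p : List (Fin N × Fin N)} (h : G.IsPath v v p) : p = [] :=
  G.acyclic v p h

theorem DAG.head_ne (G : DAG N) {e : Fin N × Fin N} (he : e ∈ G.edges) (hv : e.1 = v) :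
    e.2 ≠ v := by
  intro heq
  have h : G.IsPath v v [e] := ⟨he, hv, heq⟩
  exact absurd h.eq_nil (by simp)

theorem DAG.IsPath.exists_cons {p : List (Fin N × Fin N)} (h : G.IsPath u v p) (huv : u ≠ v) :
    ∃ e q, p = e :: q ∧ e ∈ G.edges ∧ e.1 = u ∧ G.IsPath e.2 v q := by
  cases p with
  | nil => exact absurd h huv
  | cons e q => exact ⟨e, q, rfl, h⟩

theorem DAG.IsPath.append {p q : List (Fin N × Fin N)} (h : G.IsPath s u p)
    (h' : G.IsPath u v q) : G.IsPath s v (p ++ q) := by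
  induction p generalizing s with
  | nil => rw [DAG.isPath_nil] at h; subst h; exact h'
  | cons e p ih => exact ⟨h.1, h.2.1, ih h.2.2⟩

/-- The first edge determines the source, and an empty path starts at `t`. Hence lists of different
nodes have no entry in common. -/
theorem DAG.IsPath.source_unique {p : List (Fin N × Fin N)} (h : G.IsPath u t p)
    (h' : G.IsPath v t p) : u = v := by
  cases p with
  | nil => exact (show u = t from h).trans (show v = t from h').symm
  | cons e q => exact h.2.1.symm.trans h'.2.1

end

/-! ### Weights of paths, edge by edge -/

section
variable {W : Type u} [LinearOrder W] {w : Multiset W → W} {ops : WeightOps W} {N : ℕ}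
  {wt : Fin N × Fin N → W}

theorem pathWeight_nil : pathWeight w wt [] = w 0 := rfl

/-- By decomposability the weight of a candidate is found in constant time from the weight stored
with the entry of its head. -/
theorem pathWeight_cons (hC : ops.Computes w) (e : Fin N × Fin N) (p : List (Fin N × Fin N)) :
    pathWeight w wt (e :: p) = ops.combine (ops.single (wt e)) (pathWeight w wt p) := by
  rw [hC.single_eq, pathWeight, pathWeight, hC.combine_eq]
  simp

/-- The principle of optimality: among paths with the same first edge, the order is that of the
remainders. This is the only use of monotonicity. -/
theorem pathWeight_cons_mono (hw : SubsetMonotone w) (e : Fin N × Fin N)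
    {p q : List (Fin N × Fin N)} (h : pathWeight w wt p ≤ pathWeight w wt q) :
    pathWeight w wt (e :: p) ≤ pathWeight w wt (e :: q) := by
  have := hw {wt e} _ _ h
  simpa [pathWeight] using this

end

/-- The entries and leaves of node `v` are as they should be, where `g` is the leaf of the last
entry, or `0` if the leaf of the last entry has been advanced. -/
structure Core {W : Type u} [LinearOrder W] {N : ℕ} (w : Multiset W → W) (G : DAG N)
    (wt : Fin N × Fin N → W) (t : Fin N) (σ : State W) (Γ : Ghost N) (D : Finset (Fin N))
    (v : Fin N) (g : ℕ) : Prop where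
  ent_ne : ∀ z ∈ Γ.ent v, z ≠ 0
  ent_lt : ∀ z ∈ Γ.ent v, z < σ.reg 11
  isPath : ∀ z ∈ Γ.ent v, G.IsPath v t (Γ.path z)
  weight : ∀ z ∈ Γ.ent v, σ.wmem 1 z = pathWeight w wt (Γ.path z)
  nodup : (Γ.paths v).Nodup
  sorted : (Γ.paths v).Pairwise fun p q => pathWeight w wt p ≤ pathWeight w wt q
  link : ∀ i (h : i < (Γ.ent v).length), σ.mem 17 (Γ.ent v)[i] = (Γ.ent v).getD (i + 1) 0
  sub : v ≠ t → ∀ z ∈ Γ.ent v, σ.mem 15 z ∈ Γ.leaves v ∧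
    Γ.path z = Γ.edge (σ.mem 15 z) :: Γ.path (σ.mem 16 z) ∧
    σ.mem 16 z ∈ Γ.ent (Γ.head (σ.mem 15 z))
  min : ∀ p, G.IsPath v t p → p ∉ Γ.paths v → ∀ z ∈ Γ.ent v,
    pathWeight w wt (Γ.path z) ≤ pathWeight w wt p
  leaf_ne : ∀ f ∈ Γ.leaves v, f ≠ 0
  leaf_edge : ∀ f ∈ Γ.leaves v, G.edges[σ.mem 13 f]? = some (Γ.edge f)
  leaf_own : ∀ f ∈ Γ.leaves v, (Γ.edge f).1 = v
  leaf_inj : ∀ f ∈ Γ.leaves v, ∀ f' ∈ Γ.leaves v, Γ.edge f = Γ.edge f' → f = f'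
  leaf_pos : ∀ f ∈ Γ.leaves v, Γ.pos f ≤ (Γ.ent (Γ.head f)).length
  leaf_cur : ∀ f ∈ Γ.leaves v, σ.mem 14 f = (Γ.ent (Γ.head f)).getD (Γ.pos f) 0
  leaf_dead : ∀ f ∈ Γ.leaves v, Γ.pos f = (Γ.ent (Γ.head f)).length →
    ∀ p, G.IsPath (Γ.head f) t p → p ∈ Γ.paths (Γ.head f)
  -- The second alternative reflects laziness: the leaf of the last entry still stands at the
  -- candidate that was listed, and moves on only when another path of `v` is requested.
  gen : ∀ f ∈ Γ.leaves v, ∀ j (h : j < (Γ.ent (Γ.head f)).length),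
    Γ.edge f :: Γ.path (Γ.ent (Γ.head f))[j] ∈ Γ.paths v ↔
      j < Γ.pos f ∨ (f = g ∧ j = Γ.pos f)
  -- Every advance passes one listed candidate, and `g` stands at one that is listed but not yet
  -- passed.
  count : v ≠ t → (Γ.ent v).length =
    ((Γ.leaves v).map Γ.pos).sum + if g = 0 then 0 else 1
  complete : v ∈ D → v ≠ t → ∀ e ∈ G.edges, e.1 = v → Γ.ent e.2 ≠ [] →
    ∃ f ∈ Γ.leaves v, Γ.edge f = e

/-! ### One node: its best candidate, and its changes -/

section
variable {W : Type u} [LinearOrder W] {w : Multiset W → W} {ops : WeightOps W} {N : ℕ}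
  {G : DAG N} {wt : Fin N × Fin N → W} {t v : Fin N} {σ τ : State W} {Γ Γ' : Ghost N}
  {D : Finset (Fin N)} {g : ℕ}

theorem Ghost.mem_paths {p : List (Fin N × Fin N)} :
    p ∈ Γ.paths v ↔ ∃ z ∈ Γ.ent v, Γ.path z = p := List.mem_map

theorem Ghost.mem_paths_iff_getElem {p : List (Fin N × Fin N)} :
    p ∈ Γ.paths v ↔ ∃ j, ∃ h : j < (Γ.ent v).length, Γ.path (Γ.ent v)[j] = p := by
  rw [Ghost.mem_paths]
  constructor
  · rintro ⟨z, hz, rfl⟩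
    obtain ⟨j, h, rfl⟩ := List.getElem_of_mem hz
    exact ⟨j, h, rfl⟩
  · rintro ⟨j, h, rfl⟩
    exact ⟨_, List.getElem_mem h, rfl⟩

/-- The facts about the input, and about nodes other than `v` with a path to `t`, that are used with `Core`. -/
structure Setting {W : Type u} [LinearOrder W] {N : ℕ} (G : DAG N) (wt : Fin N × Fin N → W)
    (t : Fin N) (σ : State W) (Γ : Ghost N) (D : Finset (Fin N)) (v : Fin N) : Prop where
  wt_eq : ∀ i e, G.edges[i]? = some e → σ.wmem 0 i = wt e
  closed : ∀ e ∈ G.edges, e.1 ∈ D → e.2 ∈ D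
  nonempty : ∀ u ∈ D, u ≠ v → ∀ p, G.IsPath u t p → Γ.ent u ≠ []

/-- The current entry of a live leaf. -/
theorem Core.cur_eq {f : ℕ} (h : Core w G wt t σ Γ D v g) (hf : f ∈ Γ.leaves v)
    (hp : Γ.pos f < (Γ.ent (Γ.head f)).length) :
    σ.mem 14 f = (Γ.ent (Γ.head f))[Γ.pos f] := by
  rw [h.leaf_cur f hf, List.getD_eq_getElem _ _ hp]

theorem Core.cur_mem {f : ℕ} (h : Core w G wt t σ Γ D v g) (hf : f ∈ Γ.leaves v)
    (hc : σ.mem 14 f ≠ 0) : Γ.pos f < (Γ.ent (Γ.head f)).length := by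
  by_contra hlt
  rw [h.leaf_cur f hf, List.getD_eq_default _ _ (by omega)] at hc
  exact hc rfl

/-- The value of a live leaf is the weight of its candidate. -/
theorem Core.val_eq {f : ℕ} (hC : ops.Computes w) (hS : Setting G wt t σ Γ D v)
    (hu : ∀ u, ∃ g, Core w G wt t σ Γ D u g)
    (h : Core w G wt t σ Γ D v g) (hf : f ∈ Γ.leaves v) (hc : σ.mem 14 f ≠ 0) :
    σ.val ops f = (pathWeight w wt (Γ.edge f :: Γ.path (σ.mem 14 f)) : W) := by
  have hp := h.cur_mem hf hc
  obtain ⟨g', hu⟩ := hu (Γ.head f)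
  rw [State.val, if_neg hc, pathWeight_cons hC, hS.wt_eq _ _ (h.leaf_edge f hf),
    hu.weight _ (by rw [h.cur_eq hf hp]; exact List.getElem_mem hp)]

/-- A path that is not generated consists of the edge of a live leaf and of a path that is at least
as heavy as the one of the current entry. -/
theorem Core.exists_leaf (hw : SubsetMonotone w) (hS : Setting G wt t σ Γ D v)
    (hu : ∀ u, ∃ g, Core w G wt t σ Γ D u g) (h : Core w G wt t σ Γ D v g) (hv : v ∈ D)
    (hvt : v ≠ t) {p : List (Fin N × Fin N)} (hp : G.IsPath v t p) (hn : p ∉ Γ.paths v) :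
    ∃ f ∈ Γ.leaves v, σ.mem 14 f ≠ 0 ∧
      pathWeight w wt (Γ.edge f :: Γ.path (σ.mem 14 f)) ≤ pathWeight w wt p := by
  obtain ⟨e, q, rfl, he, hev, hq⟩ := hp.exists_cons hvt
  have heD : e.2 ∈ D := hS.closed e he (hev ▸ hv)
  obtain ⟨f, hf, rfl⟩ := h.complete hv hvt e he hev (hS.nonempty _ heD (G.head_ne he hev) q hq)
  obtain ⟨g', hu⟩ := hu (Γ.head f)
  have hlt : Γ.pos f < (Γ.ent (Γ.head f)).length := by
    -- If the leaf were exhausted, its head would have listed `q`, and the leaf would have passed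
    -- it, so that the path were generated.
    refine lt_of_le_of_ne (h.leaf_pos f hf) fun heq => ?_
    obtain ⟨j, hj, rfl⟩ := Ghost.mem_paths_iff_getElem.1 (h.leaf_dead f hf heq q hq)
    exact hn ((h.gen f hf j hj).2 (.inl (by omega)))
  have hcur := h.cur_eq hf hlt
  have hmem : σ.mem 14 f ∈ Γ.ent (Γ.head f) := by rw [hcur]; exact List.getElem_mem hlt
  refine ⟨f, hf, hu.ent_ne _ hmem, pathWeight_cons_mono hw _ ?_⟩
  -- Either the head has listed `q`, at the current position or later, and its list is sorted; or it
  -- has not, and then all that it has listed is at most as heavy.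
  by_cases hqm : q ∈ Γ.paths (Γ.head f)
  · obtain ⟨j, hj, rfl⟩ := Ghost.mem_paths_iff_getElem.1 hqm
    have hle : Γ.pos f ≤ j := by
      by_contra hlt'
      exact hn ((h.gen f hf j hj).2 (.inl (by omega)))
    rcases hle.eq_or_lt with rfl | hlt'
    · rw [hcur]
    · have := List.pairwise_iff_getElem.1 hu.sorted (Γ.pos f) j (by simpa [Ghost.paths] using hlt)
        (by simpa [Ghost.paths] using hj) hlt'
      rw [hcur]
      simpa [Ghost.paths] using this
  · exact hu.min q hq hqm _ hmem

/-- If all leaves are exhausted, then all paths have been generated. -/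
theorem Core.exhausted (hw : SubsetMonotone w) (hS : Setting G wt t σ Γ D v)
    (hu : ∀ u, ∃ g, Core w G wt t σ Γ D u g) (h : Core w G wt t σ Γ D v g) (hv : v ∈ D)
    (hvt : v ≠ t) (hW : WinOk (σ.val ops) 0 (Γ.leaves v)) {p : List (Fin N × Fin N)}
    (hp : G.IsPath v t p) : p ∈ Γ.paths v := by
  by_contra hn
  obtain ⟨f, hf, hc, -⟩ := h.exists_leaf hw hS hu hv hvt hp hn
  rcases hW with hW | hW
  · have := hW.2 f hf
    simp [State.val, hc] at this
  · exact hW.1 rfl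

/-- The winner advances. -/
theorem Core.advance (h : Core w G wt t σ Γ D v g) (hvt : v ≠ t) (hg : g ∈ Γ.leaves v)
    (hnd : (Γ.leaves v).Nodup) (hc : σ.mem 14 g ≠ 0)
    (hu : Core w G wt t σ Γ D (Γ.head g) g')
    (hdead : Γ.pos g + 1 = (Γ.ent (Γ.head g)).length → ∀ p, G.IsPath (Γ.head g) t p →
      p ∈ Γ.paths (Γ.head g))
    (hτ11 : τ.reg 11 = σ.reg 11) (hτ13 : τ.mem 13 = σ.mem 13)
    (hτ14 : τ.mem 14 = Function.update (σ.mem 14) g (σ.mem 17 (σ.mem 14 g)))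
    (hτ15 : τ.mem 15 = σ.mem 15) (hτ16 : τ.mem 16 = σ.mem 16) (hτ17 : τ.mem 17 = σ.mem 17)
    (hτw : τ.wmem 1 = σ.wmem 1) (he : Γ'.ent = Γ.ent) (hp : Γ'.path = Γ.path)
    (hl : (Γ'.leaves v).Perm (Γ.leaves v)) (hed : Γ'.edge = Γ.edge)
    (hpos : Γ'.pos = Function.update Γ.pos g (Γ.pos g + 1)) :
    Core w G wt t τ Γ' D v 0 := by
  have hlt := h.cur_mem hg hc
  have hhead : Γ'.head = Γ.head := by funext f; simp [Ghost.head, hed]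
  have hpaths : Γ'.paths = Γ.paths := by funext u; simp [Ghost.paths, he, hp]
  have hm : ∀ f, f ∈ Γ'.leaves v ↔ f ∈ Γ.leaves v := fun f => hl.mem_iff
  constructor
  · simpa only [he] using h.ent_ne
  · simpa only [he, hτ11] using h.ent_lt
  · simpa only [he, hp] using h.isPath
  · simpa only [he, hp, hτw] using h.weight
  · simpa only [hpaths] using h.nodup
  · simpa only [hpaths] using h.sorted
  · simpa only [he, hτ17] using h.link
  · simpa only [he, hp, hed, hhead, hτ15, hτ16, hm] using h.sub
  · simpa only [he, hp, hpaths] using h.min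
  · simpa only [hm] using h.leaf_ne
  · simpa only [hm, hed, hτ13] using h.leaf_edge
  · simpa only [hm, hed] using h.leaf_own
  · simpa only [hm, hed] using h.leaf_inj
  · intro f hf
    have := h.leaf_pos f ((hm f).1 hf)
    rw [hpos, he, hhead, Function.update_apply]
    split
    · subst f; exact hlt
    · exact this
  · intro f hf
    rw [hτ14, hpos, he, hhead, Function.update_apply, Function.update_apply]
    split
    · subst f
      -- The link of an entry is the entry at the next position and `0` at the end of the list,
      -- which is just the default of `getD` in `leaf_cur`.
      rw [h.cur_eq hg hlt, hu.link _ hlt]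
    · exact h.leaf_cur f ((hm f).1 hf)
  · intro f hf
    rw [hpos, he, hhead, hpaths, Function.update_apply]
    split
    · subst f; exact hdead
    · exact h.leaf_dead f ((hm f).1 hf)
  · intro f hf j hj
    have := h.gen f ((hm f).1 hf) j (by simpa only [he, hhead] using hj)
    simp only [he, hp, hed, hhead, hpaths, this, hpos, Function.update_apply]
    have hf0 := h.leaf_ne f ((hm f).1 hf)
    split <;> grind
  · intro _
    have hg0 := h.leaf_ne g hg
    rw [he, h.count hvt, if_neg hg0, (hl.map _).sum_eq, hpos, if_pos rfl]
    have key : ∀ l : List ℕ, l.Nodup → g ∈ l →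
        (l.map (Function.update Γ.pos g (Γ.pos g + 1))).sum = (l.map Γ.pos).sum + 1 := by
      intro l hl hgl
      have h1 := List.perm_cons_erase hgl
      rw [(h1.map _).sum_eq, (h1.map Γ.pos).sum_eq]
      have h2 : (l.erase g).map (Function.update Γ.pos g (Γ.pos g + 1)) = (l.erase g).map Γ.pos := by
        refine List.map_congr_left fun x hx => Function.update_of_ne ?_ _ _
        rintro rfl
        exact hl.not_mem_erase hx
      rw [List.map_cons, List.map_cons, List.sum_cons, List.sum_cons, h2, Function.update_self]
      omega
    rw [key _ hnd hg]
  · simpa only [hm, hed, he] using h.complete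

/-- The entry `z` for the winner `g` is appended to the entries of `v`. -/
structure Extends {W : Type u} {N : ℕ} (σ τ : State W) (Γ Γ' : Ghost N) (v : Fin N) (g z : ℕ) :
    Prop where
  mem15 : τ.mem 15 = Function.update (σ.mem 15) z g
  mem16 : τ.mem 16 = Function.update (σ.mem 16) z (σ.mem 14 g)
  wmem : ∀ i, i ≠ z → τ.wmem 1 i = σ.wmem 1 i
  link : ∀ i, i ∉ Γ.ent v → τ.mem 17 i = σ.mem 17 i
  ent : Γ'.ent = Function.update Γ.ent v (Γ.ent v ++ [z])
  path : Γ'.path = Function.update Γ.path z (Γ.edge g :: Γ.path (σ.mem 14 g))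
  mem13 : τ.mem 13 = σ.mem 13
  mem14 : τ.mem 14 = σ.mem 14
  reg11 : σ.reg 11 ≤ τ.reg 11
  edge : Γ'.edge = Γ.edge
  pos : Γ'.pos = Γ.pos
  leaves : Γ'.leaves = Γ.leaves

/-- A new entry of another node does no harm. -/
theorem Core.of_extends {v₀ : Fin N} {z : ℕ} {D' : Finset (Fin N)} (h : Core w G wt t σ Γ D v g)
    (hE : Extends σ τ Γ Γ' v₀ g' z)
    (hne : v ≠ v₀) (hu : ∀ u, ∃ g, Core w G wt t σ Γ D u g)
    (hz : z = σ.reg 11) (hnew : G.IsPath v₀ t (Γ.edge g' :: Γ.path (σ.mem 14 g')))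
    (hfresh : Γ.edge g' :: Γ.path (σ.mem 14 g') ∉ Γ.paths v₀)
    (hD : v ∈ D' → v ∈ D) (hD0 : v ∈ D → Γ.ent v₀ = [] → ∀ e ∈ G.edges, e.1 = v → e.2 ≠ v₀) :
    Core w G wt t τ Γ' D' v g := by
  have hzold : ∀ u, ∀ y ∈ Γ.ent u, y ≠ z := by
    intro u y hy
    obtain ⟨g, hu⟩ := hu u
    have := hu.ent_lt y hy
    omega
  have hent : ∀ u, u ≠ v₀ → Γ'.ent u = Γ.ent u := fun u hu => by
    rw [hE.ent, Function.update_of_ne hu]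
  have hpath : ∀ u, ∀ y ∈ Γ.ent u, Γ'.path y = Γ.path y := fun u y hy => by
    rw [hE.path, Function.update_of_ne (hzold u y hy)]
  have hpathz : Γ'.path z = Γ.edge g' :: Γ.path (σ.mem 14 g') := by
    rw [hE.path, Function.update_self]
  have hpaths : ∀ u, u ≠ v₀ → Γ'.paths u = Γ.paths u := fun u hu => by
    rw [Ghost.paths, Ghost.paths, hent u hu]
    exact List.map_congr_left fun y hy => hpath u y hy
  have hpaths0 : Γ'.paths v₀ = Γ.paths v₀ ++ [Γ.edge g' :: Γ.path (σ.mem 14 g')] := by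
    rw [Ghost.paths, Ghost.paths, hE.ent, Function.update_self, List.map_append, List.map_singleton,
      hpathz]
    congr 1
    exact List.map_congr_left fun y hy => hpath v₀ y hy
  have hhead : Γ'.head = Γ.head := by funext f; simp [Ghost.head, hE.edge]
  have h15 : ∀ u, ∀ y ∈ Γ.ent u, τ.mem 15 y = σ.mem 15 y := fun u y hy => by
    rw [hE.mem15, Function.update_of_ne (hzold u y hy)]
  have h16 : ∀ u, ∀ y ∈ Γ.ent u, τ.mem 16 y = σ.mem 16 y := fun u y hy => by
    rw [hE.mem16, Function.update_of_ne (hzold u y hy)]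
  -- No leaf can be standing behind the end of the list that is extended: `leaf_dead` would say that
  -- the new path is already listed.
  have hnot : ∀ f ∈ Γ.leaves v, Γ.head f = v₀ → Γ.pos f ≠ (Γ.ent v₀).length := by
    intro f hf hf0 hp
    refine hfresh ?_
    have := h.leaf_dead f hf (by rw [hf0, hp]) _ (by rw [hf0]; exact hnew)
    rwa [hf0] at this
  constructor
  · rw [hent v hne]; exact h.ent_ne
  · rw [hent v hne]; exact fun y hy => (h.ent_lt y hy).trans_le hE.reg11
  · rw [hent v hne]; exact fun y hy => by rw [hpath v y hy]; exact h.isPath y hy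
  · rw [hent v hne]
    exact fun y hy => by rw [hpath v y hy, hE.wmem y (hzold v y hy)]; exact h.weight y hy
  · rw [hpaths v hne]; exact h.nodup
  · rw [hpaths v hne]; exact h.sorted
  · intro i hi
    have hi' : i < (Γ.ent v).length := by rwa [hent v hne] at hi
    have hmem : (Γ.ent v)[i] ∉ Γ.ent v₀ := by
      intro hm
      obtain ⟨g0, hu⟩ := hu v₀
      exact hne ((h.isPath _ (List.getElem_mem hi')).source_unique (hu.isPath _ hm))
    have := h.link i hi'
    simp only [hent v hne]
    rwa [hE.link _ hmem]
  · intro hvt y hy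
    rw [hent v hne] at hy
    obtain ⟨h1, h2, h3⟩ := h.sub hvt y hy
    rw [h15 v y hy, h16 v y hy, hE.leaves, hhead, hpath v y hy, hE.edge, hpath _ _ h3]
    refine ⟨h1, h2, ?_⟩
    rw [hE.ent, Function.update_apply]
    split
    · next heq => rw [heq] at h3; exact List.mem_append_left _ h3
    · exact h3
  · intro p hp hn y hy
    rw [hpaths v hne] at hn
    rw [hent v hne] at hy
    rw [hpath v y hy]
    exact h.min p hp hn y hy
  · rw [hE.leaves]; exact h.leaf_ne
  · rw [hE.leaves, hE.mem13, hE.edge]; exact h.leaf_edge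
  · rw [hE.leaves, hE.edge]; exact h.leaf_own
  · rw [hE.leaves, hE.edge]; exact h.leaf_inj
  · intro f hf
    rw [hE.leaves] at hf
    have := h.leaf_pos f hf
    rw [hhead, hE.pos, hE.ent, Function.update_apply]
    split
    · next heq => rw [heq] at this; simp; omega
    · exact this
  · intro f hf
    rw [hE.leaves] at hf
    have h1 := h.leaf_pos f hf
    have h2 := h.leaf_cur f hf
    rw [hhead, hE.pos, hE.ent, Function.update_apply, hE.mem14, h2]
    split
    · next heq =>
      have h3 := hnot f hf heq
      rw [heq] at h1 ⊢
      rw [List.getD_append _ _ _ _ (by omega)]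
    · rfl
  · intro f hf
    rw [hE.leaves] at hf
    have h1 := h.leaf_pos f hf
    rw [hhead, hE.pos]
    by_cases heq : Γ.head f = v₀
    · have h3 := hnot f hf heq
      rw [heq, hE.ent, Function.update_self]
      rw [heq] at h1
      simp
      omega
    · rw [hent _ heq, hpaths _ heq]
      exact h.leaf_dead f hf
  · intro f hf j hj
    rw [hE.leaves] at hf
    have h1 := h.leaf_pos f hf
    rw [hpaths v hne]
    simp only [hhead, hE.pos, hE.edge] at hj ⊢
    by_cases heq : Γ.head f = v₀
    · have h3 := hnot f hf heq
      by_cases hj' : j < (Γ.ent (Γ.head f)).length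
      · rw [← h.gen f hf j hj']
        have : (Γ'.ent (Γ.head f))[j] = (Γ.ent (Γ.head f))[j] := by
          simp only [hE.ent, heq, Function.update_self]
          rw [List.getElem_append_left]
        rw [this, hpath _ _ (List.getElem_mem hj')]
      · have hj2 : j = (Γ.ent (Γ.head f)).length := by
          have : (Γ'.ent (Γ.head f)).length = (Γ.ent (Γ.head f)).length + 1 := by
            rw [hE.ent, heq, Function.update_self]; simp
          omega
        have : (Γ'.ent (Γ.head f))[j] = z := by
          simp only [hE.ent, heq, Function.update_self]
          rw [List.getElem_append_right (by rw [hj2, heq])]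
          simp
        rw [this, hpathz]
        constructor
        -- A listed path of `v` with this first edge continues with an old entry of the head, by
        -- `sub`; so it cannot continue with the new one.
        · intro hm
          exfalso
          obtain ⟨y, hy, hyp⟩ := Ghost.mem_paths.1 hm
          have hvt : v ≠ t := by
            rintro rfl
            have := (h.isPath y hy).eq_nil
            rw [this] at hyp
            exact absurd hyp (by simp)
          obtain ⟨k1, k2, k3⟩ := h.sub hvt y hy
          rw [k2] at hyp
          have hed := (List.cons.inj hyp).1
          rw [show Γ.head (σ.mem 15 y) = v₀ by rw [← heq, Ghost.head, hed, Ghost.head]] at k3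
          exact hfresh (Ghost.mem_paths.2 ⟨_, k3, (List.cons.inj hyp).2⟩)
        · rw [heq] at h1 hj2
          omega
    · have hj' : j < (Γ.ent (Γ.head f)).length := by rwa [hent _ heq] at hj
      rw [← h.gen f hf j hj']
      simp only [hent _ heq]
      rw [hpath _ _ (List.getElem_mem hj')]
  · rw [hent v hne, hE.leaves, hE.pos]; exact h.count
  · intro hv hvt e he hev hnil
    rw [hE.leaves, hE.edge]
    refine h.complete (hD hv) hvt e he hev ?_
    by_cases heq : e.2 = v₀
    · exact fun hnil' => hD0 (hD hv) (heq ▸ hnil') e he hev heq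
    · rwa [hent _ heq] at hnil

/-- The candidate of the winner is a new path. -/
theorem Core.candidate (h : Core w G wt t σ Γ D v 0) (hu : ∀ u, ∃ g, Core w G wt t σ Γ D u g)
    (hg : g ∈ Γ.leaves v) (hc : σ.mem 14 g ≠ 0) :
    G.IsPath v t (Γ.edge g :: Γ.path (σ.mem 14 g)) ∧
      Γ.edge g :: Γ.path (σ.mem 14 g) ∉ Γ.paths v := by
  have hlt := h.cur_mem hg hc
  have hcur := h.cur_eq hg hlt
  obtain ⟨g', hu⟩ := hu (Γ.head g)
  refine ⟨⟨List.mem_of_getElem? (h.leaf_edge g hg), h.leaf_own g hg, ?_⟩, ?_⟩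
  · rw [hcur]
    exact hu.isPath _ (List.getElem_mem hlt)
  · rw [hcur, h.gen g hg _ hlt]
    have := h.leaf_ne g hg
    omega

/-- A new entry for the winner. -/
theorem Core.create {z : ℕ} {D' : Finset (Fin N)} (hC : ops.Computes w) (hw : SubsetMonotone w)
    (hS : Setting G wt t σ Γ D v)
    (hu : ∀ u, ∃ g, Core w G wt t σ Γ D u g) (h : Core w G wt t σ Γ D v 0) (hv : v ∈ D)
    (hvt : v ≠ t) (hE : Extends σ τ Γ Γ' v g z) (hz : z = σ.reg 11) (hz0 : z ≠ 0)
    (hg0 : g ≠ 0) (hW : WinOk (σ.val ops) g (Γ.leaves v))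
    (hreg : τ.reg 11 = z + 1)
    (hwz : (τ.wmem 1 z : WithTop W) = σ.val ops g)
    (hlink0 : τ.mem 17 z = 0)
    (hlink : ∀ i (hi : i < (Γ.ent v).length), τ.mem 17 (Γ.ent v)[i] =
      (Γ.ent v ++ [z]).getD (i + 1) 0) (hD : D' = D) :
    Core w G wt t τ Γ' D' v g := by
  subst hD
  obtain ⟨-, hgl, hvg, hmin⟩ : g ≠ 0 ∧ g ∈ Γ.leaves v ∧ σ.val ops g ≠ ⊤ ∧
      ∀ f ∈ Γ.leaves v, σ.val ops g ≤ σ.val ops f := by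
    rcases hW with hW | hW
    · exact absurd hW.1 hg0
    · exact hW
  have hc : σ.mem 14 g ≠ 0 := by
    intro hc; simp [State.val, hc] at hvg
  obtain ⟨hnew, hfresh⟩ := h.candidate hu hgl hc
  have hlt := h.cur_mem hgl hc
  have hcur := h.cur_eq hgl hlt
  have hzold : ∀ u, ∀ y ∈ Γ.ent u, y ≠ z := by
    intro u y hy
    obtain ⟨g, hu⟩ := hu u
    have := hu.ent_lt y hy
    omega
  have hpath : ∀ u, ∀ y ∈ Γ.ent u, Γ'.path y = Γ.path y := fun u y hy => by
    rw [hE.path, Function.update_of_ne (hzold u y hy)]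
  have hpathz : Γ'.path z = Γ.edge g :: Γ.path (σ.mem 14 g) := by
    rw [hE.path, Function.update_self]
  have hentv : Γ'.ent v = Γ.ent v ++ [z] := by rw [hE.ent, Function.update_self]
  have hpaths0 : Γ'.paths v = Γ.paths v ++ [Γ.edge g :: Γ.path (σ.mem 14 g)] := by
    rw [Ghost.paths, Ghost.paths, hentv, List.map_append, List.map_singleton, hpathz]
    congr 1
    exact List.map_congr_left fun y hy => hpath v y hy
  have hhead : Γ'.head = Γ.head := by funext f; simp [Ghost.head, hE.edge]
  have hheadne : ∀ f ∈ Γ.leaves v, Γ.head f ≠ v := fun f hf =>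
    G.head_ne (List.mem_of_getElem? (h.leaf_edge f hf)) (h.leaf_own f hf)
  have hent : ∀ f ∈ Γ.leaves v, Γ'.ent (Γ.head f) = Γ.ent (Γ.head f) := fun f hf => by
    rw [hE.ent, Function.update_of_ne (hheadne f hf)]
  have hpathsh : ∀ f ∈ Γ.leaves v, Γ'.paths (Γ.head f) = Γ.paths (Γ.head f) := fun f hf => by
    rw [Ghost.paths, Ghost.paths, hent f hf]
    exact List.map_congr_left fun y hy => hpath _ y hy
  have hwnew : τ.wmem 1 z = pathWeight w wt (Γ.edge g :: Γ.path (σ.mem 14 g)) := by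
    have := hwz.trans (h.val_eq hC hS hu hgl hc)
    exact WithTop.coe_injective this
  -- The winner is at most every live candidate, and some live candidate is at most any path that is
  -- not listed.
  have hold : ∀ p, G.IsPath v t p → p ∉ Γ.paths v →
      pathWeight w wt (Γ.edge g :: Γ.path (σ.mem 14 g)) ≤ pathWeight w wt p := by
    intro p hp hn
    obtain ⟨f, hf, hcf, hle⟩ := h.exists_leaf hw hS hu hv hvt hp hn
    refine le_trans ?_ hle
    have := hmin f hf
    rw [h.val_eq hC hS hu hgl hc, h.val_eq hC hS hu hf hcf] at this
    exact WithTop.coe_le_coe.1 this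
  constructor
  · intro y hy
    rw [hentv, List.mem_append, List.mem_singleton] at hy
    rcases hy with hy | rfl
    exacts [h.ent_ne y hy, hz0]
  · intro y hy
    rw [hentv, List.mem_append, List.mem_singleton] at hy
    rcases hy with hy | rfl
    · have := h.ent_lt y hy
      omega
    · omega
  · intro y hy
    rw [hentv, List.mem_append, List.mem_singleton] at hy
    rcases hy with hy | rfl
    · rw [hpath v y hy]; exact h.isPath y hy
    · rw [hpathz]; exact hnew
  · intro y hy
    rw [hentv, List.mem_append, List.mem_singleton] at hy
    rcases hy with hy | rfl
    · rw [hpath v y hy, hE.wmem y (hzold v y hy)]; exact h.weight y hy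
    · rw [hpathz, hwnew]
  · rw [hpaths0]
    refine List.nodup_append.2 ⟨h.nodup, by simp, ?_⟩
    rintro a ha b hb rfl
    rw [List.mem_singleton] at hb
    exact hfresh (hb ▸ ha)
  · rw [hpaths0]
    refine List.pairwise_append.2 ⟨h.sorted, by simp, ?_⟩
    intro a ha b hb
    rw [List.mem_singleton] at hb
    obtain ⟨y, hy, rfl⟩ := Ghost.mem_paths.1 ha
    rw [hb]
    exact h.min _ hnew hfresh y hy
  · intro i hi
    simp only [hentv]
    have hi' : i < (Γ.ent v ++ [z]).length := by rwa [hentv] at hi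
    by_cases hil : i < (Γ.ent v).length
    · rw [List.getElem_append_left hil]
      exact hlink i hil
    · have hi2 : i = (Γ.ent v).length := by
        simp at hi'; omega
      rw [List.getElem_append_right (by omega), List.getD_eq_default _ _ (by simp; omega)]
      simp [hi2, hlink0]
  · intro _ y hy
    rw [hentv, List.mem_append, List.mem_singleton] at hy
    rw [hE.leaves, hE.edge, hhead]
    rcases hy with hy | rfl
    · obtain ⟨k1, k2, k3⟩ := h.sub hvt y hy
      have : τ.mem 15 y = σ.mem 15 y := by
        rw [hE.mem15, Function.update_of_ne (hzold v y hy)]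
      have h16 : τ.mem 16 y = σ.mem 16 y := by
        rw [hE.mem16, Function.update_of_ne (hzold v y hy)]
      rw [this, h16, hent _ k1, hpath v y hy, hpath _ _ k3]
      exact ⟨k1, k2, k3⟩
    · rw [hpathz, hE.mem15, hE.mem16, Function.update_self, Function.update_self, hent g hgl]
      have hm : σ.mem 14 g ∈ Γ.ent (Γ.head g) := by rw [hcur]; exact List.getElem_mem hlt
      rw [hpath _ _ hm]
      exact ⟨hgl, rfl, hm⟩
  · intro p hp hn y hy
    rw [hpaths0, List.mem_append, List.mem_singleton, not_or] at hn
    rw [hentv, List.mem_append, List.mem_singleton] at hy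
    rcases hy with hy | rfl
    · rw [hpath v y hy]; exact h.min p hp hn.1 y hy
    · rw [hpathz]; exact hold p hp hn.1
  · rw [hE.leaves]; exact h.leaf_ne
  · rw [hE.leaves, hE.mem13, hE.edge]; exact h.leaf_edge
  · rw [hE.leaves, hE.edge]; exact h.leaf_own
  · rw [hE.leaves, hE.edge]; exact h.leaf_inj
  · intro f hf
    rw [hE.leaves] at hf
    rw [hhead, hE.pos, hent f hf]
    exact h.leaf_pos f hf
  · intro f hf
    rw [hE.leaves] at hf
    rw [hhead, hE.pos, hent f hf, hE.mem14]
    exact h.leaf_cur f hf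
  · intro f hf
    rw [hE.leaves] at hf
    rw [hhead, hE.pos, hent f hf, hpathsh f hf]
    exact h.leaf_dead f hf
  · intro f hf j hj
    rw [hE.leaves] at hf
    simp only [hhead, hE.pos, hE.edge, hent f hf] at hj ⊢
    rw [hpath _ _ (List.getElem_mem hj), hpaths0, List.mem_append, List.mem_singleton,
      h.gen f hf j hj]
    have hf0 := h.leaf_ne f hf
    -- Different leaves have different edges, and the entries of one head have different paths; so
    -- the leaf and the position can be read off the path.
    have : (Γ.edge f :: Γ.path (Γ.ent (Γ.head f))[j] = Γ.edge g :: Γ.path (σ.mem 14 g)) ↔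
        (f = g ∧ j = Γ.pos f) := by
      constructor
      · intro heq
        obtain rfl := h.leaf_inj f hf g hgl (List.cons.inj heq).1
        refine ⟨rfl, ?_⟩
        have h2 := (List.cons.inj heq).2
        rw [hcur] at h2
        obtain ⟨g', hu⟩ := hu (Γ.head f)
        have h3 := (List.nodup_iff_injective_get.1 hu.nodup)
        have h4 := @h3 ⟨j, by simpa [Ghost.paths] using hj⟩
          ⟨Γ.pos f, by simpa [Ghost.paths] using hlt⟩ (by simpa [Ghost.paths] using h2)
        simpa using h4
      · rintro ⟨rfl, rfl⟩
        rw [hcur]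
    rw [this]
    omega
  · intro _
    rw [hentv, hE.leaves, hE.pos, List.length_append, h.count hvt]
    simp [hg0]
  · intro hvD _ e he hev hnil
    rw [hE.leaves, hE.edge]
    refine h.complete hvD hvt e he hev ?_
    rwa [hE.ent, Function.update_of_ne (G.head_ne he hev)] at hnil

end

/-- The best leaf of a node, or `0`. -/
def winner {W : Type u} {N : ℕ} (σ : State W) (v : Fin N) : ℕ := σ.mem 12 (σ.mem 8 v)

/-- `T` is the tree of node `v`, and the rotations in it are paid for. -/
structure TreeOk {W : Type u} [LinearOrder W] {N : ℕ} (ops : WeightOps W) (σ : State W)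
    (Γ : Ghost N) (v : Fin N) (T : BT) : Prop where
  root : σ.mem 8 v = T.id
  rep : Rep (σ.mem 10) (σ.mem 11) (σ.mem 12) (σ.val ops) T
  par_root : σ.mem 10 T.id = 0
  nodup : (0 :: T.ids).Nodup
  lt : ∀ i ∈ T.ids, i < σ.reg 10
  -- For all weights at once: the weights that give the final bound depend on the number of advances
  -- and are known only after the run.
  amort : ∀ w : ℕ → ℝ, (∀ i, 1 ≤ w i) → (Γ.rot v : ℝ) + T.pot w ≤
    4 * T.leaves.length + 2 * T.mass w +
      2 * (T.leaves.map fun f => (Γ.pos f : ℝ) * (Real.log (T.mass w) - Real.log (w f))).sum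

/-- The nodes in `D` have been processed; in node `x`, if any, the winner has no entry yet. -/
structure Inv {W : Type u} [LinearOrder W] {N : ℕ} (w : Multiset W → W) (G : DAG N)
    (wt : Fin N × Fin N → W) (t : Fin N) (ops : WeightOps W) (σ : State W) (Γ : Ghost N)
    (D : Finset (Fin N)) (x : Option (Fin N)) : Prop where
  wt_eq : ∀ i e, G.edges[i]? = some e → σ.wmem 0 i = wt e
  src_eq : ∀ i e, G.edges[i]? = some e → σ.mem 0 i = e.1
  dst_eq : ∀ i e, G.edges[i]? = some e → σ.mem 1 i = e.2
  closed : ∀ e ∈ G.edges, e.1 ∈ D → e.2 ∈ D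
  nonempty : ∀ u ∈ D, some u ≠ x → ∀ p, G.IsPath u t p → Γ.ent u ≠ []
  -- A new entry is the last of its list without its link being written.
  fresh : ∀ i, σ.reg 11 ≤ i → σ.mem 17 i = 0
  pos : 1 ≤ σ.reg 11
  t_ent : (Γ.ent t).length ≤ 1
  t_leaf : ∀ z ∈ Γ.ent t, σ.mem 15 z = 0
  out : ∀ v, v ∉ D → Γ.ent v = [] ∧ Γ.tree v = none
  tree_t : Γ.tree t = none
  tree_none : ∀ v, Γ.tree v = none → σ.mem 8 v = 0
  rot_none : ∀ v, Γ.tree v = none → Γ.rot v = 0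
  -- A node without a tree has root `0`, so its `winner` is read from this cell and is `0`.
  win_zero : σ.mem 12 0 = 0
  tree_ok : ∀ v T, Γ.tree v = some T → TreeOk ops σ Γ v T
  disj : ∀ v v' T T', Γ.tree v = some T → Γ.tree v' = some T' → ∀ i ∈ T.ids, i ∈ T'.ids → v = v'
  core : ∀ v, Core w G wt t σ Γ D v (if some v = x then 0 else winner σ v)

/-! ### All nodes together: preservation of the invariant -/

section
variable {W : Type u} [LinearOrder W] {w : Multiset W → W} {ops : WeightOps W} {N : ℕ}
  {G : DAG N} {wt : Fin N × Fin N → W} {t v : Fin N} {σ τ : State W} {Γ Γ' : Ghost N}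
  {D : Finset (Fin N)} {g : ℕ}

theorem Core.congr (h : Core w G wt t σ Γ D v g) (hent : Γ'.ent = Γ.ent)
    (hpath : Γ'.path = Γ.path) (hleaves : Γ'.leaves v = Γ.leaves v) (hedge : Γ'.edge = Γ.edge)
    (hpos : ∀ f ∈ Γ.leaves v, Γ'.pos f = Γ.pos f) (h11 : τ.reg 11 = σ.reg 11)
    (hw : τ.wmem 1 = σ.wmem 1) (h13 : ∀ f ∈ Γ.leaves v, τ.mem 13 f = σ.mem 13 f)
    (h14 : ∀ f ∈ Γ.leaves v, τ.mem 14 f = σ.mem 14 f)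
    (h15 : τ.mem 15 = σ.mem 15) (h16 : τ.mem 16 = σ.mem 16) (h17 : τ.mem 17 = σ.mem 17) :
    Core w G wt t τ Γ' D v g := by
  have hhead : Γ'.head = Γ.head := by funext f; simp [Ghost.head, hedge]
  have hpaths : Γ'.paths = Γ.paths := by funext u; simp [Ghost.paths, hent, hpath]
  constructor
  · rw [hent]; exact h.ent_ne
  · rw [hent, h11]; exact h.ent_lt
  · rw [hent, hpath]; exact h.isPath
  · rw [hent, hpath, hw]; exact h.weight
  · rw [hpaths]; exact h.nodup
  · rw [hpaths]; exact h.sorted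
  · simp only [hent, h17]; exact h.link
  · rw [hent, hpath, hedge, hhead, h15, h16, hleaves]; exact h.sub
  · rw [hent, hpath, hpaths]; exact h.min
  · rw [hleaves]; exact h.leaf_ne
  · rw [hleaves, hedge]
    intro f hf
    rw [h13 f hf]
    exact h.leaf_edge f hf
  · rw [hleaves, hedge]; exact h.leaf_own
  · rw [hleaves, hedge]; exact h.leaf_inj
  · rw [hleaves, hhead, hent]
    intro f hf
    rw [hpos f hf]
    exact h.leaf_pos f hf
  · rw [hleaves, hhead, hent]
    intro f hf
    rw [hpos f hf, h14 f hf]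
    exact h.leaf_cur f hf
  · rw [hleaves, hhead, hent, hpaths]
    intro f hf
    rw [hpos f hf]
    exact h.leaf_dead f hf
  · rw [hleaves]
    simp only [hhead, hent, hpaths, hpath, hedge]
    intro f hf
    rw [hpos f hf]
    exact h.gen f hf
  · rw [hleaves, hent, List.map_congr_left hpos]; exact h.count
  · rw [hleaves, hedge, hent]; exact h.complete

theorem Ghost.leaves_eq {T : BT} (h : Γ.tree v = some T) : Γ.leaves v = T.leaves := by
  simp [Ghost.leaves, h]

theorem Ghost.leaves_none (h : Γ.tree v = none) : Γ.leaves v = [] := by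
  simp [Ghost.leaves, h]

theorem TreeOk.winOk {T : BT} (h : TreeOk ops σ Γ v T) :
    WinOk (σ.val ops) (winner σ v) T.leaves := by
  rw [winner, h.root]; exact h.rep.winOk

theorem TreeOk.leaf_mem_ids {T : BT} {f : ℕ} (hf : f ∈ T.leaves) : f ∈ T.ids :=
  T.leaves_sublist_ids.subset hf

theorem TreeOk.congr {T : BT} (h : TreeOk ops σ Γ v T) (h8 : τ.mem 8 v = σ.mem 8 v)
    (h10 : ∀ i ∈ T.ids, τ.mem 10 i = σ.mem 10 i) (h11 : ∀ i ∈ T.ids, τ.mem 11 i = σ.mem 11 i)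
    (h12 : ∀ i ∈ T.ids, τ.mem 12 i = σ.mem 12 i)
    (hv : ∀ f ∈ T.leaves, τ.val ops f = σ.val ops f) (hr : σ.reg 10 ≤ τ.reg 10)
    (hrot : Γ'.rot v = Γ.rot v) (hpos : ∀ f ∈ T.leaves, Γ'.pos f = Γ.pos f) :
    TreeOk ops τ Γ' v T where
  root := h8.trans h.root
  rep := h.rep.congr (fun i hi => h10 i (List.mem_cons_of_mem _ hi))
    (fun i hi => h11 i (List.mem_cons_of_mem _ hi)) h12 hv
  par_root := (h10 _ T.id_mem_ids).trans h.par_root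
  nodup := h.nodup
  lt := fun i hi => (h.lt i hi).trans_le hr
  amort := fun w hw => by
    have := h.amort w hw
    rw [hrot]
    refine this.trans_eq ?_
    congr 3
    refine List.map_congr_left fun f hf => ?_
    rw [hpos f hf]

/-- `Inv` depends on some arrays and registers only. -/
theorem Inv.congr_state {x : Option (Fin N)} (h : Inv w G wt t ops σ Γ D x)
    (h10 : τ.reg 10 = σ.reg 10) (h11 : τ.reg 11 = σ.reg 11)
    (hm : ∀ a, a = 0 ∨ a = 1 ∨ a = 8 ∨ (10 ≤ a ∧ a ≤ 17) → τ.mem a = σ.mem a)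
    (hwm : τ.wmem = σ.wmem) : Inv w G wt t ops τ Γ D x := by
  have hv : τ.val ops = σ.val ops := State.val_congr (hm 13 (by simp)) (hm 14 (by simp)) hwm
  have hwin : ∀ u : Fin N, winner τ u = winner σ u := fun u => by
    rw [winner, winner, hm 8 (by simp), hm 12 (by simp)]
  exact
    { wt_eq := by rw [hwm]; exact h.wt_eq
      src_eq := by rw [hm 0 (by simp)]; exact h.src_eq
      dst_eq := by rw [hm 1 (by simp)]; exact h.dst_eq
      closed := h.closed
      nonempty := h.nonempty
      fresh := by rw [h11, hm 17 (by simp)]; exact h.fresh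
      pos := by rw [h11]; exact h.pos
      t_ent := h.t_ent
      t_leaf := by rw [hm 15 (by simp)]; exact h.t_leaf
      out := h.out
      tree_t := h.tree_t
      tree_none := by rw [hm 8 (by simp)]; exact h.tree_none
      rot_none := h.rot_none
      win_zero := by rw [hm 12 (by simp)]; exact h.win_zero
      tree_ok := fun u U hU => (h.tree_ok u U hU).congr (by rw [hm 8 (by simp)])
        (fun _ _ => by rw [hm 10 (by simp)]) (fun _ _ => by rw [hm 11 (by simp)])
        (fun _ _ => by rw [hm 12 (by simp)]) (fun _ _ => by rw [hv]) h10.ge rfl fun _ _ => rfl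
      disj := h.disj
      core := fun u => by
        rw [hwin u]
        exact (h.core u).congr rfl rfl rfl rfl (fun _ _ => rfl) h11 (by rw [hwm])
          (fun _ _ => by rw [hm 13 (by simp)]) (fun _ _ => by rw [hm 14 (by simp)])
          (hm 15 (by simp)) (hm 16 (by simp)) (hm 17 (by simp)) }

theorem Inv.winOk {x : Option (Fin N)} (h : Inv w G wt t ops σ Γ D x) (v : Fin N) :
    WinOk (σ.val ops) (winner σ v) (Γ.leaves v) := by
  cases hT : Γ.tree v with
  | none =>
    rw [Ghost.leaves_none hT]
    exact .inl ⟨by rw [winner, h.tree_none v hT, h.win_zero], by simp⟩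
  | some T =>
    rw [Ghost.leaves_eq hT]
    exact (h.tree_ok v T hT).winOk

theorem Inv.setting {x : Option (Fin N)} (h : Inv w G wt t ops σ Γ D x)
    (hx : ∀ u, x = some u → u = v) :
    Setting G wt t σ Γ D v :=
  ⟨h.wt_eq, h.closed, fun u hu huv => h.nonempty u hu fun heq => huv (hx u heq.symm)⟩

theorem Inv.exists_core {x : Option (Fin N)} (h : Inv w G wt t ops σ Γ D x) (u : Fin N) :
    ∃ g, Core w G wt t σ Γ D u g := ⟨_, h.core u⟩

/-- A node whose leaves are exhausted has all its paths. -/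
theorem Inv.exhausted {x : Option (Fin N)} (hw : SubsetMonotone w) (h : Inv w G wt t ops σ Γ D x)
    (hx : ∀ u, x = some u → u = v)
    (hv : v ∈ D) (hvx : v ≠ t ∨ x = none) (h0 : winner σ v = 0) {p : List (Fin N × Fin N)}
    (hp : G.IsPath v t p) : p ∈ Γ.paths v := by
  -- The only path from `t` to itself is the empty one, and it is listed as soon as `t` has an
  -- entry.
  by_cases hvt : v = t
  · subst hvt
    have hxn : x = none := by
      rcases hvx with hvx | hvx
      exacts [absurd rfl hvx, hvx]
    have hne := h.nonempty v hv (by simp [hxn]) p hp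
    obtain ⟨z, hz⟩ := List.exists_mem_of_ne_nil _ hne
    refine Ghost.mem_paths.2 ⟨z, hz, ?_⟩
    rw [((h.core v).isPath z hz).eq_nil, hp.eq_nil]
  · refine (h.core v).exhausted hw (h.setting hx) h.exists_core hv hvt (ops := ops) ?_ hp
    rw [← h0]
    exact h.winOk v

theorem Inv.winner_live {x : Option (Fin N)} (h : Inv w G wt t ops σ Γ D x)
    (h0 : winner σ v ≠ 0) : ∃ T, Γ.tree v = some T ∧ v ≠ t ∧ winner σ v ∈ T.leaves ∧
      σ.mem 14 (winner σ v) ≠ 0 := by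
  cases hT : Γ.tree v with
  | none => exact absurd (by rw [winner, h.tree_none v hT, h.win_zero]) h0
  | some T =>
    refine ⟨T, rfl, ?_, ?_⟩
    · rintro rfl
      rw [h.tree_t] at hT
      exact absurd hT (by simp)
    · rcases (h.tree_ok v T hT).winOk with hW | hW
      · exact absurd hW.1 h0
      · exact ⟨hW.2.1, fun hc => hW.2.2.1 (by simp [State.val, hc])⟩

/-- The winner of `v` advances, and the tree of `v` is restored. -/
theorem Inv.advance {T T' : BT} {n : ℕ} (h : Inv w G wt t ops σ Γ D none)
    (hT : Γ.tree v = some T) (hg : winner σ v = g) (hg0 : g ≠ 0)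
    (hdead : Γ.pos g + 1 = (Γ.ent (Γ.head g)).length → ∀ p, G.IsPath (Γ.head g) t p →
      p ∈ Γ.paths (Γ.head g))
    (h10 : ∀ i, i ∉ T.ids → τ.mem 10 i = σ.mem 10 i)
    (h11 : ∀ i, i ∉ T.ids → τ.mem 11 i = σ.mem 11 i)
    (h12 : ∀ i, i ∉ T.ids → τ.mem 12 i = σ.mem 12 i)
    (h14 : τ.mem 14 = Function.update (σ.mem 14) g (σ.mem 17 (σ.mem 14 g)))
    (hr10 : τ.reg 10 = σ.reg 10) (hr11 : τ.reg 11 = σ.reg 11)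
    (hmem : ∀ a, a = 0 ∨ a = 1 ∨ a = 8 ∨ a = 13 ∨ a = 15 ∨ a = 16 ∨ a = 17 →
      τ.mem a = σ.mem a)
    (hwm : τ.wmem = σ.wmem)
    (hrep : Rep (τ.mem 10) (τ.mem 11) (τ.mem 12) (τ.val ops) T') (hpar : τ.mem 10 T'.id = 0)
    (hids : T'.ids.Perm T.ids) (hleaves : T'.leaves.Perm T.leaves) (hid : T'.id = T.id)
    (hpot : ∀ w : ℕ → ℝ, (∀ i, 1 ≤ w i) →
      n + T'.pot w ≤ T.pot w + 2 * (Real.log (T'.mass w) - Real.log (w g))) :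
    Inv w G wt t ops τ { Γ with
      tree := Function.update Γ.tree v (some T')
      pos := Function.update Γ.pos g (Γ.pos g + 1)
      rot := Function.update Γ.rot v (Γ.rot v + n) } D (some v) := by
  subst hg
  obtain ⟨T₀, hT₀, hvt, hgT, hc⟩ := h.winner_live hg0
  obtain rfl : T₀ = T := by rw [hT] at hT₀; exact (Option.some.inj hT₀).symm
  have hgl : winner σ v ∈ Γ.leaves v := by rwa [Ghost.leaves_eq hT]
  have hok := h.tree_ok v _ hT
  have hnd : (Γ.leaves v).Nodup := by
    rw [Ghost.leaves_eq hT]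
    exact (List.nodup_cons.1 hok.nodup).2.sublist T₀.leaves_sublist_ids
  set Γ' : Ghost N := { Γ with
      tree := Function.update Γ.tree v (some T')
      pos := Function.update Γ.pos (winner σ v) (Γ.pos (winner σ v) + 1)
      rot := Function.update Γ.rot v (Γ.rot v + n) } with hΓ'
  have htree : Γ'.tree v = some T' := by simp [hΓ']
  have htree' : ∀ u, u ≠ v → Γ'.tree u = Γ.tree u := fun u hu => by
    simp [hΓ', Function.update_of_ne hu]
  have hlv' : ∀ u, u ≠ v → Γ'.leaves u = Γ.leaves u := fun u hu => by
    rw [Ghost.leaves, Ghost.leaves, htree' u hu]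
  have hnot : ∀ u, u ≠ v → ∀ T, Γ.tree u = some T → ∀ i ∈ T.ids, i ∉ T₀.ids :=
    fun u hu T hTu i hi hi' => hu (h.disj u v T T₀ hTu hT i hi hi')
  have hnotf : ∀ u, u ≠ v → ∀ f ∈ Γ.leaves u, f ≠ winner σ v := by
    rintro u hu f hf rfl
    cases hTu : Γ.tree u with
    | none => rw [Ghost.leaves_none hTu] at hf; simp at hf
    | some T =>
      rw [Ghost.leaves_eq hTu] at hf
      exact hnot u hu T hTu _ (TreeOk.leaf_mem_ids hf) (TreeOk.leaf_mem_ids hgT)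
  have h13 := hmem 13 (by simp)
  have hval : ∀ u, u ≠ v → ∀ f ∈ Γ.leaves u, τ.val ops f = σ.val ops f := by
    intro u hu f hf
    simp only [State.val, h14, h13, hwm, Function.update_of_ne (hnotf u hu f hf)]
  have h8 : τ.mem 8 = σ.mem 8 := hmem 8 (by simp)
  have h00 : (0 : ℕ) ∉ T₀.ids := (List.nodup_cons.1 hok.nodup).1
  have hwin : ∀ u, u ≠ v → winner τ u = winner σ u := by
    intro u hu
    rw [winner, winner, h8]
    cases hTu : Γ.tree u with
    | none => rw [h.tree_none u hTu]; exact h12 0 h00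
    | some T =>
      rw [(h.tree_ok u T hTu).root]
      exact h12 _ (hnot u hu T hTu _ T.id_mem_ids)
  constructor
  · rw [hwm]; exact h.wt_eq
  · rw [hmem 0 (by simp)]; exact h.src_eq
  · rw [hmem 1 (by simp)]; exact h.dst_eq
  · exact h.closed
  · exact fun u hu _ => h.nonempty u hu (by simp)
  · rw [hr11, hmem 17 (by simp)]; exact h.fresh
  · rw [hr11]; exact h.pos
  · exact h.t_ent
  · rw [hmem 15 (by simp)]; exact h.t_leaf
  · intro u hu
    have huv : u ≠ v := by
      rintro rfl
      have := (h.out u hu).2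
      rw [hT] at this
      exact absurd this (by simp)
    rw [htree' u huv]
    exact h.out u hu
  · rw [htree' t (Ne.symm hvt)]; exact h.tree_t
  · intro u hu
    have huv : u ≠ v := by
      rintro rfl
      rw [htree] at hu
      exact absurd hu (by simp)
    rw [htree' u huv] at hu
    rw [h8]
    exact h.tree_none u hu
  · intro u hu
    have huv : u ≠ v := by
      rintro rfl
      rw [htree] at hu
      exact absurd hu (by simp)
    rw [htree' u huv] at hu
    exact (Function.update_of_ne huv _ _).trans (h.rot_none u hu)
  · rw [h12 0 h00]; exact h.win_zero
  · intro u U hU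
    by_cases huv : u = v
    · subst huv
      obtain rfl : T' = U := by rw [htree] at hU; exact Option.some.inj hU
      refine ⟨by rw [h8, hok.root, hid], hrep, hpar, (hids.cons 0).nodup_iff.2 hok.nodup,
        fun i hi => by rw [hr10]; exact hok.lt i (hids.subset hi), fun w hw => ?_⟩
      have h1 := hok.amort w hw
      have h2 := hpot w hw
      have hmass : T'.mass w = T₀.mass w := (hleaves.map w).sum_eq
      rw [hmass] at h2
      rw [hmass, hleaves.length_eq, (hleaves.map _).sum_eq]
      -- The advance adds exactly one term `log M - log (w f)`, for the winner; doubled, it covers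
      -- the right-hand side of `hpot`.
      have key : (T₀.leaves.map fun f => (Γ'.pos f : ℝ) *
            (Real.log (T₀.mass w) - Real.log (w f))).sum =
          (T₀.leaves.map fun f => (Γ.pos f : ℝ) *
            (Real.log (T₀.mass w) - Real.log (w f))).sum +
          (Real.log (T₀.mass w) - Real.log (w (winner σ u))) := by
        rw [Ghost.leaves_eq hT] at hnd
        have h3 := List.perm_cons_erase hgT
        rw [(h3.map _).sum_eq,
          (h3.map fun f => (Γ.pos f : ℝ) * (Real.log (T₀.mass w) - Real.log (w f))).sum_eq,
          List.map_cons, List.map_cons, List.sum_cons, List.sum_cons]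
        have h4 : ∀ f ∈ T₀.leaves.erase (winner σ u), Γ'.pos f = Γ.pos f := by
          intro f hf
          refine Function.update_of_ne ?_ _ _
          rintro rfl
          exact hnd.not_mem_erase hf
        rw [List.map_congr_left (g := fun f => (Γ.pos f : ℝ) *
          (Real.log (T₀.mass w) - Real.log (w f))) (fun f hf => by rw [h4 f hf])]
        have h5 : Γ'.pos (winner σ u) = Γ.pos (winner σ u) + 1 := by simp [hΓ']
        rw [h5]
        push_cast
        ring
      have h6 : Γ'.rot u = Γ.rot u + n := by simp [hΓ']
      rw [key, h6]
      push_cast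
      linarith
    · rw [htree' u huv] at hU
      refine (h.tree_ok u U hU).congr (by rw [h8]) (fun i hi => h10 i (hnot u huv U hU i hi))
        (fun i hi => h11 i (hnot u huv U hU i hi)) (fun i hi => h12 i (hnot u huv U hU i hi))
        (fun f hf => hval u huv f (by rwa [Ghost.leaves_eq hU])) hr10.ge
        (by simp [hΓ', Function.update_of_ne huv]) fun f hf => ?_
      exact Function.update_of_ne (hnotf u huv f (by rwa [Ghost.leaves_eq hU])) _ _
  · intro u u' U U' hU hU' i hi hi'
    by_cases huv : u = v
    · subst huv
      obtain rfl : T' = U := by rw [htree] at hU; exact Option.some.inj hU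
      by_cases huv' : u' = u
      · exact huv'.symm
      · rw [htree' u' huv'] at hU'
        exact absurd (hids.subset hi) (hnot u' huv' U' hU' i hi')
    · rw [htree' u huv] at hU
      by_cases huv' : u' = v
      · subst huv'
        obtain rfl : T' = U' := by rw [htree] at hU'; exact Option.some.inj hU'
        exact absurd (hids.subset hi') (hnot u huv U hU i hi)
      · rw [htree' u' huv'] at hU'
        exact h.disj u u' U U' hU hU' i hi hi'
  · intro u
    by_cases huv : u = v
    · subst huv
      rw [if_pos rfl]
      have hcore := h.core u
      simp only [reduceCtorEq, if_false] at hcore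
      refine hcore.advance hvt hgl hnd hc (h.core _) hdead hr11 h13 h14 (hmem 15 (by simp))
        (hmem 16 (by simp)) (hmem 17 (by simp)) (by rw [hwm]) rfl rfl ?_ rfl rfl
      rw [Ghost.leaves_eq htree, Ghost.leaves_eq hT]
      exact hleaves
    · have hcore := h.core u
      simp only [reduceCtorEq, if_false] at hcore
      rw [if_neg (by simpa using huv), hwin u huv]
      refine hcore.congr rfl rfl (hlv' u huv) rfl
        (fun f hf => Function.update_of_ne (hnotf u huv f hf) _ _) hr11 (by rw [hwm])
        (fun f _ => by rw [h13])
        (fun f hf => by rw [h14, Function.update_of_ne (hnotf u huv f hf)]) (hmem 15 (by simp))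
        (hmem 16 (by simp)) (hmem 17 (by simp))

/-- The winner of `v` gets an entry. -/
theorem Inv.create {z : ℕ} (hC : ops.Computes w) (hw : SubsetMonotone w)
    (h : Inv w G wt t ops σ Γ D (some v)) (hv : v ∈ D) (hvt : v ≠ t)
    (hg : winner σ v = g) (hg0 : g ≠ 0)
    (hE : Extends σ τ Γ Γ' v g z) (hz : z = σ.reg 11) (hreg : τ.reg 11 = z + 1)
    (hwz : (τ.wmem 1 z : WithTop W) = σ.val ops g)
    (hlink : ∀ i (hi : i < (Γ.ent v).length), τ.mem 17 (Γ.ent v)[i] =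
      (Γ.ent v ++ [z]).getD (i + 1) 0)
    (hnew : Γ.ent v = [] → ∀ e ∈ G.edges, e.1 ∈ D → e.2 ≠ v)
    (hr10 : τ.reg 10 = σ.reg 10) (hmem : ∀ a, a = 0 ∨ a = 1 ∨ a = 8 ∨ a = 10 ∨ a = 11 ∨ a = 12 →
      τ.mem a = σ.mem a) (hwm : τ.wmem 0 = σ.wmem 0) (htree : Γ'.tree = Γ.tree)
    (hrot : Γ'.rot = Γ.rot) : Inv w G wt t ops τ Γ' D none := by
  have hz0 : z ≠ 0 := by have := h.pos; omega
  have hcore := h.core v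
  rw [if_pos rfl] at hcore
  have hW : WinOk (σ.val ops) g (Γ.leaves v) := hg ▸ h.winOk v
  have hgl : g ∈ Γ.leaves v ∧ σ.mem 14 g ≠ 0 := by
    rcases hW with hW | hW
    · exact absurd hW.1 hg0
    · exact ⟨hW.2.1, fun hc => hW.2.2.1 (by simp [State.val, hc])⟩
  obtain ⟨hcand, hfresh⟩ := hcore.candidate h.exists_core hgl.1 hgl.2
  have hent : ∀ u, u ≠ v → Γ'.ent u = Γ.ent u := fun u hu => by
    rw [hE.ent, Function.update_of_ne hu]
  have hzold : ∀ u, ∀ y ∈ Γ.ent u, y < z := by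
    intro u y hy
    have := (h.core u).ent_lt y hy
    omega
  have hwin : ∀ u : Fin N, winner τ u = winner σ u := fun u => by
    rw [winner, winner, hmem 8 (by simp), hmem 12 (by simp)]
  -- A live leaf reads the weight of an entry that exists already, never that of the new address
  -- `z`; so all trees remain correct.
  have hval : ∀ u, ∀ f ∈ Γ.leaves u, τ.val ops f = σ.val ops f := by
    intro u f hf
    simp only [State.val, hE.mem14, hE.mem13, hwm]
    split
    · rfl
    · next hc =>
      have hlt := (h.core u).cur_mem hf hc
      have hcur := (h.core u).cur_eq hf hlt
      rw [hE.wmem _ ?_]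
      have := hzold _ (σ.mem 14 f) (by rw [hcur]; exact List.getElem_mem hlt)
      omega
  constructor
  · rw [hwm]; exact h.wt_eq
  · rw [hmem 0 (by simp)]; exact h.src_eq
  · rw [hmem 1 (by simp)]; exact h.dst_eq
  · exact h.closed
  · intro u hu _ p hp
    by_cases huv : u = v
    · rw [huv, hE.ent, Function.update_self]; simp
    · rw [hent u huv]
      exact h.nonempty u hu (by simpa using huv) p hp
  · intro i hi
    rw [hreg] at hi
    rw [hE.link i fun hi' => by have := hzold v i hi'; omega]
    exact h.fresh i (by omega)
  · omega
  · rw [hent t (Ne.symm hvt)]; exact h.t_ent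
  · intro y hy
    rw [hent t (Ne.symm hvt)] at hy
    have := hzold t y hy
    rw [hE.mem15, Function.update_of_ne (by omega)]
    exact h.t_leaf y hy
  · intro u hu
    have huv : u ≠ v := fun huv => hu (huv ▸ hv)
    rw [hent u huv, htree]
    exact h.out u hu
  · rw [htree]; exact h.tree_t
  · rw [htree, hmem 8 (by simp)]; exact h.tree_none
  · rw [htree, hrot]; exact h.rot_none
  · rw [hmem 12 (by simp)]; exact h.win_zero
  · intro u T hT
    rw [htree] at hT
    exact (h.tree_ok u T hT).congr (by rw [hmem 8 (by simp)]) (fun i _ => by rw [hmem 10 (by simp)])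
      (fun i _ => by rw [hmem 11 (by simp)]) (fun i _ => by rw [hmem 12 (by simp)])
      (fun f hf => hval u f (by rwa [Ghost.leaves_eq hT])) hr10.ge (by rw [hrot])
      (fun f _ => by rw [hE.pos])
  · rw [htree]; exact h.disj
  · intro u
    simp only [reduceCtorEq, if_false, hwin]
    by_cases huv : u = v
    · subst huv
      rw [hg]
      refine hcore.create hC hw (h.setting fun a ha => (Option.some.inj ha).symm) h.exists_core hv
        hvt hE hz hz0 hg0 hW hreg hwz ?_ hlink rfl
      rw [hE.link z fun hz' => by have := hzold u z hz'; omega]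
      exact h.fresh z hz.ge
    · have hcu := h.core u
      rw [if_neg (by simpa using huv)] at hcu
      exact hcu.of_extends hE huv h.exists_core hz hcand hfresh (fun hu => hu)
        fun hu hnil e he heu => hnew hnil e he (heu ▸ hu)

/-- Without a winner, there is nothing to do. -/
theorem Inv.close (h : Inv w G wt t ops σ Γ D (some v)) (hg : winner σ v = 0)
    (hne : ∀ p, G.IsPath v t p → Γ.ent v ≠ []) : Inv w G wt t ops σ Γ D none where
  __ := h
  nonempty := fun u hu _ p hp => by
    by_cases huv : u = v
    · subst huv; exact hne p hp
    · exact h.nonempty u hu (by simpa using huv) p hp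
  core := fun u => by
    have := h.core u
    by_cases huv : u = v
    · subst huv
      rw [if_pos rfl] at this
      simpa [hg] using this
    · rw [if_neg (by simpa using huv)] at this
      simpa using this

end

/-! ### Enumeration of the entries of a node -/

/-- Allocate the entry for the leaf in register `13`. -/
def newEntry : Program :=
  .store 15 (.reg 11) (.reg 13) ⟫ .store 16 (.reg 11) (.cell 14 (.reg 13)) ⟫
  .wstore 1 (.reg 11) (keyExp (.reg 13)) ⟫ .assign 11 (.add (.reg 11) (.lit 1))

/-- Take a leaf from the stack and advance it. -/
def popStep : Program :=
  .assign 21 (.sub (.reg 21) (.lit 1)) ⟫ .assign 14 (.cell 19 (.reg 21)) ⟫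
  .store 14 (.reg 14) (.cell 17 (.cell 14 (.reg 14))) ⟫
  .branch (.eq (.cell 14 (.reg 14)) (.lit 0)) (.store 12 (.reg 14) (.lit 0)) .skip

/-- Append an entry for the winner to the list that ends with the entry on the stack. -/
def linkStep : Program :=
  .assign 13 (.cell 12 (.reg 14)) ⟫
  .branch (.eq (.reg 13) (.lit 0)) .skip
    (newEntry ⟫ .store 17 (.cell 18 (.reg 21)) (.sub (.reg 11) (.lit 1)))

def upStep : Program := popStep ⟫ fixup ⟫ linkStep

/-- The effect of advancing leaf `f` of node `v` with `n` rotations. -/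
structure Ghost.Step {N : ℕ} (Γ Γ' : Ghost N) (v : Fin N) (f n : ℕ) : Prop where
  edge : Γ'.edge = Γ.edge
  pos : Γ'.pos = Function.update Γ.pos f (Γ.pos f + 1)
  rot : Γ'.rot = Function.update Γ.rot v (Γ.rot v + n)
  leaves : ∀ u, (Γ'.leaves u).Perm (Γ.leaves u)
  ent : ∀ u, u ≠ v → Γ'.ent u = Γ.ent u
  prefix_ent : Γ.ent v <+: Γ'.ent v
  path : ∀ u, ∀ y ∈ Γ.ent u, Γ'.path y = Γ.path y

section
variable {W : Type u} [LinearOrder W] {w : Multiset W → W} {ops : WeightOps W} {N : ℕ}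
  {G : DAG N} {wt : Fin N × Fin N → W} {t v : Fin N} {σ τ : State W} {Γ Γ' : Ghost N}
  {D : Finset (Fin N)} {f m x : ℕ}

/-- One return of the recursion. The hypothesis `hA` says that an absent successor of the current
entry means that the head is exhausted, not merely late. The conclusion about `τ.mem 17 x` is the
same statement for `v`, as needed by the leaf that waits for `v` in turn. -/
theorem upStep_spec (hC : ops.Computes w) (hw : SubsetMonotone w)
    (h : Inv w G wt t ops σ Γ Finset.univ none) (hf : winner σ v = f) (hf0 : f ≠ 0)
    (hx : (Γ.ent v).getLast? = some x) (hm : σ.reg 21 = m + 1) (h19 : σ.mem 19 m = f)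
    (h18 : σ.mem 18 m = x)
    (hA : σ.mem 17 (σ.mem 14 f) = 0 → winner σ (Γ.head f) = 0) :
    ∃ τ Γ' n, Leads ops upStep σ τ (220 * n + 400) 4 ∧ Inv w G wt t ops τ Γ' Finset.univ none ∧
      Γ.Step Γ' v f n ∧ τ.reg 21 = m ∧ (τ.mem 17 x = 0 → winner τ v = 0) ∧
      (∀ u, u ≠ v → winner τ u = winner σ u) ∧
      (∀ i, i ≠ f → τ.mem 14 i = σ.mem 14 i) ∧ (∀ i, i ≠ x → τ.mem 17 i = σ.mem 17 i) := by
  obtain ⟨T, hT, hvt, hfT, hc⟩ := h.winner_live (by rwa [hf])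
  rw [hf] at hfT hc
  have hok := h.tree_ok v T hT
  have hfl : f ∈ Γ.leaves v := by rwa [Ghost.leaves_eq hT]
  have hcore := h.core v
  simp only [reduceCtorEq, if_false] at hcore
  have hlt := hcore.cur_mem hfl hc
  have hhead := h.core (Γ.head f)
  have hlink : σ.mem 17 (σ.mem 14 f) = (Γ.ent (Γ.head f)).getD (Γ.pos f + 1) 0 := by
    rw [hcore.cur_eq hfl hlt, hhead.link _ hlt]
  -- If the leaf moves behind the last entry of its head, then by `hA` the head has no live leaf,
  -- and so it has listed all its paths.
  have hdead : Γ.pos f + 1 = (Γ.ent (Γ.head f)).length → ∀ p, G.IsPath (Γ.head f) t p →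
      p ∈ Γ.paths (Γ.head f) := by
    intro heq p hp
    refine h.exhausted hw (by simp) (Finset.mem_univ _) (.inr rfl) (hA ?_) hp
    rw [hlink, List.getD_eq_default _ _ heq.ge]
  -- the first part
  have hL1 := Leads.exec (ops := ops) popStep (by decide) σ
  obtain ⟨σ1, hσ1⟩ : ∃ σ1, σ1 = popStep.exec ops σ := ⟨_, rfl⟩
  rw [← hσ1] at hL1
  have r21 : σ1.reg 21 = m := by
    by_cases h0 : σ.mem 17 (σ.mem 14 f) = 0 <;>
      (rw [hσ1]; simp [popStep, Program.exec, Test.Holds, Exp.eval, hm, h19, h0])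
  have r14 : σ1.reg 14 = f := by
    by_cases h0 : σ.mem 17 (σ.mem 14 f) = 0 <;>
      (rw [hσ1]; simp [popStep, Program.exec, Test.Holds, Exp.eval, hm, h19, h0])
  have m14 : σ1.mem 14 = Function.update (σ.mem 14) f (σ.mem 17 (σ.mem 14 f)) := by
    by_cases h0 : σ.mem 17 (σ.mem 14 f) = 0 <;>
      (rw [hσ1]; simp [popStep, Program.exec, Test.Holds, Exp.eval, hm, h19, h0])
  -- The leaf is its own winner as long as it is live, so only its exhaustion changes the cell.
  have m12 : σ1.mem 12 = Function.update (σ.mem 12) f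
      (if σ.mem 17 (σ.mem 14 f) = 0 then 0 else f) := by
    have hwin : σ.mem 12 f = f := by
      obtain ⟨k', -, -, -, -, hW, -⟩ := exists_ctx [] hok.rep hok.par_root hfT
      rcases hW with hW | hW
      · have := hW.2 f (by simp)
        simp [State.val, hc] at this
      · simpa using hW.2.1
    by_cases h0 : σ.mem 17 (σ.mem 14 f) = 0
    · rw [hσ1]; simp [popStep, Program.exec, Test.Holds, Exp.eval, hm, h19, h0]
    · rw [if_neg h0, Function.update_eq_self_iff.2 hwin.symm, hσ1]
      simp [popStep, Program.exec, Test.Holds, Exp.eval, hm, h19, h0]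
  have mo : ∀ a, a ≠ 12 → a ≠ 14 → σ1.mem a = σ.mem a := fun a h1 h2 =>
    hL1.frame_mem a (by simp [popStep, Program.arrays, h1, h2])
  have wo : σ1.wmem = σ.wmem := by
    funext a; exact hL1.frame_wmem a (by simp [popStep, Program.warrays])
  have v1 : ∀ i, i ≠ f → σ1.val ops i = σ.val ops i := fun i hi => by
    simp only [State.val, m14, mo 13 (by simp) (by simp), wo, Function.update_of_ne hi]
  -- the second part
  obtain ⟨k, e1, e2, e3, e4, e5, e6⟩ := exists_ctx [] hok.rep hok.par_root hfT
  simp only [Ctx.ids, Ctx.leaves, List.append_nil, Ctx.pot, Ctx.root, add_zero] at e2 e3 e4 e6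
  have hnd : (0 :: f :: k.ids).Nodup := (e2.cons 0).nodup_iff.2 hok.nodup
  have hfk : f ∉ k.ids := (List.nodup_cons.1 (List.nodup_cons.1 hnd).2).1
  have hfl' : f ∉ k.leaves := (List.nodup_cons.1 (e3.nodup_iff.2
    ((List.nodup_cons.1 hok.nodup).2.sublist T.leaves_sublist_ids))).1
  have hRT : Rep (σ1.mem 10) (σ1.mem 11) (σ1.mem 12) (σ1.val ops) (.leaf f) := by
    simp only [Rep, m12, Function.update_self]
    split
    · next h0 => exact .inl ⟨rfl, by simp [State.val, m14, h0]⟩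
    · next h0 => exact .inr ⟨hf0, by simp, by simp [State.val, m14, h0], by simp⟩
  have hRk : RepCtx (σ1.mem 10) (σ1.mem 11) (σ1.mem 12) (σ1.val ops) f k := by
    rw [mo 10 (by simp) (by simp), mo 11 (by simp) (by simp)]
    refine e1.congr (fun _ _ => rfl) (fun _ _ => rfl) (fun a ha i hi => ?_) fun i hi => ?_
    · rw [m12, Function.update_of_ne]
      rintro rfl
      exact hfk (Ctx.ids_of_mem ha hi)
    · exact v1 i (by rintro rfl; exact hfl' hi)
  obtain ⟨σ2, T', n, hL2, q1, q2, q3, q4, q5, q6, q7, q8⟩ :=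
    fixup_spec k (.leaf f) σ1 r14 hRT hRk hnd
  have p5 : T'.ids.Perm T.ids := q5.trans e2
  have mo2 : ∀ a, a ≠ 10 → a ≠ 11 → a ≠ 12 → σ2.mem a = σ1.mem a := fun a h1 h2 h3 =>
    hL2.frame_mem a (by
      simp [fixup, fixStep, rotateStep, setWin, Program.arrays, h1, h2, h3])
  have wo2 : σ2.wmem = σ1.wmem := by
    funext a
    exact hL2.frame_wmem a (by simp [show fixup.warrays = [] by decide])
  have ro : ∀ a, a ≠ 14 → a ≠ 15 → a ≠ 16 → a ≠ 17 → a ≠ 18 → a ≠ 21 → σ2.reg a = σ.reg a := by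
    intro a h1 h2 h3 h4 h5 h6
    rw [hL2.frame_reg a (by
      simp [fixup, fixStep, rotateStep, setWin, Program.regs, *]), hL1.frame_reg a (by
      simp [popStep, Program.regs, *])]
  have r21' : σ2.reg 21 = m := by rw [hL2.frame_reg 21 (by decide), r21]
  have hid : T'.id = T.id := q2.trans e4
  have hids : ∀ i, i ∉ T.ids → i ∉ f :: k.ids := fun i hi hi' => hi (e2.subset hi')
  have hadv := h.advance (τ := σ2) (T' := T') (n := n) hT hf hf0 hdead
    (fun i hi => by rw [(q7 i (hids i hi)).1, mo 10 (by simp) (by simp)])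
    (fun i hi => by rw [(q7 i (hids i hi)).2.1, mo 11 (by simp) (by simp)])
    (fun i hi => by
      rw [(q7 i (hids i hi)).2.2, m12, Function.update_of_ne]
      rintro rfl
      exact hids i hi (by simp))
    (by rw [mo2 14 (by simp) (by simp) (by simp), m14])
    (ro 10 (by simp) (by simp) (by simp) (by simp) (by simp) (by simp))
    (ro 11 (by simp) (by simp) (by simp) (by simp) (by simp) (by simp))
    (fun a ha => by rw [mo2 a (by omega) (by omega) (by omega), mo a (by omega) (by omega)])
    (wo2.trans wo)
    (by
      rw [State.val_congr (mo2 13 (by simp) (by simp) (by simp))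
        (mo2 14 (by simp) (by simp) (by simp)) wo2]
      exact q3) q4 p5 (q6.trans e3) hid
    (fun w hw => by
      have := q8 w hw
      rw [BT.mass_leaf, e6] at this
      simpa [BT.pot] using this)
  set Γ1 : Ghost N := { Γ with
    tree := Function.update Γ.tree v (some T')
    pos := Function.update Γ.pos f (Γ.pos f + 1)
    rot := Function.update Γ.rot v (Γ.rot v + n) } with hΓ1
  have hleaves : ∀ u, (Γ1.leaves u).Perm (Γ.leaves u) := by
    intro u
    by_cases huv : u = v
    · subst huv
      rw [Ghost.leaves_eq hT, Ghost.leaves_eq (T := T') (by simp [hΓ1])]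
      exact q6.trans e3
    · rw [Ghost.leaves, Ghost.leaves, hΓ1]
      simp [Function.update_of_ne huv]
  have hwin : ∀ u, u ≠ v → winner σ2 u = winner σ u := by
    intro u hu
    rw [winner, winner, mo2 8 (by simp) (by simp) (by simp), mo 8 (by simp) (by simp)]
    have hnm : σ.mem 8 u ∉ T.ids := by
      cases hTu : Γ.tree u with
      | none => rw [h.tree_none u hTu]; exact (List.nodup_cons.1 hok.nodup).1
      | some U =>
        rw [(h.tree_ok u U hTu).root]
        exact fun hi => hu (h.disj u v U T hTu hT _ U.id_mem_ids hi)
    rw [(q7 _ (hids _ hnm)).2.2, m12, Function.update_of_ne]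
    rintro heq
    exact hnm (heq ▸ TreeOk.leaf_mem_ids hfT)
  have hwinv : winner σ2 v = σ2.mem 12 (σ2.reg 14) := by
    rw [winner, mo2 8 (by simp) (by simp) (by simp), mo 8 (by simp) (by simp), hok.root, q1, hid]
  -- the third part
  have hL3 := Leads.exec (ops := ops) linkStep (by decide) σ2
  obtain ⟨σ3, hσ3⟩ : ∃ σ3, σ3 = linkStep.exec ops σ2 := ⟨_, rfl⟩
  rw [← hσ3] at hL3
  have t1 : popStep.time + linkStep.time ≤ 180 := by decide
  have g1 : popStep.growth + linkStep.growth ≤ 4 := by decide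
  have hL : Leads ops upStep σ σ3 (220 * n + 400) 4 :=
    (hL1.seq (hL2.seq hL3)).mono (by omega) (by omega)
  have r21'' : σ3.reg 21 = m := by rw [hL3.frame_reg 21 (by decide), r21']
  have hne : Γ.ent v ≠ [] := by rintro h0; simp [h0] at hx
  obtain ⟨g, hg⟩ : ∃ g, σ2.mem 12 (σ2.reg 14) = g := ⟨_, rfl⟩
  -- Without a live leaf the list of `v` is complete: no entry is made, and the node is closed
  -- again.
  by_cases hg0 : g = 0
  · have hσ3' : σ3 = { σ2 with reg := Function.update σ2.reg 13 0 } := by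
      rw [hσ3]; simp [linkStep, Program.exec, Test.Holds, Exp.eval, hg, hg0]
    have hwin3 : ∀ u : Fin N, winner σ3 u = winner σ2 u := fun u => by rw [hσ3']; rfl
    have hInv2 := hadv.close (by rw [hwinv, hg, hg0]) (fun p _ => hne)
    refine ⟨σ3, Γ1, n, hL, ?_, ⟨rfl, rfl, rfl, hleaves, fun _ _ => rfl, List.prefix_refl _,
      fun _ _ _ => rfl⟩, r21'', fun _ => ?_, fun u hu => ?_, fun i hi => ?_, fun i _ => ?_⟩
    · exact hInv2.congr_state (by rw [hσ3']; rfl) (by rw [hσ3']; rfl) (fun _ _ => by rw [hσ3'])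
        (by rw [hσ3'])
    · rw [hwin3, hwinv, hg, hg0]
    · rw [hwin3, hwin u hu]
    · rw [hσ3']
      simp only [mo2 14 (by simp) (by simp) (by simp), m14, Function.update_of_ne hi]
    · rw [hσ3']
      simp only [mo2 17 (by simp) (by simp) (by simp), mo 17 (by simp) (by simp)]
  · obtain ⟨z, hz⟩ : ∃ z, z = σ2.reg 11 := ⟨_, rfl⟩
    have x18 : σ2.mem 18 m = x := by
      rw [mo2 18 (by simp) (by simp) (by simp), mo 18 (by simp) (by simp), h18]
    have key : σ3 = linkStep.exec ops σ2 := hσ3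
    simp only [linkStep, newEntry, Program.exec, Test.Holds, Exp.eval, hg, hg0,
      Function.update_self, if_false] at key
    have k10 : σ3.reg 10 = σ2.reg 10 := hL3.frame_reg 10 (by decide)
    have k11 : σ3.reg 11 = z + 1 := by rw [key]; simp [hz]
    have k15 : σ3.mem 15 = Function.update (σ2.mem 15) z g := by rw [key]; simp [hz]
    have k16 : σ3.mem 16 = Function.update (σ2.mem 16) z (σ2.mem 14 g) := by rw [key]; simp [hz]
    have k17 : σ3.mem 17 = Function.update (σ2.mem 17) x z := by
      rw [key]; simp [hz, r21', x18]
    have kw0 : σ3.wmem 0 = σ2.wmem 0 := by rw [key]; simp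
    have kw1 : σ3.wmem 1 = Function.update (σ2.wmem 1) z (ops.combine
        (ops.single (σ2.wmem 0 (σ2.mem 13 g))) (σ2.wmem 1 (σ2.mem 14 g))) := by
      rw [key]; simp [hz, keyExp, WExp.eval, Exp.eval]
    have ko : ∀ a, a ≠ 15 → a ≠ 16 → a ≠ 17 → σ3.mem a = σ2.mem a := fun a h1 h2 h3 =>
      hL3.frame_mem a (by simp [linkStep, newEntry, Program.arrays, h1, h2, h3])
    clear key
    have hxz : x ∈ Γ.ent v := List.mem_of_getLast? hx
    have hwin3 : ∀ u : Fin N, winner σ3 u = winner σ2 u := fun u => by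
      rw [winner, winner, ko 8 (by simp) (by simp) (by simp), ko 12 (by simp) (by simp) (by simp)]
    have hgl : g ∈ Γ1.leaves v ∧ σ2.mem 14 g ≠ 0 := by
      have := hadv.winOk v
      rw [hwinv, hg] at this
      rcases this with hW | hW
      · exact absurd hW.1 hg0
      · exact ⟨hW.2.1, fun hc => hW.2.2.1 (by simp [State.val, hc])⟩
    have hzlt : ∀ u, ∀ y ∈ Γ.ent u, y < z := fun u y hy => by
      have := (hadv.core u).ent_lt y hy
      omega
    have hr11 : σ.reg 11 = z := by
      rw [hz, ro 11 (by simp) (by simp) (by simp) (by simp) (by simp) (by simp)]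
    set Γ2 : Ghost N := { Γ1 with
      ent := Function.update Γ.ent v (Γ.ent v ++ [z])
      path := Function.update Γ.path z (Γ.edge g :: Γ.path (σ2.mem 14 g)) } with hΓ2
    have hE : Extends σ2 σ3 Γ1 Γ2 v g z :=
      { mem15 := k15
        mem16 := k16
        wmem := fun i hi => by rw [kw1, Function.update_of_ne hi]
        link := fun i hi => by
          rw [k17, Function.update_of_ne]
          rintro rfl
          exact hi hxz
        ent := rfl
        path := rfl
        mem13 := ko 13 (by simp) (by simp) (by simp)
        mem14 := ko 14 (by simp) (by simp) (by simp)
        reg11 := by omega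
        edge := rfl
        pos := rfl
        leaves := rfl }
    refine ⟨σ3, Γ2, n, hL, ?_, ⟨rfl, rfl, rfl, hleaves, fun u hu => ?_, ?_, fun u y hy => ?_⟩, r21'',
      fun h0 => ?_, fun u hu => ?_, fun i hi => ?_, fun i hi => ?_⟩
    · refine hadv.create hC hw (Finset.mem_univ _) hvt (by rw [hwinv, hg]) hg0 hE hz k11 ?_ ?_
        (fun h0 => absurd h0 hne) k10
        (fun a ha => ko a (by omega) (by omega) (by omega)) kw0 rfl rfl
      · rw [kw1, Function.update_self, State.val, if_neg hgl.2]
      · intro i hi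
        have hi' : i < (Γ.ent v).length := hi
        change σ3.mem 17 (Γ.ent v)[i] = (Γ.ent v ++ [z]).getD (i + 1) 0
        rw [k17, Function.update_apply, mo2 17 (by simp) (by simp) (by simp),
          mo 17 (by simp) (by simp), hcore.link i hi']
        -- The stacked entry `x` is the last one of `v`; so writing its link appends to the list,
        -- and no other link changes.
        have hxl : x = (Γ.ent v)[(Γ.ent v).length - 1] := by
          rw [List.getLast?_eq_getElem?, List.getElem?_eq_getElem (by omega)] at hx
          exact (Option.some.inj hx).symm
        have hentnd : (Γ.ent v).Nodup := List.Nodup.of_map _ hcore.nodup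
        split
        · next heq =>
          rw [hxl] at heq
          have := (hentnd.getElem_inj_iff).1 heq
          rw [List.getD_append_right _ _ _ _ (by omega)]
          simp [show i + 1 - (Γ.ent v).length = 0 by omega]
        · next hneq =>
          have : i + 1 < (Γ.ent v).length := by
            by_contra hlt'
            have : i = (Γ.ent v).length - 1 := by omega
            subst this
            exact hneq hxl.symm
          rw [List.getD_append _ _ _ _ this]
    · rw [hΓ2]; exact Function.update_of_ne hu _ _
    · rw [hΓ2]; simp
    · rw [hΓ2]
      refine Function.update_of_ne ?_ _ _
      have := hzlt u y hy
      omega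
    · rw [k17, Function.update_self] at h0
      have := h.pos
      omega
    · rw [hwin3, hwin u hu]
    · rw [hE.mem14, mo2 14 (by simp) (by simp) (by simp), m14, Function.update_of_ne hi]
    · rw [k17, Function.update_of_ne hi, mo2 17 (by simp) (by simp) (by simp),
        mo 17 (by simp) (by simp)]

end

/-! ### Descent along the waiting leaves, and the way back -/

def upTest : Test := .neg (.eq (.reg 21) (.lit 0))

def upLoop : Program := .loop upTest upStep

/-- Put the winner of node `9` on the stack, together with the last entry of the node. -/
def downStep : Program :=
  .assign 22 (.cell 12 (.cell 8 (.reg 9))) ⟫ .store 18 (.reg 21) (.reg 20) ⟫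
  .store 19 (.reg 21) (.reg 22) ⟫ .assign 21 (.add (.reg 21) (.lit 1)) ⟫
  .assign 20 (.cell 14 (.reg 22)) ⟫ .assign 9 (.cell 1 (.cell 13 (.reg 22)))

def downTest : Test :=
  .conj (.eq (.cell 17 (.reg 20)) (.lit 0)) (.neg (.eq (.cell 12 (.cell 8 (.reg 9))) (.lit 0)))

def downLoop : Program := .loop downTest downStep

def emitStep : Program :=
  .assign 8 (.cell 13 (.cell 15 (.reg 23))) ⟫ .emit (.cell 0 (.reg 8)) ⟫ .emit (.cell 1 (.reg 8)) ⟫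
  .assign 23 (.cell 16 (.reg 23))

def emitTest : Test := .neg (.eq (.cell 15 (.reg 23)) (.lit 0))

def emitLoop : Program := .loop emitTest emitStep

/-- The stack from top to bottom: nodes with their last entries and their winners, such that each
winner waits for the entry after its current one, which is the entry above. At the bottom is the
entry `z` of `s`. -/
def Stack {W : Type u} {N : ℕ} (σ : State W) (Γ : Ghost N) (s : Fin N) (z : ℕ) :
    Fin N → ℕ → List (Fin N × ℕ × ℕ) → Prop
  | v, x, [] => v = s ∧ x = z
  | v, x, (v', x', f) :: l => σ.mem 19 l.length = f ∧ σ.mem 18 l.length = x' ∧ winner σ v' = f ∧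
      f ≠ 0 ∧ (Γ.ent v').getLast? = some x' ∧ σ.mem 14 f = x ∧ Γ.head f = v ∧
      Stack σ Γ s z v' x' l

/-- The number of advances of the leaves of a node. -/
def Ghost.adv {N : ℕ} (Γ : Ghost N) (u : Fin N) : ℕ := ((Γ.leaves u).map Γ.pos).sum

/-- No more advances than those of some leaf that leads to `u`. -/
def Ghost.Led {N : ℕ} (Γ : Ghost N) (u : Fin N) : Prop :=
  Γ.adv u = 0 ∨ ∃ v, ∃ f ∈ Γ.leaves v, Γ.head f = u ∧ Γ.adv u ≤ Γ.pos f

/-- All nodes but `s` and the top of the stack are led. -/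
def Ghost.LedBut {N : ℕ} (Γ : Ghost N) (s : Fin N) (l : List (Fin N × ℕ × ℕ)) : Prop :=
  ∀ u, u ≠ s → Γ.Led u ∨ ∃ a ∈ l.head?, Γ.head a.2.2 = u ∧ Γ.adv u ≤ Γ.pos a.2.2 + 1

section
variable {W : Type u} [LinearOrder W] {w : Multiset W → W} {ops : WeightOps W} {N : ℕ}
  {G : DAG N} {wt : Fin N × Fin N → W} {s t v : Fin N} {σ τ : State W} {Γ Γ' : Ghost N}
  {D : Finset (Fin N)} {f m x z : ℕ} {l : List (Fin N × ℕ × ℕ)}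

theorem Inv.core' (h : Inv w G wt t ops σ Γ D none) (v : Fin N) :
    Core w G wt t σ Γ D v (winner σ v) := by
  simpa using h.core v

theorem Inv.leaves_nodup {x : Option (Fin N)} (h : Inv w G wt t ops σ Γ D x) (v : Fin N) :
    (Γ.leaves v).Nodup := by
  cases hT : Γ.tree v with
  | none => simp [Ghost.leaves_none hT]
  | some T =>
    rw [Ghost.leaves_eq hT]
    exact (List.nodup_cons.1 (h.tree_ok v T hT).nodup).2.sublist T.leaves_sublist_ids

theorem Inv.winner_leaf {x : Option (Fin N)} (h : Inv w G wt t ops σ Γ D x)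
    (h0 : winner σ v ≠ 0) : v ≠ t ∧ winner σ v ∈ Γ.leaves v ∧ σ.mem 14 (winner σ v) ≠ 0 := by
  obtain ⟨T, hT, h1, h2, h3⟩ := h.winner_live h0
  exact ⟨h1, by rwa [Ghost.leaves_eq hT], h3⟩

theorem Inv.ent_nodup {x : Option (Fin N)} (h : Inv w G wt t ops σ Γ D x) (v : Fin N) :
    (Γ.ent v).Nodup := List.Nodup.of_map _ (h.core v).nodup

/-- An entry without successor is the last one. -/
theorem Inv.getLast?_eq {o : Option (Fin N)} (h : Inv w G wt t ops σ Γ D o) (hx : x ∈ Γ.ent v)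
    (h0 : σ.mem 17 x = 0) : (Γ.ent v).getLast? = some x := by
  obtain ⟨i, hi, rfl⟩ := List.getElem_of_mem hx
  rw [(h.core v).link i hi] at h0
  have : i + 1 = (Γ.ent v).length := by
    by_contra hne
    rw [List.getD_eq_getElem _ _ (by omega)] at h0
    exact (h.core v).ent_ne _ (List.getElem_mem _) h0
  rw [List.getLast?_eq_getElem?, ← this]
  simp

/-- The edges of the waiting leaves lead from `s` to the top. Hence the stack cannot be higher than
`ℓ`, nor contain a node twice. -/
theorem Stack.exists_path (h : Inv w G wt t ops σ Γ D none) (hS : Stack σ Γ s z v x l) :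
    ∃ p, G.IsPath s v p ∧ p.length = l.length := by
  induction l generalizing v x with
  | nil => exact ⟨[], hS.1.symm, rfl⟩
  | cons a l ih =>
    obtain ⟨v', x', f⟩ := a
    obtain ⟨-, -, h3, h4, -, -, h7, h8⟩ := hS
    obtain ⟨p, hp, hl⟩ := ih h8
    obtain ⟨-, k1, -⟩ := h.winner_leaf (by rwa [h3])
    rw [h3] at k1
    refine ⟨p ++ [Γ.edge f], hp.append ⟨?_, (h.core' v').leaf_own f k1, h7⟩, by simp [hl]⟩
    exact List.mem_of_getElem? ((h.core' v').leaf_edge f k1)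

/-- The nodes on the stack are not the top node. -/
theorem Stack.ne (h : Inv w G wt t ops σ Γ D none) (hS : Stack σ Γ s z v x l) :
    ∀ a ∈ l, a.1 ≠ v := by
  suffices ∀ a ∈ l, ∃ p, p ≠ [] ∧ G.IsPath a.1 v p by
    intro a ha heq
    obtain ⟨p, hp, hp'⟩ := this a ha
    exact hp (heq ▸ hp' : G.IsPath v v p).eq_nil
  induction l generalizing v x with
  | nil => simp
  | cons b l ih =>
    obtain ⟨v', x', f⟩ := b
    obtain ⟨-, -, h3, h4, -, -, h7, h8⟩ := hS
    obtain ⟨-, k1, -⟩ := h.winner_leaf (by rwa [h3])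
    rw [h3] at k1
    have he : G.IsPath v' v [Γ.edge f] :=
      ⟨List.mem_of_getElem? ((h.core' v').leaf_edge f k1), (h.core' v').leaf_own f k1, h7⟩
    intro a ha
    rcases List.mem_cons.1 ha with rfl | ha
    · exact ⟨_, by simp, he⟩
    · obtain ⟨p, hp, hp'⟩ := ih h8 a ha
      exact ⟨_, by simp, hp'.append he⟩

/-- The stack below the top is not affected by changes at the top. -/
theorem Stack.congr (hS : Stack σ Γ s z v x l) (h18 : τ.mem 18 = σ.mem 18)
    (h19 : τ.mem 19 = σ.mem 19) (hw : ∀ a ∈ l, winner τ a.1 = winner σ a.1)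
    (he : ∀ a ∈ l, Γ'.ent a.1 = Γ.ent a.1) (h14 : ∀ a ∈ l, τ.mem 14 a.2.2 = σ.mem 14 a.2.2)
    (hed : Γ'.edge = Γ.edge) : Stack τ Γ' s z v x l := by
  induction l generalizing v x with
  | nil => exact hS
  | cons b l ih =>
    obtain ⟨v', x', f⟩ := b
    obtain ⟨h1, h2, h3, h4, h5, h6, h7, h8⟩ := hS
    have hb : (v', x', f) ∈ (v', x', f) :: l := by simp
    refine ⟨by rw [h19, h1], by rw [h18, h2], by rw [hw _ hb, h3], h4, by rw [he _ hb, h5],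
      by rw [h14 _ hb, h6], by rw [Ghost.head, hed]; exact h7, ih h8 ?_ ?_ ?_⟩
    · exact fun a ha => hw a (by simp [ha])
    · exact fun a ha => he a (by simp [ha])
    · exact fun a ha => h14 a (by simp [ha])

theorem Stack.winner_eq (hS : Stack σ Γ s z v x l) : ∀ a ∈ l, winner σ a.1 = a.2.2 ∧ a.2.2 ≠ 0 := by
  induction l generalizing v x with
  | nil => simp
  | cons b l ih =>
    obtain ⟨v', x', f⟩ := b
    obtain ⟨h1, h2, h3, h4, h5, h6, h7, h8⟩ := hS
    intro a ha
    rcases List.mem_cons.1 ha with rfl | ha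
    exacts [⟨h3, h4⟩, ih h8 a ha]

theorem Ghost.Step.head {n : ℕ} (hs : Γ.Step Γ' v f n) : Γ'.head = Γ.head := by
  funext g; simp [Ghost.head, hs.edge]

theorem Ghost.Step.adv_self {n : ℕ} (hs : Γ.Step Γ' v f n) (hf : f ∈ Γ.leaves v)
    (hn : (Γ.leaves v).Nodup) : Γ'.adv v = Γ.adv v + 1 := by
  have h1 := List.perm_cons_erase hf
  rw [Ghost.adv, Ghost.adv, ((hs.leaves v).map _).sum_eq, (h1.map _).sum_eq,
    (h1.map Γ.pos).sum_eq, List.map_cons, List.map_cons, List.sum_cons, List.sum_cons, hs.pos,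
    Function.update_self]
  rw [List.map_congr_left (g := Γ.pos) fun y hy => Function.update_of_ne (by
    rintro rfl
    exact hn.not_mem_erase hy) _ _]
  omega

theorem Ghost.Step.adv_of_ne {n : ℕ} (hs : Γ.Step Γ' v f n) {u : Fin N} (hf : f ∉ Γ.leaves u) :
    Γ'.adv u = Γ.adv u := by
  rw [Ghost.adv, Ghost.adv, ((hs.leaves u).map _).sum_eq, hs.pos]
  rw [List.map_congr_left (g := Γ.pos) fun y hy => Function.update_of_ne (by
    rintro rfl
    exact hf hy) _ _]

theorem Ghost.Step.pos_le {n : ℕ} (hs : Γ.Step Γ' v f n) (i : ℕ) : Γ.pos i ≤ Γ'.pos i := by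
  rw [hs.pos, Function.update_apply]
  split
  · next h => rw [h]; omega
  · exact le_rfl

theorem Ghost.Step.sum_rot {n : ℕ} (hs : Γ.Step Γ' v f n) :
    ∑ u, Γ'.rot u = ∑ u, Γ.rot u + n := by
  rw [hs.rot, ← Finset.add_sum_erase _ _ (Finset.mem_univ v),
    ← Finset.add_sum_erase _ Γ.rot (Finset.mem_univ v), Function.update_self]
  rw [Finset.sum_congr rfl fun u hu => Function.update_of_ne (Finset.ne_of_mem_erase hu) _ _]
  omega

theorem Inv.leaves_disjoint {o : Option (Fin N)} (h : Inv w G wt t ops σ Γ D o) {u : Fin N}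
    (hf : f ∈ Γ.leaves v) (huv : u ≠ v) : f ∉ Γ.leaves u := fun hf' =>
  huv (((h.core u).leaf_own f hf').symm.trans ((h.core v).leaf_own f hf))

/-- What the loops on the stack leave alone. -/
structure Ghost.Later {N : ℕ} (Γ Γ' : Ghost N) : Prop where
  prefix_ent : ∀ u, Γ.ent u <+: Γ'.ent u
  path : ∀ u, ∀ y ∈ Γ.ent u, Γ'.path y = Γ.path y

/-- Each pass advances one leaf of one node, so the stack's height is the number of new advances.
The rotations are left in the time bound as a difference of totals, since they can be bounded only
over the whole run. -/
theorem upLoop_spec (hC : ops.Computes w) (hw : SubsetMonotone w) {K : ℕ}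
    (h : Inv w G wt t ops σ Γ Finset.univ none) (hS : Stack σ Γ s z v x l)
    (hl : σ.reg 21 = l.length) (hA : σ.mem 17 x = 0 → winner σ v = 0)
    (hled : Γ.LedBut s l) (hK : Γ.adv s ≤ K + if l = [] then 1 else 0) :
    ∃ τ Γ', Leads ops upLoop σ τ
        (220 * (∑ u, Γ'.rot u - ∑ u, Γ.rot u) + 410 * l.length + 10) (5 * l.length) ∧
      Inv w G wt t ops τ Γ' Finset.univ none ∧ Γ.Later Γ' ∧ ∑ u, Γ.rot u ≤ ∑ u, Γ'.rot u ∧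
      ∑ u, Γ'.adv u = ∑ u, Γ.adv u + l.length ∧ (∀ u, u ≠ s → Γ'.Led u) ∧ Γ'.adv s ≤ K + 1 ∧
      (τ.mem 17 z = 0 → winner τ s = 0) := by
  have hlin : upTest.linear = true := by decide
  have hcost : upTest.cost = 4 := by decide
  have hgrow : upTest.growth = 0 := by decide
  induction l generalizing σ Γ v x with
  | nil =>
    obtain ⟨rfl, rfl⟩ := hS
    refine ⟨σ, Γ, (Leads.loop_false ?_ hlin).mono (by rw [hcost]; omega) (by rw [hgrow]; omega), h,
      ⟨fun _ => List.prefix_refl _, fun _ _ _ => rfl⟩, le_rfl, rfl, fun u hu => ?_, by simpa using hK,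
      hA⟩
    · simp [upTest, Test.Holds, Exp.eval, hl]
    · simpa using hled u hu
  | cons a l ih =>
    obtain ⟨v', x', f⟩ := a
    have hS' := hS
    obtain ⟨h1, h2, h3, h4, h5, h6, h7, h8⟩ := hS
    subst h6 h7
    obtain ⟨hvt, hfl, hfc⟩ := h.winner_leaf (by rwa [h3])
    rw [h3] at hfl hfc
    obtain ⟨τ, Γ', n, hL, hI, hst, k1, k2, k3, k4, k5⟩ := upStep_spec hC hw h h3 h4 h5
      (by simpa using hl) h1 h2 hA
    have hne := Stack.ne h h8
    have hS1 : Stack τ Γ' s z v' x' l := by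
      refine h8.congr (hL.frame_mem 18 (by decide)) (hL.frame_mem 19 (by decide)) (fun a ha => ?_)
        (fun a ha => ?_) (fun a ha => ?_) hst.edge
      · exact k3 _ (hne a ha)
      · exact hst.ent _ (hne a ha)
      · refine k4 _ ?_
        rintro heq
        obtain ⟨q1, q2⟩ := h8.winner_eq a ha
        have := (h.winner_leaf (v := a.1) (by rw [q1]; exact q2)).2.1
        rw [q1, heq] at this
        exact h.leaves_disjoint hfl (hne a ha) this
    have hheadne : Γ.head f ≠ v' := fun heq =>
      G.head_ne (List.mem_of_getElem? ((h.core' v').leaf_edge f hfl))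
        ((h.core' v').leaf_own f hfl) heq
    -- The node that has just advanced may be one ahead of the leaf that waits for it, and that leaf
    -- is the next to advance; the node that was ahead before is led again, by `f`.
    have hled' : Γ'.LedBut s l := by
      intro u hu
      by_cases huv : u = v'
      · subst huv
        cases l with
        | nil => exact absurd h8.1 hu
        | cons b l =>
          obtain ⟨v'', x'', f'⟩ := b
          right
          refine ⟨(v'', x'', f'), by simp, ?_⟩
          obtain ⟨g1, g2, g3, g4, g5, g6, g7, g8⟩ := h8
          have hst' := hst.head
          refine ⟨by rw [hst', g7], ?_⟩
          rw [hst.adv_self hfl (h.leaves_nodup u)]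
          refine Nat.add_le_add_right (le_trans ?_ (hst.pos_le f')) 1
          obtain ⟨-, gl, gc⟩ := h.winner_leaf (v := v'') (by rwa [g3])
          rw [g3] at gl gc
          have hlt := (h.core' v'').cur_mem gl gc
          have hcur := (h.core' v'').cur_eq gl hlt
          simp only [g7, g6] at hlt hcur
          rw [List.getLast?_eq_getElem?, List.getElem?_eq_getElem (by omega), Option.some.injEq,
            hcur, (h.ent_nodup u).getElem_inj_iff] at h5
          -- Before the step `u` has one entry more than advances, and `f'` stands at the last
          -- entry; so the advances of `u` equalled `Γ.pos f'`.
          have hcount := (h.core' u).count hvt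
          rw [h3, if_neg h4] at hcount
          rw [Ghost.adv]
          omega
      · have hfu : f ∉ Γ.leaves u := h.leaves_disjoint hfl huv
        left
        rcases hled u hu with (h0 | ⟨v₁, f₁, hf₁, hh, hle⟩) | ⟨a, ha, hh, hle⟩
        · exact .inl ((hst.adv_of_ne hfu).trans h0)
        · exact .inr ⟨v₁, f₁, (hst.leaves v₁).mem_iff.2 hf₁, by rw [hst.head, hh], by
            rw [hst.adv_of_ne hfu]; exact hle.trans (hst.pos_le f₁)⟩
        · simp only [List.head?_cons, Option.mem_def, Option.some.injEq] at ha
          subst ha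
          refine .inr ⟨v', f, (hst.leaves v').mem_iff.2 hfl, by rw [hst.head]; exact hh, ?_⟩
          rw [hst.adv_of_ne hfu, hst.pos, Function.update_self]
          exact hle
    -- By acyclicity `s` occurs only at the bottom of the stack, so it advances in the last pass
    -- only.
    have hK' : Γ'.adv s ≤ K + if l = [] then 1 else 0 := by
      simp only [reduceCtorEq, if_false, add_zero] at hK
      by_cases hl0 : l = []
      · subst hl0
        obtain ⟨rfl, -⟩ := h8
        rw [hst.adv_self hfl (h.leaves_nodup _)]
        simpa using hK
      · have hsv : s ≠ v' := by
          rintro rfl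
          obtain ⟨p, hp, hpl⟩ := Stack.exists_path h h8
          rw [hp.eq_nil] at hpl
          exact hl0 (List.length_eq_zero_iff.1 hpl.symm)
        rw [hst.adv_of_ne (h.leaves_disjoint hfl hsv)]
        omega
    obtain ⟨υ, Γ'', r1, r2, r3, r4, r5, r6, r7, r8⟩ := ih hI hS1 k1 k2 hled' hK'
    have hrot := hst.sum_rot
    refine ⟨υ, Γ'', (Leads.loop_true ?_ hlin hL r1).mono ?_ ?_, r2, ⟨fun u => ?_, fun u y hy => ?_⟩,
      by omega, ?_, r6, r7, r8⟩
    · simp [upTest, Test.Holds, Exp.eval, hl]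
    · simp only [List.length_cons]; omega
    · simp only [List.length_cons]; omega
    · refine List.IsPrefix.trans ?_ (r3.prefix_ent u)
      by_cases huv : u = v'
      · subst huv; exact hst.prefix_ent
      · rw [hst.ent u huv]
    · have hmem : y ∈ Γ'.ent u := by
        by_cases huv : u = v'
        · subst huv; exact hst.prefix_ent.subset hy
        · rwa [hst.ent u huv]
      rw [r3.path u y hmem, hst.path u y hy]
    · rw [r5]
      have : ∑ u, Γ'.adv u = ∑ u, Γ.adv u + 1 := by
        rw [← Finset.add_sum_erase _ _ (Finset.mem_univ v'),
          ← Finset.add_sum_erase _ Γ.adv (Finset.mem_univ v'),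
          hst.adv_self hfl (h.leaves_nodup _)]
        rw [Finset.sum_congr rfl fun u hu =>
          hst.adv_of_ne (h.leaves_disjoint hfl (Finset.ne_of_mem_erase hu))]
        omega
      rw [this]
      simp only [List.length_cons]
      omega

/-- The stacked edges, followed by the path of the entry `x` at the top, form an `s`–`t` path; so
there are at most `ℓ` passes. At the end either `x` has a successor or its node is exhausted, which
is what the way back requires. -/
theorem downLoop_spec {ℓ : ℕ} (hℓ : ∀ p, G.IsPath s t p → p.length ≤ ℓ)
    (h : Inv w G wt t ops σ Γ D none) (hs : σ.reg 9 = s) (hz : σ.reg 20 = z) (hzs : z ∈ Γ.ent s)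
    (h21 : σ.reg 21 = 0) :
    ∃ τ v x l, Leads ops downLoop σ τ (40 * ℓ + 15) (2 * ℓ) ∧ Inv w G wt t ops τ Γ D none ∧
      Stack τ Γ s z v x l ∧ τ.reg 21 = l.length ∧ l.length ≤ ℓ ∧
      (τ.mem 17 x = 0 → winner τ v = 0) := by
  have hlin : downTest.linear = true := by decide
  have hcost : downTest.cost = 11 := by decide
  have hgrow : downTest.growth = 0 := by decide
  have htime : downStep.time ≤ 25 := by decide
  have hgr : downStep.growth ≤ 2 := by decide
  have hlen : ∀ (σ : State W) (v : Fin N) (x : ℕ) (l : List (Fin N × ℕ × ℕ)),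
      Inv w G wt t ops σ Γ D none → Stack σ Γ s z v x l → x ∈ Γ.ent v → l.length ≤ ℓ := by
    intro σ v x l hI hS hx
    obtain ⟨p, hp, hpl⟩ := Stack.exists_path hI hS
    have := hℓ _ (hp.append ((hI.core' v).isPath x hx))
    rw [List.length_append] at this
    omega
  -- Here `n` is an upper bound for the number of further edges that can be stacked.
  have main : ∀ (n : ℕ) (σ : State W) (v : Fin N) (x : ℕ) (l : List (Fin N × ℕ × ℕ)),
      Inv w G wt t ops σ Γ D none → Stack σ Γ s z v x l → x ∈ Γ.ent v → σ.reg 9 = v →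
      σ.reg 20 = x → σ.reg 21 = l.length → ℓ ≤ l.length + n →
      ∃ τ v x l, Leads ops downLoop σ τ (40 * n + 15) (2 * n) ∧ Inv w G wt t ops τ Γ D none ∧
        Stack τ Γ s z v x l ∧ τ.reg 21 = l.length ∧ l.length ≤ ℓ ∧
        (τ.mem 17 x = 0 → winner τ v = 0) := by
    intro n
    induction n with
    | zero =>
      intro σ v x l hI hS hx h9 h20 h21 hn
      -- A live winner would mean `v ≠ t`, so that the path of `x` is not empty; together with the
      -- `ℓ` stacked edges it would be too long.
      have hfinal : σ.mem 17 x = 0 → winner σ v = 0 := by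
        intro h0
        by_contra hw0
        obtain ⟨k1, k2, k3⟩ := hI.winner_leaf hw0
        have hlt := (hI.core' v).cur_mem k2 k3
        obtain ⟨p, hp, hpl⟩ := Stack.exists_path hI hS
        have := hℓ _ (hp.append ((hI.core' v).isPath x hx))
        obtain ⟨q1, q2, q3⟩ := (hI.core' v).sub k1 x hx
        rw [q2] at this
        simp only [List.length_append, List.length_cons] at this
        omega
      refine ⟨σ, v, x, l, (Leads.loop_false ?_ hlin).mono (by rw [hcost]; omega) (by rw [hgrow]),
        hI, hS, h21, hlen σ v x l hI hS hx, hfinal⟩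
      simpa [downTest, Test.Holds, Exp.eval, winner, h9, h20] using hfinal
    | succ n ih =>
      intro σ v x l hI hS hx h9 h20 h21 hn
      by_cases hfinal : σ.mem 17 x = 0 → winner σ v = 0
      · refine ⟨σ, v, x, l, (Leads.loop_false ?_ hlin).mono (by rw [hcost]; omega)
          (by rw [hgrow]; omega), hI, hS, h21, hlen σ v x l hI hS hx, hfinal⟩
        simpa [downTest, Test.Holds, Exp.eval, winner, h9, h20] using hfinal
      · push Not at hfinal
        obtain ⟨h0, hw0⟩ := hfinal
        obtain ⟨k1, k2, k3⟩ := hI.winner_leaf hw0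
        have hlt := (hI.core' v).cur_mem k2 k3
        have hcur := (hI.core' v).cur_eq k2 hlt
        have hL := Leads.exec (ops := ops) downStep (by decide) σ
        obtain ⟨υ, hυ⟩ : ∃ υ, υ = downStep.exec ops σ := ⟨_, rfl⟩
        rw [← hυ] at hL
        have hf : σ.mem 12 (σ.mem 8 v) = winner σ v := rfl
        have e9 : υ.reg 9 = Γ.head (winner σ v) := by
          rw [hυ]
          simp only [downStep, Program.exec, Exp.eval]
          simp [h9, hf, Ghost.head, hI.dst_eq _ _ ((hI.core' v).leaf_edge _ k2)]
        have e20 : υ.reg 20 = σ.mem 14 (winner σ v) := by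
          rw [hυ]; simp [downStep, Program.exec, Exp.eval, h9, hf]
        have e21 : υ.reg 21 = l.length + 1 := by
          rw [hυ]; simp [downStep, Program.exec, Exp.eval, h21]
        have e18 : υ.mem 18 = Function.update (σ.mem 18) l.length x := by
          rw [hυ]; simp [downStep, Program.exec, Exp.eval, h21, h20]
        have e19 : υ.mem 19 = Function.update (σ.mem 19) l.length (winner σ v) := by
          rw [hυ]; simp [downStep, Program.exec, Exp.eval, h21, h9, hf]
        have em : ∀ a, a ≠ 18 → a ≠ 19 → υ.mem a = σ.mem a := fun a q1 q2 =>
          hL.frame_mem a (by simp [downStep, Program.arrays, q1, q2])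
        have ew : ∀ u : Fin N, winner υ u = winner σ u := fun u => by
          rw [winner, winner, em 8 (by simp) (by simp), em 12 (by simp) (by simp)]
        have hI' : Inv w G wt t ops υ Γ D none := hI.congr_state (hL.frame_reg 10 (by decide))
          (hL.frame_reg 11 (by decide)) (fun a ha => em a (by omega) (by omega))
          (by funext a; exact hL.frame_wmem a (by simp [downStep, Program.warrays]))
        -- Pushing writes only to cells above all those that hold the present stack.
        have hstk : ∀ (l' : List (Fin N × ℕ × ℕ)) v' x', l'.length ≤ l.length →
            Stack σ Γ s z v' x' l' → Stack υ Γ s z v' x' l' := by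
          intro l'
          induction l' with
          | nil => exact fun v' x' _ hS => hS
          | cons b l' ih =>
            obtain ⟨v₁, x₁, f₁⟩ := b
            rintro v' x' hle ⟨g1, g2, g3, g4, g5, g6, g7, g8⟩
            simp only [List.length_cons] at hle
            refine ⟨?_, ?_, by rw [ew, g3], g4, g5, by rw [em 14 (by simp) (by simp), g6], g7,
              ih _ _ (by omega) g8⟩
            · rw [e19, Function.update_of_ne (by omega), g1]
            · rw [e18, Function.update_of_ne (by omega), g2]
        have hS' : Stack υ Γ s z (Γ.head (winner σ v)) (σ.mem 14 (winner σ v))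
            ((v, x, winner σ v) :: l) := by
          refine ⟨by rw [e19, Function.update_self], by rw [e18, Function.update_self], ew v, hw0,
            hI.getLast?_eq hx h0, by rw [em 14 (by simp) (by simp)], rfl, hstk l v x le_rfl hS⟩
        obtain ⟨τ, v', x', l', r1, r2⟩ := ih υ _ _ _ hI' hS'
          (by rw [hcur]; exact List.getElem_mem hlt) e9 e20 (by simpa using e21)
          (by simp only [List.length_cons]; omega)
        refine ⟨τ, v', x', l', (Leads.loop_true ?_ hlin hL r1).mono (by omega) (by omega), r2⟩
        simpa [downTest, Test.Holds, Exp.eval, winner, h9, h20, h0] using hw0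
  obtain ⟨τ, v, x, l, r⟩ := main ℓ σ s z [] h ⟨rfl, rfl⟩ hzs hs hz (by simpa using h21) (by simp)
  exact ⟨τ, v, x, l, r⟩

/-- A path is unfolded along its chain of entries, each giving its first edge by its leaf. The chain
ends at the entry of `t`, whose leaf is `0`. -/
theorem emitLoop_spec (h : Inv w G wt t ops σ Γ D none) {u : Fin N} {y : ℕ} (hy : y ∈ Γ.ent u)
    (h23 : σ.reg 23 = y) :
    ∃ τ, Leads ops emitLoop σ τ (30 * (Γ.path y).length + 10) 0 ∧
      τ.out = σ.out ++ encodePath (Γ.path y) := by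
  have hlin : emitTest.linear = true := by decide
  have hcost : emitTest.cost = 5 := by decide
  have hgrow : emitTest.growth = 0 := by decide
  have htime : emitStep.time ≤ 20 := by decide
  have hgr : emitStep.growth = 0 := by decide
  generalize hp : Γ.path y = p
  induction p generalizing σ u y with
  | nil =>
    have hut : u = t := by
      have := (h.core' u).isPath y hy
      rw [hp] at this
      exact this
    refine ⟨σ, (Leads.loop_false ?_ hlin).mono (by rw [hcost]; omega) (by rw [hgrow]), by
      simp [encodePath]⟩
    subst hut
    simp [emitTest, Test.Holds, Exp.eval, h23, h.t_leaf y hy]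
  | cons e p ih =>
    have hut : u ≠ t := by
      rintro rfl
      have := ((h.core' u).isPath y hy).eq_nil
      rw [hp] at this
      exact absurd this (by simp)
    obtain ⟨k1, k2, k3⟩ := (h.core' u).sub hut y hy
    rw [hp] at k2
    obtain ⟨he, hq⟩ := List.cons.inj k2
    have hle := (h.core' u).leaf_edge _ k1
    rw [← he] at hle
    have hL := Leads.exec (ops := ops) emitStep (by decide) σ
    obtain ⟨υ, hυ⟩ : ∃ υ, υ = emitStep.exec ops σ := ⟨_, rfl⟩
    rw [← hυ] at hL
    have e23 : υ.reg 23 = σ.mem 16 y := by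
      rw [hυ]; simp [emitStep, Program.exec, Exp.eval, h23]
    have eo : υ.out = σ.out ++ [e.1.val, e.2.val] := by
      rw [hυ]
      simp [emitStep, Program.exec, Exp.eval, h23, h.src_eq _ _ hle, h.dst_eq _ _ hle]
    have hI' : Inv w G wt t ops υ Γ D none := h.congr_state (hL.frame_reg 10 (by decide))
      (hL.frame_reg 11 (by decide))
      (fun a ha => hL.frame_mem a (by simp [emitStep, Program.arrays]))
      (by funext a; exact hL.frame_wmem a (by simp [emitStep, Program.warrays]))
    obtain ⟨τ, r1, r2⟩ := ih hI' k3 e23 hq.symm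
    refine ⟨τ, (Leads.loop_true ?_ hlin hL r1).mono (by rw [hcost, List.length_cons]; omega)
      (by rw [hgr, hgrow]), ?_⟩
    · have := (h.core' u).leaf_ne _ k1
      simpa [emitTest, Test.Holds, Exp.eval, h23] using this
    · rw [r2, eo]
      simp [encodePath]

end

/-! ### Enumeration -/

/-- Write the path of the entry in register `19`. -/
def writePath : Program := .assign 23 (.reg 19) ⟫ emitLoop

def restart : Program := .assign 20 (.reg 19) ⟫ .assign 9 (.reg 2) ⟫ .assign 21 (.lit 0)

/-- Replace the entry of `s` in register `19` by the next one. -/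
def nextEntry : Program := restart ⟫ downLoop ⟫ upLoop ⟫ .assign 19 (.cell 17 (.reg 19))

def enumTest : Test := .neg (.eq (.reg 19) (.lit 0))

def enumBody : Program := writePath ⟫ .deliver ⟫ nextEntry

def enumLoop : Program := .loop enumTest enumBody

/-- The ghosts after `K` answers have been delivered. -/
structure Ghost.Spent {N : ℕ} (Γ : Ghost N) (s : Fin N) (ℓ K : ℕ) : Prop where
  total : ∑ u, Γ.adv u ≤ K * ℓ
  source : Γ.adv s ≤ K
  led : ∀ u, u ≠ s → Γ.Led u

/-- The state after `K` answers have been delivered, where `T` and `B` bound the time and the space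
of the preprocessing, and `R k` bounds the number of rotations until answer `k`. -/
structure Enumerating {W : Type u} [LinearOrder W] {N : ℕ} (w : Multiset W → W) (G : DAG N)
    (wt : Fin N × Fin N → W) (s t : Fin N) (ops : WeightOps W) (ℓ T B : ℕ) (R : ℕ → ℕ)
    (K : ℕ) (σ : State W) (Γ : Ghost N) : Prop where
  inv : Inv w G wt t ops σ Γ Finset.univ none
  spent : Γ.Spent s ℓ K
  source : σ.reg 2 = s
  out : σ.out = []
  cur : σ.reg 19 = (Γ.ent s).getD K 0
  le : K ≤ (Γ.ent s).length
  final : σ.reg 19 = 0 → winner σ s = 0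
  words : σ.answers.map Answer.word = ((Γ.paths s).take K).map encodePath
  clock : σ.clock ≤ T + K * (500 * (ℓ + 1)) + 220 * ∑ u, Γ.rot u
  bounded : σ.Bounded (B + K * (7 * ℓ))
  time : ∀ k (h : k < σ.answers.length),
    (σ.answers[k]).time ≤ T + (k + 1) * (500 * (ℓ + 1)) + 220 * R (k + 1)
  space : ∀ k (h : k < σ.answers.length), (σ.answers[k]).space ≤ B + k * (7 * ℓ)

section
variable {W : Type u} [LinearOrder W] {w : Multiset W → W} {ops : WeightOps W} {N : ℕ}
  {G : DAG N} {wt : Fin N × Fin N → W} {s t : Fin N} {σ : State W} {Γ : Ghost N}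
  {ℓ T B K z : ℕ} {R : ℕ → ℕ}

/-- The round makes at most `ℓ` advances in all and at most one at `s`; so it preserves
`Ghost.Spent`, on which the bound on rotations rests. -/
theorem nextEntry_spec (hC : ops.Computes w) (hw : SubsetMonotone w)
    (hℓ : ∀ p, G.IsPath s t p → p.length ≤ ℓ)
    (h : Inv w G wt t ops σ Γ Finset.univ none) (hsp : Γ.Spent s ℓ K) (h2 : σ.reg 2 = s)
    (h19 : σ.reg 19 = z) (hz : z ∈ Γ.ent s) :
    ∃ τ Γ', Leads ops nextEntry σ τ
        (220 * (∑ u, Γ'.rot u - ∑ u, Γ.rot u) + 450 * ℓ + 50) (7 * ℓ) ∧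
      Inv w G wt t ops τ Γ' Finset.univ none ∧ Γ.Later Γ' ∧ ∑ u, Γ.rot u ≤ ∑ u, Γ'.rot u ∧
      Γ'.Spent s ℓ (K + 1) ∧ τ.reg 2 = s ∧ τ.reg 19 = τ.mem 17 z ∧
      (τ.reg 19 = 0 → winner τ s = 0) := by
  have hL1 := Leads.exec (ops := ops) restart (by decide) σ
  obtain ⟨σ1, hσ1⟩ : ∃ σ1, σ1 = restart.exec ops σ := ⟨_, rfl⟩
  rw [← hσ1] at hL1
  have r9 : σ1.reg 9 = s := by rw [hσ1]; simp [restart, Program.exec, Exp.eval, h2]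
  have r20 : σ1.reg 20 = z := by rw [hσ1]; simp [restart, Program.exec, Exp.eval, h19]
  have r21 : σ1.reg 21 = 0 := by rw [hσ1]; simp [restart, Program.exec, Exp.eval]
  have hI1 : Inv w G wt t ops σ1 Γ Finset.univ none := h.congr_state (hL1.frame_reg 10 (by decide))
    (hL1.frame_reg 11 (by decide)) (fun a _ => hL1.frame_mem a (by simp [restart, Program.arrays]))
    (by funext a; exact hL1.frame_wmem a (by simp [restart, Program.warrays]))
  obtain ⟨σ2, v, x, l, hL2, hI2, hS, k1, k2, k3⟩ := downLoop_spec hℓ hI1 r9 r20 hz r21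
  obtain ⟨σ3, Γ', hL3, hI3, q1, q2, q3, q4, q5, q6⟩ := upLoop_spec hC hw (K := K) hI2 hS k1 k3
    (fun u hu => .inl (hsp.led u hu)) (by have := hsp.source; omega)
  have hL4 := Leads.exec (ops := ops) (.assign 19 (.cell 17 (.reg 19))) (by decide) σ3
  obtain ⟨σ4, hσ4⟩ : ∃ σ4, σ4 = (Program.assign 19 (.cell 17 (.reg 19))).exec ops σ3 := ⟨_, rfl⟩
  rw [← hσ4] at hL4
  have e3 : σ3.reg 19 = z := by
    rw [hL3.frame_reg 19 (by decide), hL2.frame_reg 19 (by decide), hL1.frame_reg 19 (by decide),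
      h19]
  have e4 : σ4.reg 19 = σ3.mem 17 z := by rw [hσ4]; simp [Program.exec, Exp.eval, e3]
  have m4 : ∀ a, σ4.mem a = σ3.mem a := fun a => hL4.frame_mem a (by simp [Program.arrays])
  have t1 : restart.time ≤ 20 := by decide
  have g1 : restart.growth = 0 := by decide
  have t4 : (Program.assign 19 (.cell 17 (.reg 19))).time ≤ 5 := by decide
  have g4 : (Program.assign 19 (.cell 17 (.reg 19))).growth = 0 := by decide
  refine ⟨σ4, Γ', (hL1.seq (hL2.seq (hL3.seq hL4))).mono (by omega) (by omega),
    hI3.congr_state (hL4.frame_reg 10 (by decide)) (hL4.frame_reg 11 (by decide)) (fun a _ => m4 a)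
      (by funext a; exact hL4.frame_wmem a (by simp [Program.warrays])), q1, q2, ⟨?_, q5, q4⟩, ?_,
    by rw [e4, m4], fun h0 => ?_⟩
  · rw [q3]
    have := hsp.total
    rw [add_mul, one_mul]
    omega
  · rw [hL4.frame_reg 2 (by decide), hL3.frame_reg 2 (by decide), hL2.frame_reg 2 (by decide),
      hL1.frame_reg 2 (by decide), h2]
  · rw [winner, m4, m4]
    exact q6 (e4 ▸ h0)

theorem Enumerating.step (hC : ops.Computes w) (hw : SubsetMonotone w)
    (hℓ : ∀ p, G.IsPath s t p → p.length ≤ ℓ)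
    (hR : ∀ (σ : State W) (Γ : Ghost N) K, Inv w G wt t ops σ Γ Finset.univ none →
      Γ.Spent s ℓ K → ∑ u, Γ.rot u ≤ R K) (hRm : Monotone R)
    (h : Enumerating w G wt s t ops ℓ T B R K σ Γ) (h0 : σ.reg 19 ≠ 0) :
    ∃ τ Γ', Run ops enumBody (σ.tick (enumTest.cost + 1) (enumTest.peak σ)) τ ∧
      Enumerating w G wt s t ops ℓ T B R (K + 1) τ Γ' := by
  obtain ⟨z, hz⟩ : ∃ z, z = σ.reg 19 := ⟨_, rfl⟩
  have hK : K < (Γ.ent s).length := by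
    by_contra hK
    rw [h.cur, List.getD_eq_default _ _ (by omega)] at h0
    exact h0 rfl
  have hzK : z = (Γ.ent s)[K] := by rw [hz, h.cur, List.getD_eq_getElem _ _ hK]
  have hzs : z ∈ Γ.ent s := hzK ▸ List.getElem_mem hK
  have hcost : enumTest.cost = 4 := by decide
  obtain ⟨σ0, hσ0⟩ : ∃ σ0, σ0 = σ.tick (enumTest.cost + 1) (enumTest.peak σ) := ⟨_, rfl⟩
  have hsim : σ0.Sim σ := hσ0 ▸ State.tick_sim _ _ _
  have hB0 : σ0.Bounded (B + K * (7 * ℓ)) := hσ0 ▸ h.bounded.tick_test (b := enumTest) (by decide)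
  have hc0 : σ0.clock = σ.clock + 5 := by rw [hσ0, hcost]; rfl
  have ha0 : σ0.answers = σ.answers := by rw [hσ0]; rfl
  rw [← hσ0]
  -- the current answer
  have hL1 := Leads.exec (ops := ops) (.assign 23 (.reg 19)) (by decide) σ0
  obtain ⟨σ1, hσ1⟩ : ∃ σ1, σ1 = (Program.assign 23 (.reg 19)).exec ops σ0 := ⟨_, rfl⟩
  rw [← hσ1] at hL1
  have hI0 : Inv w G wt t ops σ0 Γ Finset.univ none := h.inv.congr_state (by rw [hsim.reg])
    (by rw [hsim.reg]) (fun a _ => by rw [hsim.mem]) hsim.wmem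
  have hI1 : Inv w G wt t ops σ1 Γ Finset.univ none := hI0.congr_state
    (hL1.frame_reg 10 (by decide)) (hL1.frame_reg 11 (by decide))
    (fun a _ => hL1.frame_mem a (by simp [Program.arrays]))
    (by funext a; exact hL1.frame_wmem a (by simp [Program.warrays]))
  obtain ⟨σ2, hL2, ho2⟩ := emitLoop_spec hI1 hzs
    (by rw [hσ1]; simp [Program.exec, Exp.eval, hsim.reg, hz])
  obtain ⟨υ, w1, w2, w3, w4, w5⟩ := (hL1.seq hL2) σ0 (.refl _)
  have hI2 : Inv w G wt t ops υ Γ Finset.univ none := hI0.congr_state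
    (w1.frame_reg (by decide)) (w1.frame_reg (by decide))
    (fun a _ => w1.frame_mem (by
      simp [emitLoop, emitStep, Program.arrays]))
    (by funext a; exact w1.frame_wmem (by simp [emitLoop, emitStep, Program.warrays]))
  have hou : υ.out = encodePath (Γ.path z) := by
    rw [w2.out, ho2, hL1.frame_out (by decide), hsim.out, h.out, List.nil_append]
  have ht1 : (Program.assign 23 (.reg 19)).time ≤ 5 := by decide
  have hg1 : (Program.assign 23 (.reg 19)).growth = 0 := by decide
  have hlz := hℓ _ ((h.inv.core s).isPath z hzs)
  have hcu : υ.clock ≤ σ0.clock + (30 * ℓ + 15) := by omega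
  have hBu : υ.Bounded (B + K * (7 * ℓ)) := by
    have := w5 _ hB0
    rwa [hg1] at this
  -- the next entry
  obtain ⟨υ', hυ'⟩ : ∃ υ', υ' = ({ υ with
            out := []
            answers := υ.answers ++ [Answer.mk υ.out (υ.clock + 1) υ.peak] } : State W).tick 1 0 :=
    ⟨_, rfl⟩
  have hdel : Run ops .deliver υ υ' := hυ' ▸ Run.deliver υ
  have ru : υ'.reg = υ.reg := by rw [hυ']; rfl
  have mu : υ'.mem = υ.mem := by rw [hυ']; rfl
  have hI3 : Inv w G wt t ops υ' Γ Finset.univ none := hI2.congr_state (by rw [ru]) (by rw [ru])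
    (fun a _ => by rw [mu]) (by rw [hυ']; rfl)
  have hBu' : υ'.Bounded (B + K * (7 * ℓ)) :=
    ⟨by simpa [hυ', State.tick] using hBu.peak, ru ▸ hBu.reg, mu ▸ hBu.mem⟩
  have hcu' : υ'.clock = υ.clock + 1 := by rw [hυ']; rfl
  obtain ⟨τ, Γ', hL, hI, q1, q2, q3, q4, q5, q6⟩ := nextEntry_spec (z := z) hC hw hℓ hI3 h.spent
    (by rw [ru, w1.frame_reg (by decide), hsim.reg, h.source])
    (by rw [ru, w1.frame_reg (by decide), hsim.reg, hz]) hzs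
  obtain ⟨τ', y1, y2, y3, y4, y5⟩ := hL υ' (.refl _)
  have hans : τ'.answers = σ.answers ++ [Answer.mk υ.out (υ.clock + 1) υ.peak] := by
    rw [y3, hυ', ← ha0, ← w3]; rfl
  have hpre := q1.prefix_ent s
  have hK' : K < (Γ'.ent s).length := hK.trans_le hpre.length_le
  have hget : (Γ'.ent s)[K] = z := by rw [hzK]; exact (hpre.getElem hK).symm
  have hlen : σ.answers.length = K := by
    have := congrArg List.length h.words
    simp only [List.length_map, List.length_take, Ghost.paths] at this
    have := h.le
    omega
  -- Lists only grow at their ends and entries keep their paths, so what has been delivered remains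
  -- an initial segment.
  have htake : (Γ'.paths s).take K = (Γ.paths s).take K := by
    obtain ⟨r, hr⟩ := hpre
    rw [Ghost.paths, ← hr, List.map_append, List.take_append_of_le_length (by simp; omega),
      Ghost.paths]
    rw [List.map_congr_left (q1.path s)]
  -- The answer is delivered before the next entry is sought, so only the rotations of the first `K`
  -- rounds precede it; `hRm` relaxes their bound to the index used in `time`.
  have hrot := hR σ Γ K h.inv h.spent
  have hRK := hRm (Nat.le_succ K)
  have hclock := h.clock
  have htime : υ.clock + 1 ≤ T + (K + 1) * (500 * (ℓ + 1)) + 220 * ∑ u, Γ.rot u := by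
    rw [add_mul, one_mul]
    omega
  refine ⟨τ', Γ', .seq w1 (.seq hdel y1), ?_, q3, ?_, ?_, ?_, hK', ?_, ?_, ?_, ?_, ?_, ?_⟩
  · exact hI.congr_state (by rw [y2.reg]) (by rw [y2.reg]) (fun a _ => by rw [y2.mem]) y2.wmem
  · rw [y2.reg, q4]
  · rw [y2.out, hL.frame_out (by decide), hυ']; rfl
  · rw [y2.reg, q5, ← hget]
    exact (hI.core s).link K hK'
  · intro h1
    rw [winner, y2.mem]
    exact q6 (y2.reg ▸ h1)
  · rw [hans, List.map_append, h.words, ← htake,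
      List.take_add_one, List.getElem?_eq_getElem (show K < (Γ'.paths s).length by
        simpa [Ghost.paths]), Option.toList_some, List.map_append]
    simp only [List.map_cons, List.map_nil, hou, Ghost.paths, List.getElem_map, hget]
    rw [q1.path s z hzs]
  · rw [add_mul, one_mul]
    omega
  · exact (y5 _ hBu').mono (by rw [add_mul, one_mul]; omega)
  · intro k hk
    simp only [hans, List.getElem_append]
    split
    · next hk' => exact h.time k hk'
    · next hk' =>
      have : k = K := by
        rw [hans, List.length_append, List.length_singleton] at hk
        omega
      subst this
      simp only [List.getElem_singleton]
      simp only [Nat.succ_eq_add_one] at hRK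
      omega
  · intro k hk
    simp only [hans, List.getElem_append]
    split
    · next hk' => exact h.space k hk'
    · next hk' =>
      have : k = K := by
        rw [hans, List.length_append, List.length_singleton] at hk
        omega
      subst this
      simpa using hBu.peak

theorem finite_paths (hℓ : ∀ p, G.IsPath s t p → p.length ≤ ℓ) : {p | G.IsPath s t p}.Finite :=
  (List.finite_length_le _ ℓ).subset hℓ

/-- Every round uses one more entry of `s`, and the entries have distinct paths, of which there are
finitely many. When no entry is left, the winner of `s` is `0`, and the list is complete. -/
theorem enumLoop_spec (hC : ops.Computes w) (hw : SubsetMonotone w)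
    (hℓ : ∀ p, G.IsPath s t p → p.length ≤ ℓ)
    (hR : ∀ (σ : State W) (Γ : Ghost N) K, Inv w G wt t ops σ Γ Finset.univ none →
      Γ.Spent s ℓ K → ∑ u, Γ.rot u ≤ R K) (hRm : Monotone R)
    (h : Enumerating w G wt s t ops ℓ T B R K σ Γ) :
    ∃ τ ps, Run ops enumLoop σ τ ∧ IsRankedEnumeration w G wt s t ps ∧
      τ.answers.map Answer.word = ps.map encodePath ∧
      (∀ k (h : k < τ.answers.length),
        (τ.answers[k]).time ≤ T + (k + 1) * (500 * (ℓ + 1)) + 220 * R (k + 1) ∧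
        (τ.answers[k]).space ≤ B + k * (7 * ℓ)) ∧
      τ.clock ≤ T + ps.length * (500 * (ℓ + 1)) + 220 * R ps.length + 5 ∧
      τ.peak ≤ B + ps.length * (7 * ℓ) := by
  -- This makes the number of paths minus `K` a measure that decreases strictly in every round.
  have hle : ∀ (σ : State W) (Γ : Ghost N), Inv w G wt t ops σ Γ Finset.univ none →
      (Γ.ent s).length ≤ {p | G.IsPath s t p}.ncard := by
    intro σ Γ h
    have hfin := finite_paths hℓ
    have hnd := (h.core s).nodup
    rw [← List.length_map (as := Γ.ent s) Γ.path, show ((Γ.ent s).map Γ.path) = Γ.paths s from rfl,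
      ← List.toFinset_card_of_nodup hnd, ← Set.ncard_coe_finset]
    refine Set.ncard_le_ncard (fun p hp => ?_) hfin
    obtain ⟨y, hy, rfl⟩ := List.mem_map.1 (List.mem_toFinset.1 (Finset.mem_coe.1 hp))
    exact (h.core s).isPath y hy
  induction hn : {p | G.IsPath s t p}.ncard - K using Nat.strong_induction_on generalizing K σ Γ with
  | _ n ih =>
    by_cases h0 : σ.reg 19 = 0
    · have hcost : enumTest.cost = 4 := by decide
      have hlen : K = (Γ.ent s).length := by
        by_contra hK
        have hlt : K < (Γ.ent s).length := lt_of_le_of_ne h.le hK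
        have := h.cur
        rw [h0, List.getD_eq_getElem _ _ hlt] at this
        exact (h.inv.core s).ent_ne _ (List.getElem_mem hlt) this.symm
      have hlen' : (Γ.paths s).length = K := by simp [Ghost.paths, hlen]
      refine ⟨_, Γ.paths s, .loop_false (by simp [enumTest, Test.Holds, Exp.eval, h0]),
        ⟨fun p => ⟨fun hp => ?_, fun hp => h.inv.exhausted hw (by simp) (Finset.mem_univ _) (.inr rfl)
          (h.final h0) hp⟩, (h.inv.core s).nodup, (h.inv.core s).sorted⟩, ?_,
        fun k hk => ⟨h.time k hk, h.space k hk⟩, ?_, ?_⟩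
      · obtain ⟨y, hy, rfl⟩ := Ghost.mem_paths.1 hp
        exact (h.inv.core s).isPath y hy
      · have := h.words
        rw [← hlen', List.take_length] at this
        exact this
      · have := h.clock
        have := hR σ Γ K h.inv h.spent
        rw [hlen']
        simp only [State.tick, hcost]
        omega
      · rw [hlen']
        exact (h.bounded.tick_test (b := enumTest) (by decide)).peak
    · obtain ⟨τ, Γ', h1, h2⟩ := h.step hC hw hℓ hR hRm h0
      have := hle τ Γ' h2.inv
      have := h2.le
      obtain ⟨υ, ps, k1, k2⟩ := ih _ (by omega) h2 rfl
      exact ⟨υ, ps, .loop_true (by simpa [enumTest, Test.Holds, Exp.eval] using h0) h1 k1, k2⟩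

end

/-! ### The number of rotations -/

section
open Finset

variable {V : Type*} [Fintype V]

/-- The number of nodes from which a node can be reached. -/
noncomputable def coreach (r : V → V → Prop) (v : V) : ℕ :=
  {u | Relation.ReflTransGen r u v}.ncard

theorem coreach_pos (r : V → V → Prop) (v : V) : 0 < coreach r v :=
  (Set.ncard_pos (Set.toFinite _)).2 ⟨v, .refl⟩

theorem coreach_le (r : V → V → Prop) (v : V) : coreach r v ≤ Fintype.card V := by
  rw [← Nat.card_eq_fintype_card, ← Set.ncard_univ]
  exact Set.ncard_le_ncard (Set.subset_univ _)

/-- The sets of nodes that reach the predecessors of `v` are disjoint. -/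
theorem sum_coreach_le {r : V → V → Prop} (hr : Relator.RightUnique r)
    (hac : ∀ v, ¬ Relation.TransGen r v v) (v : V) (A : Finset V) (hA : ∀ c ∈ A, r c v) :
    ∑ c ∈ A, coreach r c ≤ coreach r v := by
  classical
  -- Leaving `b`, one can only go to `v`. So if `b` reached a different predecessor `c` of `v`, then
  -- `v` would reach `c` and thus itself.
  have key : ∀ b c, r b v → r c v → b ≠ c → Relation.ReflTransGen r b c → False := by
    intro b c hb hc hne h
    rcases Relation.ReflTransGen.cases_head h with h | ⟨x, hx, h⟩
    · exact hne h
    · rw [hr hx hb] at h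
      exact hac v (Relation.TransGen.tail' h hc)
  have hdis : (A : Set V).PairwiseDisjoint fun c =>
      univ.filter fun u => Relation.ReflTransGen r u c := by
    intro b hb c hc hbc
    refine Finset.disjoint_left.2 fun u hub huc => ?_
    simp only [mem_filter, mem_univ, true_and] at hub huc
    rcases Relation.ReflTransGen.total_of_right_unique hr hub huc with h | h
    · exact key b c (hA b hb) (hA c hc) hbc h
    · exact key c b (hA c hc) (hA b hb) hbc.symm h
  have hc : ∀ v, coreach r v = (univ.filter fun u => Relation.ReflTransGen r u v).card := by
    intro v
    rw [coreach, ← Set.ncard_coe_finset]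
    simp
  simp only [hc]
  rw [← Finset.card_biUnion hdis]
  refine Finset.card_le_card fun u hu => ?_
  obtain ⟨c, hcA, huc⟩ := Finset.mem_biUnion.1 hu
  simp only [mem_filter, mem_univ, true_and] at huc ⊢
  exact huc.tail (hA c hcA)

variable [DecidableEq V] {ι : Type*} [DecidableEq ι]

/-- In an acyclic flow where all that leaves a node other than `s` has entered it by a single arc,
the shares `q` of the arcs are such that the entropy is at most logarithmic per unit of flow. -/
theorem exists_shares {L : Finset ι} {own head : ι → V} {pos : ι → ℝ} {s : V} {A : V → ℝ}
    (hpos : ∀ f ∈ L, 0 ≤ pos f) (hA : ∀ v, A v = ∑ f ∈ L with own f = v, pos f)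
    (hled : ∀ u, u ≠ s → A u = 0 ∨ ∃ f ∈ L, head f = u ∧ A u ≤ pos f)
    (hac : ∀ v, ¬ Relation.TransGen (fun u v => ∃ f ∈ L, head f = u ∧ own f = v) v v)
    (hinj : ∀ f ∈ L, ∀ f' ∈ L, own f = own f' → head f = head f' → f = f') :
    ∃ q : ι → ℝ, (∀ f, 0 < q f) ∧ (∀ v, ∑ f ∈ L with own f = v, q f ≤ 2) ∧
      ∑ f ∈ L, pos f * (-Real.log (q f)) ≤ 3 * (A s * Real.log (Fintype.card V)) := by
  classical
  -- The heavy arc into `u`, if there is one. None is chosen for `s`, or where `A u = 0`.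
  obtain ⟨h, hh⟩ : ∃ h : V → Option ι, ∀ u, (∀ f, h u = some f → f ∈ L ∧ head f = u ∧ A u ≤ pos f) ∧
      (u ≠ s → h u = none → A u = 0) ∧ (u = s → h u = none) := by
    have : ∀ u, ∃ o : Option ι, (∀ f, o = some f → f ∈ L ∧ head f = u ∧ A u ≤ pos f) ∧
      (u ≠ s → o = none → A u = 0) ∧ (u = s → o = none) := by
      intro u
      by_cases hu : u = s
      · exact ⟨none, by simp, fun h => absurd hu h, fun _ => rfl⟩
      · rcases hled u hu with h | ⟨f, h⟩
        · exact ⟨none, by simp, fun _ _ => h, fun _ => rfl⟩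
        · exact ⟨some f, fun f' hf' => by cases hf'; exact h, fun _ h => by simp at h,
            fun h => absurd h hu⟩
    choose h hh using this
    exact ⟨h, hh⟩
  -- Every node points to the tail of its heavy arc. This relation is functional and acyclic, hence
  -- a forest.
  set r : V → V → Prop := fun u v => ∃ f, h u = some f ∧ own f = v with hrdef
  have hr : Relator.RightUnique r := by
    rintro a b c ⟨f, h1, h2⟩ ⟨f', h3, h4⟩
    rw [h1] at h3
    cases h3
    exact h2.symm.trans h4
  have hac' : ∀ v, ¬ Relation.TransGen r v v := fun v hv => hac v
    (Relation.TransGen.mono (r := r) (fun u v ⟨f, h1, h2⟩ =>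
      ⟨f, ((hh u).1 f h1).1, ((hh u).1 f h1).2.1, h2⟩) v v hv)
  set n : ℝ := (Fintype.card V : ℝ) with hn
  have hn1 : 1 ≤ n := by
    rw [hn]; exact_mod_cast Fintype.card_pos_iff.2 ⟨s⟩
  set S : V → ℝ := fun v => (coreach r v : ℝ) with hS
  have hS1 : ∀ v, 1 ≤ S v := fun v => by simp only [hS]; exact_mod_cast coreach_pos r v
  have hSn : ∀ v, S v ≤ n := fun v => by simp only [hS, hn]; exact_mod_cast coreach_le r v
  have hS0 : ∀ v, 0 < S v := fun v => one_pos.trans_le (hS1 v)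
  -- A heavy arc gets the fraction of the nodes below its tail that lie below its head, as in a
  -- heavy path decomposition; a light arc gets the smallest share that costs only `log n`.
  set q : ι → ℝ := fun f => if h (head f) = some f then S (head f) / S (own f) else 1 / n with hq
  refine ⟨q, fun f => ?_, fun v => ?_, ?_⟩
  · rw [hq]
    dsimp only
    split
    · exact div_pos (hS0 _) (hS0 _)
    · positivity
  · have h1 : ∀ f ∈ L.filter fun f => own f = v, q f ≤
        (if h (head f) = some f then S (head f) / S v else 0) + 1 / n := by
      intro f hf
      rw [hq, ← (mem_filter.1 hf).2]
      dsimp only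
      split
      · have : 0 ≤ 1 / n := by positivity
        linarith
      · linarith
    refine (Finset.sum_le_sum h1).trans ?_
    rw [Finset.sum_add_distrib, ← Finset.sum_filter, Finset.sum_const, nsmul_eq_mul,
      ← Finset.sum_div]
    -- The heads of the heavy arcs out of `v` are the children of `v` in the forest, and the sets of
    -- nodes below them are disjoint.
    have h2 : ∑ f ∈ (L.filter fun f => own f = v) with h (head f) = some f, S (head f) ≤ S v := by
      rw [← Finset.sum_image (g := head) (f := S)]
      · rw [hS]
        refine le_trans (le_of_eq (by push_cast; rfl)) (Nat.cast_le.2 (sum_coreach_le hr hac' v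
          (((L.filter fun f => own f = v).filter fun f => h (head f) = some f).image head) ?_))
        intro c hc
        obtain ⟨f, hf, rfl⟩ := Finset.mem_image.1 hc
        simp only [mem_filter] at hf
        exact ⟨f, hf.2, hf.1.2⟩
      · intro f hf f' hf' heq
        simp only [coe_filter, mem_filter, Set.mem_ofPred_eq] at hf hf'
        rw [heq, hf'.2] at hf
        exact (Option.some.inj hf.2).symm
    -- There are no parallel arcs, so at most `n` arcs leave `v`, and the light shares sum to at
    -- most `1`.
    have h3 : ((L.filter fun f => own f = v).card : ℝ) ≤ n := by
      rw [hn, Nat.cast_le, ← Finset.card_univ]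
      refine Finset.card_le_card_of_injOn head (by simp) fun f hf f' hf' heq => ?_
      simp only [coe_filter, Set.mem_ofPred_eq] at hf hf'
      exact hinj f hf.1 f' hf'.1 (hf.2.trans hf'.2.symm) heq
    have h4 := (div_le_one (hS0 v)).2 h2
    have h5 : ((L.filter fun f => own f = v).card : ℝ) * (1 / n) ≤ 1 := by
      rw [mul_one_div]
      exact (div_le_one (by linarith)).2 h3
    linarith
  · have hψ0 : ∀ v, 0 ≤ Real.log (S v) := fun v => Real.log_nonneg (hS1 v)
    have hψn : ∀ v, Real.log (S v) ≤ Real.log n := fun v => Real.log_le_log (hS0 v) (hSn v)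
    set I : V → ℝ := fun u => ∑ f ∈ L with head f = u, pos f with hI
    -- The heavy arc alone carries at least `A u`; so the light arcs into `u` carry at most the
    -- surplus of inflow over outflow.
    have hheavy : ∀ u, u ≠ s →
        ∑ f ∈ (L.filter fun f => head f = u) with ¬ h (head f) = some f, pos f ≤ I u - A u := by
      intro u hu
      cases hf : h u with
      | none =>
        rw [(hh u).2.1 hu hf, sub_zero]
        exact Finset.sum_le_sum_of_subset_of_nonneg (Finset.filter_subset _ _)
          fun f hf _ => hpos f (mem_filter.1 hf).1
      | some g =>
        obtain ⟨k1, k2, k3⟩ := (hh u).1 g hf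
        have : ((L.filter fun f => head f = u).filter fun f => ¬ h (head f) = some f) =
            (L.filter fun f => head f = u).erase g := by
          ext f
          simp only [mem_filter, mem_erase]
          constructor
          · rintro ⟨⟨h1, h2⟩, h3⟩
            refine ⟨?_, h1, h2⟩
            rintro rfl
            exact h3 (by rw [h2, hf])
          · rintro ⟨h1, h2, h3⟩
            refine ⟨⟨h2, h3⟩, fun h4 => h1 ?_⟩
            rw [h3, hf] at h4
            exact (Option.some.inj h4).symm
        rw [this, Finset.sum_erase_eq_sub (mem_filter.2 ⟨k1, k2⟩)]
        linarith
    have hAI : ∀ u, u ≠ s → A u ≤ I u := fun u hu => by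
      have := hheavy u hu
      have h0 := Finset.sum_nonneg (s := ((L.filter fun f => head f = u).filter
        fun f => ¬ h (head f) = some f)) (f := pos)
        fun f hf => hpos f (mem_filter.1 (mem_filter.1 hf).1).1
      linarith
    have hI0 : ∀ u, 0 ≤ I u := fun u => Finset.sum_nonneg fun f hf => hpos f (mem_filter.1 hf).1
    have hA0 : 0 ≤ A s := by
      rw [hA]; exact Finset.sum_nonneg fun f hf => hpos f (mem_filter.1 hf).1
    have hsum : ∑ u, A u = ∑ u, I u := by
      rw [hI]
      simp only [hA]
      rw [Finset.sum_fiberwise, Finset.sum_fiberwise]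
    -- Total inflow equals total outflow, so the surpluses at the nodes other than `s` sum to the
    -- deficit at `s`, which together with the light inflow at `s` is at most `A s`.
    have hlight : ∑ f ∈ L with ¬ h (head f) = some f, pos f ≤ A s := by
      rw [← Finset.sum_fiberwise _ head]
      have : ∀ u, ∑ f ∈ (L.filter fun f => ¬ h (head f) = some f) with head f = u, pos f ≤
          I u - A u + if u = s then A s else 0 := by
        intro u
        rw [Finset.filter_comm]
        by_cases hu : u = s
        · subst hu
          simp only [if_true, sub_add_cancel]
          exact Finset.sum_le_sum_of_subset_of_nonneg (Finset.filter_subset _ _)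
            fun f hf _ => hpos f (mem_filter.1 hf).1
        · simpa [hu] using hheavy u hu
      refine (Finset.sum_le_sum fun u _ => this u).trans ?_
      rw [Finset.sum_add_distrib, Finset.sum_sub_distrib, hsum]
      simp
    -- Light arcs are put into the telescoping sum as well; a second `log n` pays for the term `log
    -- (S (head f))` that they do not deserve.
    have hterm : ∀ f ∈ L, pos f * (-Real.log (q f)) ≤
        pos f * Real.log (S (own f)) - pos f * Real.log (S (head f)) +
          if ¬ h (head f) = some f then pos f * (2 * Real.log n) else 0 := by
      intro f hf
      have hp := hpos f hf
      rw [hq]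
      dsimp only
      by_cases hc : h (head f) = some f
      · simp only [hc, if_true, not_true_eq_false, if_false]
        rw [Real.log_div (hS0 _).ne' (hS0 _).ne']
        linarith
      · simp only [hc, if_false, not_false_eq_true, if_true]
        rw [one_div, Real.log_inv, neg_neg]
        nlinarith [hψn (head f), hψ0 (own f)]
    refine (Finset.sum_le_sum hterm).trans ?_
    rw [Finset.sum_add_distrib, Finset.sum_sub_distrib, ← Finset.sum_filter, ← Finset.sum_mul]
    have e1 : ∑ f ∈ L, pos f * Real.log (S (own f)) = ∑ v, A v * Real.log (S v) := by
      rw [← Finset.sum_fiberwise _ own]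
      refine Finset.sum_congr rfl fun v _ => ?_
      rw [hA, Finset.sum_mul]
      refine Finset.sum_congr rfl fun f hf => ?_
      rw [(mem_filter.1 hf).2]
    have e2 : ∑ f ∈ L, pos f * Real.log (S (head f)) = ∑ v, I v * Real.log (S v) := by
      rw [← Finset.sum_fiberwise _ head]
      refine Finset.sum_congr rfl fun v _ => ?_
      rw [hI, Finset.sum_mul]
      refine Finset.sum_congr rfl fun f hf => ?_
      rw [(mem_filter.1 hf).2]
    -- At a node other than `s` no more flows out than in, so the contribution is not positive; at
    -- `s` the outflow gives the bound.
    have e3 : ∑ v, A v * Real.log (S v) - ∑ v, I v * Real.log (S v) ≤ A s * Real.log n := by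
      rw [← Finset.sum_sub_distrib]
      have : ∀ v, A v * Real.log (S v) - I v * Real.log (S v) ≤
          if v = s then A s * Real.log n else 0 := by
        intro v
        by_cases hv : v = s
        · subst hv
          simp only [if_true]
          have := mul_le_mul_of_nonneg_left (hψn v) hA0
          have := mul_nonneg (hI0 v) (hψ0 v)
          linarith
        · simp only [hv, if_false]
          have := mul_le_mul_of_nonneg_right (hAI v hv) (hψ0 v)
          linarith
      refine (Finset.sum_le_sum fun v _ => this v).trans ?_
      simp
    have e4 := mul_le_mul_of_nonneg_right hlight (show 0 ≤ 2 * Real.log n by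
      have := Real.log_nonneg hn1; linarith)
    linarith

end

/-- The summand `1` of the weights keeps logarithms nonnegative at the price of `F.card` in the
mass; the summand `A * q f` turns `log M - log (w f)` into `log (1 / q f)`, up to terms that sum to
`A + F.card`. -/
theorem two_mul_add_sum_le {ι : Type*} {F : Finset ι} {pos q w : ι → ℝ} {A M : ℝ}
    (hpos : ∀ f ∈ F, 0 ≤ pos f) (hq : ∀ f, 0 < q f) (hQ : ∑ f ∈ F, q f ≤ 2)
    (hA : A = ∑ f ∈ F, pos f) (hw : ∀ f, w f = 1 + A * q f) (hM : M = ∑ f ∈ F, w f) :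
    2 * M + 2 * ∑ f ∈ F, pos f * (Real.log M - Real.log (w f)) ≤
      4 * F.card + 6 * A + 2 * ∑ f ∈ F, pos f * (-Real.log (q f)) := by
  have hA0 : 0 ≤ A := hA ▸ Finset.sum_nonneg hpos
  have hM2 : M ≤ F.card + 2 * A := by
    rw [hM, Finset.sum_congr rfl fun f _ => hw f, Finset.sum_add_distrib, ← Finset.mul_sum]
    simp only [Finset.sum_const, nsmul_eq_mul, mul_one]
    nlinarith
  rcases hA0.eq_or_lt with h0 | h0
  · have hz : ∀ f ∈ F, pos f = 0 :=
      (Finset.sum_eq_zero_iff_of_nonneg hpos).1 (hA.symm.trans h0.symm)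
    rw [Finset.sum_eq_zero fun f hf => by rw [hz f hf, zero_mul],
      Finset.sum_eq_zero fun f hf => by rw [hz f hf, zero_mul]]
    have : (0 : ℝ) ≤ F.card := by positivity
    linarith
  · have hterm : ∀ f ∈ F, pos f * (Real.log M - Real.log (w f)) ≤
        pos f * (-Real.log (q f)) + pos f * (1 + F.card / A) := by
      intro f hf
      rw [← mul_add]
      refine mul_le_mul_of_nonneg_left ?_ (hpos f hf)
      have hwf : A * q f ≤ w f := by rw [hw]; linarith
      have h1 : Real.log A + Real.log (q f) ≤ Real.log (w f) := by
        rw [← Real.log_mul h0.ne' (hq f).ne']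
        exact Real.log_le_log (mul_pos h0 (hq f)) hwf
      have hM0 : 0 < M := by
        rw [hM]
        exact Finset.sum_pos (fun g _ => by rw [hw]; have := mul_pos h0 (hq g); linarith) ⟨f, hf⟩
      -- From `log x ≤ x - 1` at `x = M / A`. The term `F.card / A` is harmless, as the values `pos
      -- f` that multiply it sum to `A`.
      have h2 : Real.log M ≤ Real.log A + (1 + F.card / A) := by
        have h3 := Real.log_le_sub_one_of_pos (div_pos hM0 h0)
        rw [Real.log_div hM0.ne' h0.ne'] at h3
        have h4 : M / A ≤ F.card / A + 2 := by
          rw [div_add' _ _ _ h0.ne', div_le_div_iff_of_pos_right h0]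
          exact hM2
        linarith
      linarith
    have h5 := Finset.sum_le_sum hterm
    rw [Finset.sum_add_distrib, ← Finset.sum_mul, ← hA, mul_add, mul_one,
      mul_div_cancel₀ _ h0.ne'] at h5
    linarith

/-! ### The bound on the rotations of the program -/

section
open Finset
variable {W : Type u} [LinearOrder W] {w : Multiset W → W} {ops : WeightOps W} {N : ℕ}
  {G : DAG N} {wt : Fin N × Fin N → W} {s t : Fin N} {σ : State W} {Γ : Ghost N} {ℓ K : ℕ}

theorem exists_path_of_transGen {r : Fin N → Fin N → Prop}
    (hr : ∀ u v, r u v → ∃ e ∈ G.edges, e.1 = v ∧ e.2 = u) {u v : Fin N}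
    (h : Relation.TransGen r u v) : ∃ p, p ≠ [] ∧ G.IsPath v u p := by
  induction h with
  | single h =>
    obtain ⟨e, he, h1, h2⟩ := hr _ _ h
    exact ⟨[e], by simp, he, h1, h2⟩
  | tail _ h ih =>
    obtain ⟨e, he, h1, h2⟩ := hr _ _ h
    obtain ⟨p, -, hp⟩ := ih
    exact ⟨e :: p, by simp, he, h1, h2 ▸ hp⟩

/-- The leaves are the arcs of a flow, with `Γ.pos f` units from the owner of `f` to its head. The
shares from `exists_shares` give each tree its weights; summing over the nodes leaves the degrees,
all advances, and the entropy, which is logarithmic per advance of `s`. -/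
theorem Inv.sum_rot_le (h : Inv w G wt t ops σ Γ Finset.univ none) (hsp : Γ.Spent s ℓ K) :
    ∑ u, Γ.rot u ≤ 8 * G.edges.length + 6 * (K * (Nat.log 2 N + ℓ + 1)) := by
  set L : Finset ℕ := univ.biUnion fun v => (Γ.leaves v).toFinset with hL
  have hmem : ∀ f, f ∈ L ↔ ∃ v, f ∈ Γ.leaves v := fun f => by simp [hL]
  set own : ℕ → Fin N := fun f => (Γ.edge f).1 with hown
  have hfib : ∀ v, L.filter (fun f => own f = v) = (Γ.leaves v).toFinset := by
    intro v
    ext f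
    simp only [mem_filter, hmem, List.mem_toFinset]
    constructor
    · rintro ⟨⟨v', hf⟩, rfl⟩
      have := (h.core' v').leaf_own f hf
      show f ∈ Γ.leaves (Γ.edge f).1
      rwa [this]
    · intro hf
      exact ⟨⟨v, hf⟩, (h.core' v).leaf_own f hf⟩
  have hedge : ∀ f ∈ L, Γ.edge f ∈ G.edges := by
    intro f hf
    obtain ⟨v, hv⟩ := (hmem f).1 hf
    exact List.mem_of_getElem? ((h.core' v).leaf_edge f hv)
  have hinj : ∀ f ∈ L, ∀ f' ∈ L, Γ.edge f = Γ.edge f' → f = f' := by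
    intro f hf f' hf' heq
    obtain ⟨v, hv⟩ := (hmem f).1 hf
    obtain ⟨v', hv'⟩ := (hmem f').1 hf'
    have h1 := (h.core' v).leaf_own f hv
    have h2 := (h.core' v').leaf_own f' hv'
    obtain rfl : v = v' := by rw [← h1, ← h2, heq]
    exact (h.core' v).leaf_inj f hv f' hv' heq
  have hsum : ∀ (g : ℕ → ℝ) v, ∑ f ∈ L with own f = v, g f = ((Γ.leaves v).map g).sum := by
    intro g v
    rw [hfib, List.sum_toFinset g (h.leaves_nodup v)]
  set A : Fin N → ℝ := fun v => (Γ.adv v : ℝ) with hA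
  have hAs : ∀ v, A v = ∑ f ∈ L with own f = v, (Γ.pos f : ℝ) := by
    intro v
    rw [hsum (fun f => (Γ.pos f : ℝ)), hA]
    simp only [Ghost.adv, Nat.cast_list_sum, List.map_map]
    rfl
  obtain ⟨q, hq0, hq2, hq⟩ := exists_shares (L := L) (own := own) (head := Γ.head)
    (pos := fun f => (Γ.pos f : ℝ)) (s := s) (A := A) (fun _ _ => Nat.cast_nonneg _) hAs (by
      intro u hu
      rcases hsp.led u hu with h0 | ⟨v, f, hf, h1, h2⟩
      · left; simp only [hA]; exact_mod_cast h0
      · right; exact ⟨f, (hmem f).2 ⟨v, hf⟩, h1, by simp only [hA]; exact_mod_cast h2⟩) (by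
      intro v hv
      obtain ⟨p, hp, hp'⟩ := exists_path_of_transGen (G := G) (by
        rintro a b ⟨f, hf, rfl, rfl⟩
        exact ⟨_, hedge f hf, rfl, rfl⟩) hv
      exact hp hp'.eq_nil) (by
      intro f hf f' hf' h1 h2
      exact hinj f hf f' hf' (Prod.ext h1 h2))
  have hnode : ∀ v, (Γ.rot v : ℝ) ≤ 8 * (Γ.leaves v).length + 6 * A v +
      2 * ∑ f ∈ L with own f = v, (Γ.pos f : ℝ) * (-Real.log (q f)) := by
    intro v
    cases hT : Γ.tree v with
    | none =>
      rw [h.rot_none v hT, hsum fun f => (Γ.pos f : ℝ) * (-Real.log (q f)), Ghost.leaves_none hT]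
      simp [hA]
    | some T =>
      -- Each tree gets its own weights, scaled by the advances at its node; this is where the
      -- quantifier over weights in `amort` is used.
      have hw1 : ∀ i, 1 ≤ 1 + A v * q i := fun i => by
        have : 0 ≤ A v * q i := mul_nonneg (by rw [hA]; positivity) (hq0 i).le
        linarith
      have h1 := (h.tree_ok v T hT).amort (fun f => 1 + A v * q f) hw1
      have h2 := BT.pot_nonneg hw1 T
      have h3 := two_mul_add_sum_le (F := L.filter fun f => own f = v)
        (pos := fun f => (Γ.pos f : ℝ)) (q := q) (w := fun f => 1 + A v * q f)
        (M := T.mass fun f => 1 + A v * q f) (fun _ _ => Nat.cast_nonneg _) hq0 (hq2 v) (hAs v)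
        (fun _ => rfl) (by rw [hsum, Ghost.leaves_eq hT]; rfl)
      rw [hsum (fun f => (Γ.pos f : ℝ) * (Real.log (T.mass fun f => 1 + A v * q f) -
        Real.log (1 + A v * q f)))] at h3
      rw [hfib, List.toFinset_card_of_nodup (h.leaves_nodup v)] at h3
      rw [← hfib] at h3
      rw [Ghost.leaves_eq hT] at h3 ⊢
      linarith
  have hd : ∑ v, ((Γ.leaves v).length : ℝ) ≤ G.edges.length := by
    have : ∑ v, (Γ.leaves v).length = L.card := by
      rw [Finset.card_eq_sum_card_fiberwise (f := own) (t := univ) (by simp)]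
      refine Finset.sum_congr rfl fun v _ => ?_
      rw [hfib, List.toFinset_card_of_nodup (h.leaves_nodup v)]
    have h2 : L.card ≤ G.edges.length := by
      rw [← List.toFinset_card_of_nodup G.nodup]
      exact Finset.card_le_card_of_injOn Γ.edge (fun f hf => by simpa using hedge f hf)
        fun f hf f' hf' heq => hinj f hf f' hf' heq
    exact_mod_cast this.le.trans h2
  have htot : ∑ v, A v ≤ K * ℓ := by
    simp only [hA]; exact_mod_cast hsp.total
  have hsrc : A s ≤ K := by
    simp only [hA]; exact_mod_cast hsp.source
  have hN : 0 < N := s.pos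
  have hlog : Real.log (Fintype.card (Fin N)) ≤ Nat.log 2 N + 1 := by
    rw [Fintype.card_fin]
    have h1 : (N : ℝ) ≤ 2 ^ (Nat.log 2 N + 1) := by
      exact_mod_cast (Nat.lt_pow_succ_log_self (by norm_num) N).le
    have h2 := Real.log_le_log (by exact_mod_cast hN) h1
    rw [Real.log_pow] at h2
    have h3 := Real.log_two_lt_d9
    push_cast at h2
    nlinarith [show (0 : ℝ) ≤ Nat.log 2 N by positivity]
  have hlog0 : 0 ≤ Real.log (Fintype.card (Fin N)) := by
    rw [Fintype.card_fin]
    exact Real.log_nonneg (by exact_mod_cast hN)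
  have hKlog : A s * Real.log (Fintype.card (Fin N)) ≤ K * (Nat.log 2 N + 1) :=
    mul_le_mul hsrc hlog hlog0 (Nat.cast_nonneg _)
  have hall := Finset.sum_le_sum fun v (_ : v ∈ univ) => hnode v
  rw [Finset.sum_add_distrib, Finset.sum_add_distrib, ← Finset.mul_sum, ← Finset.mul_sum,
    ← Finset.mul_sum, Finset.sum_fiberwise] at hall
  have hfin : (∑ u, (Γ.rot u : ℝ)) ≤ 8 * G.edges.length + 6 * (K * (Nat.log 2 N + ℓ + 1)) := by
    linarith
  exact_mod_cast hfin

end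

/-! ### Balanced trees -/

namespace BT

def height : BT → ℕ
  | leaf _ => 0
  | node _ l r => max l.height r.height + 1

/-- The heights of siblings differ by at most one. -/
def Balanced : BT → Prop
  | leaf _ => True
  | node _ l r => l.Balanced ∧ r.Balanced ∧ l.height ≤ r.height + 1 ∧ r.height ≤ l.height + 1

/-- The tangent of the logarithm at `2 ^ h`, simplified by `log 2 < 1`. -/
theorem log_le_add_div {S : ℝ} (hS : 0 < S) (h : ℕ) : Real.log S ≤ h + S / 2 ^ h := by
  have h1 := Real.log_le_sub_one_of_pos (show 0 < S / 2 ^ h by positivity)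
  rw [Real.log_div hS.ne' (by positivity), Real.log_pow] at h1
  have := Real.log_two_lt_d9
  nlinarith [show (0 : ℝ) ≤ h by positivity]

/-- A node of height `h` and mass `S` contributes at most `h + S / 2 ^ h`. The second terms are paid
by the slack `- S / 2 ^ h`, which at least doubles from a node to its children; the heights are paid
by the term `- T.height`, since heights of siblings are close. A bound of this kind, linear and
valid for all weights, needs balance. -/
theorem Balanced.pot_le {w : ℕ → ℝ} (hw : ∀ i, 1 ≤ w i) {T : BT} (hT : T.Balanced) :
    T.pot w ≤ 3 * T.leaves.length - T.height - 3 + T.mass w * (1 - 1 / 2 ^ T.height) := by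
  induction T with
  | leaf i => simp [pot, leaves, height]
  | node i l r ihl ihr =>
    obtain ⟨hl, hr, h1, h2⟩ := hT
    have ihl := ihl hl
    have ihr := ihr hr
    have hml := one_le_mass hw l
    have hmr := one_le_mass hw r
    have hlog := log_le_add_div (show 0 < l.mass w + r.mass w by linarith) (height (node i l r))
    have key : ∀ k : ℕ, k + 1 ≤ height (node i l r) →
        2 * (1 / 2 ^ height (node i l r) : ℝ) ≤ 1 / 2 ^ k := by
      intro k hk
      have : (1 : ℝ) / 2 ^ height (node i l r) ≤ 1 / 2 ^ (k + 1) :=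
        one_div_le_one_div_of_le (by positivity) (pow_le_pow_right₀ (by norm_num) hk)
      rw [pow_succ] at this
      calc 2 * (1 / 2 ^ height (node i l r) : ℝ) ≤ 2 * (1 / (2 ^ k * 2)) := by linarith
        _ = 1 / 2 ^ k := by field_simp
    have k1 := key l.height (by simp [height])
    have k2 := key r.height (by simp [height])
    -- The height is one more than the larger of the children's, and these differ by at most one.
    have hh : (2 * height (node i l r) : ℝ) ≤ l.height + r.height + 3 := by
      have : 2 * height (node i l r) ≤ l.height + r.height + 3 := by
        simp only [height]; omega
      exact_mod_cast this
    rw [mass_node]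
    simp only [pot, leaves, List.length_append]
    push_cast
    rw [div_eq_mul_one_div] at hlog
    set q : ℝ := 1 / 2 ^ height (node i l r)
    nlinarith

end BT

/-! ### Construction of tournament trees -/

def mergeStep : Program :=
  .store 10 (.reg 12) (.reg 10) ⟫ .store 10 (.add (.reg 12) (.lit 1)) (.reg 10) ⟫
  .store 11 (.reg 12) (.add (.reg 12) (.lit 1)) ⟫
  .store 11 (.add (.reg 12) (.lit 1)) (.reg 12) ⟫
  setWin (.reg 10) (.reg 12) (.add (.reg 12) (.lit 1)) ⟫
  .assign 10 (.add (.reg 10) (.lit 1)) ⟫ .assign 12 (.add (.reg 12) (.lit 2))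

def mergeTest : Test := .lt (.add (.reg 12) (.lit 1)) (.reg 10)

def mergeLoop : Program := .loop mergeTest mergeStep

/-- The nodes from `b` on form the trees `F`, whose leaves are those in `L`; the roots are in
register `12` and the following ones, up to the next free node, in register `10`. -/
structure Forest {W : Type u} [LinearOrder W] (ops : WeightOps W) (σ : State W) (b : ℕ)
    (L : List ℕ) (F : List BT) : Prop where
  roots : F.map BT.id = List.range' (σ.reg 12) F.length
  next : σ.reg 10 = σ.reg 12 + F.length
  rep : ∀ T ∈ F, Rep (σ.mem 10) (σ.mem 11) (σ.mem 12) (σ.val ops) T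
  par : ∀ i, σ.reg 12 ≤ i → σ.mem 10 i = 0
  balanced : ∀ T ∈ F, T.Balanced
  sorted : F.Pairwise fun T T' => T.height ≤ T'.height
  close : ∀ T ∈ F, ∀ T' ∈ F, T.height ≤ T'.height + 1
  nodup : (F.flatMap BT.ids).Nodup
  range : ∀ i ∈ F.flatMap BT.ids, b ≤ i ∧ i < σ.reg 10
  leaves : (F.flatMap BT.leaves).Perm L

section
variable {W : Type u} [LinearOrder W] {ops : WeightOps W} {σ : State W} {b : ℕ} {L : List ℕ}
  {F : List BT}

/-- The roots form a queue of consecutive addresses. Merging the two lowest trees at its front and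
appending the result keeps the heights sorted and within one of each other, as when pairing up the
leaves in rounds. -/
theorem Forest.step {T₁ T₂ : BT} (h : Forest ops σ b L (T₁ :: T₂ :: F)) :
    ∃ τ, Leads ops mergeStep σ τ 100 20 ∧
      Forest ops τ b L (F ++ [.node (σ.reg 10) T₁ T₂]) ∧
      ∀ a, ∀ i < b, τ.mem a i = σ.mem a i := by
  have hL := Leads.exec (ops := ops) mergeStep (by decide) σ
  have hids := h.roots
  simp only [List.map_cons, List.length_cons, List.range'_succ, List.cons.injEq] at hids
  obtain ⟨e1, e2, e3⟩ := hids
  have hnext := h.next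
  simp only [List.length_cons] at hnext
  have hmem1 : T₁.id ∈ (T₁ :: T₂ :: F).flatMap BT.ids :=
    List.mem_flatMap.2 ⟨T₁, by simp, T₁.id_mem_ids⟩
  have hb := (h.range _ hmem1).1
  rw [e1] at hb
  obtain ⟨υ, hυ⟩ : ∃ υ : State W, υ = { σ with
      mem := Function.update (Function.update σ.mem 10 (Function.update
        (Function.update (σ.mem 10) (σ.reg 12) (σ.reg 10)) (σ.reg 12 + 1) (σ.reg 10))) 11
        (Function.update (Function.update (σ.mem 11) (σ.reg 12) (σ.reg 12 + 1))
          (σ.reg 12 + 1) (σ.reg 12)) } := ⟨_, rfl⟩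
  have hv : υ.val ops = σ.val ops :=
    State.val_congr (by rw [hυ]; simp) (by rw [hυ]; simp) (by rw [hυ])
  obtain ⟨m, hm, hwin⟩ := exec_setWin (ops := ops) (.reg 10) (.reg 12) (.add (.reg 12) (.lit 1)) υ
    (A := T₁.leaves) (B := T₂.leaves)
    (by
      have := (h.rep T₁ (by simp)).winOk
      rw [e1] at this
      rw [hv, hυ]
      simpa [Exp.eval] using this)
    (by
      have := (h.rep T₂ (by simp)).winOk
      rw [e2] at this
      rw [hv, hυ]
      simpa [Exp.eval] using this)
  rw [hv] at hwin
  rw [hυ] at hm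
  obtain ⟨τ, hτ⟩ : ∃ τ, τ = mergeStep.exec ops σ := ⟨_, rfl⟩
  have hτ' : τ = { σ with
      reg := Function.update (Function.update σ.reg 10 (σ.reg 10 + 1)) 12 (σ.reg 12 + 2)
      mem := Function.update (Function.update (Function.update σ.mem 10 (Function.update
        (Function.update (σ.mem 10) (σ.reg 12) (σ.reg 10)) (σ.reg 12 + 1) (σ.reg 10))) 11
        (Function.update (Function.update (σ.mem 11) (σ.reg 12) (σ.reg 12 + 1))
          (σ.reg 12 + 1) (σ.reg 12))) 12 (Function.update (σ.mem 12) (σ.reg 10) m) } := by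
    rw [hτ]
    simp only [mergeStep, Program.exec, Exp.eval]
    simp only [Function.update_self, Function.update_idem,
      Function.update_of_ne (show (11 : ℕ) ≠ 10 by decide)]
    rw [hm]
    simp [Exp.eval]
  rw [← hτ] at hL
  have r10 : τ.reg 10 = σ.reg 10 + 1 := by rw [hτ']; simp
  have r12 : τ.reg 12 = σ.reg 12 + 2 := by rw [hτ']; simp
  have m10 : τ.mem 10 = Function.update
      (Function.update (σ.mem 10) (σ.reg 12) (σ.reg 10)) (σ.reg 12 + 1) (σ.reg 10) := by
    rw [hτ']; simp
  have m11 : τ.mem 11 = Function.update (Function.update (σ.mem 11) (σ.reg 12) (σ.reg 12 + 1))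
      (σ.reg 12 + 1) (σ.reg 12) := by
    rw [hτ']; simp
  have m12 : τ.mem 12 = Function.update (σ.mem 12) (σ.reg 10) m := by rw [hτ']; simp
  have hval : τ.val ops = σ.val ops :=
    State.val_congr (by rw [hτ']; simp) (by rw [hτ']; simp) (by rw [hτ'])
  have hnd := h.nodup
  simp only [List.flatMap_cons, List.nodup_append'] at hnd
  obtain ⟨hnd1, ⟨hnd2, hndF, hd2⟩, hd1⟩ := hnd
  have hid1 : ∀ T ∈ T₁ :: T₂ :: F, σ.reg 12 ∉ T.inner := by
    intro T hT hi
    simp only [List.mem_cons] at hT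
    rcases hT with rfl | hT
    · rw [BT.ids, List.nodup_cons, e1] at hnd1
      exact hnd1.1 hi
    · have : σ.reg 12 ∈ (T₂ :: F).flatMap BT.ids :=
        List.mem_flatMap.2 ⟨T, by simpa using hT, List.mem_cons_of_mem _ hi⟩
      rw [List.flatMap_cons] at this
      exact hd1 (e1 ▸ T₁.id_mem_ids) this
  have hid2 : ∀ T ∈ T₁ :: T₂ :: F, σ.reg 12 + 1 ∉ T.inner := by
    intro T hT hi
    simp only [List.mem_cons] at hT
    rcases hT with rfl | rfl | hT
    · refine hd1 (List.mem_cons_of_mem _ hi) (List.mem_append_left _ ?_)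
      exact e2 ▸ T₂.id_mem_ids
    · rw [BT.ids, List.nodup_cons, e2] at hnd2
      exact hnd2.1 hi
    · exact hd2 (e2 ▸ T₂.id_mem_ids) (List.mem_flatMap.2 ⟨T, hT, List.mem_cons_of_mem _ hi⟩)
  have hrep : ∀ T ∈ T₁ :: T₂ :: F, Rep (τ.mem 10) (τ.mem 11) (τ.mem 12) (τ.val ops) T := by
    intro T hT
    refine (h.rep T hT).congr (fun i hi => ?_) (fun i hi => ?_) (fun i hi => ?_)
      fun i _ => by rw [hval]
    · rw [m10, Function.update_of_ne, Function.update_of_ne]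
      · rintro rfl; exact hid1 T hT hi
      · rintro rfl; exact hid2 T hT hi
    · rw [m11, Function.update_of_ne, Function.update_of_ne]
      · rintro rfl; exact hid1 T hT hi
      · rintro rfl; exact hid2 T hT hi
    · rw [m12, Function.update_of_ne]
      have := (h.range i (List.mem_flatMap.2 ⟨T, hT, hi⟩)).2
      omega
  have hflat : ∀ i, i ∈ (F ++ [BT.node (σ.reg 10) T₁ T₂]).flatMap BT.ids ↔
      i = σ.reg 10 ∨ i ∈ (T₁ :: T₂ :: F).flatMap BT.ids := by
    intro i
    simp only [List.flatMap_append, List.flatMap_cons, List.flatMap_nil, List.append_nil,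
      BT.ids_node, List.mem_append, List.mem_cons]
    tauto
  have ht : mergeStep.time ≤ 100 := by decide
  have hg : mergeStep.growth ≤ 20 := by decide
  refine ⟨τ, hL.mono ht hg, ⟨?_, ?_, ?_, ?_, ?_, ?_, ?_, ?_, ?_, ?_⟩, ?_⟩
  · rw [List.map_append, e3, List.length_append, r12, List.length_singleton, List.range'_concat]
    simp [BT.id, hnext]
    omega
  · rw [r10, r12, hnext, List.length_append, List.length_singleton]
    omega
  · intro T hT
    rcases List.mem_append.1 hT with hT | hT
    · exact hrep T (by simp [hT])
    · rw [List.mem_singleton] at hT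
      subst hT
      refine ⟨?_, ?_, ?_, ?_, ?_, hrep _ (by simp), hrep _ (by simp)⟩
      · rw [e1, m10, Function.update_of_ne (by omega), Function.update_self]
      · rw [e2, m10, Function.update_self]
      · rw [e1, e2, m11, Function.update_of_ne (by omega), Function.update_self]
      · rw [e1, e2, m11, Function.update_self]
      · rw [m12, Function.update_self, hval]
        exact hwin
  · intro i hi
    rw [r12] at hi
    rw [m10, Function.update_of_ne (by omega), Function.update_of_ne (by omega)]
    exact h.par i (by omega)
  · intro T hT
    rcases List.mem_append.1 hT with hT | hT
    · exact h.balanced T (by simp [hT])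
    · rw [List.mem_singleton] at hT
      subst hT
      exact ⟨h.balanced _ (by simp), h.balanced _ (by simp), h.close _ (by simp) _ (by simp),
        h.close _ (by simp) _ (by simp)⟩
  · have hs := h.sorted
    simp only [List.pairwise_cons, List.mem_cons] at hs
    obtain ⟨s1, s2, s3⟩ := hs
    rw [List.pairwise_append]
    refine ⟨s3, List.pairwise_singleton _ _, fun T hT T' hT' => ?_⟩
    rw [List.mem_singleton] at hT'
    subst hT'
    -- No tree is higher than the front one by more than one, and the new tree is higher than the
    -- front one by at least one.
    have := h.close T (by simp [hT]) T₁ (by simp)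
    simp only [BT.height]
    omega
  · have hs := h.sorted
    simp only [List.pairwise_cons, List.mem_cons] at hs
    obtain ⟨s1, s2, s3⟩ := hs
    have h12 := s1 T₂ (.inl rfl)
    intro T hT T' hT'
    rcases List.mem_append.1 hT with hT | hT <;> rcases List.mem_append.1 hT' with hT' | hT'
    · exact h.close T (by simp [hT]) T' (by simp [hT'])
    · rw [List.mem_singleton] at hT'
      subst hT'
      have := h.close T (by simp [hT]) T₁ (by simp)
      simp only [BT.height]
      omega
    · rw [List.mem_singleton] at hT
      subst hT
      have := s2 T' hT'
      simp only [BT.height]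
      omega
    · rw [List.mem_singleton] at hT hT'
      subst hT hT'
      omega
  · have hnew : σ.reg 10 ∉ (T₁ :: T₂ :: F).flatMap BT.ids := fun hmem => by
      have := (h.range _ hmem).2
      omega
    have hperm : ((F ++ [BT.node (σ.reg 10) T₁ T₂]).flatMap BT.ids).Perm
        (σ.reg 10 :: (T₁ :: T₂ :: F).flatMap BT.ids) := by
      simp only [List.flatMap_append, List.flatMap_cons, List.flatMap_nil, List.append_nil,
        BT.ids_node]
      refine List.perm_append_comm.trans ?_
      simp
    exact hperm.nodup_iff.2 (List.nodup_cons.2 ⟨hnew, h.nodup⟩)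
  · intro i hi
    rw [r10]
    rcases (hflat i).1 hi with rfl | hi
    · omega
    · have := h.range i hi
      omega
  · refine List.Perm.trans ?_ h.leaves
    simp only [List.flatMap_append, List.flatMap_cons, List.flatMap_nil, List.append_nil, BT.leaves]
    refine List.perm_append_comm.trans ?_
    simp
  · intro a i hi
    by_cases h10 : a = 10
    · rw [h10, m10, Function.update_of_ne (by omega), Function.update_of_ne (by omega)]
    by_cases h11 : a = 11
    · rw [h11, m11, Function.update_of_ne (by omega), Function.update_of_ne (by omega)]
    by_cases h12 : a = 12
    · rw [h12, m12, Function.update_of_ne (by omega)]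
    rw [hτ']
    simp [Function.update_of_ne, h10, h11, h12]

theorem mergeLoop_spec (h : Forest ops σ b L F) (hF : F ≠ []) :
    ∃ τ T, Leads ops mergeLoop σ τ (110 * F.length + 10) (21 * F.length) ∧ Forest ops τ b L [T] ∧
      ∀ a, ∀ i < b, τ.mem a i = σ.mem a i := by
  have hlin : mergeTest.linear = true := by decide
  have hcost : mergeTest.cost = 5 := by decide
  have hgrow : mergeTest.growth ≤ 1 := by decide
  induction hn : F.length generalizing σ F with
  | zero => exact absurd (List.length_eq_zero_iff.1 hn) hF
  | succ n ih =>
    match F, hF with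
    | [T], _ =>
      refine ⟨σ, T, (Leads.loop_false ?_ hlin).mono (by omega) (by omega), h, fun _ _ _ => rfl⟩
      have := h.next
      simp only [List.length_singleton] at this
      simp [mergeTest, Test.Holds, Exp.eval, this]
    | T₁ :: T₂ :: F, _ =>
      obtain ⟨σ', hL, h', hfr⟩ := h.step
      simp only [List.length_cons] at hn
      obtain ⟨τ, T, k1, k2, k3⟩ := ih h' (by simp) (by simp; omega)
      refine ⟨τ, T, (Leads.loop_true ?_ hlin hL k1).mono (by omega) (by omega), k2,
        fun a i hi => (k3 a i hi).trans (hfr a i hi)⟩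
      have := h.next
      simp only [List.length_cons] at this
      simp only [mergeTest, Test.Holds, Exp.eval]
      omega

end

/-! ### The trees of the nodes -/

section
variable {W : Type u} [LinearOrder W] {w : Multiset W → W} {ops : WeightOps W} {N : ℕ}
  {G : DAG N} {wt : Fin N × Fin N → W} {t u v : Fin N} {σ τ : State W} {Γ Γ' : Ghost N}
  {D D' : Finset (Fin N)} {g b : ℕ} {T : BT}

/-- `Core` depends on the entries of the node and of the heads of its edges only. -/
theorem Core.local_congr (h : Core w G wt t σ Γ D v g) (hent : Γ'.ent v = Γ.ent v)
    (hent' : ∀ f ∈ Γ.leaves v, Γ'.ent (Γ.head f) = Γ.ent (Γ.head f))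
    (hpath : ∀ z ∈ Γ.ent v, Γ'.path z = Γ.path z)
    (hpath' : ∀ f ∈ Γ.leaves v, ∀ z ∈ Γ.ent (Γ.head f), Γ'.path z = Γ.path z)
    (hleaves : Γ'.leaves v = Γ.leaves v) (hedge : ∀ f ∈ Γ.leaves v, Γ'.edge f = Γ.edge f)
    (hpos : ∀ f ∈ Γ.leaves v, Γ'.pos f = Γ.pos f) (h11 : σ.reg 11 ≤ τ.reg 11)
    (hw : ∀ z ∈ Γ.ent v, τ.wmem 1 z = σ.wmem 1 z)
    (h13 : ∀ f ∈ Γ.leaves v, τ.mem 13 f = σ.mem 13 f)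
    (h14 : ∀ f ∈ Γ.leaves v, τ.mem 14 f = σ.mem 14 f)
    (h15 : ∀ z ∈ Γ.ent v, τ.mem 15 z = σ.mem 15 z)
    (h16 : ∀ z ∈ Γ.ent v, τ.mem 16 z = σ.mem 16 z)
    (h17 : ∀ z ∈ Γ.ent v, τ.mem 17 z = σ.mem 17 z)
    (hD : v ∈ D' → v ∈ D)
    (hnew : v ∈ D' → ∀ e ∈ G.edges, e.1 = v → Γ'.ent e.2 ≠ [] → Γ.ent e.2 ≠ []) :
    Core w G wt t τ Γ' D' v g := by
  have hhead : ∀ f ∈ Γ.leaves v, Γ'.head f = Γ.head f := fun f hf => by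
    simp [Ghost.head, hedge f hf]
  have hpaths : Γ'.paths v = Γ.paths v := by
    rw [Ghost.paths, hent, List.map_congr_left hpath, Ghost.paths]
  have hpaths' : ∀ f ∈ Γ.leaves v, Γ'.paths (Γ.head f) = Γ.paths (Γ.head f) := fun f hf => by
    rw [Ghost.paths, hent' f hf, List.map_congr_left (hpath' f hf), Ghost.paths]
  constructor
  · rw [hent]; exact h.ent_ne
  · rw [hent]; exact fun z hz => (h.ent_lt z hz).trans_le h11
  · rw [hent]
    intro z hz
    rw [hpath z hz]
    exact h.isPath z hz
  · rw [hent]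
    intro z hz
    rw [hpath z hz, hw z hz]
    exact h.weight z hz
  · rw [hpaths]; exact h.nodup
  · rw [hpaths]; exact h.sorted
  · simp only [hent]
    intro i hi
    rw [h17 _ (List.getElem_mem hi)]
    exact h.link i hi
  · rw [hent, hleaves]
    intro hvt z hz
    obtain ⟨k1, k2, k3⟩ := h.sub hvt z hz
    rw [h15 z hz, h16 z hz, hpath z hz, hedge _ k1, hpath' _ k1 _ k3, hhead _ k1, hent' _ k1]
    exact ⟨k1, k2, k3⟩
  · rw [hent, hpaths]
    intro p hp hn z hz
    rw [hpath z hz]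
    exact h.min p hp hn z hz
  · rw [hleaves]; exact h.leaf_ne
  · rw [hleaves]
    intro f hf
    rw [h13 f hf, hedge f hf]
    exact h.leaf_edge f hf
  · rw [hleaves]
    intro f hf
    rw [hedge f hf]
    exact h.leaf_own f hf
  · rw [hleaves]
    intro f hf f' hf'
    rw [hedge f hf, hedge f' hf']
    exact h.leaf_inj f hf f' hf'
  · rw [hleaves]
    intro f hf
    rw [hpos f hf, hhead f hf, hent' f hf]
    exact h.leaf_pos f hf
  · rw [hleaves]
    intro f hf
    rw [hpos f hf, h14 f hf, hhead f hf, hent' f hf]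
    exact h.leaf_cur f hf
  · rw [hleaves]
    intro f hf
    rw [hpos f hf, hhead f hf, hent' f hf, hpaths' f hf]
    exact h.leaf_dead f hf
  · rw [hleaves]
    intro f hf
    simp only [hhead f hf, hent' f hf, hpaths]
    intro j hj
    rw [hpos f hf, hpath' f hf _ (List.getElem_mem hj), hedge f hf]
    exact h.gen f hf j hj
  · rw [hleaves, hent, List.map_congr_left hpos]; exact h.count
  · intro hv hvt e he hev hne
    obtain ⟨f, hf, rfl⟩ := h.complete (hD hv) hvt e he hev (hnew hv e he hev hne)
    exact ⟨f, hleaves ▸ hf, hedge f hf⟩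

/-- Processed sets are closed under edges, so no processed node has an edge to `u`; the first entry
of `u` therefore cannot miss a leaf. -/
theorem Inv.edge_ne_of_notMem (h : Inv w G wt t ops σ Γ D none) (hu : u ∉ D)
    {e : Fin N × Fin N} (he : e ∈ G.edges) (hD : e.1 ∈ insert u D) : e.2 ≠ u := by
  rcases Finset.mem_insert.1 hD with h1 | h1
  · exact G.head_ne he h1
  · exact fun h2 => hu (h2 ▸ h.closed e he h1)

theorem Inv.closed_insert (h : Inv w G wt t ops σ Γ D none)
    (hcl : ∀ e ∈ G.edges, e.1 = u → e.2 ∈ D) :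
    ∀ e ∈ G.edges, e.1 ∈ insert u D → e.2 ∈ insert u D := by
  intro e he h1
  refine Finset.mem_insert_of_mem ?_
  rcases Finset.mem_insert.1 h1 with h1 | h1
  exacts [hcl e he h1, h.closed e he h1]

/-- A node without a path to `t` is processed. -/
theorem Inv.insert_dead (h : Inv w G wt t ops σ Γ D none) (hu : u ∉ D) (hut : u ≠ t)
    (hcl : ∀ e ∈ G.edges, e.1 = u → e.2 ∈ D)
    (hdead : ∀ e ∈ G.edges, e.1 = u → Γ.ent e.2 = []) :
    Inv w G wt t ops σ Γ (insert u D) none where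
  __ := h
  closed := h.closed_insert hcl
  nonempty := fun v hv _ p hp => by
    rcases Finset.mem_insert.1 hv with rfl | hv
    · obtain ⟨e, q, rfl, he, hev, hq⟩ := hp.exists_cons hut
      exact absurd (hdead e he hev) (h.nonempty _ (hcl e he hev) (by simp) q hq)
    · exact h.nonempty v hv (by simp) p hp
  out := fun v hv => h.out v fun hv' => hv (Finset.mem_insert_of_mem hv')
  core := fun v =>
    { h.core v with
      complete := fun hv hvt e he hev hne => by
        rcases Finset.mem_insert.1 hv with rfl | hv
        · exact absurd (hdead e he hev) hne
        · exact (h.core v).complete hv hvt e he hev hne }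

/-- The target is processed. -/
theorem Inv.insert_target {z : ℕ} (hC : ops.Computes w) (h : Inv w G wt t ops σ Γ D none)
    (ht : t ∉ D) (hcl : ∀ e ∈ G.edges, e.1 = t → e.2 ∈ D) (hz : z = σ.reg 11)
    (hreg : τ.reg 11 = z + 1) (hr10 : τ.reg 10 = σ.reg 10)
    (hmem : ∀ a, a = 0 ∨ a = 1 ∨ a = 8 ∨ (10 ≤ a ∧ a ≤ 14) ∨ a = 16 ∨ a = 17 →
      τ.mem a = σ.mem a)
    (h15 : τ.mem 15 = Function.update (σ.mem 15) z 0)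
    (hw0 : τ.wmem 0 = σ.wmem 0) (hw1 : τ.wmem 1 = Function.update (σ.wmem 1) z ops.empty) :
    Inv w G wt t ops τ { Γ with
      ent := Function.update Γ.ent t [z]
      path := Function.update Γ.path z [] } (insert t D) none := by
  have hpos := h.pos
  have hzold : ∀ u, ∀ y ∈ Γ.ent u, y ≠ z := by
    intro u y hy
    have := (h.core u).ent_lt y hy
    omega
  have hte : Γ.ent t = [] := (h.out t ht).1
  have hwin : ∀ u : Fin N, winner τ u = winner σ u := fun u => by
    rw [winner, winner, hmem 8 (by simp), hmem 12 (by simp)]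
  have hwt : winner σ t = 0 := by
    rw [winner, h.tree_none t h.tree_t, h.win_zero]
  have hltt : Γ.leaves t = [] := Ghost.leaves_none h.tree_t
  -- A leaf towards the empty list of `t` would be exhausted, so that the empty path would have to
  -- be listed there.
  have hhead : ∀ v, ∀ f ∈ Γ.leaves v, Γ.head f ≠ t := by
    intro v f hf heq
    have h1 := (h.core v).leaf_pos f hf
    rw [heq, hte] at h1
    have h2 := (h.core v).leaf_dead f hf (by rw [heq, hte]; simpa using h1) []
      (by rw [heq]; exact rfl)
    rw [heq, Ghost.paths, hte] at h2
    simp at h2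
  have hval : ∀ u, ∀ f ∈ Γ.leaves u, τ.val ops f = σ.val ops f := by
    intro u f hf
    simp only [State.val, hmem 13 (by simp), hmem 14 (by simp), hw0]
    split
    · rfl
    · next hc =>
      have hlt := (h.core u).cur_mem hf hc
      have hcur := (h.core u).cur_eq hf hlt
      rw [hw1, Function.update_of_ne (hzold _ _ (by rw [hcur]; exact List.getElem_mem hlt))]
  set Γ' : Ghost N := { Γ with
      ent := Function.update Γ.ent t [z]
      path := Function.update Γ.path z [] } with hΓ'
  have hent : ∀ v, v ≠ t → Γ'.ent v = Γ.ent v := fun v hv => by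
    simp [hΓ', Function.update_of_ne hv]
  have hentt : Γ'.ent t = [z] := by simp [hΓ']
  have hpath : ∀ u, ∀ y ∈ Γ.ent u, Γ'.path y = Γ.path y := fun u y hy => by
    simp [hΓ', Function.update_of_ne (hzold u y hy)]
  have hpathz : Γ'.path z = [] := by simp [hΓ']
  constructor
  · rw [hw0]; exact h.wt_eq
  · rw [hmem 0 (by simp)]; exact h.src_eq
  · rw [hmem 1 (by simp)]; exact h.dst_eq
  · exact h.closed_insert hcl
  · intro v hv _ p hp
    rcases Finset.mem_insert.1 hv with rfl | hv'
    · rw [hentt]; simp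
    · rw [hent v fun hvt => ht (hvt ▸ hv')]
      exact h.nonempty v hv' (by simp) p hp
  · intro i hi
    rw [hmem 17 (by simp)]
    exact h.fresh i (by omega)
  · omega
  · rw [hentt]; simp
  · rw [hentt]
    intro y hy
    rw [List.mem_singleton.1 hy, h15, Function.update_self]
  · intro v hv
    rw [Finset.mem_insert, not_or] at hv
    rw [hent v hv.1]
    exact h.out v hv.2
  · exact h.tree_t
  · rw [hmem 8 (by simp)]; exact h.tree_none
  · exact h.rot_none
  · rw [hmem 12 (by simp)]; exact h.win_zero
  · intro v T hT
    change Γ.tree v = some T at hT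
    exact (h.tree_ok v T hT).congr (by rw [hmem 8 (by simp)]) (fun i _ => by rw [hmem 10 (by simp)])
      (fun i _ => by rw [hmem 11 (by simp)]) (fun i _ => by rw [hmem 12 (by simp)])
      (fun f hf => hval v f (by rwa [Ghost.leaves_eq hT])) hr10.ge rfl fun _ _ => rfl
  · exact h.disj
  · intro v
    simp only [reduceCtorEq, if_false, hwin]
    by_cases hvt : v = t
    · subst hvt
      rw [hwt]
      have hnl : ∀ f, f ∉ Γ'.leaves v := fun f hf => by
        rw [show f ∈ Γ'.leaves v ↔ f ∈ Γ.leaves v from Iff.rfl, hltt] at hf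
        simp at hf
      have hp : Γ'.paths v = [[]] := by simp [Ghost.paths, hentt, hpathz]
      constructor
      · rw [hentt]; simp only [List.mem_singleton]; rintro y rfl; omega
      · rw [hentt]; simp only [List.mem_singleton]; rintro y rfl; omega
      · rw [hentt]; simp only [List.mem_singleton]; rintro y rfl; rw [hpathz]; exact rfl
      · rw [hentt]
        simp only [List.mem_singleton]
        rintro y rfl
        rw [hpathz, hw1, Function.update_self, hC.empty_eq, pathWeight_nil]
      · rw [hp]; simp
      · rw [hp]; simp
      · rw [hentt]
        simp only [List.length_singleton]
        intro i hi
        obtain rfl : i = 0 := by omega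
        rw [hmem 17 (by simp)]
        simpa using h.fresh z hz.ge
      · exact fun hvv => absurd rfl hvv
      · intro p hp' hn
        rw [hp'.eq_nil, hp] at hn
        simp at hn
      · exact fun f hf => absurd hf (hnl f)
      · exact fun f hf => absurd hf (hnl f)
      · exact fun f hf => absurd hf (hnl f)
      · exact fun f hf => absurd hf (hnl f)
      · exact fun f hf => absurd hf (hnl f)
      · exact fun f hf => absurd hf (hnl f)
      · exact fun f hf => absurd hf (hnl f)
      · exact fun f hf => absurd hf (hnl f)
      · exact fun hvv => absurd rfl hvv
      · exact fun _ hvv => absurd rfl hvv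
    · have hcv := h.core v
      simp only [reduceCtorEq, if_false] at hcv
      refine hcv.local_congr (hent v hvt) (fun f hf => hent _ (hhead v f hf)) (hpath v)
        (fun f _ => hpath _) rfl (fun _ _ => rfl) (fun _ _ => rfl) (by omega)
        (fun y hy => by rw [hw1, Function.update_of_ne (hzold v y hy)])
        (fun f _ => by rw [hmem 13 (by simp)]) (fun f _ => by rw [hmem 14 (by simp)])
        (fun y hy => by rw [h15, Function.update_of_ne (hzold v y hy)])
        (fun y _ => by rw [hmem 16 (by simp)]) (fun y _ => by rw [hmem 17 (by simp)])
        (fun hv => (Finset.mem_insert.1 hv).resolve_left hvt) fun hv e he hev hne => ?_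
      rwa [hent _ (h.edge_ne_of_notMem ht he (hev ▸ hv))] at hne

/-- A node gets its tree. -/
theorem Inv.attach (h : Inv w G wt t ops σ Γ D none) (hu : u ∉ D) (hut : u ≠ t)
    (hcl : ∀ e ∈ G.edges, e.1 = u → e.2 ∈ D) (hp0 : ∀ f, Γ.pos f = 0)
    (hb : b = σ.reg 10) (hb1 : 1 ≤ b) (hr10 : b ≤ τ.reg 10) (hr11 : τ.reg 11 = σ.reg 11)
    (hmem : ∀ a, a = 0 ∨ a = 1 ∨ (15 ≤ a ∧ a ≤ 17) → τ.mem a = σ.mem a)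
    (hwm : τ.wmem = σ.wmem) (h8 : τ.mem 8 = Function.update (σ.mem 8) u T.id)
    (hlow : ∀ a, ∀ i < b, 10 ≤ a → τ.mem a i = σ.mem a i)
    (hrep : Rep (τ.mem 10) (τ.mem 11) (τ.mem 12) (τ.val ops) T) (hpar : τ.mem 10 T.id = 0)
    (hnd : T.ids.Nodup) (hids : ∀ i ∈ T.ids, b ≤ i ∧ i < τ.reg 10) (hbal : T.Balanced)
    (hl : ∀ f ∈ T.leaves, ∃ e, G.edges[τ.mem 13 f]? = some e ∧ e.1 = u ∧ Γ.ent e.2 ≠ [] ∧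
      τ.mem 14 f = (Γ.ent e.2).getD 0 0)
    (hinj : ∀ f ∈ T.leaves, ∀ f' ∈ T.leaves, τ.mem 13 f = τ.mem 13 f' → f = f')
    (hall : ∀ i e, G.edges[i]? = some e → e.1 = u → Γ.ent e.2 ≠ [] →
      ∃ f ∈ T.leaves, τ.mem 13 f = i) :
    Inv w G wt t ops τ { Γ with
      tree := Function.update Γ.tree u (some T)
      edge := fun f => if f < b then Γ.edge f else (G.edges[τ.mem 13 f]?).getD (Γ.edge f) }
      (insert u D) (some u) := by
  set Γ' : Ghost N := { Γ with
      tree := Function.update Γ.tree u (some T)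
      edge := fun f => if f < b then Γ.edge f else (G.edges[τ.mem 13 f]?).getD (Γ.edge f) } with hΓ'
  -- Tree nodes are allocated in increasing order: all older trees lie below `b`, and the new one
  -- lies above.
  have hold : ∀ v T, Γ.tree v = some T → ∀ i ∈ T.ids, i < b := fun v T hT i hi =>
    hb ▸ (h.tree_ok v T hT).lt i hi
  have hlold : ∀ v, ∀ f ∈ Γ.leaves v, f < b := by
    intro v f hf
    cases hT : Γ.tree v with
    | none => rw [Ghost.leaves_none hT] at hf; simp at hf
    | some T =>
      rw [Ghost.leaves_eq hT] at hf
      exact hold v T hT f (TreeOk.leaf_mem_ids hf)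
  have htu : Γ.tree u = none := (h.out u hu).2
  have heu : Γ.ent u = [] := (h.out u hu).1
  have htree : Γ'.tree u = some T := by simp [hΓ']
  have htree' : ∀ v, v ≠ u → Γ'.tree v = Γ.tree v := fun v hv => by
    simp [hΓ', Function.update_of_ne hv]
  have hlv' : ∀ v, v ≠ u → Γ'.leaves v = Γ.leaves v := fun v hv => by
    rw [Ghost.leaves, Ghost.leaves, htree' v hv]
  have hlu : Γ'.leaves u = T.leaves := Ghost.leaves_eq htree
  have hval : ∀ v, ∀ f ∈ Γ.leaves v, τ.val ops f = σ.val ops f := by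
    intro v f hf
    have := hlold v f hf
    simp only [State.val, hlow 13 f this (by simp), hlow 14 f this (by simp), hwm]
  have hwin : ∀ v, v ≠ u → winner τ v = winner σ v := by
    intro v hv
    rw [winner, winner, h8, Function.update_of_ne (fun heq => hv (Fin.ext heq))]
    cases hT : Γ.tree v with
    | none => rw [h.tree_none v hT, hlow 12 0 (by omega) (by simp)]
    | some T =>
      rw [(h.tree_ok v T hT).root, hlow 12 _ (hold v T hT _ T.id_mem_ids) (by simp)]
  have hedge : ∀ f ∈ T.leaves, G.edges[τ.mem 13 f]? = some (Γ'.edge f) ∧ (Γ'.edge f).1 = u ∧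
      Γ.ent (Γ'.edge f).2 ≠ [] ∧ τ.mem 14 f = (Γ.ent (Γ'.edge f).2).getD 0 0 := by
    intro f hf
    obtain ⟨e, he, k⟩ := hl f hf
    have : Γ'.edge f = e := by
      have := (hids f (TreeOk.leaf_mem_ids hf)).1
      simp [hΓ', he, not_lt.2 this]
    rw [this]
    exact ⟨he, k⟩
  have hne0 : ∀ f ∈ T.leaves, f ≠ 0 := fun f hf => by
    have := (hids f (TreeOk.leaf_mem_ids hf)).1
    omega
  constructor
  · rw [hwm]; exact h.wt_eq
  · rw [hmem 0 (by simp)]; exact h.src_eq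
  · rw [hmem 1 (by simp)]; exact h.dst_eq
  · exact h.closed_insert hcl
  · intro v hv hvu p hp
    exact h.nonempty v ((Finset.mem_insert.1 hv).resolve_left (by simpa using hvu)) (by simp) p hp
  · rw [hr11, hmem 17 (by simp)]; exact h.fresh
  · rw [hr11]; exact h.pos
  · exact h.t_ent
  · rw [hmem 15 (by simp)]; exact h.t_leaf
  · intro v hv
    rw [Finset.mem_insert, not_or] at hv
    rw [htree' v hv.1]
    exact h.out v hv.2
  · rw [htree' t hut.symm]; exact h.tree_t
  · intro v hv
    have hvu : v ≠ u := by
      rintro rfl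
      rw [htree] at hv
      simp at hv
    rw [htree' v hvu] at hv
    rw [h8, Function.update_of_ne (fun heq => hvu (Fin.ext heq))]
    exact h.tree_none v hv
  · intro v hv
    have hvu : v ≠ u := by
      rintro rfl
      rw [htree] at hv
      simp at hv
    rw [htree' v hvu] at hv
    exact h.rot_none v hv
  · rw [hlow 12 0 (by omega) (by simp)]; exact h.win_zero
  · intro v U hU
    by_cases hvu : v = u
    · subst hvu
      obtain rfl : T = U := by rw [htree] at hU; exact Option.some.inj hU
      refine ⟨by rw [h8, Function.update_self], hrep, hpar, List.nodup_cons.2 ⟨fun h0 => ?_, hnd⟩,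
        fun i hi => (hids i hi).2, fun w hw => ?_⟩
      · have := (hids 0 h0).1
        omega
      · have h1 := hbal.pot_le hw
        have h2 := BT.one_le_mass hw T
        have h3 : (Γ'.rot v : ℝ) = 0 := by
          rw [show Γ'.rot v = Γ.rot v from rfl, h.rot_none v htu, Nat.cast_zero]
        have h4 : (T.leaves.map fun f => (Γ'.pos f : ℝ) *
            (Real.log (T.mass w) - Real.log (w f))).sum = 0 := by
          refine List.sum_eq_zero fun x hx => ?_
          obtain ⟨f, -, rfl⟩ := List.mem_map.1 hx
          rw [show Γ'.pos f = Γ.pos f from rfl, hp0 f, Nat.cast_zero, zero_mul]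
        have h5 : (0 : ℝ) ≤ 1 / 2 ^ T.height := by positivity
        have h6 : (0 : ℝ) ≤ T.leaves.length := by positivity
        have h7 : (0 : ℝ) ≤ T.height := by positivity
        rw [h3, h4]
        nlinarith
    · rw [htree' v hvu] at hU
      have hlt := hold v U hU
      exact (h.tree_ok v U hU).congr
        (by rw [h8, Function.update_of_ne (fun heq => hvu (Fin.ext heq))])
        (fun i hi => hlow 10 i (hlt i hi) (by simp)) (fun i hi => hlow 11 i (hlt i hi) (by simp))
        (fun i hi => hlow 12 i (hlt i hi) (by simp))
        (fun f hf => hval v f (by rwa [Ghost.leaves_eq hU])) (hb ▸ hr10) rfl fun _ _ => rfl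
  · intro v v' U U' hU hU' i hi hi'
    by_cases hvu : v = u
    · subst hvu
      obtain rfl : T = U := by rw [htree] at hU; exact Option.some.inj hU
      by_contra hne
      rw [htree' v' (Ne.symm hne)] at hU'
      have := hold v' U' hU' i hi'
      have := (hids i hi).1
      omega
    · rw [htree' v hvu] at hU
      by_cases hvu' : v' = u
      · subst hvu'
        obtain rfl : T = U' := by rw [htree] at hU'; exact Option.some.inj hU'
        have := hold v U hU i hi
        have := (hids i hi').1
        omega
      · rw [htree' v' hvu'] at hU'
        exact h.disj v v' U U' hU hU' i hi hi'
  · intro v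
    by_cases hvu : v = u
    · subst hvu
      rw [if_pos rfl]
      have hev : Γ'.ent v = [] := heu
      have hpv : Γ'.paths v = [] := by simp [Ghost.paths, hev]
      have hp0' : ∀ f, Γ'.pos f = 0 := hp0
      constructor
      · simp [hev]
      · simp [hev]
      · simp [hev]
      · simp [hev]
      · simp [hpv]
      · simp [hpv]
      · simp [hev]
      · simp [hev]
      · simp [hev]
      · rw [hlu]; exact hne0
      · rw [hlu]; exact fun f hf => (hedge f hf).1
      · rw [hlu]; exact fun f hf => (hedge f hf).2.1
      · rw [hlu]
        intro f hf f' hf' heq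
        refine hinj f hf f' hf' ?_
        have h1 := (hedge f hf).1
        have h2 := (hedge f' hf').1
        rw [heq, ← h2] at h1
        have h3 : τ.mem 13 f < G.edges.length := by
          by_contra h3
          rw [List.getElem?_eq_none (by omega)] at h1
          rw [← h1] at h2
          simp at h2
        exact (List.getElem?_inj h3 G.nodup).1 h1
      · intro f _; rw [hp0']; omega
      · rw [hlu]
        intro f hf
        rw [hp0']
        exact (hedge f hf).2.2.2
      · rw [hlu]
        intro f hf h0
        rw [hp0'] at h0
        exact absurd (List.length_eq_zero_iff.1 h0.symm) (hedge f hf).2.2.1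
      · rw [hlu]
        intro f hf j hj
        have := hne0 f hf
        rw [hpv, hp0']
        simp
        omega
      · intro _
        rw [hev, List.map_congr_left fun f _ => hp0' f]
        simp
      · intro _ _ e he hev' hne
        obtain ⟨i, hi⟩ := List.mem_iff_getElem?.1 he
        obtain ⟨f, hf, hfi⟩ := hall i e hi hev' hne
        refine ⟨f, hlu ▸ hf, ?_⟩
        have h1 := (hedge f hf).1
        rw [hfi, hi] at h1
        exact (Option.some.inj h1).symm
    · rw [if_neg (by simpa using hvu), hwin v hvu]
      have hcv := h.core v
      simp only [reduceCtorEq, if_false] at hcv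
      exact hcv.local_congr rfl (fun _ _ => rfl) (fun _ _ => rfl) (fun _ _ _ _ => rfl) (hlv' v hvu)
        (fun f hf => by simp [hΓ', hlold v f hf]) (fun _ _ => rfl) hr11.ge
        (fun _ _ => by rw [hwm]) (fun f hf => hlow 13 f (hlold v f hf) (by simp))
        (fun f hf => hlow 14 f (hlold v f hf) (by simp)) (fun _ _ => by rw [hmem 15 (by simp)])
        (fun _ _ => by rw [hmem 16 (by simp)]) (fun _ _ => by rw [hmem 17 (by simp)])
        (fun hv => (Finset.mem_insert.1 hv).resolve_left hvu) fun _ _ _ _ hne => hne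

end

/-! ### Processing of a node -/

/-- `l` is the list of the indices, increased by one, from `h` on. -/
def Linked (nxt : ℕ → ℕ) : ℕ → List ℕ → Prop
  | h, [] => h = 0
  | h, i :: l => h = i + 1 ∧ Linked nxt (nxt i) l

theorem Linked.congr {nxt nxt' : ℕ → ℕ} {h : ℕ} {l : List ℕ} (hl : Linked nxt h l)
    (hn : ∀ i ∈ l, nxt' i = nxt i) : Linked nxt' h l := by
  induction l generalizing h with
  | nil => exact hl
  | cons i l ih =>
    refine ⟨hl.1, ?_⟩
    rw [hn i (by simp)]
    exact ih hl.2 fun j hj => hn j (by simp [hj])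

/-- Create the leaf for an edge whose index, increased by one, is in register `8`. -/
def leafStep : Program :=
  .assign 9 (.sub (.reg 8) (.lit 1)) ⟫ .store 13 (.reg 10) (.reg 9) ⟫
  .store 14 (.reg 10) (.cell 9 (.cell 1 (.reg 9))) ⟫ .store 12 (.reg 10) (.reg 10) ⟫
  .assign 10 (.add (.reg 10) (.lit 1)) ⟫ .assign 8 (.cell 7 (.reg 9))

def listTest : Test := .neg (.eq (.reg 8) (.lit 0))

def leafLoop : Program := .loop listTest leafStep

def attachRoot : Program :=
  .store 8 (.reg 7) (.reg 12) ⟫ .assign 13 (.cell 12 (.reg 12)) ⟫ newEntry ⟫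
  .store 9 (.reg 7) (.sub (.reg 11) (.lit 1))

def makeTree : Program :=
  (.assign 8 (.cell 6 (.reg 7)) ⟫ .assign 12 (.reg 10)) ⟫ leafLoop ⟫ mergeLoop ⟫
  .branch (.lt (.reg 12) (.reg 10)) attachRoot .skip

def makeTarget : Program :=
  .store 15 (.reg 11) (.lit 0) ⟫ .wstore 1 (.reg 11) .empty ⟫ .store 9 (.reg 7) (.reg 11) ⟫
  .assign 11 (.add (.reg 11) (.lit 1))

def makeNode : Program := .branch (.eq (.reg 7) (.reg 3)) makeTarget makeTree

section
variable {W : Type u} [LinearOrder W] {w : Multiset W → W} {ops : WeightOps W} {N : ℕ}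
  {G : DAG N} {wt : Fin N × Fin N → W} {t u v : Fin N} {σ τ : State W} {Γ Γ' : Ghost N}
  {D : Finset (Fin N)} {l : List ℕ}

theorem leafLoop_spec (hl : Linked (σ.mem 7) (σ.reg 8) l) :
    ∃ τ, Leads ops leafLoop σ τ (40 * l.length + 10) (5 * l.length) ∧
      τ.reg 10 = σ.reg 10 + l.length ∧
      (∀ i (h : i < l.length), τ.mem 13 (σ.reg 10 + i) = l[i] ∧
        τ.mem 14 (σ.reg 10 + i) = σ.mem 9 (σ.mem 1 l[i]) ∧
        τ.mem 12 (σ.reg 10 + i) = σ.reg 10 + i) ∧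
      ∀ a, ∀ i < σ.reg 10, τ.mem a i = σ.mem a i := by
  have hlin : listTest.linear = true := by decide
  have hcost : listTest.cost = 4 := by decide
  have hgrow : listTest.growth = 0 := by decide
  induction l generalizing σ with
  | nil =>
    refine ⟨σ, (Leads.loop_false ?_ hlin).mono (by omega) (by omega), rfl, by simp,
      fun _ _ _ => rfl⟩
    have h0 : σ.reg 8 = 0 := hl
    simp [listTest, Test.Holds, Exp.eval, h0]
  | cons e l ih =>
    obtain ⟨h8, hl⟩ := hl
    have hL := Leads.exec (ops := ops) leafStep (by decide) σ
    obtain ⟨υ, hυ⟩ : ∃ υ, υ = leafStep.exec ops σ := ⟨_, rfl⟩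
    rw [← hυ] at hL
    have r8 : υ.reg 8 = σ.mem 7 e := by rw [hυ]; simp [leafStep, Program.exec, Exp.eval, h8]
    have r10 : υ.reg 10 = σ.reg 10 + 1 := by rw [hυ]; simp [leafStep, Program.exec, Exp.eval]
    have m13 : υ.mem 13 = Function.update (σ.mem 13) (σ.reg 10) e := by
      rw [hυ]; simp [leafStep, Program.exec, Exp.eval, h8]
    have m14 : υ.mem 14 = Function.update (σ.mem 14) (σ.reg 10) (σ.mem 9 (σ.mem 1 e)) := by
      rw [hυ]; simp [leafStep, Program.exec, Exp.eval, h8]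
    have m12 : υ.mem 12 = Function.update (σ.mem 12) (σ.reg 10) (σ.reg 10) := by
      rw [hυ]; simp [leafStep, Program.exec, Exp.eval]
    have mo : ∀ a, a ≠ 12 → a ≠ 13 → a ≠ 14 → υ.mem a = σ.mem a := fun a h1 h2 h3 =>
      hL.frame_mem a (by simp [leafStep, Program.arrays, h1, h2, h3])
    have hlow : ∀ a, ∀ i < σ.reg 10, υ.mem a i = σ.mem a i := by
      intro a i hi
      by_cases h1 : a = 12
      · rw [h1, m12, Function.update_of_ne (by omega)]
      by_cases h2 : a = 13
      · rw [h2, m13, Function.update_of_ne (by omega)]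
      by_cases h3 : a = 14
      · rw [h3, m14, Function.update_of_ne (by omega)]
      rw [mo a h1 h2 h3]
    obtain ⟨τ, k1, k2, k3, k4⟩ := ih (σ := υ) (by
      rw [mo 7 (by simp) (by simp) (by simp), r8]; exact hl)
    have ht : leafStep.time ≤ 30 := by decide
    have hg : leafStep.growth ≤ 5 := by decide
    refine ⟨τ, (Leads.loop_true ?_ hlin hL k1).mono (by rw [List.length_cons]; omega)
      (by rw [List.length_cons]; omega), by rw [k2, r10, List.length_cons]; omega, ?_,
      fun a i hi => (k4 a i (by omega)).trans (hlow a i hi)⟩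
    · simp [listTest, Test.Holds, Exp.eval, h8]
    · intro i hi
      cases i with
      | zero =>
        simp only [add_zero, List.getElem_cons_zero]
        rw [k4 13 _ (by omega), k4 14 _ (by omega), k4 12 _ (by omega), m13, m14, m12]
        simp
      | succ i =>
        have := k3 i (by simpa using hi)
        rw [r10, mo 9 (by simp) (by simp) (by simp), mo 1 (by simp) (by simp) (by simp)] at this
        rw [show σ.reg 10 + (i + 1) = σ.reg 10 + 1 + i by omega]
        simpa using this

/-- The leaves made by `leafLoop` form a forest. -/
theorem forest_leaves {b n : ℕ} (hb : b ≠ 0) (h12 : σ.reg 12 = b) (h10 : σ.reg 10 = b + n)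
    (hpar : ∀ i, b ≤ i → σ.mem 10 i = 0)
    (hwin : ∀ i < n, σ.mem 12 (b + i) = b + i) (hcur : ∀ i < n, σ.mem 14 (b + i) ≠ 0) :
    Forest ops σ b (List.range' b n) ((List.range' b n).map BT.leaf) where
  roots := by
    rw [List.map_map, List.length_map, List.length_range', h12]
    exact List.map_id _
  next := by rw [h10, h12, List.length_map, List.length_range']
  rep := by
    intro T hT
    obtain ⟨i, hi, rfl⟩ := List.mem_map.1 hT
    obtain ⟨j, hj, rfl⟩ := List.mem_range'.1 hi
    have h1 := hwin j hj
    have h2 := hcur j hj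
    simp only [one_mul] at h1 h2 ⊢
    rw [Rep, h1]
    exact .inr ⟨by omega, by simp, by simp [State.val, h2], by simp⟩
  par := h12 ▸ hpar
  balanced := by
    intro T hT
    obtain ⟨i, -, rfl⟩ := List.mem_map.1 hT
    trivial
  sorted := by
    rw [List.pairwise_map]
    exact List.pairwise_iff_getElem.2 fun _ _ _ _ _ => le_rfl
  close := by
    intro T hT T' hT'
    obtain ⟨i, -, rfl⟩ := List.mem_map.1 hT
    simp [BT.height]
  nodup := by
    have : ((List.range' b n).map BT.leaf).flatMap BT.ids = List.range' b n := by
      rw [List.flatMap_map]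
      simp [BT.ids_leaf]
    rw [this]
    exact List.nodup_range'
  range := by
    have : ((List.range' b n).map BT.leaf).flatMap BT.ids = List.range' b n := by
      rw [List.flatMap_map]
      simp [BT.ids_leaf]
    rw [this]
    intro i hi
    have := List.mem_range'_1.1 hi
    omega
  leaves := by
    rw [List.flatMap_map]
    simp [BT.leaves]

theorem attachRoot_spec (hC : ops.Computes w) (hw : SubsetMonotone w)
    (h : Inv w G wt t ops σ Γ (insert u D) (some u)) (hut : u ≠ t) (hu : Γ.ent u = [])
    (hne : winner σ u ≠ 0) (hnew : ∀ e ∈ G.edges, e.1 ∈ insert u D → e.2 ≠ u)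
    (h13 : σ.reg 13 = winner σ u) (h7 : σ.reg 7 = u) :
    ∃ τ Γ', Leads ops (newEntry ⟫ .store 9 (.reg 7) (.sub (.reg 11) (.lit 1))) σ τ 40 4 ∧
      Inv w G wt t ops τ Γ' (insert u D) none ∧ Γ'.pos = Γ.pos ∧ Γ'.rot = Γ.rot ∧
      Γ'.ent = Function.update Γ.ent u [σ.reg 11] ∧
      τ.mem 9 = Function.update (σ.mem 9) u (σ.reg 11) := by
  obtain ⟨c, hc⟩ : ∃ c, c = (newEntry ⟫ .store 9 (.reg 7) (.sub (.reg 11) (.lit 1))) := ⟨_, rfl⟩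
  have hL := Leads.exec (ops := ops) c (by rw [hc]; decide) σ
  obtain ⟨τ, hτ⟩ : ∃ τ, τ = c.exec ops σ := ⟨_, rfl⟩
  rw [← hτ] at hL
  obtain ⟨g, hg⟩ : ∃ g, winner σ u = g := ⟨_, rfl⟩
  obtain ⟨z, hz⟩ : ∃ z, z = σ.reg 11 := ⟨_, rfl⟩
  rw [hg] at h13 hne
  have key : τ = c.exec ops σ := hτ
  simp only [hc, newEntry, Program.exec, Exp.eval] at key
  have k10 : τ.reg 10 = σ.reg 10 := hL.frame_reg 10 (by rw [hc]; decide)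
  have k11 : τ.reg 11 = z + 1 := by rw [key]; simp [hz]
  have k15 : τ.mem 15 = Function.update (σ.mem 15) z g := by rw [key]; simp [hz, h13]
  have k16 : τ.mem 16 = Function.update (σ.mem 16) z (σ.mem 14 g) := by
    rw [key]; simp [hz, h13]
  have k9 : τ.mem 9 = Function.update (σ.mem 9) u z := by rw [key]; simp [hz, h7]
  have kw0 : τ.wmem 0 = σ.wmem 0 := by rw [key]; simp
  have kw1 : τ.wmem 1 = Function.update (σ.wmem 1) z (ops.combine
      (ops.single (σ.wmem 0 (σ.mem 13 g))) (σ.wmem 1 (σ.mem 14 g))) := by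
    rw [key]; simp [hz, h13, keyExp, WExp.eval, Exp.eval]
  have ko : ∀ a, a ≠ 15 → a ≠ 16 → a ≠ 9 → τ.mem a = σ.mem a := fun a h1 h2 h3 =>
    hL.frame_mem a (by simp [hc, newEntry, Program.arrays, h1, h2, h3])
  clear key
  have hgl : g ∈ Γ.leaves u ∧ σ.mem 14 g ≠ 0 := by
    have := h.winOk u
    rw [hg] at this
    rcases this with hW | hW
    · exact absurd hW.1 hne
    · exact ⟨hW.2.1, fun hc => hW.2.2.1 (by simp [State.val, hc])⟩
  set Γ2 : Ghost N := { Γ with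
    ent := Function.update Γ.ent u (Γ.ent u ++ [z])
    path := Function.update Γ.path z (Γ.edge g :: Γ.path (σ.mem 14 g)) } with hΓ2
  have hE : Extends σ τ Γ Γ2 u g z :=
    { mem15 := k15
      mem16 := k16
      wmem := fun i hi => by rw [kw1, Function.update_of_ne hi]
      link := fun i _ => by rw [ko 17 (by simp) (by simp) (by simp)]
      ent := rfl
      path := rfl
      mem13 := ko 13 (by simp) (by simp) (by simp)
      mem14 := ko 14 (by simp) (by simp) (by simp)
      reg11 := by omega
      edge := rfl
      pos := rfl
      leaves := rfl }
  have ht : c.time ≤ 40 := by rw [hc]; decide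
  have hgr : c.growth ≤ 4 := by rw [hc]; decide
  refine ⟨τ, Γ2, hc ▸ hL.mono ht hgr, ?_, rfl, rfl, ?_, by rw [k9, hz]⟩
  · refine h.create hC hw (Finset.mem_insert_self _ _) hut hg hne hE hz k11 ?_ ?_
      (fun _ => hnew) k10 (fun a ha => ko a (by omega) (by omega) (by omega)) kw0 rfl rfl
    · rw [kw1, Function.update_self, State.val, if_neg hgl.2]
    · intro i hi
      simp [hu] at hi
  · rw [hΓ2, hu, hz]; rfl

/-- The part of the state that is set up by `makeNode`. -/
structure Made {W : Type u} {N : ℕ} (σ : State W) (Γ : Ghost N) : Prop where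
  pos : ∀ f, Γ.pos f = 0
  rot : ∀ v, Γ.rot v = 0
  next : 1 ≤ σ.reg 10
  par : ∀ i, σ.reg 10 ≤ i → σ.mem 10 i = 0
  first : ∀ v : Fin N, σ.mem 9 v = (Γ.ent v).getD 0 0

/-- The list holds just the edges whose heads reach `t`. If it is empty, then `u` has no path to `t`
and remains without tree and entry; otherwise all leaves start live, and the winner of the root
gives the best path. -/
theorem makeTree_spec (hC : ops.Computes w) (hw : SubsetMonotone w)
    (h : Inv w G wt t ops σ Γ D none) (hM : Made σ Γ) (hu : u ∉ D) (hut : u ≠ t)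
    (hcl : ∀ e ∈ G.edges, e.1 = u → e.2 ∈ D) (h7 : σ.reg 7 = u)
    (hl : Linked (σ.mem 7) (σ.mem 6 u) l) (hnd : l.Nodup)
    (hmem : ∀ i, i ∈ l ↔ ∃ e, G.edges[i]? = some e ∧ e.1 = u ∧ Γ.ent e.2 ≠ []) :
    ∃ τ Γ', Leads ops makeTree σ τ (200 * l.length + 200) (30 * l.length + 30) ∧
      Inv w G wt t ops τ Γ' (insert u D) none ∧ Made τ Γ' ∧
      ∀ v, v ≠ u → Γ'.ent v = Γ.ent v := by
  have hL1 := Leads.exec (ops := ops) (.assign 8 (.cell 6 (.reg 7)) ⟫ .assign 12 (.reg 10))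
    (by decide) σ
  obtain ⟨σ1, hσ1⟩ : ∃ σ1, σ1 = Program.exec ops
    (.assign 8 (.cell 6 (.reg 7)) ⟫ .assign 12 (.reg 10)) σ := ⟨_, rfl⟩
  rw [← hσ1] at hL1
  have r8 : σ1.reg 8 = σ.mem 6 u := by rw [hσ1]; simp [Program.exec, Exp.eval, h7]
  have r10 : σ1.reg 10 = σ.reg 10 := hL1.frame_reg 10 (by decide)
  have r12 : σ1.reg 12 = σ.reg 10 := by rw [hσ1]; simp [Program.exec, Exp.eval]
  have m1 : ∀ a, σ1.mem a = σ.mem a := fun a => hL1.frame_mem a (by simp [Program.arrays])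
  have w1 : σ1.wmem = σ.wmem := by
    funext a; exact hL1.frame_wmem a (by simp [Program.warrays])
  have t1 : (Program.time (.assign 8 (.cell 6 (.reg 7)) ⟫ .assign 12 (.reg 10))) ≤ 10 := by decide
  have g1 : (Program.growth (.assign 8 (.cell 6 (.reg 7)) ⟫ .assign 12 (.reg 10))) = 0 := by decide
  obtain ⟨σ2, hL2, k2, k3, k4⟩ := leafLoop_spec (ops := ops) (σ := σ1) (l := l)
    (by rw [m1, r8]; exact hl)
  obtain ⟨b, hb⟩ : ∃ b, b = σ.reg 10 := ⟨_, rfl⟩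
  rw [r10, ← hb] at k2 k3 k4
  have hb1 : 1 ≤ b := hb ▸ hM.next
  have m2 : ∀ a, a ≠ 12 → a ≠ 13 → a ≠ 14 → σ2.mem a = σ.mem a := fun a h1 h2 h3 => by
    rw [hL2.frame_mem a (by simp [leafLoop, leafStep, Program.arrays, h1, h2, h3]), m1]
  have w2 : σ2.wmem = σ.wmem := by
    rw [← w1]
    funext a; exact hL2.frame_wmem a (by simp [leafLoop, leafStep, Program.warrays])
  have ro2 : ∀ x, x ≠ 8 → x ≠ 9 → x ≠ 10 → x ≠ 12 → σ2.reg x = σ.reg x := fun x h1 h2 h3 h4 => by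
    rw [hL2.frame_reg x (by simp [leafLoop, leafStep, Program.regs, h1, h2, h3]),
      hL1.frame_reg x (by simp [Program.regs, h1, h4])]
  have r12' : σ2.reg 12 = b := by rw [hL2.frame_reg 12 (by decide), r12, hb]
  by_cases hl0 : l = []
  · -- no leaves
    subst hl0
    simp only [List.length_nil, add_zero] at k2
    have hL3 : Leads ops mergeLoop σ2 σ2 (mergeTest.cost + 1) mergeTest.growth :=
      Leads.loop_false (by simp only [mergeTest, Test.Holds, Exp.eval]; omega) (by decide)
    have hL4 := Leads.exec (ops := ops) .skip (by decide) σ2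
    have hL5 := Leads.branch_false (b := .lt (.reg 12) (.reg 10)) (c := attachRoot)
      (by simp only [Test.Holds, Exp.eval]; omega) (by decide) hL4
    have c3 : mergeTest.cost = 5 := by decide
    have c4 : mergeTest.growth ≤ 1 := by decide
    have c5 : (Test.lt (.reg 12) (.reg 10)).cost = 3 := by decide
    have c6 : (Test.lt (.reg 12) (.reg 10)).growth = 0 := by decide
    have c7 : Program.time .skip = 1 := by decide
    have c8 : Program.growth .skip = 0 := by decide
    have e4 : Program.exec ops .skip σ2 = σ2 := rfl
    rw [e4] at hL5
    refine ⟨σ2, Γ, (hL1.seq (hL2.seq (hL3.seq hL5))).mono ?_ ?_, ?_, ?_, fun _ _ => rfl⟩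
    · simp only [List.length_nil]; omega
    · simp only [List.length_nil]; omega
    · have hsim : Inv w G wt t ops σ2 Γ D none := by
        have hlow : ∀ a i, σ2.mem a i = σ.mem a i ∨ b ≤ i := fun a i => by
          by_cases hi : i < b
          · exact .inl ((k4 a i hi).trans (by rw [m1]))
          · exact .inr (by omega)
        -- The text of the loop does write to memory, so no frame rule applies; what helps is that
        -- its test fails at once.
        have hall : ∀ a, σ2.mem a = σ.mem a := by
          obtain ⟨υ, q1, q2, -⟩ := hL2 σ1 (.refl _)
          have : ¬ listTest.Holds ops σ1 := by
            simp only [listTest, Test.Holds, Exp.eval, not_not]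
            rw [r8]; exact hl
          cases q1 with
          | loop_true hb _ _ => exact absurd hb this
          | loop_false _ => exact fun a => by rw [← q2.mem]; exact m1 a
        exact h.congr_state (by rw [k2, hb]) (ro2 11 (by simp) (by simp) (by simp) (by simp))
          (fun a _ => hall a) w2
      refine hsim.insert_dead hu hut hcl fun e he hev => ?_
      by_contra hne
      obtain ⟨i, hi⟩ := List.mem_iff_getElem?.1 he
      have := (hmem i).2 ⟨e, hi, hev, hne⟩
      simp at this
    · refine ⟨hM.pos, hM.rot, by omega, fun i hi => ?_, fun v => ?_⟩
      · rw [m2 10 (by simp) (by simp) (by simp)]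
        exact hM.par i (by omega)
      · rw [m2 9 (by simp) (by simp) (by simp)]
        exact hM.first v
  · -- the leaves
    have hcur : ∀ i (hi : i < l.length), ∃ e, G.edges[l[i]]? = some e ∧ e.1 = u ∧
        Γ.ent e.2 ≠ [] ∧ σ2.mem 14 (b + i) = (Γ.ent e.2).getD 0 0 := by
      intro i hi
      obtain ⟨e, he, hev, hne⟩ := (hmem _).1 (List.getElem_mem hi)
      refine ⟨e, he, hev, hne, ?_⟩
      rw [(k3 i hi).2.1, m1, m1, h.dst_eq _ _ he, hM.first]
    -- The heads have entries, and entries are not `0`; so each new leaf has a candidate and is its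
    -- own winner.
    have hcur0 : ∀ i < l.length, σ2.mem 14 (b + i) ≠ 0 := by
      intro i hi
      obtain ⟨e, -, -, hne, h14⟩ := hcur i hi
      rw [h14, List.getD_eq_getElem _ _ (List.length_pos_iff.2 hne)]
      exact (h.core e.2).ent_ne _ (List.getElem_mem _)
    have hF : Forest ops σ2 b (List.range' b l.length) ((List.range' b l.length).map BT.leaf) :=
      forest_leaves (by omega) r12' k2 (fun i hi => by
        rw [m2 10 (by simp) (by simp) (by simp)]; exact hM.par i (hb ▸ hi))
        (fun i hi => (k3 i hi).2.2) hcur0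
    obtain ⟨σ3, T, hL3, hT, hlow3⟩ := mergeLoop_spec hF (by simpa using hl0)
    rw [List.length_map, List.length_range'] at hL3
    have m3 : ∀ a, a ≠ 10 → a ≠ 11 → a ≠ 12 → σ3.mem a = σ2.mem a := fun a h1 h2 h3 =>
      hL3.frame_mem a (by simp [mergeLoop, mergeStep, setWin, Program.arrays, h1, h2, h3])
    have w3 : σ3.wmem = σ.wmem := by
      rw [← w2]
      funext a; exact hL3.frame_wmem a (by simp [mergeLoop, mergeStep, setWin, Program.warrays])
    have ro3 : ∀ x, x ≠ 8 → x ≠ 9 → x ≠ 10 → x ≠ 12 → σ3.reg x = σ.reg x :=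
      fun x h1 h2 h3 h4 => by
        rw [hL3.frame_reg x (by simp [mergeLoop, mergeStep, setWin, Program.regs, h3, h4]),
          ro2 x h1 h2 h3 h4]
    have hid : T.id = σ3.reg 12 := by simpa using hT.roots
    have hnext : σ3.reg 10 = σ3.reg 12 + 1 := by simpa using hT.next
    have hrange : ∀ i ∈ T.ids, b ≤ i ∧ i < σ3.reg 10 := fun i hi => hT.range i (by simpa using hi)
    have hidb := hrange _ T.id_mem_ids
    have hleaves : T.leaves.Perm (List.range' b l.length) := by simpa using hT.leaves
    have hleaf : ∀ f ∈ T.leaves, ∃ i, ∃ _ : i < l.length, f = b + i := by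
      intro f hf
      obtain ⟨i, hi, rfl⟩ := List.mem_range'.1 (hleaves.subset hf)
      exact ⟨i, hi, by rw [one_mul]⟩
    -- the root
    obtain ⟨c, hc⟩ : ∃ c : Program, c = (.store 8 (.reg 7) (.reg 12) ⟫
      .assign 13 (.cell 12 (.reg 12))) := ⟨_, rfl⟩
    have hL4 := Leads.exec (ops := ops) c (by rw [hc]; decide) σ3
    obtain ⟨σ4, hσ4⟩ : ∃ σ4, σ4 = c.exec ops σ3 := ⟨_, rfl⟩
    rw [← hσ4] at hL4
    have e7 : σ3.reg 7 = u := by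
      rw [ro3 7 (by simp) (by simp) (by simp) (by simp), h7]
    have m48 : σ4.mem 8 = Function.update (σ.mem 8) u T.id := by
      rw [hσ4, hc]
      simp [Program.exec, Exp.eval, e7, m3 8, m2 8, hid]
    have m4 : ∀ a, a ≠ 8 → σ4.mem a = σ3.mem a := fun a h1 =>
      hL4.frame_mem a (by simp [hc, Program.arrays, h1])
    have w4 : σ4.wmem = σ.wmem := by
      rw [← w3]
      funext a; exact hL4.frame_wmem a (by simp [hc, Program.warrays])
    have ro4 : ∀ x, x ≠ 13 → σ4.reg x = σ3.reg x := fun x h1 =>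
      hL4.frame_reg x (by simp [hc, Program.regs, h1])
    have hval : σ4.val ops = σ3.val ops :=
      State.val_congr (m4 13 (by simp)) (m4 14 (by simp)) (by rw [w4, w3])
    have hwin : winner σ4 u = σ3.mem 12 T.id := by
      rw [winner, m48, Function.update_self, m4 12 (by simp)]
    have r13 : σ4.reg 13 = winner σ4 u := by
      rw [hwin, hid, hσ4, hc]
      simp [Program.exec, Exp.eval]
    have h13 : ∀ i (hi : i < l.length), σ4.mem 13 (b + i) = l[i] := fun i hi => by
      rw [m4 13 (by simp), m3 13 (by simp) (by simp) (by simp), (k3 i hi).1]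
    have hatt := h.attach (τ := σ4) (T := T) (b := b) hu hut hcl hM.pos hb hb1
      (by rw [ro4 10 (by simp)]; omega)
      (by rw [ro4 11 (by simp), ro3 11 (by simp) (by simp) (by simp) (by simp)])
      (fun a ha => by
        rw [m4 a (by omega), m3 a (by omega) (by omega) (by omega),
          m2 a (by omega) (by omega) (by omega)]) w4 m48
      (fun a i hi ha => by
        rw [m4 a (by omega), hlow3 a i hi, k4 a i hi, m1])
      (by
        rw [m4 10 (by simp), m4 11 (by simp), m4 12 (by simp), hval]
        exact hT.rep T (by simp))
      (by rw [m4 10 (by simp)]; exact hT.par _ hid.ge)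
      (by simpa using hT.nodup)
      (fun i hi => by rw [ro4 10 (by simp)]; exact hrange i hi)
      (hT.balanced T (by simp))
      (fun f hf => by
        obtain ⟨i, hi, rfl⟩ := hleaf f hf
        obtain ⟨e, he, hev, hne, h14⟩ := hcur i hi
        refine ⟨e, by rw [h13 i hi]; exact he, hev, hne, ?_⟩
        rw [m4 14 (by simp), m3 14 (by simp) (by simp) (by simp), h14])
      (fun f hf f' hf' heq => by
        obtain ⟨i, hi, rfl⟩ := hleaf f hf
        obtain ⟨j, hj, rfl⟩ := hleaf f' hf'
        rw [h13 i hi, h13 j hj, hnd.getElem_inj_iff] at heq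
        rw [heq])
      (fun i e hi hev hne => by
        obtain ⟨j, hj, rfl⟩ := List.getElem_of_mem ((hmem i).2 ⟨e, hi, hev, hne⟩)
        exact ⟨b + j, hleaves.symm.subset (List.mem_range'.2 ⟨j, hj, by rw [one_mul]⟩), h13 j hj⟩)
    set Γ1 : Ghost N := { Γ with
      tree := Function.update Γ.tree u (some T)
      edge := fun f => if f < b then Γ.edge f else (G.edges[σ4.mem 13 f]?).getD (Γ.edge f) } with hΓ1
    have hne : winner σ4 u ≠ 0 := by
      rw [hwin]
      have hW := (hT.rep T (by simp)).winOk
      intro h0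
      rw [h0] at hW
      rcases hW with hW | hW
      · obtain ⟨f, hf⟩ := List.exists_mem_of_ne_nil _ T.leaves_ne_nil
        have h1 := hW.2 f hf
        obtain ⟨i, hi, rfl⟩ := hleaf f hf
        have h2 := hcur0 i hi
        rw [← m3 14 (by simp) (by simp) (by simp)] at h2
        simp [State.val, h2] at h1
      · exact hW.1 rfl
    obtain ⟨τ, Γ', hL5, hI, q1, q2, q3, q4⟩ := attachRoot_spec hC hw hatt hut (h.out u hu).1 hne
      (fun e he he1 => h.edge_ne_of_notMem hu he he1) r13
      (by rw [ro4 7 (by simp), e7])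
    have c5 : (Test.lt (.reg 12) (.reg 10)).cost = 3 := by decide
    have c6 : (Test.lt (.reg 12) (.reg 10)).growth = 0 := by decide
    have c7 : c.time ≤ 20 := by rw [hc]; decide
    have c8 : c.growth = 0 := by rw [hc]; decide
    -- Only a matter of bracketing: the run of the two halves is regrouped as `attachRoot` is
    -- written.
    have hL6 : Leads ops attachRoot σ3 τ 60 4 := by
      rintro σ' hσ'
      obtain ⟨υ, y1, y2, y3, y4, y5⟩ := (hL4.seq hL5) σ' hσ'
      refine ⟨υ, ?_, y2, y3, by omega, fun B hB => (y5 B hB).mono (by omega)⟩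
      rw [hc] at y1
      cases y1 with
      | seq a1 a2 =>
        cases a1 with
        | seq a3 a4 => exact .seq a3 (.seq a4 a2)
    have hL7 := Leads.branch_true (b := .lt (.reg 12) (.reg 10)) (d := .skip)
      (by simp only [Test.Holds, Exp.eval]; omega) (by decide) hL6
    have m5 : ∀ a, a ≠ 9 → a ≠ 15 → a ≠ 16 → τ.mem a = σ4.mem a := fun a h1 h2 h3 =>
      hL5.frame_mem a (by simp [newEntry, Program.arrays, h1, h2, h3])
    have r5 : τ.reg 10 = σ3.reg 10 := by rw [hL5.frame_reg 10 (by decide), ro4 10 (by simp)]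
    refine ⟨τ, Γ', (hL1.seq (hL2.seq (hL3.seq hL7))).mono (by omega) (by omega), hI,
      ⟨fun f => by rw [q1]; exact hM.pos f, fun v => by rw [q2]; exact hM.rot v, by omega,
        fun i hi => ?_, fun v => ?_⟩, fun v hv => ?_⟩
    · rw [m5 10 (by simp) (by simp) (by simp), m4 10 (by simp)]
      exact hT.par i (by omega)
    · rw [q3, q4]
      by_cases hvu : v = u
      · subst hvu; simp
      · rw [Function.update_of_ne (fun heq => hvu (Fin.ext heq)), Function.update_of_ne hvu,
          m4 9 (by simp), m3 9 (by simp) (by simp) (by simp), m2 9 (by simp) (by simp) (by simp)]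
        exact hM.first v
    · rw [q3, Function.update_of_ne hv]

theorem makeNode_spec (hC : ops.Computes w) (hw : SubsetMonotone w)
    (h : Inv w G wt t ops σ Γ D none) (hM : Made σ Γ) (hu : u ∉ D)
    (hcl : ∀ e ∈ G.edges, e.1 = u → e.2 ∈ D) (h3 : σ.reg 3 = t) (h7 : σ.reg 7 = u)
    (hl : Linked (σ.mem 7) (σ.mem 6 u) l) (hnd : l.Nodup)
    (hmem : ∀ i, i ∈ l ↔ ∃ e, G.edges[i]? = some e ∧ e.1 = u ∧ Γ.ent e.2 ≠ []) :
    ∃ τ Γ', Leads ops makeNode σ τ (200 * l.length + 210) (30 * l.length + 30) ∧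
      Inv w G wt t ops τ Γ' (insert u D) none ∧ Made τ Γ' ∧
      ∀ v, v ≠ u → Γ'.ent v = Γ.ent v := by
  have c5 : (Test.eq (.reg 7) (.reg 3)).cost = 3 := by decide
  have c6 : (Test.eq (.reg 7) (.reg 3)).growth = 0 := by decide
  by_cases hut : u = t
  · subst hut
    have hL := Leads.exec (ops := ops) makeTarget (by decide) σ
    obtain ⟨τ, hτ⟩ : ∃ τ, τ = makeTarget.exec ops σ := ⟨_, rfl⟩
    rw [← hτ] at hL
    have m9 : τ.mem 9 = Function.update (σ.mem 9) u (σ.reg 11) := by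
      rw [hτ]; simp [makeTarget, Program.exec, Exp.eval, h7]
    have mo : ∀ a, a ≠ 9 → a ≠ 15 → τ.mem a = σ.mem a := fun a h1 h2 =>
      hL.frame_mem a (by simp [makeTarget, Program.arrays, h1, h2])
    have r10 : τ.reg 10 = σ.reg 10 := hL.frame_reg 10 (by decide)
    have hI := h.insert_target (τ := τ) hC hu hcl rfl
      (by rw [hτ]; simp [makeTarget, Program.exec, Exp.eval]) r10
      (fun a ha => mo a (by omega) (by omega))
      (by rw [hτ]; simp [makeTarget, Program.exec, Exp.eval])
      (by rw [hτ]; simp [makeTarget, Program.exec, Exp.eval])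
      (by rw [hτ]; simp [makeTarget, Program.exec, Exp.eval, WExp.eval])
    have ht : makeTarget.time ≤ 20 := by decide
    have hg : makeTarget.growth ≤ 5 := by decide
    refine ⟨τ, _, (Leads.branch_true (by simp [Test.Holds, Exp.eval, h3, h7]) (by decide)
      hL).mono (by omega) (by omega), hI, ⟨hM.pos, hM.rot, r10.symm ▸ hM.next, fun i hi => ?_,
      fun v => ?_⟩, fun v hv => Function.update_of_ne hv _ _⟩
    · rw [mo 10 (by simp) (by simp)]
      exact hM.par i (by omega)
    · rw [m9]
      by_cases hvu : v = u
      · subst hvu; simp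
      · rw [Function.update_of_ne (fun heq => hvu (Fin.ext heq))]
        simp only [Function.update_of_ne hvu]
        exact hM.first v
  · obtain ⟨τ, Γ', hL, k⟩ := makeTree_spec hC hw h hM hu hut hcl h7 hl hnd hmem
    refine ⟨τ, Γ', (Leads.branch_false ?_ (by decide) hL).mono (by omega) (by omega), k⟩
    simp only [Test.Holds, Exp.eval, h3, h7]
    exact fun heq => hut (Fin.ext heq)

end

/-! ### Traversal of the graph from its sinks -/

/-- Put an edge on the list of its target and count it at its source. -/
def scanStep : Program :=
  .store 3 (.reg 4) (.cell 2 (.cell 1 (.reg 4))) ⟫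
  .store 2 (.cell 1 (.reg 4)) (.add (.reg 4) (.lit 1)) ⟫
  .store 4 (.cell 0 (.reg 4)) (.add (.cell 4 (.cell 0 (.reg 4))) (.lit 1)) ⟫
  .assign 4 (.add (.reg 4) (.lit 1))

def scanLoop : Program := .loop (.lt (.reg 4) (.reg 1)) scanStep

/-- Put node `x` on the queue if all its edges are done. -/
def enqueue (x : ℕ) : Program :=
  .branch (.eq (.cell 4 (.reg x)) (.lit 0))
    (.store 5 (.reg 5) (.reg x) ⟫ .assign 5 (.add (.reg 5) (.lit 1))) .skip

def sinkStep : Program := enqueue 4 ⟫ .assign 4 (.add (.reg 4) (.lit 1))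

def sinkLoop : Program := .loop (.lt (.reg 4) (.reg 0)) sinkStep

/-- Edges into a node without a path to `t` are counted down but not listed; hence leaves are made
for useful edges only. -/
def relaxStep : Program :=
  .assign 9 (.sub (.reg 8) (.lit 1)) ⟫ .assign 13 (.cell 0 (.reg 9)) ⟫
  .branch (.eq (.cell 9 (.reg 7)) (.lit 0)) .skip
    (.store 7 (.reg 9) (.cell 6 (.reg 13)) ⟫ .store 6 (.reg 13) (.add (.reg 9) (.lit 1))) ⟫
  .store 4 (.reg 13) (.sub (.cell 4 (.reg 13)) (.lit 1)) ⟫ enqueue 13 ⟫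
  .assign 8 (.cell 3 (.reg 9))

def relaxLoop : Program := .loop listTest relaxStep

def visitNext : Program :=
  .assign 7 (.cell 5 (.reg 6)) ⟫ .assign 6 (.add (.reg 6) (.lit 1))

def visitStep : Program := visitNext ⟫ makeNode ⟫ .assign 8 (.cell 2 (.reg 7)) ⟫ relaxLoop

def visitLoop : Program := .loop (.lt (.reg 6) (.reg 5)) visitStep

section
variable {N : ℕ}

/-- The indices of the edges with a property. -/
noncomputable def DAG.idx (G : DAG N) (P : ℕ → Fin N × Fin N → Prop) : Finset ℕ := by
  classical
  exact (Finset.range G.edges.length).filter fun i => ∃ e, G.edges[i]? = some e ∧ P i e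

theorem DAG.mem_idx {G : DAG N} {P : ℕ → Fin N × Fin N → Prop} {i : ℕ} :
    i ∈ G.idx P ↔ ∃ e, G.edges[i]? = some e ∧ P i e := by
  classical
  rw [DAG.idx, Finset.mem_filter, Finset.mem_range, and_iff_right_iff_imp]
  rintro ⟨e, he, -⟩
  by_contra hi
  rw [List.getElem?_eq_none (by omega)] at he
  simp at he

/-- The edges are partitioned by their sources and by their targets. -/
theorem DAG.sum_idx_le (G : DAG N) (a : Fin N × Fin N → Fin N) :
    ∑ v, (G.idx fun _ e => a e = v).card ≤ G.edges.length := by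
  rw [← Finset.card_biUnion]
  · refine (Finset.card_le_card fun i hi => ?_).trans_eq (Finset.card_range _)
    obtain ⟨v, -, hv⟩ := Finset.mem_biUnion.1 hi
    obtain ⟨e, he, -⟩ := DAG.mem_idx.1 hv
    exact Finset.mem_range.2 (List.getElem?_eq_some_iff.1 he).1
  · intro v _ v' _ hne
    refine Finset.disjoint_left.2 fun i h1 h2 => hne ?_
    obtain ⟨e, he, rfl⟩ := DAG.mem_idx.1 h1
    obtain ⟨e', he', rfl⟩ := DAG.mem_idx.1 h2
    rw [he] at he'
    rw [Option.some.inj he']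

/-- Acyclic graphs admit induction from the sinks. -/
theorem DAG.induction (G : DAG N) {P : Fin N → Prop}
    (h : ∀ v, (∀ e ∈ G.edges, e.1 = v → P e.2) → P v) (v : Fin N) : P v := by
  let r : Fin N → Fin N → Prop := fun a b => ∃ p, p ≠ [] ∧ G.IsPath b a p
  have : IsTrans (Fin N) r := ⟨fun a b c ⟨p, hp, hp'⟩ ⟨q, _, hq'⟩ =>
    ⟨q ++ p, by simp [hp], hq'.append hp'⟩⟩
  have : Std.Irrefl r := ⟨fun a ⟨p, hp, hp'⟩ => hp hp'.eq_nil⟩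
  refine (Finite.wellFounded_of_trans_of_irrefl r).induction v fun v ih => h v fun e he hev => ?_
  exact ih _ ⟨[e], by simp, he, hev, rfl⟩

end

/-- The lists of the edges by targets, for the first `n` edges. -/
def InLists {W : Type u} {N : ℕ} (σ : State W) (G : DAG N) (n : ℕ) : Prop :=
  ∀ v : Fin N, ∃ l, Linked (σ.mem 3) (σ.mem 2 v) l ∧ l.Nodup ∧
    ∀ i, i ∈ l ↔ i ∈ G.idx fun i e => i < n ∧ e.2 = v

/-- The queue `Q` holds the nodes whose edges are all in `X`. -/
structure Queue {W : Type u} {N : ℕ} (σ : State W) (G : DAG N) (Γ : Ghost N) (X : Finset ℕ)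
    (Q : List (Fin N)) : Prop where
  len : σ.reg 5 = Q.length
  cell : ∀ i (h : i < Q.length), σ.mem 5 i = Q[i]
  nodup : Q.Nodup
  cnt : ∀ v : Fin N, σ.mem 4 v = (G.idx fun i e => i ∉ X ∧ e.1 = v).card
  mem : ∀ v : Fin N, v ∈ Q ↔ σ.mem 4 v = 0
  out : ∀ v : Fin N, ∃ l, Linked (σ.mem 7) (σ.mem 6 v) l ∧ l.Nodup ∧
    ∀ i, i ∈ l ↔ i ∈ G.idx fun i e => i ∈ X ∧ e.1 = v ∧ Γ.ent e.2 ≠ []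

section
variable {W : Type u} [LinearOrder W] {w : Multiset W → W} {ops : WeightOps W} {N : ℕ}
  {G : DAG N} {wt : Fin N × Fin N → W} {s t u : Fin N} {σ τ : State W} {Γ Γ' : Ghost N}
  {D : Finset (Fin N)} {X : Finset ℕ} {Q : List (Fin N)}

theorem scanLoop_spec {n d : ℕ} (hd : n + d = G.edges.length) (h4 : σ.reg 4 = n)
    (h1 : σ.reg 1 = G.edges.length)
    (hsrc : ∀ i e, G.edges[i]? = some e → σ.mem 0 i = e.1)
    (hdst : ∀ i e, G.edges[i]? = some e → σ.mem 1 i = e.2) (hin : InLists σ G n)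
    (hcnt : ∀ v : Fin N, σ.mem 4 v = (G.idx fun i e => i < n ∧ e.1 = v).card) :
    ∃ τ, Leads ops scanLoop σ τ (50 * d + 10) (20 * d) ∧ InLists τ G G.edges.length ∧
      ∀ v : Fin N, τ.mem 4 v = (G.idx fun i e => i < G.edges.length ∧ e.1 = v).card := by
  have hlin : (Test.lt (.reg 4) (.reg 1)).linear = true := by decide
  have hcost : (Test.lt (.reg 4) (.reg 1)).cost = 3 := by decide
  have hgrow : (Test.lt (.reg 4) (.reg 1)).growth = 0 := by decide
  induction d generalizing σ n with
  | zero =>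
    obtain rfl : n = G.edges.length := by omega
    refine ⟨σ, (Leads.loop_false ?_ hlin).mono (by omega) (by omega), hin, hcnt⟩
    simp [Test.Holds, Exp.eval, h4, h1]
  | succ d ih =>
    have hn : n < G.edges.length := by omega
    obtain ⟨e, he⟩ : ∃ e, G.edges[n]? = some e := ⟨_, List.getElem?_eq_getElem hn⟩
    have hL := Leads.exec (ops := ops) scanStep (by decide) σ
    obtain ⟨υ, hυ⟩ : ∃ υ, υ = scanStep.exec ops σ := ⟨_, rfl⟩
    rw [← hυ] at hL
    have e0 := hsrc n e he
    have e1 := hdst n e he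
    have r4 : υ.reg 4 = n + 1 := by rw [hυ]; simp [scanStep, Program.exec, Exp.eval, h4]
    have m3 : υ.mem 3 = Function.update (σ.mem 3) n (σ.mem 2 e.2) := by
      rw [hυ]; simp [scanStep, Program.exec, Exp.eval, h4, e1]
    have m2 : υ.mem 2 = Function.update (σ.mem 2) e.2 (n + 1) := by
      rw [hυ]; simp [scanStep, Program.exec, Exp.eval, h4, e1]
    have m4 : υ.mem 4 = Function.update (σ.mem 4) e.1 (σ.mem 4 e.1 + 1) := by
      rw [hυ]; simp [scanStep, Program.exec, Exp.eval, h4, e0]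
    have mo : ∀ a, a ≠ 2 → a ≠ 3 → a ≠ 4 → υ.mem a = σ.mem a := fun a k1 k2 k3 =>
      hL.frame_mem a (by simp [scanStep, Program.arrays, k1, k2, k3])
    have hidx : ∀ (a : Fin N × Fin N → Fin N) v, (G.idx fun i e => i < n + 1 ∧ a e = v) =
        if a e = v then insert n (G.idx fun i e => i < n ∧ a e = v)
        else G.idx fun i e => i < n ∧ a e = v := by
      intro a v
      ext i
      have : i ∈ (G.idx fun i e => i < n + 1 ∧ a e = v) ↔
          i ∈ (G.idx fun i e => i < n ∧ a e = v) ∨ (i = n ∧ a e = v) := by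
        rw [DAG.mem_idx, DAG.mem_idx]
        constructor
        · rintro ⟨e', he', hi, hv⟩
          rcases Nat.lt_succ_iff_lt_or_eq.1 hi with hi | rfl
          · exact .inl ⟨e', he', hi, hv⟩
          · rw [he] at he'
            cases he'
            exact .inr ⟨rfl, hv⟩
        · rintro (⟨e', he', hi, hv⟩ | ⟨rfl, hv⟩)
          · exact ⟨e', he', by omega, hv⟩
          · exact ⟨e, he, by omega, hv⟩
      rw [this]
      split
      · next hv => rw [Finset.mem_insert]; tauto
      · next hv => tauto
    have hnot : ∀ (a : Fin N × Fin N → Fin N) v, n ∉ G.idx fun i e => i < n ∧ a e = v := by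
      intro a v hmem
      obtain ⟨_, _, h, _⟩ := DAG.mem_idx.1 hmem
      omega
    have ht : scanStep.time ≤ 40 := by decide
    have hg : scanStep.growth ≤ 20 := by decide
    obtain ⟨τ, k1, k2⟩ := ih (σ := υ) (n := n + 1) (by omega) r4
      (by rw [hL.frame_reg 1 (by decide), h1]) (by rw [mo 0 (by simp) (by simp) (by simp)]; exact hsrc)
      (by rw [mo 1 (by simp) (by simp) (by simp)]; exact hdst)
      (by
        intro v
        obtain ⟨l, g1, g2, g3⟩ := hin v
        have hnl : n ∉ l := fun h => hnot (fun e => e.2) v ((g3 n).1 h)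
        have g1' : Linked (υ.mem 3) (σ.mem 2 v) l := g1.congr fun i hi => by
          rw [m3, Function.update_of_ne]
          rintro rfl
          exact hnl hi
        have := hidx (fun e => e.2) v
        by_cases hv : e.2 = v
        · subst hv
          rw [if_pos rfl] at this
          refine ⟨n :: l, ⟨by rw [m2, Function.update_self], ?_⟩, List.nodup_cons.2 ⟨hnl, g2⟩,
            fun i => ?_⟩
          · rw [m3, Function.update_self, ← m3]; exact g1'
          · rw [this, Finset.mem_insert, List.mem_cons, g3]
        · rw [if_neg hv] at this
          refine ⟨l, ?_, g2, fun i => by rw [this, g3]⟩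
          rw [m2, Function.update_of_ne (fun heq => hv (Fin.ext heq.symm))]
          exact g1')
      (by
        intro v
        have := hidx (fun e => e.1) v
        by_cases hv : e.1 = v
        · subst hv
          rw [if_pos rfl] at this
          rw [this, Finset.card_insert_of_notMem (hnot (fun e => e.1) _), m4, Function.update_self,
            hcnt]
        · rw [if_neg hv] at this
          rw [this, m4, Function.update_of_ne (fun heq => hv (Fin.ext heq.symm)), hcnt])
    refine ⟨τ, (Leads.loop_true ?_ hlin hL k1).mono (by omega) (by omega), k2⟩
    simp only [Test.Holds, Exp.eval]
    omega

theorem sinkLoop_spec {n d : ℕ} (hd : n + d = N) (h4 : σ.reg 4 = n) (h0 : σ.reg 0 = N)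
    (h5 : σ.reg 5 = Q.length) (hcell : ∀ i (h : i < Q.length), σ.mem 5 i = Q[i]) (hnd : Q.Nodup)
    (hmem : ∀ v : Fin N, v ∈ Q ↔ v.val < n ∧ σ.mem 4 v = 0) :
    ∃ (τ : State W) (Q : List (Fin N)), Leads ops sinkLoop σ τ (40 * d + 10) (10 * d) ∧ τ.reg 5 = Q.length ∧
      (∀ i (h : i < Q.length), τ.mem 5 i = Q[i]) ∧ Q.Nodup ∧
      ∀ v : Fin N, v ∈ Q ↔ τ.mem 4 v = 0 := by
  have hlin : (Test.lt (.reg 4) (.reg 0)).linear = true := by decide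
  have hcost : (Test.lt (.reg 4) (.reg 0)).cost = 3 := by decide
  have hgrow : (Test.lt (.reg 4) (.reg 0)).growth = 0 := by decide
  induction d generalizing σ n Q with
  | zero =>
    obtain rfl : n = N := by omega
    refine ⟨σ, Q, (Leads.loop_false ?_ hlin).mono (by omega) (by omega), h5, hcell, hnd,
      fun v => (hmem v).trans (and_iff_right v.2)⟩
    simp [Test.Holds, Exp.eval, h4, h0]
  | succ d ih =>
    have hn : n < N := by omega
    have hL := Leads.exec (ops := ops) sinkStep (by decide) σ
    obtain ⟨υ, hυ⟩ : ∃ υ, υ = sinkStep.exec ops σ := ⟨_, rfl⟩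
    rw [← hυ] at hL
    have r4 : υ.reg 4 = n + 1 := by
      rw [hυ]
      by_cases hc : σ.mem 4 n = 0 <;>
        simp [sinkStep, enqueue, Program.exec, Test.Holds, Exp.eval, h4, hc]
    have m4 : υ.mem 4 = σ.mem 4 := hL.frame_mem 4 (by decide)
    have ht : sinkStep.time ≤ 30 := by decide
    have hg : sinkStep.growth ≤ 10 := by decide
    obtain ⟨Q', hQ', q5, qc⟩ : ∃ Q', Q' = (if σ.mem 4 n = 0 then Q ++ [⟨n, hn⟩] else Q) ∧
        υ.reg 5 = Q'.length ∧ ∀ i (h : i < Q'.length), υ.mem 5 i = Q'[i] := by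
      by_cases hc : σ.mem 4 n = 0
      · refine ⟨Q ++ [⟨n, hn⟩], by rw [if_pos hc], ?_, fun i hi => ?_⟩
        · rw [hυ]
          simp [sinkStep, enqueue, Program.exec, Test.Holds, Exp.eval, h4, hc, h5]
        · have : υ.mem 5 = Function.update (σ.mem 5) Q.length n := by
            rw [hυ]
            simp [sinkStep, enqueue, Program.exec, Test.Holds, Exp.eval, h4, hc, h5]
          rw [this, Function.update_apply, List.getElem_append]
          simp only [List.length_append, List.length_singleton] at hi
          by_cases h : i < Q.length
          · rw [if_neg (by omega), dif_pos h]; exact hcell i h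
          · rw [if_pos (by omega), dif_neg h]; simp
      · refine ⟨Q, by rw [if_neg hc], ?_, fun i hi => ?_⟩
        · rw [hυ]
          simp [sinkStep, enqueue, Program.exec, Test.Holds, Exp.eval, h4, hc, h5]
        · rw [← hcell i hi, hυ]
          simp [sinkStep, enqueue, Program.exec, Test.Holds, Exp.eval, h4, hc]
    obtain ⟨τ, Q'', k1, k2⟩ := ih (σ := υ) (n := n + 1) (Q := Q') (by omega) r4
      (by rw [hL.frame_reg 0 (by decide), h0]) q5 qc
      (by
        rw [hQ']
        split
        · refine List.nodup_append'.2 ⟨hnd, by simp, fun v hv hv' => ?_⟩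
          rw [List.mem_singleton.1 hv', hmem] at hv
          simp at hv
        · exact hnd)
      (by
        intro v
        rw [hQ', m4]
        by_cases hvn : v.val = n
        · obtain rfl : v = ⟨n, hn⟩ := Fin.ext hvn
          have : (⟨n, hn⟩ : Fin N) ∉ Q := fun h => by
            have := ((hmem _).1 h).1
            simp at this
          split <;> simp [*]
        · have hlt : v.val < n + 1 ↔ v.val < n := by omega
          rw [hlt, ← hmem]
          split
          · simp [Fin.ext_iff, hvn]
          · exact Iff.rfl)
    refine ⟨τ, Q'', (Leads.loop_true ?_ hlin hL k1).mono (by omega) (by omega), k2⟩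
    simp only [Test.Holds, Exp.eval]
    omega

end

/-! ### Visiting the nodes from the sinks upwards -/

section
variable {W : Type u} [LinearOrder W] {w : Multiset W → W} {ops : WeightOps W} {N : ℕ}
  {G : DAG N} {wt : Fin N × Fin N → W} {s t u : Fin N} {σ τ : State W} {Γ Γ' : Ghost N}
  {D : Finset (Fin N)} {X : Finset ℕ} {Q : List (Fin N)}

theorem Queue.relax {i : ℕ} {e : Fin N × Fin N} (h : Queue σ G Γ X Q) (h8 : σ.reg 8 = i + 1)
    (he : G.edges[i]? = some e) (hX : i ∉ X) (h7 : σ.reg 7 = e.2)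
    (h9 : σ.mem 9 e.2 = 0 ↔ Γ.ent e.2 = []) (h0 : σ.mem 0 i = e.1) :
    ∃ τ Q', Leads ops relaxStep σ τ 80 20 ∧ Queue τ G Γ (insert i X) Q' ∧ Q <+: Q' ∧
      τ.reg 8 = σ.mem 3 i := by
  have hL := Leads.exec (ops := ops) relaxStep (by decide) σ
  obtain ⟨υ, hυ⟩ : ∃ υ, υ = relaxStep.exec ops σ := ⟨_, rfl⟩
  rw [← hυ] at hL
  have r8 : υ.reg 8 = σ.mem 3 i := by
    rw [hυ]
    by_cases hz : σ.mem 9 e.2 = 0 <;> by_cases hc : σ.mem 4 e.1 - 1 = 0 <;>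
      simp [relaxStep, enqueue, Program.exec, Test.Holds, Exp.eval, h8, h7, h0, hz, hc]
  have m4 : υ.mem 4 = Function.update (σ.mem 4) e.1 (σ.mem 4 e.1 - 1) := by
    rw [hυ]
    by_cases hz : σ.mem 9 e.2 = 0 <;> by_cases hc : σ.mem 4 e.1 - 1 = 0 <;>
      simp [relaxStep, enqueue, Program.exec, Test.Holds, Exp.eval, h8, h7, h0, hz, hc]
  have m7 : υ.mem 7 = if Γ.ent e.2 = [] then σ.mem 7
      else Function.update (σ.mem 7) i (σ.mem 6 e.1) := by
    rw [hυ]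
    by_cases hz : σ.mem 9 e.2 = 0 <;> by_cases hc : σ.mem 4 e.1 - 1 = 0 <;>
      simp [relaxStep, enqueue, Program.exec, Test.Holds, Exp.eval, h8, h7, h0, hz, hc, ← h9]
  have m6 : υ.mem 6 = if Γ.ent e.2 = [] then σ.mem 6
      else Function.update (σ.mem 6) e.1 (i + 1) := by
    rw [hυ]
    by_cases hz : σ.mem 9 e.2 = 0 <;> by_cases hc : σ.mem 4 e.1 - 1 = 0 <;>
      simp [relaxStep, enqueue, Program.exec, Test.Holds, Exp.eval, h8, h7, h0, hz, hc, ← h9]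
  have r5 : υ.reg 5 = if σ.mem 4 e.1 - 1 = 0 then σ.reg 5 + 1 else σ.reg 5 := by
    rw [hυ]
    by_cases hz : σ.mem 9 e.2 = 0 <;> by_cases hc : σ.mem 4 e.1 - 1 = 0 <;>
      simp [relaxStep, enqueue, Program.exec, Test.Holds, Exp.eval, h8, h7, h0, hz, hc]
  have m5 : υ.mem 5 = if σ.mem 4 e.1 - 1 = 0 then Function.update (σ.mem 5) (σ.reg 5) e.1
      else σ.mem 5 := by
    rw [hυ]
    by_cases hz : σ.mem 9 e.2 = 0 <;> by_cases hc : σ.mem 4 e.1 - 1 = 0 <;>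
      simp [relaxStep, enqueue, Program.exec, Test.Holds, Exp.eval, h8, h7, h0, hz, hc]
  have ht : relaxStep.time ≤ 80 := by decide
  have hg : relaxStep.growth ≤ 20 := by decide
  have hcard : ∀ v, (G.idx fun j e => j ∉ insert i X ∧ e.1 = v).card =
      if e.1 = v then (G.idx fun j e => j ∉ X ∧ e.1 = v).card - 1
      else (G.idx fun j e => j ∉ X ∧ e.1 = v).card := by
    intro v
    split
    · next hv =>
      rw [← Finset.card_erase_of_mem (DAG.mem_idx.2 ⟨e, he, hX, hv⟩)]
      congr 1
      ext j
      rw [Finset.mem_erase, DAG.mem_idx, DAG.mem_idx]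
      constructor
      · rintro ⟨e', he', hj, hv'⟩
        rw [Finset.mem_insert, not_or] at hj
        exact ⟨hj.1, e', he', hj.2, hv'⟩
      · rintro ⟨hj, e', he', hj', hv'⟩
        exact ⟨e', he', by rw [Finset.mem_insert, not_or]; exact ⟨hj, hj'⟩, hv'⟩
    · next hv =>
      congr 1
      ext j
      rw [DAG.mem_idx, DAG.mem_idx]
      constructor
      · rintro ⟨e', he', hj, hv'⟩
        rw [Finset.mem_insert, not_or] at hj
        exact ⟨e', he', hj.2, hv'⟩
      · rintro ⟨e', he', hj', hv'⟩
        refine ⟨e', he', ?_, hv'⟩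
        rw [Finset.mem_insert, not_or]
        refine ⟨?_, hj'⟩
        rintro rfl
        rw [he] at he'
        cases he'
        exact hv hv'
  -- The edge itself is still counted, so the truncated subtraction is exact, and its source is not
  -- yet on the queue.
  have hpos : 0 < σ.mem 4 e.1 := by
    rw [h.cnt]
    exact Finset.card_pos.2 ⟨i, DAG.mem_idx.2 ⟨e, he, hX, rfl⟩⟩
  have hnQ : e.1 ∉ Q := fun hm => by
    have := (h.mem _).1 hm
    omega
  have hcnt : ∀ v : Fin N, υ.mem 4 v = (G.idx fun j e => j ∉ insert i X ∧ e.1 = v).card := by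
    intro v
    rw [hcard, m4]
    split
    · next hv => subst hv; rw [Function.update_self, h.cnt]
    · next hv => rw [Function.update_of_ne (fun heq => hv (Fin.ext heq.symm)), h.cnt]
  have hmem4 : ∀ v : Fin N, υ.mem 4 v = 0 ↔ σ.mem 4 v = 0 ∨ (v = e.1 ∧ σ.mem 4 e.1 - 1 = 0) := by
    intro v
    rw [m4]
    by_cases hv : v = e.1
    · subst hv
      rw [Function.update_self]
      simp only [true_and]
      omega
    · rw [Function.update_of_ne (fun heq => hv (Fin.ext heq))]
      tauto
  have hout : ∀ v : Fin N, ∃ l, Linked (υ.mem 7) (υ.mem 6 v) l ∧ l.Nodup ∧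
      ∀ j, j ∈ l ↔ j ∈ G.idx fun j e => j ∈ insert i X ∧ e.1 = v ∧ Γ.ent e.2 ≠ [] := by
    intro v
    obtain ⟨l, k1, k2, k3⟩ := h.out v
    have hil : i ∉ l := fun hm => by
      obtain ⟨_, _, hx, _⟩ := DAG.mem_idx.1 ((k3 i).1 hm)
      exact hX hx
    have hiff : ∀ j, j ∈ (G.idx fun j e => j ∈ insert i X ∧ e.1 = v ∧ Γ.ent e.2 ≠ []) ↔
        (j = i ∧ e.1 = v ∧ Γ.ent e.2 ≠ []) ∨ j ∈ l := by
      intro j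
      rw [k3, DAG.mem_idx, DAG.mem_idx]
      constructor
      · rintro ⟨e', he', hj, hv', hne⟩
        rcases Finset.mem_insert.1 hj with rfl | hj
        · rw [he] at he'
          cases he'
          exact .inl ⟨rfl, hv', hne⟩
        · exact .inr ⟨e', he', hj, hv', hne⟩
      · rintro (⟨rfl, hv', hne⟩ | ⟨e', he', hj, hv', hne⟩)
        · exact ⟨e, he, Finset.mem_insert_self _ _, hv', hne⟩
        · exact ⟨e', he', Finset.mem_insert_of_mem hj, hv', hne⟩
    by_cases hne : Γ.ent e.2 = []
    · rw [m7, m6, if_pos hne, if_pos hne]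
      exact ⟨l, k1, k2, fun j => by rw [hiff]; tauto⟩
    · rw [m7, m6, if_neg hne, if_neg hne]
      have k1' : Linked (Function.update (σ.mem 7) i (σ.mem 6 e.1)) (σ.mem 6 v) l :=
        k1.congr fun j hj => Function.update_of_ne (by rintro rfl; exact hil hj) _ _
      by_cases hv : e.1 = v
      · subst hv
        refine ⟨i :: l, ⟨by rw [Function.update_self], ?_⟩, List.nodup_cons.2 ⟨hil, k2⟩,
          fun j => ?_⟩
        · rw [Function.update_self]; exact k1'
        · rw [hiff, List.mem_cons]; tauto
      · refine ⟨l, ?_, k2, fun j => by rw [hiff]; tauto⟩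
        rw [Function.update_of_ne (fun heq => hv (Fin.ext heq.symm))]
        exact k1'
  by_cases hc : σ.mem 4 e.1 - 1 = 0
  · rw [if_pos hc] at r5 m5
    refine ⟨υ, Q ++ [e.1], hL.mono ht hg, ⟨?_, ?_, ?_, hcnt, ?_, hout⟩, List.prefix_append _ _, r8⟩
    · rw [r5, h.len, List.length_append, List.length_singleton]
    · intro j hj
      rw [m5, h.len, Function.update_apply, List.getElem_append]
      simp only [List.length_append, List.length_singleton] at hj
      by_cases hj' : j < Q.length
      · rw [if_neg (by omega), dif_pos hj']; exact h.cell j hj'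
      · rw [if_pos (by omega), dif_neg hj']; simp
    · refine List.nodup_append'.2 ⟨h.nodup, by simp, fun v hv hv' => ?_⟩
      rw [List.mem_singleton.1 hv'] at hv
      exact hnQ hv
    · intro v
      rw [hmem4, List.mem_append, List.mem_singleton, h.mem]
      tauto
  · rw [if_neg hc] at r5 m5
    refine ⟨υ, Q, hL.mono ht hg, ⟨by rw [r5, h.len], by rw [m5]; exact h.cell, h.nodup, hcnt, ?_,
      hout⟩, List.prefix_refl _, r8⟩
    intro v
    rw [hmem4, h.mem]
    tauto

theorem relaxLoop_spec {l : List ℕ} (h : Queue σ G Γ X Q) (hl : Linked (σ.mem 3) (σ.reg 8) l)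
    (hnd : l.Nodup) (hl' : ∀ i ∈ l, i ∉ X ∧ ∃ e, G.edges[i]? = some e ∧ e.2 = u)
    (h7 : σ.reg 7 = u) (h9 : σ.mem 9 u = 0 ↔ Γ.ent u = [])
    (hsrc : ∀ i e, G.edges[i]? = some e → σ.mem 0 i = e.1) :
    ∃ τ Q', Leads ops relaxLoop σ τ (90 * l.length + 10) (20 * l.length) ∧
      Queue τ G Γ (X ∪ l.toFinset) Q' ∧ Q <+: Q' := by
  have hlin : listTest.linear = true := by decide
  have hcost : listTest.cost = 4 := by decide
  have hgrow : listTest.growth = 0 := by decide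
  induction l generalizing σ X Q with
  | nil =>
    have h0 : σ.reg 8 = 0 := hl
    refine ⟨σ, Q, (Leads.loop_false ?_ hlin).mono (by omega) (by omega), by simpa using h,
      List.prefix_refl _⟩
    simp [listTest, Test.Holds, Exp.eval, h0]
  | cons i l ih =>
    obtain ⟨h8, hl⟩ := hl
    obtain ⟨hX, e, he, rfl⟩ := hl' i (by simp)
    obtain ⟨υ, Q', hL, k1, k2, k3⟩ := h.relax (ops := ops) h8 he hX h7 h9 (hsrc i e he)
    have mo : ∀ a, a ≠ 4 → a ≠ 5 → a ≠ 6 → a ≠ 7 → υ.mem a = σ.mem a := fun a h1 h2 h3 h4 =>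
      hL.frame_mem a (by simp [relaxStep, enqueue, Program.arrays, h1, h2, h3, h4])
    rw [List.nodup_cons] at hnd
    obtain ⟨τ, Q'', q1, q2, q3⟩ := ih k1
      (by rw [mo 3 (by simp) (by simp) (by simp) (by simp), k3]; exact hl) hnd.2
      (fun j hj => by
        obtain ⟨g1, g2⟩ := hl' j (by simp [hj])
        refine ⟨?_, g2⟩
        rw [Finset.mem_insert, not_or]
        refine ⟨?_, g1⟩
        rintro rfl
        exact hnd.1 hj)
      (by rw [hL.frame_reg 7 (by decide), h7])
      (by rw [mo 9 (by simp) (by simp) (by simp) (by simp)]; exact h9)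
      (by rw [mo 0 (by simp) (by simp) (by simp) (by simp)]; exact hsrc)
    refine ⟨τ, Q'', (Leads.loop_true ?_ hlin hL q1).mono (by rw [List.length_cons]; omega)
      (by rw [List.length_cons]; omega), ?_, k2.trans q3⟩
    · simp [listTest, Test.Holds, Exp.eval, h8]
    · have : insert i X ∪ l.toFinset = X ∪ (i :: l).toFinset := by
        ext j
        simp only [Finset.mem_union, Finset.mem_insert, List.mem_toFinset, List.mem_cons]
        tauto
      rwa [← this]

/-- The edges into `D`. -/
noncomputable def DAG.into (G : DAG N) (D : Finset (Fin N)) : Finset ℕ := G.idx fun _ e => e.2 ∈ D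

/-- The number of edges at a node, with a constant for the node itself. -/
noncomputable def DAG.load (G : DAG N) (v : Fin N) : ℕ :=
  1 + (G.idx fun _ e => e.1 = v).card + (G.idx fun _ e => e.2 = v).card

/-- An edge is counted once at its source and once at its target. -/
theorem DAG.sum_load_le (G : DAG N) : ∑ v, G.load v ≤ 2 * G.size := by
  have h1 := G.sum_idx_le Prod.fst
  have h2 := G.sum_idx_le Prod.snd
  simp only [DAG.load, Finset.sum_add_distrib, Finset.sum_const, Finset.card_univ,
    Fintype.card_fin, smul_eq_mul, mul_one, DAG.size]
  omega

/-- The nodes in `D`, the first ones on the queue, have been visited. -/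
structure Visiting {W : Type u} [LinearOrder W] {N : ℕ} (w : Multiset W → W) (G : DAG N)
    (wt : Fin N × Fin N → W) (t : Fin N) (ops : WeightOps W) (σ : State W) (Γ : Ghost N)
    (D : Finset (Fin N)) (Q : List (Fin N)) (n : ℕ) : Prop where
  inv : Inv w G wt t ops σ Γ D none
  made : Made σ Γ
  queue : Queue σ G Γ (G.into D) Q
  lists : InLists σ G G.edges.length
  target : σ.reg 3 = t
  count : σ.reg 6 = n
  mem : ∀ v, v ∈ D ↔ v ∈ Q.take n

/-- The work at `u` consists of its tree, linear in the useful edges out of `u`, and of the release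
of the edges into `u`; so it is paid for by `G.load u`. -/
theorem Visiting.step {n : ℕ} (hC : ops.Computes w) (hw : SubsetMonotone w)
    (h : Visiting w G wt t ops σ Γ D Q n) (hn : n < Q.length) :
    ∃ τ Γ' u Q', u ∉ D ∧ Leads ops visitStep σ τ (300 * G.load u) (60 * G.load u) ∧
      Visiting w G wt t ops τ Γ' (insert u D) Q' (n + 1) := by
  obtain ⟨u, hu⟩ : ∃ u, u = Q[n] := ⟨_, rfl⟩
  have huD : u ∉ D := by
    rw [h.mem, hu]
    intro hm
    obtain ⟨i, hi, heq⟩ := List.getElem_of_mem hm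
    rw [List.getElem_take, h.queue.nodup.getElem_inj_iff] at heq
    rw [List.length_take] at hi
    omega
  -- A node on the queue has counter `0`, so none of its edges leads outside of `D`.
  have hX : ∀ (i : ℕ) (e : Fin N × Fin N), G.edges[i]? = some e → e.1 = u → e.2 ∈ D := by
    intro i e he heu
    have h0 := (h.queue.mem u).1 (hu ▸ List.getElem_mem hn)
    rw [h.queue.cnt, Finset.card_eq_zero] at h0
    by_contra hD
    have : i ∈ G.idx fun i e => i ∉ G.into D ∧ e.1 = u := by
      refine DAG.mem_idx.2 ⟨e, he, fun hi => ?_, heu⟩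
      obtain ⟨e', he', hD'⟩ := DAG.mem_idx.1 hi
      rw [he] at he'
      cases he'
      exact hD hD'
    rw [h0] at this
    simp at this
  have hcl : ∀ e ∈ G.edges, e.1 = u → e.2 ∈ D := by
    intro e he
    obtain ⟨i, hi⟩ := List.mem_iff_getElem?.1 he
    exact hX i e hi
  have hL1 := Leads.exec (ops := ops) visitNext (by decide) σ
  obtain ⟨σ1, hσ1⟩ : ∃ σ1, σ1 = visitNext.exec ops σ := ⟨_, rfl⟩
  rw [← hσ1] at hL1
  have r7 : σ1.reg 7 = u := by
    rw [hσ1, hu, ← h.queue.cell n hn]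
    simp [visitNext, Program.exec, Exp.eval, h.count]
  have r6 : σ1.reg 6 = n + 1 := by
    rw [hσ1]; simp [visitNext, Program.exec, Exp.eval, h.count]
  have m1 : σ1.mem = σ.mem := by
    funext a; exact hL1.frame_mem a (by simp [visitNext, Program.arrays])
  have w1 : σ1.wmem = σ.wmem := by
    funext a; exact hL1.frame_wmem a (by simp [visitNext, Program.warrays])
  have hI1 : Inv w G wt t ops σ1 Γ D none := h.inv.congr_state (hL1.frame_reg 10 (by decide))
    (hL1.frame_reg 11 (by decide)) (fun a _ => by rw [m1]) w1
  have hM1 : Made σ1 Γ := ⟨h.made.pos, h.made.rot, by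
    rw [hL1.frame_reg 10 (by decide)]; exact h.made.next, by
    rw [hL1.frame_reg 10 (by decide), m1]; exact h.made.par, by rw [m1]; exact h.made.first⟩
  obtain ⟨l, k1, k2, k3⟩ := h.queue.out u
  have hlmem : ∀ i, i ∈ l ↔ ∃ e, G.edges[i]? = some e ∧ e.1 = u ∧ Γ.ent e.2 ≠ [] := by
    intro i
    rw [k3, DAG.mem_idx]
    constructor
    · rintro ⟨e, he, -, h1, h2⟩
      exact ⟨e, he, h1, h2⟩
    · rintro ⟨e, he, h1, h2⟩
      exact ⟨e, he, DAG.mem_idx.2 ⟨e, he, hX i e he h1⟩, h1, h2⟩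
  obtain ⟨σ2, Γ', hL2, hI2, hM2, hent⟩ := makeNode_spec hC hw hI1 hM1 huD hcl
    (by rw [hL1.frame_reg 3 (by decide), h.target]) r7 (by rw [m1]; exact k1) k2 hlmem
  have m2 : ∀ a, a = 0 ∨ (2 ≤ a ∧ a ≤ 7) → σ2.mem a = σ.mem a := fun a ha => by
    rw [← m1]
    refine hL2.frame_mem a ?_
    simp [makeNode, makeTarget, makeTree, leafLoop, leafStep, mergeLoop, mergeStep, setWin,
      attachRoot, newEntry, Program.arrays]
    omega
  have hL3 := Leads.exec (ops := ops) (.assign 8 (.cell 2 (.reg 7))) (by decide) σ2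
  obtain ⟨σ3, hσ3⟩ : ∃ σ3, σ3 = (Program.assign 8 (.cell 2 (.reg 7))).exec ops σ2 := ⟨_, rfl⟩
  rw [← hσ3] at hL3
  have r72 : σ2.reg 7 = u := by rw [hL2.frame_reg 7 (by decide), r7]
  have r8 : σ3.reg 8 = σ.mem 2 u := by
    rw [hσ3, ← m2 2 (by simp)]; simp [Program.exec, Exp.eval, r72]
  have m3 : σ3.mem = σ2.mem := by
    funext a; exact hL3.frame_mem a (by simp [Program.arrays])
  have w3 : σ3.wmem = σ2.wmem := by
    funext a; exact hL3.frame_wmem a (by simp [Program.warrays])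
  have r5 : σ3.reg 5 = σ.reg 5 := by
    rw [hL3.frame_reg 5 (by decide), hL2.frame_reg 5 (by decide), hL1.frame_reg 5 (by decide)]
  have hq3 : Queue σ3 G Γ' (G.into D) Q := by
    refine ⟨by rw [r5, h.queue.len], ?_, h.queue.nodup, ?_, ?_, ?_⟩
    · rw [m3, m2 5 (by simp)]; exact h.queue.cell
    · rw [m3, m2 4 (by simp)]; exact h.queue.cnt
    · rw [m3, m2 4 (by simp)]; exact h.queue.mem
    · rw [m3, m2 6 (by simp), m2 7 (by simp)]
      intro v
      obtain ⟨l, k1, k2, k3⟩ := h.queue.out v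
      refine ⟨l, k1, k2, fun i => ?_⟩
      rw [k3, DAG.mem_idx, DAG.mem_idx]
      refine exists_congr fun e => and_congr_right fun he => and_congr_right fun hi => ?_
      obtain ⟨e', he', hD⟩ := DAG.mem_idx.1 hi
      rw [he] at he'
      cases he'
      rw [hent _ (fun heq => huD (heq ▸ hD))]
  obtain ⟨l', q1, q2, q3⟩ := h.lists u
  have hl'mem : ∀ i, i ∈ l' ↔ ∃ e, G.edges[i]? = some e ∧ e.2 = u := by
    intro i
    rw [q3, DAG.mem_idx]
    refine exists_congr fun e => and_congr_right fun he => and_iff_right ?_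
    exact (List.getElem?_eq_some_iff.1 he).1
  obtain ⟨τ, Q', hL4, hq4, hpre⟩ := relaxLoop_spec (ops := ops) (u := u) hq3
    (by rw [m3, m2 3 (by simp), r8]; exact q1) q2
    (fun i hi => by
      obtain ⟨e, he, heu⟩ := (hl'mem i).1 hi
      refine ⟨fun hi' => ?_, e, he, heu⟩
      obtain ⟨e', he', hD⟩ := DAG.mem_idx.1 hi'
      rw [he] at he'
      cases he'
      exact huD (heu ▸ hD))
    (by rw [hL3.frame_reg 7 (by decide), r72])
    (by
      rw [m3, hM2.first]
      constructor
      · intro h0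
        by_contra hne
        rw [List.getD_eq_getElem _ _ (List.length_pos_iff.2 hne)] at h0
        exact (hI2.core u).ent_ne _ (List.getElem_mem _) h0
      · intro h0
        rw [h0]; rfl)
    (by rw [m3, m2 0 (by simp)]; exact h.inv.src_eq)
  have m4 : ∀ a, a ≤ 3 ∨ 8 ≤ a → τ.mem a = σ2.mem a := fun a ha => by
    rw [← m3]
    exact hL4.frame_mem a (by
      simp [relaxLoop, relaxStep, enqueue, Program.arrays]
      omega)
  have w4 : τ.wmem = σ2.wmem := by
    rw [← w3]
    funext a; exact hL4.frame_wmem a (by simp [relaxLoop, relaxStep, enqueue, Program.warrays])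
  have r4 : ∀ a, a ≠ 5 → a ≠ 8 → a ≠ 9 → a ≠ 13 → τ.reg a = σ2.reg a := fun a h1 h2 h3 h4 => by
    rw [hL4.frame_reg a (by simp [relaxLoop, relaxStep, enqueue, Program.regs, h1, h2, h3, h4]),
      hL3.frame_reg a (by simp [Program.regs, h2])]
  have hinto : G.into D ∪ l'.toFinset = G.into (insert u D) := by
    ext i
    rw [Finset.mem_union, List.mem_toFinset, hl'mem, DAG.into, DAG.into, DAG.mem_idx, DAG.mem_idx]
    constructor
    · rintro (⟨e, he, hD⟩ | ⟨e, he, heu⟩)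
      · exact ⟨e, he, Finset.mem_insert_of_mem hD⟩
      · exact ⟨e, he, by rw [heu]; exact Finset.mem_insert_self _ _⟩
    · rintro ⟨e, he, hD⟩
      rcases Finset.mem_insert.1 hD with heu | hD
      · exact .inr ⟨e, he, heu⟩
      · exact .inl ⟨e, he, hD⟩
  have hlen : l.length ≤ (G.idx fun _ e => e.1 = u).card := by
    rw [← List.toFinset_card_of_nodup k2]
    refine Finset.card_le_card fun i hi => ?_
    obtain ⟨e, he, heu, -⟩ := (hlmem i).1 (List.mem_toFinset.1 hi)
    exact DAG.mem_idx.2 ⟨e, he, heu⟩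
  have hlen' : l'.length ≤ (G.idx fun _ e => e.2 = u).card := by
    rw [← List.toFinset_card_of_nodup q2]
    refine Finset.card_le_card fun i hi => ?_
    obtain ⟨e, he, heu⟩ := (hl'mem i).1 (List.mem_toFinset.1 hi)
    exact DAG.mem_idx.2 ⟨e, he, heu⟩
  have t1 : visitNext.time ≤ 20 := by decide
  have g1 : visitNext.growth ≤ 5 := by decide
  have t3 : (Program.assign 8 (.cell 2 (.reg 7))).time ≤ 5 := by decide
  have g3 : (Program.assign 8 (.cell 2 (.reg 7))).growth = 0 := by decide
  refine ⟨τ, Γ', u, Q', huD, (hL1.seq (hL2.seq (hL3.seq hL4))).mono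
    (by rw [DAG.load]; omega) (by rw [DAG.load]; omega), ?_, ?_, hinto ▸ hq4, ?_, ?_, ?_, ?_⟩
  · exact hI2.congr_state (r4 10 (by simp) (by simp) (by simp) (by simp))
      (r4 11 (by simp) (by simp) (by simp) (by simp)) (fun a ha => m4 a (by omega)) w4
  · have r10 := r4 10 (by simp) (by simp) (by simp) (by simp)
    exact ⟨hM2.pos, hM2.rot, r10 ▸ hM2.next, by rw [r10, m4 10 (by simp)]; exact hM2.par,
      by rw [m4 9 (by simp)]; exact hM2.first⟩
  · intro v
    rw [m4 3 (by simp), m4 2 (by simp), m2 3 (by simp), m2 2 (by simp)]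
    exact h.lists v
  · rw [r4 3 (by simp) (by simp) (by simp) (by simp), hL2.frame_reg 3 (by decide),
      hL1.frame_reg 3 (by decide), h.target]
  · rw [r4 6 (by simp) (by simp) (by simp) (by simp), hL2.frame_reg 6 (by decide), r6]
  · intro v
    obtain ⟨r, rfl⟩ := hpre
    rw [List.take_append_of_le_length (by omega), List.take_add_one, List.getElem?_eq_getElem hn,
      Option.toList_some, List.mem_append, List.mem_singleton, Finset.mem_insert, h.mem, hu]
    tauto

theorem visitLoop_spec {n : ℕ} (hC : ops.Computes w) (hw : SubsetMonotone w)
    (h : Visiting w G wt t ops σ Γ D Q n) :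
    ∃ τ Γ', Leads ops visitLoop σ τ (310 * ∑ v ∈ Dᶜ, G.load v + 10) (60 * ∑ v ∈ Dᶜ, G.load v) ∧
      Inv w G wt t ops τ Γ' Finset.univ none ∧ Made τ Γ' := by
  have hlin : (Test.lt (.reg 6) (.reg 5)).linear = true := by decide
  have hcost : (Test.lt (.reg 6) (.reg 5)).cost = 3 := by decide
  have hgrow : (Test.lt (.reg 6) (.reg 5)).growth = 0 := by decide
  induction hm : (Dᶜ).card generalizing σ Γ D Q n with
  | zero =>
    have hD : D = Finset.univ := by
      rwa [Finset.card_eq_zero, Finset.compl_eq_empty_iff] at hm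
    have hn : ¬ n < Q.length := fun hn => by
      obtain ⟨-, -, u, -, hu, -⟩ := h.step hC hw hn
      exact hu (hD ▸ Finset.mem_univ u)
    refine ⟨σ, Γ, (Leads.loop_false ?_ hlin).mono (by omega) (by omega), hD ▸ h.inv, h.made⟩
    simp only [Test.Holds, Exp.eval, h.count, h.queue.len]
    exact hn
  | succ m ih =>
    have hn : n < Q.length := by
      by_contra hn
      have hDQ : ∀ v, v ∈ D ↔ v ∈ Q := fun v => by
        rw [h.mem, List.take_of_length_le (by omega)]
      -- If the queue ran empty early, then any node all of whose edges lead into `D` would have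
      -- counter `0` and would itself be in `D`; by induction from the sinks, all nodes are.
      have hall : ∀ v, v ∈ D := by
        refine G.induction fun v ih => ?_
        rw [hDQ, h.queue.mem, h.queue.cnt, Finset.card_eq_zero, Finset.eq_empty_iff_forall_notMem]
        intro i hi
        obtain ⟨e, he, hi', hev⟩ := DAG.mem_idx.1 hi
        exact hi' (DAG.mem_idx.2 ⟨e, he, ih e (List.mem_of_getElem? he) hev⟩)
      rw [Finset.eq_univ_of_forall hall] at hm
      simp at hm
    obtain ⟨υ, Γ', u, Q', hu, hL, h'⟩ := h.step hC hw hn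
    have hsum : ∑ v ∈ Dᶜ, G.load v = G.load u + ∑ v ∈ (insert u D)ᶜ, G.load v := by
      rw [← Finset.add_sum_erase _ _ (Finset.mem_compl.2 hu), Finset.compl_insert]
    have hm' : ((insert u D)ᶜ).card = m := by
      rw [Finset.compl_insert, Finset.card_erase_of_mem (Finset.mem_compl.2 hu)]
      omega
    obtain ⟨τ, Γ'', k1, k2⟩ := ih h' hm'
    have hl1 : 1 ≤ G.load u := by rw [DAG.load]; omega
    refine ⟨τ, Γ'', (Leads.loop_true ?_ hlin hL k1).mono (by omega) (by omega), k2⟩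
    simp only [Test.Holds, Exp.eval, h.count, h.queue.len]
    exact hn

end

/-! ### The whole program and its bounds -/

/-- Address `0` stands for no entry and for no tree node. -/
def startUp : Program := .assign 10 (.lit 1) ⟫ .assign 11 (.lit 1)

def preprocessing : Program :=
  startUp ⟫ scanLoop ⟫ .assign 4 (.lit 0) ⟫ sinkLoop ⟫ visitLoop ⟫ .assign 19 (.cell 9 (.reg 2))

/-- List the paths in ascending order of weight. -/
def rankedEnumeration : Program := preprocessing ⟫ enumLoop

def Ghost.initial {N : ℕ} (s : Fin N) : Ghost N := ⟨fun _ => [], fun _ => [], fun _ => none,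
  fun _ => (s, s), fun _ => 0, fun _ => 0⟩

section
variable {W : Type u} [LinearOrder W] {w : Multiset W → W} {ops : WeightOps W} {N : ℕ}
  {G : DAG N} {wt : Fin N × Fin N → W} {s t : Fin N} {σ τ : State W} {Γ Γ' : Ghost N}

/-- If `w 0` is least, strong monotonicity may be applied with the empty multiset as `X₁`, for which
its second premise is just `w Y₁ ≤ w Y₂`. -/
theorem StrongSubsetMonotone.subsetMonotone (h : StrongSubsetMonotone w)
    (h' : (∀ X, w 0 ≤ w X) ∨ SubsetMonotone w) : SubsetMonotone w := by
  rcases h' with h' | h'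
  · intro X Y₁ Y₂ hY
    exact h 0 X Y₁ Y₂ (h' X) (by simpa using hY)
  · exact h'

theorem DAG.exists_length_le (G : DAG N) (t v : Fin N) :
    ∃ n, ∀ p, G.IsPath v t p → p.length ≤ n := by
  refine G.induction (P := fun v => ∃ n, ∀ p, G.IsPath v t p → p.length ≤ n) (fun v ih => ?_) v
  have : ∀ e, ∃ n, e ∈ G.edges → e.1 = v → ∀ p, G.IsPath e.2 t p → p.length ≤ n := by
    intro e
    by_cases he : e ∈ G.edges ∧ e.1 = v
    · obtain ⟨n, hn⟩ := ih e he.1 he.2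
      exact ⟨n, fun _ _ => hn⟩
    · exact ⟨0, fun h1 h2 => absurd ⟨h1, h2⟩ he⟩
  choose f hf using this
  -- The sum over all pairs replaces a maximum over the edges out of `v`.
  refine ⟨∑ e, f e + 1, fun p hp => ?_⟩
  cases p with
  | nil => simp
  | cons e q =>
    have h1 := hf e hp.1 hp.2.1 q hp.2.2
    have h2 := Finset.single_le_sum (f := f) (fun _ _ => Nat.zero_le _) (Finset.mem_univ e)
    rw [List.length_cons]
    omega

theorem DAG.exists_isMaxPathLength (G : DAG N) (s t : Fin N) : ∃ ℓ, G.IsMaxPathLength s t ℓ := by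
  classical
  have h : ∃ n, n ∈ upperBounds {n : ℕ | ∃ p, G.IsPath s t p ∧ p.length = n} := by
    obtain ⟨n, hn⟩ := G.exists_length_le t s
    exact ⟨n, fun _ ⟨p, hp, hm⟩ => hm ▸ hn p hp⟩
  exact ⟨Nat.find h, Nat.find_spec h, fun n hn => Nat.find_min' h hn⟩

theorem initialState_bounded : (initialState ops G wt s t).Bounded G.size := by
  have hs := s.2
  have ht := t.2
  refine ⟨Nat.zero_le _, fun x => ?_, fun a i => ?_⟩
  · simp only [initialState, DAG.size]
    split_ifs <;> omega
  · simp only [initialState, DAG.size]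
    split_ifs with h
    · have := (G.edges[i]).1.2; omega
    · have := (G.edges[i]).2.2; omega
    · omega
    · omega

theorem initialState_mem {a : ℕ} (ha : 2 ≤ a) (i : ℕ) : (initialState ops G wt s t).mem a i = 0 := by
  simp only [initialState]
  split_ifs <;> omega

theorem Inv.initial (h10 : σ.reg 10 = 1) (h11 : σ.reg 11 = 1)
    (hmem : ∀ a i, a ≤ 1 ∨ 8 ≤ a → σ.mem a i = (initialState ops G wt s t).mem a i)
    (hwmem : σ.wmem = (initialState ops G wt s t).wmem) :
    Inv w G wt t ops σ (Ghost.initial s) ∅ none ∧ Made σ (Ghost.initial s) := by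
  have hz : ∀ a i, 8 ≤ a → σ.mem a i = 0 := fun a i ha => by
    rw [hmem a i (.inr ha), initialState_mem (by omega)]
  constructor
  · constructor
    case core =>
      intro v
      constructor <;> simp [Ghost.initial, Ghost.leaves, Ghost.paths, winner, hz]
    case wt_eq =>
      intro i e he
      obtain ⟨hi, rfl⟩ := List.getElem?_eq_some_iff.1 he
      rw [hwmem]; simp [initialState, hi]
    case src_eq =>
      intro i e he
      obtain ⟨hi, rfl⟩ := List.getElem?_eq_some_iff.1 he
      rw [hmem _ _ (by simp)]; simp [initialState, hi]
    case dst_eq =>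
      intro i e he
      obtain ⟨hi, rfl⟩ := List.getElem?_eq_some_iff.1 he
      rw [hmem _ _ (by simp)]; simp [initialState, hi]
    all_goals simp [Ghost.initial, hz, h11]
  · constructor <;> simp [Ghost.initial, hz, h10]

theorem preprocessing_spec (hC : ops.Computes w) (hw : SubsetMonotone w) :
    ∃ τ Γ, Leads ops preprocessing (initialState ops G wt s t) τ (800 * G.size) (200 * G.size) ∧
      Inv w G wt t ops τ Γ Finset.univ none ∧ (∀ f, Γ.pos f = 0) ∧ (∀ v, Γ.rot v = 0) ∧
      τ.reg 2 = s ∧ τ.reg 19 = (Γ.ent s).getD 0 0 ∧ τ.out = [] := by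
  obtain ⟨σ, hσ⟩ : ∃ σ, σ = initialState ops G wt s t := ⟨_, rfl⟩
  rw [← hσ]
  have hL1 := Leads.exec (ops := ops) startUp (by decide) σ
  obtain ⟨σ1, hσ1⟩ : ∃ σ1, σ1 = startUp.exec ops σ := ⟨_, rfl⟩
  rw [← hσ1] at hL1
  have e10 : σ1.reg 10 = 1 := by rw [hσ1]; simp [startUp, Program.exec, Exp.eval]
  have e11 : σ1.reg 11 = 1 := by rw [hσ1]; simp [startUp, Program.exec, Exp.eval]
  have m1 : σ1.mem = σ.mem := by
    funext a; exact hL1.frame_mem a (by simp [startUp, Program.arrays])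
  have w1 : σ1.wmem = σ.wmem := by
    funext a; exact hL1.frame_wmem a (by simp [startUp, Program.warrays])
  have z1 : ∀ a i, 2 ≤ a → σ1.mem a i = 0 := fun a i ha => by
    rw [m1, hσ, initialState_mem ha]
  have f1 : ∀ x, x ≠ 10 → x ≠ 11 → σ1.reg x = σ.reg x := fun x h1 h2 =>
    hL1.frame_reg x (by simp [startUp, Program.regs, h1, h2])
  obtain ⟨σ2, hL2, hin, hcnt⟩ := scanLoop_spec (ops := ops) (G := G) (σ := σ1) (n := 0)
    (d := G.edges.length) (by omega)
    (by rw [f1 4 (by simp) (by simp), hσ]; simp [initialState])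
    (by rw [f1 1 (by simp) (by simp), hσ]; simp [initialState])
    (fun i e he => by
      obtain ⟨hi, rfl⟩ := List.getElem?_eq_some_iff.1 he
      rw [m1, hσ]; simp [initialState, hi])
    (fun i e he => by
      obtain ⟨hi, rfl⟩ := List.getElem?_eq_some_iff.1 he
      rw [m1, hσ]; simp [initialState, hi])
    (fun v => ⟨[], z1 2 v (by simp), by simp, by simp [DAG.mem_idx]⟩)
    (fun v => by
      rw [z1 4 v (by simp), eq_comm, Finset.card_eq_zero, Finset.eq_empty_iff_forall_notMem]
      simp [DAG.mem_idx])
  have hL3 := Leads.exec (ops := ops) (.assign 4 (.lit 0)) (by decide) σ2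
  obtain ⟨σ3, hσ3⟩ : ∃ σ3, σ3 = (Program.assign 4 (.lit 0)).exec ops σ2 := ⟨_, rfl⟩
  rw [← hσ3] at hL3
  have e4 : σ3.reg 4 = 0 := by rw [hσ3]; simp [Program.exec, Exp.eval]
  have m3 : σ3.mem = σ2.mem := by
    funext a; exact hL3.frame_mem a (by simp [Program.arrays])
  have f3 : ∀ x, x ≠ 4 → σ3.reg x = σ1.reg x := fun x h1 => by
    rw [hL3.frame_reg x (by simp [Program.regs, h1]),
      hL2.frame_reg x (by simp [scanLoop, scanStep, Program.regs, h1])]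
  obtain ⟨σ4, Q, hL4, hq1, hq2, hq3, hq4⟩ := sinkLoop_spec (ops := ops) (σ := σ3) (N := N) (n := 0)
    (d := N) (Q := []) (by omega) e4
    (by rw [f3 0 (by simp), f1 0 (by simp) (by simp), hσ]; simp [initialState])
    (by rw [f3 5 (by simp), f1 5 (by simp) (by simp), hσ]; simp [initialState])
    (by simp) (by simp) (by simp)
  have f4 : ∀ x, x ≠ 4 → x ≠ 5 → σ4.reg x = σ1.reg x := fun x h1 h2 => by
    rw [hL4.frame_reg x (by simp [sinkLoop, sinkStep, enqueue, Program.regs, h1, h2]), f3 x h1]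
  have m4 : ∀ a, a ≠ 5 → σ4.mem a = σ2.mem a := fun a h1 => by
    rw [hL4.frame_mem a (by simp [sinkLoop, sinkStep, enqueue, Program.arrays, h1]), m3]
  have m2 : ∀ a, a ≠ 2 → a ≠ 3 → a ≠ 4 → σ2.mem a = σ.mem a := fun a h1 h2 h3 => by
    rw [hL2.frame_mem a (by simp [scanLoop, scanStep, Program.arrays, h1, h2, h3]), m1]
  obtain ⟨hI, hM⟩ := Inv.initial (w := w) (σ := σ4) (ops := ops) (G := G) (wt := wt) (s := s)
    (t := t) (by rw [f4 10 (by simp) (by simp), e10]) (by rw [f4 11 (by simp) (by simp), e11])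
    (fun a i ha => by rw [m4 a (by omega), m2 a (by omega) (by omega) (by omega), hσ])
    (by
      rw [← hσ, ← w1]
      funext a
      rw [hL4.frame_wmem a (by simp [sinkLoop, sinkStep, enqueue, Program.warrays]),
        hL3.frame_wmem a (by simp [Program.warrays]),
        hL2.frame_wmem a (by simp [scanLoop, scanStep, Program.warrays])])
  have hinto : G.into ∅ = ∅ := by
    rw [Finset.eq_empty_iff_forall_notMem]
    simp [DAG.into, DAG.mem_idx]
  have hV : Visiting w G wt t ops σ4 (Ghost.initial s) ∅ Q 0 := by
    refine ⟨hI, hM, ⟨hq1, hq2, hq3, fun v => ?_, hq4, fun v => ⟨[], ?_, by simp, ?_⟩⟩, fun v => ?_,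
      ?_, ?_, by simp⟩
    · rw [m4 4 (by simp), hcnt, hinto]
      congr 1
      ext i
      rw [DAG.mem_idx, DAG.mem_idx]
      refine exists_congr fun e => and_congr_right fun he => ?_
      simp [(List.getElem?_eq_some_iff.1 he).1]
    · show σ4.mem 6 v = 0
      rw [m4 6 (by simp), m2 6 (by simp) (by simp) (by simp), hσ, initialState_mem (by simp)]
    · simp [DAG.mem_idx, Ghost.initial]
    · rw [m4 3 (by simp), m4 2 (by simp)]
      exact hin v
    · rw [f4 3 (by simp) (by simp), f1 3 (by simp) (by simp), hσ]
      simp [initialState]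
    · rw [f4 6 (by simp) (by simp), f1 6 (by simp) (by simp), hσ]
      simp [initialState]
  obtain ⟨σ5, Γ, hL5, hI5, hM5⟩ := visitLoop_spec hC hw hV
  have hL6 := Leads.exec (ops := ops) (.assign 19 (.cell 9 (.reg 2))) (by decide) σ5
  obtain ⟨σ6, hσ6⟩ : ∃ σ6, σ6 = (Program.assign 19 (.cell 9 (.reg 2))).exec ops σ5 := ⟨_, rfl⟩
  rw [← hσ6] at hL6
  have r2 : σ5.reg 2 = s := by
    rw [hL5.frame_reg 2 (by decide), f4 2 (by simp) (by simp), f1 2 (by simp) (by simp), hσ]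
    simp [initialState]
  have hsum : ∑ v ∈ (∅ : Finset (Fin N))ᶜ, G.load v ≤ 2 * G.size := by
    rw [Finset.compl_empty]; exact G.sum_load_le
  have hN : 1 ≤ N := by have := s.2; omega
  have hsize : G.size = N + G.edges.length := rfl
  have t1 : startUp.time ≤ 10 := by decide
  have g1 : startUp.growth ≤ 5 := by decide
  have t3 : (Program.assign 4 (.lit 0)).time ≤ 5 := by decide
  have g3 : (Program.assign 4 (.lit 0)).growth ≤ 5 := by decide
  have t6 : (Program.assign 19 (.cell 9 (.reg 2))).time ≤ 5 := by decide
  have g6 : (Program.assign 19 (.cell 9 (.reg 2))).growth ≤ 5 := by decide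
  have m6 : ∀ a, σ6.mem a = σ5.mem a := fun a => hL6.frame_mem a (by simp [Program.arrays])
  refine ⟨σ6, Γ, (hL1.seq (hL2.seq (hL3.seq (hL4.seq (hL5.seq hL6))))).mono (by omega) (by omega),
    hI5.congr_state (hL6.frame_reg 10 (by decide)) (hL6.frame_reg 11 (by decide))
      (fun a _ => m6 a) (by funext a; exact hL6.frame_wmem a (by simp [Program.warrays])),
    hM5.pos, hM5.rot, ?_, ?_, ?_⟩
  · rw [hL6.frame_reg 2 (by decide), r2]
  · rw [← hM5.first, hσ6]
    simp [Program.exec, Exp.eval, r2]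
  · rw [hL6.frame_out (by decide), hL5.frame_out (by decide), hL4.frame_out (by decide),
      hL3.frame_out (by decide), hL2.frame_out (by decide), hL1.frame_out (by decide), hσ]
    rfl

theorem rankedEnumeration_spec (hC : ops.Computes w) (hw : SubsetMonotone w) (G : DAG N)
    (wt : Fin N × Fin N → W) (s t : Fin N) {ℓ : ℕ} (hℓ : ∀ p, G.IsPath s t p → p.length ≤ ℓ) :
    ∃ τ ps, Run ops rankedEnumeration (initialState ops G wt s t) τ ∧
      IsRankedEnumeration w G wt s t ps ∧ τ.answers.map Answer.word = ps.map encodePath ∧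
      (∀ k (h : k < τ.answers.length),
        (τ.answers[k]).time ≤ 3000 * G.size + (k + 1) * (2000 * (Nat.log 2 N + ℓ + 1)) ∧
        (τ.answers[k]).space ≤ 3000 * G.size + k * (7 * ℓ)) ∧
      τ.clock ≤ 3000 * G.size + ps.length * (2000 * (Nat.log 2 N + ℓ + 1)) ∧
      τ.peak ≤ 3000 * G.size + ps.length * (7 * ℓ) := by
  obtain ⟨υ, Γ, hL, hI, hpos, hrot, h2, h19, ho⟩ := preprocessing_spec (G := G) (wt := wt) (s := s)
    (t := t) hC hw
  obtain ⟨σ, hr, hsim, ha, hc, hB⟩ := hL _ (.refl _)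
  have hN : 1 ≤ N := by have := s.2; omega
  have hsize : G.size = N + G.edges.length := rfl
  have hadv : ∀ u, Γ.adv u = 0 := fun u => by
    rw [Ghost.adv, funext hpos]; simp
  have hI' : Inv w G wt t ops σ Γ Finset.univ none := hI.congr_state (by rw [hsim.reg])
    (by rw [hsim.reg]) (fun a _ => by rw [hsim.mem]) hsim.wmem
  have hans : σ.answers = [] := ha
  have hE : Enumerating w G wt s t ops ℓ (800 * G.size) (G.size + 200 * G.size)
      (fun K => 8 * G.edges.length + 6 * (K * (Nat.log 2 N + ℓ + 1))) 0 σ Γ := by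
    refine ⟨hI', ⟨by simp [hadv], by simp [hadv], fun u _ => .inl (hadv u)⟩, by rw [hsim.reg, h2],
      by rw [hsim.out, ho], by rw [hsim.reg, h19], Nat.zero_le _, fun h0 => ?_, by simp [hans], ?_,
      ?_, by simp [hans], by simp [hans]⟩
    · rw [hsim.reg, h19] at h0
      have hnil : Γ.ent s = [] := by
        by_contra hne
        rw [List.getD_eq_getElem _ _ (List.length_pos_iff.2 hne)] at h0
        exact (hI'.core s).ent_ne _ (List.getElem_mem _) h0
      -- If `s = t`, the list is not empty; otherwise `count` gives at least one entry when the
      -- winner is not `0`.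
      by_contra hne
      by_cases hst : s = t
      · subst hst
        exact hI'.nonempty s (Finset.mem_univ _) (by simp) [] rfl hnil
      · have := (hI'.core s).count hst
        rw [hnil] at this
        simp [hne] at this
    · rw [show (initialState ops G wt s t).clock = 0 from rfl, Nat.zero_add] at hc
      exact hc.trans (by rw [Nat.add_assoc]; exact Nat.le_add_right _ _)
    · rw [Nat.zero_mul, Nat.add_zero]
      exact hB G.size initialState_bounded
  obtain ⟨τ, ps, k1, k2, k3, k4, k5, k6⟩ := enumLoop_spec hC hw hℓ
    (fun σ Γ K h1 h2 => h1.sum_rot_le h2)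
    (fun a b hab => by gcongr) hE
  -- Each rotation costs `220` steps: `800 + 220 * 8` and the final `5` stay within `3000`, and `500
  -- + 220 * 6` within `2000`.
  have harith : ∀ K, 800 * G.size + K * (500 * (ℓ + 1)) +
      220 * (8 * G.edges.length + 6 * (K * (Nat.log 2 N + ℓ + 1))) + 5 ≤
      3000 * G.size + K * (2000 * (Nat.log 2 N + ℓ + 1)) := by
    intro K
    have e1 : K * (500 * (ℓ + 1)) = 500 * (K * ℓ) + 500 * K := by ring
    have e2 : K * (2000 * (Nat.log 2 N + ℓ + 1)) =
      2000 * (K * Nat.log 2 N) + 2000 * (K * ℓ) + 2000 * K := by ring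
    have e3 : K * (Nat.log 2 N + ℓ + 1) = K * Nat.log 2 N + K * ℓ + K := by ring
    rw [e1, e2, e3]
    omega
  refine ⟨τ, ps, .seq hr k1, k2, k3, fun k hk => ⟨?_, ?_⟩, ?_, ?_⟩
  · have h1 := (k4 k hk).1
    have h2 := harith (k + 1)
    omega
  · have h1 := (k4 k hk).2
    omega
  · have h2 := harith ps.length
    omega
  · omega

/-- Without edges, the only path is the empty one. -/
theorem IsRankedEnumeration.length_le_one {ps : List (List (Fin N × Fin N))}
    (h : IsRankedEnumeration w G wt s t ps) (hℓ : ∀ p, G.IsPath s t p → p.length ≤ 0) :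
    ps.length ≤ 1 := by
  rw [← List.toFinset_card_of_nodup h.nodup, Finset.card_le_one]
  have : ∀ p ∈ ps, p = [] := fun p hp =>
    List.length_eq_zero_iff.1 (Nat.le_zero.1 (hℓ p ((h.complete p).1 hp)))
  intro p hp q hq
  rw [this p (List.mem_toFinset.1 hp), this q (List.mem_toFinset.1 hq)]

theorem exists_ranked_enumeration : ∃ (P : Program) (C : ℕ),
    ∀ (W : Type u) [LinearOrder W] (w : Multiset W → W) (ops : WeightOps W),
      ops.Computes w → StrongSubsetMonotone w →
      ((∀ X : Multiset W, w 0 ≤ w X) ∨ SubsetMonotone w) →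
      ∀ (N : ℕ) (G : DAG N) (wt : Fin N × Fin N → W) (s t : Fin N),
        ∃ (τ : State W) (ps : List (List (Fin N × Fin N))),
          Run ops P (initialState ops G wt s t) τ ∧
          IsRankedEnumeration w G wt s t ps ∧
          τ.answers.map Answer.word = ps.map encodePath ∧
          ∀ ℓ : ℕ, G.IsMaxPathLength s t ℓ →
            (∀ (k : ℕ) (hk : k < τ.answers.length),
              (τ.answers[k]).time ≤ C * (G.size + (k + 1) * (Nat.log 2 N + ℓ)) ∧
              (τ.answers[k]).space ≤ C * (G.size + (k + 1) * ℓ)) ∧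
            τ.clock ≤ C * (G.size + ps.length * (Nat.log 2 N + ℓ)) ∧
            τ.peak ≤ C * (G.size + ps.length * ℓ) := by
  refine ⟨rankedEnumeration, 5000, ?_⟩
  intro W _ w ops hC hS hw N G wt s t
  obtain ⟨ℓ, hℓ⟩ := G.exists_isMaxPathLength s t
  have hℓ' : ∀ p, G.IsPath s t p → p.length ≤ ℓ := fun p hp => hℓ.1 ⟨p, hp, rfl⟩
  obtain ⟨τ, ps, k1, k2, k3, k4, k5, k6⟩ := rankedEnumeration_spec hC (hS.subsetMonotone hw) G wt s
    t hℓ'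
  refine ⟨τ, ps, k1, k2, k3, fun ℓ' hm => ?_⟩
  obtain rfl := hm.unique hℓ
  have hlen : τ.answers.length = ps.length := by simpa using congrArg List.length k3
  have hN : 1 ≤ N := by have := s.2; omega
  have hsize : G.size = N + G.edges.length := rfl
  -- Absorbs the constant cost per answer, also if `ℓ = 0`: then there is at most one answer, and
  -- the graph has at least one node.
  have hK : ∀ K, K ≤ ps.length → K ≤ G.size + K * ℓ' := by
    intro K hK
    rcases Nat.eq_zero_or_pos ℓ' with rfl | hpos
    · have := k2.length_le_one hℓ'
      omega
    · have := Nat.le_mul_of_pos_right K hpos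
      omega
  have harith : ∀ K, K ≤ ps.length → 3000 * G.size + K * (2000 * (Nat.log 2 N + ℓ' + 1)) ≤
      5000 * (G.size + K * (Nat.log 2 N + ℓ')) := by
    intro K h
    have := hK K h
    have e2 : K * (2000 * (Nat.log 2 N + ℓ' + 1)) =
      2000 * (K * Nat.log 2 N) + 2000 * (K * ℓ') + 2000 * K := by ring
    have e3 : K * (Nat.log 2 N + ℓ') = K * Nat.log 2 N + K * ℓ' := by ring
    rw [e2, e3]
    omega
  have hspace : ∀ K, 3000 * G.size + K * (7 * ℓ') ≤ 5000 * (G.size + K * ℓ') := by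
    intro K
    have : K * (7 * ℓ') = 7 * (K * ℓ') := by ring
    omega
  refine ⟨fun k hk => ⟨?_, ?_⟩, ?_, ?_⟩
  · exact (k4 k hk).1.trans (harith _ (by omega))
  · refine (k4 k hk).2.trans (le_trans ?_ (hspace (k + 1)))
    gcongr
    omega
  · exact k5.trans (harith _ le_rfl)
  · exact k6.trans (hspace _)

end

/-! ### Comparison with `|G| + k (log k + ℓ)` -/

/-- Either `log N ≤ 2 log k`, or `k` is at most about the square root of `N`; then `k log N` is
linear in `N`. -/
theorem mul_log_le {N k : ℕ} : k * Nat.log 2 N ≤ 4 * N + 2 * (k * Nat.log 2 k) := by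
  rcases Nat.eq_zero_or_pos k with rfl | hk
  · simp
  obtain ⟨a, ha⟩ : ∃ a, a = Nat.log 2 N := ⟨_, rfl⟩
  obtain ⟨b, hb⟩ : ∃ b, b = Nat.log 2 k := ⟨_, rfl⟩
  rw [← ha, ← hb]
  by_cases h : a ≤ 2 * b
  · have : k * a ≤ k * (2 * b) := Nat.mul_le_mul_left _ h
    have e : k * (2 * b) = 2 * (k * b) := by ring
    omega
  · have hN : N ≠ 0 := by
      rintro rfl
      simp at ha
      omega
    have h1 : 2 ^ a ≤ N := ha ▸ Nat.pow_log_le_self 2 hN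
    have h2 : k ≤ 2 ^ (b + 1) := hb ▸ (Nat.lt_pow_succ_log_self one_lt_two k).le
    -- As `2 * b < a`, the number `a` is at most `2 * (a - b)`; and `2 ^ (b + 1) * 2 ^ (a - b)` is
    -- again of order `2 ^ a`.
    have h3 : a ≤ 2 * 2 ^ (a - b) := by
      have := (Nat.lt_two_pow_self (n := a - b)).le
      omega
    calc k * a ≤ 2 ^ (b + 1) * (2 * 2 ^ (a - b)) := Nat.mul_le_mul h2 h3
      _ = 4 * 2 ^ (b + (a - b)) := by ring
      _ = 4 * 2 ^ a := by rw [Nat.add_sub_cancel' (by omega)]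
      _ ≤ 4 * N + 2 * (k * b) := by omega

theorem exists_bound_le : ∃ D : ℕ, ∀ (N : ℕ) (G : DAG N) (k ℓ : ℕ),
    G.size + k * (Nat.log 2 N + ℓ) ≤ D * (G.size + k * (Nat.log 2 k + ℓ)) := by
  refine ⟨5, fun N G k ℓ => ?_⟩
  have h := mul_log_le (N := N) (k := k)
  have hN : N ≤ G.size := Nat.le_add_right _ _
  rw [mul_add, mul_add k]
  omega

/-! ### Layered graphs, where the new bound is better -/

section
variable {n m : ℕ}

/-- The edges from each of `m + 1` layers of `n` nodes to the next layer. -/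
def layeredEdges (n m : ℕ) : Finset (Fin (n * (m + 1)) × Fin (n * (m + 1))) :=
  Finset.univ.filter fun e => e.2.val / n = e.1.val / n + 1

/-- Each edge leads one layer further. So there are no cycles, and all paths between two given nodes
have the same length. -/
theorem layer_eq {u v : Fin (n * (m + 1))} {p : List (Fin (n * (m + 1)) × Fin (n * (m + 1)))}
    (h : IsPathIn (layeredEdges n m).toList u v p) : v.val / n = u.val / n + p.length := by
  induction p generalizing u with
  | nil => rw [show u = v from h]; rfl
  | cons e p ih =>
    obtain ⟨he, rfl, hp⟩ := h
    rw [Finset.mem_toList, layeredEdges, Finset.mem_filter] at he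
    rw [ih hp, he.2, List.length_cons]
    omega

noncomputable def layered (n m : ℕ) : DAG (n * (m + 1)) where
  edges := (layeredEdges n m).toList
  nodup := Finset.nodup_toList _
  acyclic u p hp := by
    have := layer_eq hp
    exact List.length_eq_zero_iff.1 (by omega)

theorem layered_size_le : (layered n m).size ≤ n * (m + 1) + (n * (m + 1)) * (n * (m + 1)) := by
  rw [DAG.size, Nat.add_le_add_iff_left]
  refine (Finset.length_toList _).trans_le ((Finset.card_filter_le _ _).trans_eq ?_)
  rw [Finset.card_univ, Fintype.card_prod, Fintype.card_fin]

/-- Any of the `n` nodes may be chosen in each of the `j` layers strictly between `u` and `v`. -/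
theorem layered_paths {j : ℕ} {u v : Fin (n * (m + 1))} (h : v.val / n = u.val / n + j + 1) :
    ∃ F : Finset (List (Fin (n * (m + 1)) × Fin (n * (m + 1)))), F.card = n ^ j ∧
      ∀ p ∈ F, (layered n m).IsPath u v p := by
  have hedge : ∀ e : Fin (n * (m + 1)) × Fin (n * (m + 1)), e.2.val / n = e.1.val / n + 1 →
      e ∈ (layered n m).edges := fun e he =>
    Finset.mem_toList.2 (Finset.mem_filter.2 ⟨Finset.mem_univ _, he⟩)
  induction j generalizing u with
  | zero => exact ⟨{[(u, v)]}, by simp, fun p hp => by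
      rw [Finset.mem_singleton.1 hp]
      exact ⟨hedge _ h, rfl, rfl⟩⟩
  | succ j ih =>
    have hn : 0 < n := Nat.pos_of_ne_zero (by rintro rfl; simpa using u.2)
    have hv : v.val / n < m + 1 := Nat.div_lt_of_lt_mul v.2
    have hlt : ∀ c : Fin n, n * (u.val / n + 1) + c.val < n * (m + 1) := fun c =>
      calc n * (u.val / n + 1) + c.val < n * (u.val / n + 1 + 1) := by
            rw [Nat.mul_succ n (u.val / n + 1)]; have := c.2; omega
        _ ≤ n * (m + 1) := Nat.mul_le_mul_left _ (by omega)
    have hdiv : ∀ c : Fin n, (n * (u.val / n + 1) + c.val) / n = u.val / n + 1 := fun c => by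
      rw [Nat.mul_add_div hn, Nat.div_eq_of_lt c.2, Nat.add_zero]
    obtain ⟨x, hx⟩ : ∃ x : Fin n → Fin (n * (m + 1)), ∀ c, (x c).val =
      n * (u.val / n + 1) + c.val := ⟨fun c => ⟨_, hlt c⟩, fun _ => rfl⟩
    have hF : ∀ c, ∃ F : Finset (List (Fin (n * (m + 1)) × Fin (n * (m + 1)))), F.card = n ^ j ∧
        ∀ p ∈ F, (layered n m).IsPath (x c) v p := fun c => ih (by rw [hx, hdiv, h]; omega)
    choose F hF hp using hF
    classical
    -- Paths with different second nodes differ in their first edges, so the `n` families are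
    -- disjoint.
    refine ⟨Finset.univ.biUnion fun c => (F c).image (List.cons (u, x c)), ?_, fun p hp' => ?_⟩
    · rw [Finset.card_biUnion]
      · simp only [Finset.card_image_of_injective _ List.cons_injective, hF, Finset.sum_const,
          Finset.card_univ, Fintype.card_fin, smul_eq_mul]
        ring
      · intro c _ c' _ hne
        refine Finset.disjoint_left.2 fun p h1 h2 => hne ?_
        obtain ⟨q, -, rfl⟩ := Finset.mem_image.1 h1
        obtain ⟨q', -, h3⟩ := Finset.mem_image.1 h2
        have h4 : x c' = x c := congrArg Prod.snd (List.cons.inj h3).1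
        have h5 := congrArg Fin.val h4
        rw [hx, hx] at h5
        exact Fin.ext (by omega)
    · obtain ⟨c, -, hc⟩ := Finset.mem_biUnion.1 hp'
      obtain ⟨q, hq, rfl⟩ := Finset.mem_image.1 hc
      exact ⟨hedge _ (by rw [hx, hdiv]), rfl, hp c q hq⟩

/-- With `k = n ^ j` the graph is no larger than `k`, and `log k = a * j`, whereas `log N + ℓ` is of
order `a` with a factor that does not depend on `j`. -/
theorem exists_bound_lt (D : ℕ) : ∃ (N : ℕ) (G : DAG N) (s t : Fin N) (k ℓ : ℕ),
    G.IsMaxPathLength s t ℓ ∧ 1 ≤ k ∧ k ≤ {p | G.IsPath s t p}.ncard ∧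
    D * (G.size + k * (Nat.log 2 N + ℓ)) < G.size + k * (Nat.log 2 k + ℓ) := by
  -- There are `m + 1` layers, with `j = m - 1` of them strictly inside. The choice `a = 2 * m + 1`
  -- gives `2 * 4 ^ m = n`, so that the size is at most `n ^ 3`, and also `1 + a + 2 * m = 2 * a`.
  -- Then `j ≥ 3` bounds the size by `n ^ j`, and `j > 2 * D` decides the comparison.
  obtain ⟨j, hj⟩ : ∃ j, j = 2 * D + 3 := ⟨_, rfl⟩
  obtain ⟨m, hm⟩ : ∃ m, m = j + 1 := ⟨_, rfl⟩
  obtain ⟨a, ha⟩ : ∃ a, a = 2 * m + 1 := ⟨_, rfl⟩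
  obtain ⟨n, hn⟩ : ∃ n, n = 2 ^ a := ⟨_, rfl⟩
  have hn0 : 0 < n := hn ▸ Nat.two_pow_pos a
  have hm2 : m + 1 ≤ 2 ^ m := Nat.lt_two_pow_self
  have hN0 : 0 < n * (m + 1) := Nat.mul_pos hn0 (by omega)
  obtain ⟨s, hs⟩ : ∃ s : Fin (n * (m + 1)), s.val / n = 0 := ⟨⟨0, hN0⟩, Nat.zero_div _⟩
  obtain ⟨t, ht⟩ : ∃ t : Fin (n * (m + 1)), t.val / n = m :=
    ⟨⟨n * m, Nat.mul_lt_mul_of_pos_left (by omega) hn0⟩, Nat.mul_div_cancel_left _ hn0⟩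
  obtain ⟨F, hF, hp⟩ := layered_paths (n := n) (m := m) (j := j) (u := s) (v := t) (by omega)
  have hlen : ∀ p, (layered n m).IsPath s t p → p.length = m := fun p hp => by
    have := layer_eq hp
    omega
  have hpos : 0 < n ^ j := Nat.pow_pos hn0
  refine ⟨n * (m + 1), layered n m, s, t, n ^ j, m, ⟨?_, fun b hb => ?_⟩, hpos, ?_, ?_⟩
  · rintro _ ⟨p, hp, rfl⟩
    exact (hlen p hp).le
  · obtain ⟨p, hpF⟩ := Finset.card_pos.1 (hF ▸ hpos)
    exact hb ⟨p, hp p hpF, hlen p (hp p hpF)⟩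
  · rw [← hF, ← Set.ncard_coe_finset]
    exact Set.ncard_le_ncard hp (finite_paths fun p hp => (hlen p hp).le)
  · have hk : Nat.log 2 (n ^ j) = a * j := by rw [hn, ← pow_mul, Nat.log_pow one_lt_two]
    have hlogN : Nat.log 2 (n * (m + 1)) ≤ a + m := by
      calc Nat.log 2 (n * (m + 1)) ≤ Nat.log 2 (2 ^ (a + m)) :=
            Nat.log_mono_right (by rw [pow_add, ← hn]; exact Nat.mul_le_mul_left _ hm2)
        _ = a + m := Nat.log_pow one_lt_two _
    have hsize : (layered n m).size ≤ n ^ j := by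
      refine layered_size_le.trans ?_
      calc n * (m + 1) + n * (m + 1) * (n * (m + 1))
          ≤ n * (m + 1) * (n * (m + 1)) + n * (m + 1) * (n * (m + 1)) :=
            Nat.add_le_add_right (Nat.le_mul_of_pos_left _ hN0) _
        _ = n ^ 2 * (2 * ((m + 1) * (m + 1))) := by ring
        _ ≤ n ^ 2 * (2 * (2 ^ m * 2 ^ m)) := by gcongr
        _ = n ^ 3 := by rw [hn, ha]; ring
        _ ≤ n ^ j := Nat.pow_le_pow_right hn0 (by omega)
    rw [hk]
    calc D * ((layered n m).size + n ^ j * (Nat.log 2 (n * (m + 1)) + m))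
        ≤ D * (n ^ j + n ^ j * (a + m + m)) := by gcongr
      _ = n ^ j * (D * (1 + (a + m + m))) := by ring
      _ ≤ n ^ j * (a * (2 * D)) := by
          refine Nat.mul_le_mul_left _ ?_
          calc D * (1 + (a + m + m)) ≤ D * (2 * a) := Nat.mul_le_mul_left _ (by omega)
            _ = a * (2 * D) := by ring
      _ < n ^ j * (a * j + m) := by
          refine Nat.mul_lt_mul_of_pos_left ?_ hpos
          have : a * (2 * D) ≤ a * j := Nat.mul_le_mul_left _ (by omega)
          omega
      _ ≤ (layered n m).size + n ^ j * (a * j + m) := Nat.le_add_left _ _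

end

end AnyK

theorem mainTheorem3 :
    -- one program and one constant serve all ranking functions, all graphs and all `k`
    (∃ (P : AnyK.Program) (C : ℕ),
      ∀ (W : Type u) [LinearOrder W] (w : Multiset W → W) (ops : AnyK.WeightOps W),
        ops.Computes w →
        AnyK.StrongSubsetMonotone w →
        ((∀ X : Multiset W, w 0 ≤ w X) ∨ AnyK.SubsetMonotone w) →
        ∀ (N : ℕ) (G : AnyK.DAG N) (wt : Fin N × Fin N → W) (s t : Fin N),
          ∃ (τ : AnyK.State W) (ps : List (List (Fin N × Fin N))),
            AnyK.Run ops P (AnyK.initialState ops G wt s t) τ ∧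
            AnyK.IsRankedEnumeration w G wt s t ps ∧
            τ.answers.map AnyK.Answer.word = ps.map AnyK.encodePath ∧
            ∀ ℓ : ℕ, G.IsMaxPathLength s t ℓ →
              -- time and space until the answer number `k + 1`
              (∀ (k : ℕ) (hk : k < τ.answers.length),
                (τ.answers[k]).time ≤ C * (G.size + (k + 1) * (Nat.log 2 N + ℓ)) ∧
                (τ.answers[k]).space ≤ C * (G.size + (k + 1) * ℓ)) ∧
              -- time and space until the program halts
              τ.clock ≤ C * (G.size + ps.length * (Nat.log 2 N + ℓ)) ∧
              τ.peak ≤ C * (G.size + ps.length * ℓ)) ∧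
    -- the time bound is never worse than `|G| + k (log k + ℓ)`, up to a constant factor
    (∃ D : ℕ, ∀ (N : ℕ) (G : AnyK.DAG N) (k ℓ : ℕ),
      G.size + k * (Nat.log 2 N + ℓ) ≤ D * (G.size + k * (Nat.log 2 k + ℓ))) ∧
    -- and it is better by more than any constant factor on suitable graphs
    (∀ D : ℕ, ∃ (N : ℕ) (G : AnyK.DAG N) (s t : Fin N) (k ℓ : ℕ),
      G.IsMaxPathLength s t ℓ ∧
      1 ≤ k ∧ k ≤ {p | G.IsPath s t p}.ncard ∧
      D * (G.size + k * (Nat.log 2 N + ℓ)) < G.size + k * (Nat.log 2 k + ℓ)) := by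
  exact ⟨AnyK.exists_ranked_enumeration, AnyK.exists_bound_le, AnyK.exists_bound_lt⟩
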